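/- Let $n\ge 2$, let $(\bar M^n,g)$ be a compact smooth Riemannian manifold with smooth boundary $\partial M$ and interior $M$, and let $T>0$. Write $M_T=M\times(0,T]$, $\bar M_T=\bar M\times[0,T]$ and $\mathcal P M_T=(\bar M\times\{0\})\cup(\partial M\times[0,T])$. Let $\Gamma\subsetneq\mathbb R^{n+1}$ be an open, convex, symmetric cone with vertex at the origin containing $\{\lambda:\lambda_i>0\ \forall i\}$, and let $f\in C^\infty(\Gamma)\cap C^0(\bar\Gamma)$ be symmetric with $f_i=\partial f/\partial\lambda_i>0$ in $\Gamma$ ($1\le i\le n+1$) and $f$ concave in $\Gamma$. Let $\psi(x,t,p)\in\mathbb R$ and the symmetric $(0,2)$ tensor $A(x,t,p)$ at $x$ depend smoothly on $(x,p)\in T^*\bar M$, $t\in[0,T]$; write $A^{\xi\eta}=A(\xi,\eta)$. Let $\nabla_x$ denote the partial covariant derivative in $x$ ($p$ and $\xi$ being transported parallelly), and identify vectors and covectors through $g$. Assume that there are constants $\gamma\in(0,4)$, $\gamma_1\in(0,2)$ and continuous functions $\bar\psi_1,\bar\psi_2,\bar\psi_3\ge0$ on $\bar M_T$ such that, for all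 $(x,t)\in\bar M_T$, all $\xi,\eta$ at $x$ and all $p\in T^*_x\bar M$ with $|p|$ sufficiently large, (G1) $-p\cdot\nabla_x\psi(x,t,p)\le\bar\psi_1(x,t)(1+|p|^{\gamma})$ and $p\cdot\nabla_xA^{\xi\xi}(x,t,p)\le\bar\psi_1(x,t)|\xi|^2(1+|p|^{\gamma})$; (G2) $|p\cdot D_p\psi(x,t,p)|\le\bar\psi_2(x,t)(1+|p|^{\gamma})$ and $|p\cdot D_pA^{\xi\xi}(x,t,p)|\le\bar\psi_2(x,t)|\xi|^2(1+|p|^{\gamma})$; (G3) $|A^{\xi\eta}(x,t,p)|\le\bar\psi_3(x,t)|\xi||\eta|(1+|p|^{\gamma_1})$. Assume also that there is a constant $\nu_0>0$ such that $f_j(\lambda)\ge\nu_0\big(1+\sum_{i=1}^{n+1}f_i(\lambda)\big)$ whenever $\lambda\in\Gamma$ and $\lambda_j<0$. Then for every $C_0$ there is a constant $C_3>0$, depending only on $C_0$ and the data above, such that every $u\in C^3(\bar M_T)$ with $|u|\le C_0$ on $\bar M_T$ that is admissible, i.e. $(\lambda(\nabla^2u+A(x,t,\nabla u)),-u_t)\in\Gamma$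 in $M\times[0,T]$ (where $\lambda$ denotes the eigenvalues with respect to $g$), and satisfies $$f\big(\lambda(\nabla^2u+A(x,t,\nabla u)),-u_t\big)=\psi(x,t,\nabla u)\quad\text{in }M_T,$$ obeys $$\max_{\bar M_T}|\nabla u|\le C_3\Big(1+\max_{\mathcal P M_T}|\nabla u|\Big).$$ -/

import Mathlib

open Set
open scoped Manifold ContDiff

noncomputable section

namespace ParabolicHessian

/-- The model vector space of an `n`-dimensional manifold with boundary. -/
abbrev Model (n : ℕ) : Type := EuclideanSpace ℝ (Fin n)

/-- Smooth Riemannian metrics on a smooth `n`-manifold with boundary `M`. -/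
abbrev Metric (n : ℕ) [NeZero n] (M : Type*) [TopologicalSpace M]
    [ChartedSpace (EuclideanHalfSpace n) M] [IsManifold (𝓡∂ n) ∞ M] :=
  Bundle.ContMDiffRiemannianMetric (𝓡∂ n) ∞ (Model n)
    (fun x : M => TangentSpace (𝓡∂ n) x)

/-- The cotangent space `T*_x M`. -/
abbrev Cotangent (n : ℕ) [NeZero n] {M : Type*} [TopologicalSpace M]
    [ChartedSpace (EuclideanHalfSpace n) M] (x : M) : Type :=
  TangentSpace (𝓡∂ n) x →L[ℝ] ℝ

/-- The fibre at `x` of the bundle of `(0,2)` tensors. -/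
abbrev Tensor02 (n : ℕ) [NeZero n] {M : Type*} [TopologicalSpace M]
    [ChartedSpace (EuclideanHalfSpace n) M] (x : M) : Type :=
  TangentSpace (𝓡∂ n) x →L[ℝ] TangentSpace (𝓡∂ n) x →L[ℝ] ℝ

/-- Scalar coefficients `ψ (x, t, p)` with `p ∈ T*_x M`. -/
abbrev ScalarCoeff (n : ℕ) [NeZero n] (M : Type*) [TopologicalSpace M]
    [ChartedSpace (EuclideanHalfSpace n) M] :=
  (x : M) → ℝ → Cotangent n x → ℝ

/-- Tensor coefficients `A (x, t, p)`, a `(0,2)` tensor at `x` depending on `p ∈ T*_x M`. -/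
abbrev TensorCoeff (n : ℕ) [NeZero n] (M : Type*) [TopologicalSpace M]
    [ChartedSpace (EuclideanHalfSpace n) M] :=
  (x : M) → ℝ → Cotangent n x → Tensor02 n x

section Geometry

variable {n : ℕ} [NeZero n] {M : Type*} [TopologicalSpace M]
  [ChartedSpace (EuclideanHalfSpace n) M] [IsManifold (𝓡∂ n) ∞ M]

/-- Every covector is represented by a tangent vector through the metric. -/
theorem exists_sharp (g : Metric n M) (x : M) (p : Cotangent n x) :
    ∃ w : TangentSpace (𝓡∂ n) x, ∀ v, g.inner x w v = p v := by
  let L : Model n →ₗ[ℝ] Module.Dual ℝ (Model n) :=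
    { toFun := fun w => (g.inner x w : Model n →L[ℝ] ℝ).toLinearMap
      map_add' := fun a b => by
        ext v
        exact congrArg (fun q : Cotangent n x => q v) ((g.inner x).map_add a b)
      map_smul' := fun c a => by
        ext v
        exact congrArg (fun q : Cotangent n x => q v) ((g.inner x).map_smul c a) }
  have hinj : Function.Injective L := by
    rw [injective_iff_map_eq_zero]
    intro w hw
    by_contra hne
    have h1 : 0 < g.inner x w w := g.pos x w hne
    have h2 : g.inner x w w = 0 := congrArg (fun q : Module.Dual ℝ (Model n) => q w) hw
    exact absurd h2 (ne_of_gt h1)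
  have hsurj : Function.Surjective L :=
    (LinearMap.injective_iff_surjective_of_finrank_eq_finrank
      (Subspace.dual_finrank_eq (K := ℝ) (V := Model n)).symm).1 hinj
  obtain ⟨w, hw⟩ := hsurj (p : Model n →L[ℝ] ℝ).toLinearMap
  exact ⟨w, fun v => congrArg (fun q : Module.Dual ℝ (Model n) => q v) hw⟩

/-- The tangent vector `p^♯` representing the covector `p`. -/
def sharp (g : Metric n M) (x : M) (p : Cotangent n x) : TangentSpace (𝓡∂ n) x :=
  (exists_sharp g x p).choose

theorem inner_sharp (g : Metric n M) (x : M) (p : Cotangent n x) (v : TangentSpace (𝓡∂ n) x) :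
    g.inner x (sharp g x p) v = p v :=
  (exists_sharp g x p).choose_spec v

/-- Length of a tangent vector. -/
def vecNorm (g : Metric n M) (x : M) (v : TangentSpace (𝓡∂ n) x) : ℝ :=
  Real.sqrt (g.inner x v v)

/-- Length of a covector. -/
def covecNorm (g : Metric n M) (x : M) (p : Cotangent n x) : ℝ :=
  vecNorm g x (sharp g x p)

/-- The tangent vector at `y` with coordinates `a` in the preferred chart at `x₀`. -/
def vecFrom (x₀ y : M) (a : Model n) : TangentSpace (𝓡∂ n) y :=
  tangentCoordChange (𝓡∂ n) x₀ y y a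

/-- The covector at `y` with coordinates `q` in the preferred chart at `x₀`. -/
def covecFrom (x₀ y : M) (q : Model n →L[ℝ] ℝ) : Cotangent n y :=
  q.comp (tangentCoordChange (𝓡∂ n) y x₀ y)

/-- The metric in the coordinates of the preferred chart at `x₀`. -/
def chartMetric (g : Metric n M) (x₀ : M) (z : Model n) : Model n →L[ℝ] Model n →L[ℝ] ℝ :=
  let y : M := (extChartAt (𝓡∂ n) x₀).symm z
  let B : Model n →L[ℝ] Model n →L[ℝ] ℝ := g.inner y
  B.bilinearComp (tangentCoordChange (𝓡∂ n) x₀ y y) (tangentCoordChange (𝓡∂ n) x₀ y y)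

/-- The first derivatives of the metric at `x` in the preferred chart at `x`:
`chartMetricDeriv g x c a b = ∂_c g (a, b)`. The coordinates of `T_x M` in this chart are the
identity. -/
def chartMetricDeriv (g : Metric n M) (x : M) :
    Model n →L[ℝ] Model n →L[ℝ] Model n →L[ℝ] ℝ :=
  fderivWithin ℝ (chartMetric g x) (range (𝓡∂ n)) (extChartAt (𝓡∂ n) x x)

/-- The Christoffel symbols of the Levi-Civita connection at `x`, in the preferred chart at `x`,
as the vector `Γ (a, b)` with `g (Γ (a, b), c) = (∂_a g (b, c) + ∂_b g (a, c) - ∂_c g (a, b)) / 2`. -/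
def christoffel (g : Metric n M) (x : M) (a b : Model n) : Model n :=
  let D := chartMetricDeriv g x
  let q : Model n →L[ℝ] ℝ := (1 / 2 : ℝ) • (D a b + D b a - (D.flip a).flip b)
  sharp g x q

/-- The covector `b ↦ q (Γ (a, b))`. -/
def christoffelDual (g : Metric n M) (x : M) (a : Model n) (q : Model n →L[ℝ] ℝ) :
    Model n →L[ℝ] ℝ :=
  let D := chartMetricDeriv g x
  let c : Model n := sharp g x q
  (1 / 2 : ℝ) • ((D a).flip c + (D.flip a).flip c - D c a)

theorem christoffelDual_apply (g : Metric n M) (x : M) (a b : Model n) (q : Model n →L[ℝ] ℝ) :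
    christoffelDual g x a q b = q (christoffel g x a b) := by
  have h1 : q (christoffel g x a b) = g.inner x (sharp g x q) (christoffel g x a b) :=
    (inner_sharp g x q _).symm
  have h2 : christoffelDual g x a q b = g.inner x (christoffel g x a b) (sharp g x q) :=
    (inner_sharp g x ((1 / 2 : ℝ) • (chartMetricDeriv g x a b + chartMetricDeriv g x b a
      - ((chartMetricDeriv g x).flip a).flip b) : Model n →L[ℝ] ℝ) (sharp g x q)).symm
  exact h2.trans ((g.symm x _ _).trans h1.symm)

/-- The differential `∇v` at `x`, as a covector. -/
def grad (v : M → ℝ) (x : M) : Cotangent n x :=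
  mfderiv (𝓡∂ n) 𝓘(ℝ, ℝ) v x

/-- The Hessian `∇²v (a, b) = ∂_a ∂_b v - dv (Γ (a, b))` at `x`. -/
def hess (g : Metric n M) (v : M → ℝ) (x : M) (a b : TangentSpace (𝓡∂ n) x) : ℝ :=
  let z : Model n := extChartAt (𝓡∂ n) x x
  let w : Model n → ℝ := v ∘ (extChartAt (𝓡∂ n) x).symm
  let S : Set (Model n) := range (𝓡∂ n)
  (fderivWithin ℝ (fderivWithin ℝ w S) S z : Model n →L[ℝ] Model n →L[ℝ] ℝ) a b
    - fderivWithin ℝ w S z (christoffel g x a b)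

/-- `p · ∇_x ψ (x, t, p)`: the derivative of `ψ (·, t, ·)` at `(x, p)` when `x` moves with velocity
`p^♯` and `p` is transported parallelly (in coordinates `p^k (∂_{x_k} ψ + Γ^l_{km} p_l ψ_{p_m})`). -/
def radialDx (g : Metric n M) (ψ : ScalarCoeff n M) (x : M) (t : ℝ) (p : Cotangent n x) : ℝ :=
  let h : Model n × (Model n →L[ℝ] ℝ) → ℝ := fun r =>
    ψ ((extChartAt (𝓡∂ n) x).symm r.1) t (covecFrom x ((extChartAt (𝓡∂ n) x).symm r.1) r.2)
  fderivWithin ℝ h (range (𝓡∂ n) ×ˢ univ) (extChartAt (𝓡∂ n) x x, p)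
    (sharp g x p, christoffelDual g x (sharp g x p) p)

/-- `p · ∇_x A^{ξξ} (x, t, p)`: the derivative of `A (·, t, ·) (ξ, ξ)` at `(x, p)` when `x` moves with
velocity `p^♯` and `p`, `ξ` are transported parallelly. -/
def radialDxTensor (g : Metric n M) (A : TensorCoeff n M) (x : M) (t : ℝ) (p : Cotangent n x)
    (ξ : TangentSpace (𝓡∂ n) x) : ℝ :=
  radialDx g (fun y s q => A y s q (vecFrom x y ξ) (vecFrom x y ξ)) x t p
    - A x t p (christoffel g x (sharp g x p) ξ) ξ - A x t p ξ (christoffel g x (sharp g x p) ξ)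

/-- `p · D_p ψ (x, t, p)`. -/
def radialDp (ψ : ScalarCoeff n M) (x : M) (t : ℝ) (p : Cotangent n x) : ℝ :=
  deriv (fun s : ℝ => ψ x t (s • p)) 1

/-- `p · D_p A^{ξξ} (x, t, p)`. -/
def radialDpTensor (A : TensorCoeff n M) (x : M) (t : ℝ) (p : Cotangent n x)
    (ξ : TangentSpace (𝓡∂ n) x) : ℝ :=
  deriv (fun s : ℝ => A x t (s • p) ξ ξ) 1

/-- Smoothness of `ψ`, up to `t = 0`, `t = T` and up to the boundary of `M`, in the coordinates that
the preferred chart at `x₀` induces on the cotangent bundle. -/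
def SmoothNear (T : ℝ) (x₀ : M) (ψ : ScalarCoeff n M) : Prop :=
  ContDiffOn ℝ ∞
    (fun r : Model n × ℝ × (Model n →L[ℝ] ℝ) =>
      ψ ((extChartAt (𝓡∂ n) x₀).symm r.1) r.2.1
        (covecFrom x₀ ((extChartAt (𝓡∂ n) x₀).symm r.1) r.2.2))
    ((extChartAt (𝓡∂ n) x₀).target ×ˢ Icc 0 T ×ˢ univ)

/-- `ψ ∈ C^∞ (T*M̄ × [0, T])`. -/
def SmoothScalar (T : ℝ) (ψ : ScalarCoeff n M) : Prop :=
  ∀ x₀ : M, SmoothNear T x₀ ψ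

/-- All coefficients of `A` in charts are smooth on `T*M̄ × [0, T]`. -/
def SmoothTensor (T : ℝ) (A : TensorCoeff n M) : Prop :=
  ∀ (x₀ : M) (a b : Model n),
    SmoothNear T x₀ (fun y t p => A y t p (vecFrom x₀ y a) (vecFrom x₀ y b))

/-- `A (x, t, p)` is a symmetric bilinear form. -/
def SymmTensor (T : ℝ) (A : TensorCoeff n M) : Prop :=
  ∀ x, ∀ t ∈ Icc 0 T, ∀ p a b, A x t p a b = A x t p b a

/-- Bounds on `p · ∇_x` of the coefficients for large `|p|`. -/
def GrowthDx (g : Metric n M) (T : ℝ) (A : TensorCoeff n M) (ψ : ScalarCoeff n M)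
    (ψ₁ : M → ℝ → ℝ) (γ : ℝ) : Prop :=
  ∃ R : ℝ, ∀ x, ∀ t ∈ Icc 0 T, ∀ p : Cotangent n x, R ≤ covecNorm g x p →
    - radialDx g ψ x t p ≤ ψ₁ x t * (1 + covecNorm g x p ^ γ) ∧
    ∀ ξ, radialDxTensor g A x t p ξ
      ≤ ψ₁ x t * vecNorm g x ξ ^ 2 * (1 + covecNorm g x p ^ γ)

/-- Bounds on `p · D_p` of the coefficients for large `|p|`. -/
def GrowthDp (g : Metric n M) (T : ℝ) (A : TensorCoeff n M) (ψ : ScalarCoeff n M)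
    (ψ₂ : M → ℝ → ℝ) (γ : ℝ) : Prop :=
  ∃ R : ℝ, ∀ x, ∀ t ∈ Icc 0 T, ∀ p : Cotangent n x, R ≤ covecNorm g x p →
    |radialDp ψ x t p| ≤ ψ₂ x t * (1 + covecNorm g x p ^ γ) ∧
    ∀ ξ, |radialDpTensor A x t p ξ|
      ≤ ψ₂ x t * vecNorm g x ξ ^ 2 * (1 + covecNorm g x p ^ γ)

/-- Bound on `A` itself for large `|p|`. -/
def GrowthTensor (g : Metric n M) (T : ℝ) (A : TensorCoeff n M)
    (ψ₃ : M → ℝ → ℝ) (γ₁ : ℝ) : Prop :=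
  ∃ R : ℝ, ∀ x, ∀ t ∈ Icc 0 T, ∀ p : Cotangent n x, R ≤ covecNorm g x p →
    ∀ ξ η, |A x t p ξ η|
      ≤ ψ₃ x t * vecNorm g x ξ * vecNorm g x η * (1 + covecNorm g x p ^ γ₁)

/-- A continuous nonnegative function on `M̄ × [0, T]`. -/
def IsGrowthBound (T : ℝ) (φ : M → ℝ → ℝ) : Prop :=
  ContinuousOn (fun r : M × ℝ => φ r.1 r.2) (univ ×ˢ Icc 0 T) ∧
    ∀ x, ∀ t ∈ Icc 0 T, 0 ≤ φ x t

/-- `l` lists the eigenvalues (with multiplicity) of the bilinear form `B` on `T_x M` with respect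
to the metric: `B` is diagonal with entries `l` in some orthonormal basis. -/
def IsEigenvalues (g : Metric n M) (x : M)
    (B : TangentSpace (𝓡∂ n) x → TangentSpace (𝓡∂ n) x → ℝ) (l : Fin n → ℝ) : Prop :=
  ∃ e : Fin n → TangentSpace (𝓡∂ n) x,
    (∀ i j, g.inner x (e i) (e j) = if i = j then 1 else 0) ∧
    ∀ i j, B (e i) (e j) = if i = j then l i else 0

/-- The augmented Hessian `∇²u + A (x, t, ∇u)` at `(x, t)`. -/
def augHess (g : Metric n M) (A : TensorCoeff n M) (u : M → ℝ → ℝ) (x : M) (t : ℝ)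
    (a b : TangentSpace (𝓡∂ n) x) : ℝ :=
  hess g (fun y => u y t) x a b + A x t (grad (fun y => u y t) x) a b

/-- The time derivative `u_t` on `[0, T]` (one-sided at the ends). -/
def timeDeriv (T : ℝ) (u : M → ℝ → ℝ) (x : M) (t : ℝ) : ℝ :=
  derivWithin (fun s => u x s) (Icc 0 T) t

/-- `m` is the vector `(λ (∇²u + A[u]), -u_t)` at `(x, t)`, the eigenvalues being listed in some
order. -/
def IsArgument (g : Metric n M) (T : ℝ) (A : TensorCoeff n M) (u : M → ℝ → ℝ) (x : M) (t : ℝ)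
    (m : Fin (n + 1) → ℝ) : Prop :=
  ∃ l : Fin n → ℝ, IsEigenvalues g x (augHess g A u x t) l ∧
    m = Fin.snoc l (- timeDeriv T u x t)

/-- `u ∈ C^k (M̄ × [0, T])`. -/
def IsCk (n : ℕ) [NeZero n] {M : Type*} [TopologicalSpace M]
    [ChartedSpace (EuclideanHalfSpace n) M] (k : ℕ) (T : ℝ) (u : M → ℝ → ℝ) : Prop :=
  ContMDiffOn ((𝓡∂ n).prod 𝓘(ℝ, ℝ)) 𝓘(ℝ, ℝ) k (fun r : M × ℝ => u r.1 r.2) (univ ×ˢ Icc 0 T)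

/-- `u` is admissible: `(λ (∇²u + A[u]), -u_t) ∈ Γ` on `M × [0, T]`. -/
def IsAdmissible (g : Metric n M) (T : ℝ) (Γ : Set (Fin (n + 1) → ℝ)) (A : TensorCoeff n M)
    (u : M → ℝ → ℝ) : Prop :=
  ∀ x ∈ (𝓡∂ n).interior M, ∀ t ∈ Icc 0 T, ∃ m, IsArgument g T A u x t m ∧ m ∈ Γ

/-- `u` solves `f (λ (∇²u + A[u]), -u_t) = ψ (x, t, ∇u)` on `M × (0, T]`. -/
def IsSolution (g : Metric n M) (T : ℝ) (f : (Fin (n + 1) → ℝ) → ℝ) (A : TensorCoeff n M)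
    (ψ : ScalarCoeff n M) (u : M → ℝ → ℝ) : Prop :=
  ∀ x ∈ (𝓡∂ n).interior M, ∀ t ∈ Ioc 0 T, ∃ m, IsArgument g T A u x t m ∧
    f m = ψ x t (grad (fun y => u y t) x)

/-- The parabolic boundary `(M × {0}) ∪ (∂M × [0, T])`. -/
def parabolicBoundary (n : ℕ) [NeZero n] (M : Type*) [TopologicalSpace M]
    [ChartedSpace (EuclideanHalfSpace n) M] (T : ℝ) : Set (M × ℝ) :=
  (univ ×ˢ {0}) ∪ ((𝓡∂ n).boundary M ×ˢ Icc 0 T)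

/-- `|∇u|` as a function on `M̄ × [0, T]`. -/
def gradNorm (g : Metric n M) (u : M → ℝ → ℝ) (r : M × ℝ) : ℝ :=
  covecNorm g r.1 (grad (fun y => u y r.2) r.1)

end Geometry

section Function

variable {N : ℕ}

/-- An open, convex, symmetric, proper subcone of `ℝ^N` with vertex at the origin that contains the
positive cone. -/
structure IsConeDomain (Γ : Set (Fin N → ℝ)) : Prop where
  isOpen : IsOpen Γ
  convex : Convex ℝ Γ
  smul_mem : ∀ c : ℝ, 0 < c → ∀ l ∈ Γ, c • l ∈ Γ
  perm_mem : ∀ (σ : Equiv.Perm (Fin N)), ∀ l ∈ Γ, l ∘ σ ∈ Γ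
  proper : Γ ≠ univ
  pos_subset : {l | ∀ i, 0 < l i} ⊆ Γ

/-- A symmetric function in `C^∞ (Γ) ∩ C^0 (closure Γ)`. -/
structure IsSymmSmooth (Γ : Set (Fin N → ℝ)) (f : (Fin N → ℝ) → ℝ) : Prop where
  smooth : ContDiffOn ℝ ∞ f Γ
  continuousOn : ContinuousOn f (closure Γ)
  perm : ∀ (σ : Equiv.Perm (Fin N)), ∀ l ∈ Γ, f (l ∘ σ) = f l

/-- The partial derivative `f_i = ∂f/∂λ_i`. -/
def partialD (f : (Fin N → ℝ) → ℝ) (i : Fin N) (l : Fin N → ℝ) : ℝ :=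
  fderiv ℝ f l (Pi.single i 1)

end Function

end ParabolicHessian

end

/-!
The gradient is controlled by comparing the values of `u` at the two ends of short curves, in the
style of Ishii and Lions, so that the equation is never differentiated. Suppose that the supremum `N`
of the gradient is large and exceeds a large multiple of the gradient on the parabolic boundary. With
`K = N / 2` and the concave function `φ s = s - s ^ (1 + α)`, consider the maximum of
`u (c 1, t) - u (c 0, t) - K φ (√E c)`, where `E` is the energy, over times and over short, almost
straight curves `c` in finitely many charts; a penalty keeps the starting point inside its chart. The
maximum is attained by compactness (`exists_common_maximizer`). It is positive, since the gradient
exceeds `3 K / 2` somewhere (`GoodChart.exists_twoPoint_pos`), while the smallness of the gradient on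
the parabolic boundary prevents a maximizing curve from occurring at the initial time
(`IsMaximizer.time_pos`) and from touching the boundary of the manifold (`IsMaximizer.curve_pos`). A
maximizing curve has least energy among the competitors with the same ends, hence is a geodesic
(`MetricBounds.isGeodesic_of_minimal`). In a chart in which its starting point lies well inside, the penalty
vanishes (`IsMaximizer.exists_geodesic`).

Working on curves instead of with the distance function avoids the regularity theory of the latter:
the conditions at the maximum are read off from explicit variations of the geodesic
(`IsGeodesic.two_point_conditions`). The second-order conditions bound the Hessian of `u` at one end minus the
Hessian at the other in terms of `K / s`, where `s` is the length, with a gain of order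
`(K / s) s ^ α` in the direction of the geodesic that comes from the concavity of `φ`. The first-order
conditions say that the gradients at both ends are `K φ' s` times the unit velocity. The covector dual
to the velocity is parallel along a geodesic, so the bounds on the partial covariant derivatives in
`x` integrate to one-sided bounds on the change of `ψ` and of `A` from one end to the other
(`IsGeodesic.scalar_le`, `IsGeodesic.tensor_sub_le`), and no derivative in `p` enters. Since `K s` is
bounded by the oscillation of `u`, powers of `K` cost the same powers of `1 / s`; for `γ < 4` and
`γ₁ < 2` a small exponent `α` makes all these terms of lower order than the gain.

It remains to contradict the equation at the two ends (`exists_two_point_contradiction`). The diagonal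
of a form in any orthonormal basis is the image of its eigenvalues under a doubly stochastic matrix
(`DiagIn.exists_doublyStochastic`), so that a symmetric concave `f` can be evaluated in any such
basis. If the augmented Hessian at the end `c 1` has no very negative eigenvalue, then pairing vectors
with their reflections in the direction of the geodesic turns the second-order condition into a
comparison of the two forms with a gain of rank one; otherwise, projecting off the lowest eigenvector
supplies such a gain. In both cases the lower bound for `f_j` where `λ_j < 0` converts it into a
difference of the values of `f` that exceeds the change of `ψ` (`exists_lt_of_rank_one_gain`).
-/

open Set
open scoped Manifold ContDiff

noncomputable section

namespace ParabolicHessian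

/-! ### Symmetric cones and concave functions -/

section Cone

variable {N : ℕ} {Γ : Set (Fin N → ℝ)}

theorem IsConeDomain.add_mem (hΓ : IsConeDomain Γ) {a b : Fin N → ℝ} (ha : a ∈ Γ) (hb : b ∈ Γ) :
    a + b ∈ Γ := by
  have h := hΓ.convex ha hb (a := 1 / 2) (b := 1 / 2) (by norm_num) (by norm_num) (by norm_num)
  have h2 := hΓ.smul_mem 2 (by norm_num) _ h
  convert h2 using 1
  ext i; simp; ring

theorem IsConeDomain.mono (hΓ : IsConeDomain Γ) {a b : Fin N → ℝ} (ha : a ∈ Γ) (hab : a ≤ b) :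
    b ∈ Γ := by
  obtain ⟨ε, hε, hball⟩ := Metric.isOpen_iff.1 hΓ.isOpen a ha
  have h1 : (fun i => a i - ε / 2) ∈ Γ := by
    apply hball
    rw [Metric.mem_ball, dist_pi_lt_iff hε]
    intro i
    rw [Real.dist_eq, abs_lt]
    constructor <;> linarith
  have h2 : (fun i => b i - a i + ε / 2) ∈ Γ := hΓ.pos_subset (fun i => by
    have := hab i
    change 0 < b i - a i + ε / 2
    linarith)
  convert hΓ.add_mem h1 h2 using 1
  ext i; simp

theorem IsConeDomain.exists_nonneg (hΓ : IsConeDomain Γ) {a : Fin N → ℝ} (ha : a ∈ Γ) :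
    ∃ i, 0 ≤ a i := by
  by_contra! hneg
  have h0 : (0 : Fin N → ℝ) ∈ Γ := hΓ.mono ha (fun i => (hneg i).le)
  obtain ⟨ε, hε, hball⟩ := Metric.isOpen_iff.1 hΓ.isOpen 0 h0
  apply hΓ.proper
  ext l
  simp only [mem_univ, iff_true]
  have hc : 0 < ε / (2 * (‖l‖ + 1)) := by positivity
  have h1 : (ε / (2 * (‖l‖ + 1))) • l ∈ Γ := by
    apply hball
    rw [mem_ball_zero_iff, norm_smul, Real.norm_of_nonneg hc.le, div_mul_eq_mul_div,
      div_lt_iff₀ (by positivity)]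
    nlinarith [norm_nonneg l]
  have h2 := hΓ.smul_mem (ε / (2 * (‖l‖ + 1)))⁻¹ (by positivity) _ h1
  rwa [smul_smul, inv_mul_cancel₀ hc.ne', one_smul] at h2

/-- A quantitative form of the fact that the normals of `Γ` weigh the negative coordinates most: a
negative coordinate may be traded against a comparable loss in all coordinates. The trade is made by
averaging with transpositions that move the negative entry to a nonnegative one, and by adding a
vector of `Γ` that is negative where `l` is negative, except at the traded coordinate. -/
theorem IsConeDomain.exists_trade (hΓ : IsConeDomain Γ) :
    ∃ C : ℝ, 1 ≤ C ∧ ∀ l ∈ Γ, ∀ k, l k < 0 → ∀ κ gain : ℝ, 0 < κ → C * κ ≤ gain → gain ≤ - l k →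
      l + gain • Pi.single k 1 - (fun _ => κ) ∈ Γ := by
  classical
  have hB : ∀ S : Finset (Fin N), ∃ B : ℝ, 0 ≤ B ∧
      ((∃ l ∈ Γ, ∀ i ∈ S, l i < 0) → (fun i => if i ∈ S then (-1 : ℝ) else B) ∈ Γ) := by
    intro S
    by_cases h : ∃ l ∈ Γ, ∀ i ∈ S, l i < 0
    · obtain ⟨l, hl, hneg⟩ := h
      obtain ⟨c, hc, hcl⟩ : ∃ c : ℝ, 0 < c ∧ ∀ i ∈ S, c * l i ≤ -1 := by
        refine ⟨∑ i ∈ S, (-(l i))⁻¹ + 1, ?_, ?_⟩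
        · have : 0 ≤ ∑ i ∈ S, (-(l i))⁻¹ := Finset.sum_nonneg (fun i hi => by
            have := hneg i hi
            exact inv_nonneg.2 (by linarith))
          linarith
        · intro i hi
          have h1 : (-(l i))⁻¹ ≤ ∑ i ∈ S, (-(l i))⁻¹ :=
            Finset.single_le_sum (f := fun i => (-(l i))⁻¹) (fun j hj => by
              have := hneg j hj
              exact inv_nonneg.2 (by linarith)) hi
          have h2 := hneg i hi
          have h3 : (-(l i))⁻¹ * (-(l i)) = 1 := inv_mul_cancel₀ (by linarith)
          nlinarith
      refine ⟨∑ i, |c * l i|, Finset.sum_nonneg (fun _ _ => abs_nonneg _), fun _ => ?_⟩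
      refine hΓ.mono (hΓ.smul_mem c hc l hl) (fun i => ?_)
      simp only [Pi.smul_apply, smul_eq_mul]
      split_ifs with hi
      · exact hcl i hi
      · exact (le_abs_self _).trans
          (Finset.single_le_sum (f := fun i => |c * l i|) (fun _ _ => abs_nonneg _)
            (Finset.mem_univ i))
    · exact ⟨0, le_rfl, fun h' => absurd h' h⟩
  choose Bf hBnn hBmem using hB
  set B : ℝ := ∑ S, Bf S with hBdef
  have hBnn' : 0 ≤ B := Finset.sum_nonneg (fun S _ => hBnn S)
  have hBle : ∀ S, Bf S ≤ B := fun S =>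
    Finset.single_le_sum (f := Bf) (fun S _ => hBnn S) (Finset.mem_univ S)
  refine ⟨N * (B + 1) + B + 1, by nlinarith [(Nat.cast_nonneg N : (0:ℝ) ≤ N)], ?_⟩
  intro l hl k hk κ gain hκ hgain hgl
  set P : Finset (Fin N) := Finset.univ.filter (fun j => 0 ≤ l j) with hP
  obtain ⟨j₀, hj₀⟩ := hΓ.exists_nonneg hl
  have hPpos : 0 < (P.card : ℝ) := by
    exact_mod_cast Finset.card_pos.2 ⟨j₀, by simp [hP, hj₀]⟩
  have hPN : (P.card : ℝ) ≤ N := by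
    exact_mod_cast (Finset.card_le_univ P).trans (by simp)
  set r : ℝ := P.card * (B + 1) * κ with hr
  have hr0 : 0 ≤ r := by positivity
  have hrg : r + (B + 1) * κ ≤ gain := by
    refine le_trans ?_ hgain
    have : (P.card : ℝ) * ((B + 1) * κ) ≤ N * ((B + 1) * κ) :=
      mul_le_mul_of_nonneg_right hPN (by positivity)
    rw [hr]; nlinarith
  -- moving weight `r` from a nonnegative coordinate `j` to `k` stays in `Γ`
  have hmove : ∀ j ∈ P, l + r • (Pi.single k 1 - Pi.single j 1) ∈ Γ := by
    intro j hj
    have hlj : 0 ≤ l j := by simpa [hP] using hj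
    have hjk : j ≠ k := by rintro rfl; linarith
    have hd : 0 < l j - l k := by linarith
    have hr1 : r / (l j - l k) ≤ 1 := by
      rw [div_le_one hd]; nlinarith
    have h := hΓ.convex hl (hΓ.perm_mem (Equiv.swap k j) l hl)
      (a := 1 - r / (l j - l k)) (b := r / (l j - l k)) (by linarith) (by positivity) (by ring)
    convert h using 1
    ext i
    simp only [Pi.add_apply, Pi.smul_apply, Pi.sub_apply, smul_eq_mul, Function.comp]
    rcases eq_or_ne i k with rfl | hik
    · simp only [Pi.single_eq_same, Pi.single_eq_of_ne hjk.symm, Equiv.swap_apply_left]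
      field_simp; ring
    · rcases eq_or_ne i j with rfl | hij
      · simp only [Pi.single_eq_same, Pi.single_eq_of_ne hik, Equiv.swap_apply_right]
        field_simp; ring
      · simp only [Pi.single_eq_of_ne hik, Pi.single_eq_of_ne hij,
          Equiv.swap_apply_of_ne_of_ne hik hij]
        ring
  have havg : ∑ j ∈ P, (P.card : ℝ)⁻¹ • (l + r • (Pi.single k 1 - Pi.single j 1)) ∈ Γ :=
    hΓ.convex.sum_mem (fun _ _ => by positivity) (by simp [hPpos.ne']) hmove
  set S : Finset (Fin N) := Finset.univ.filter (fun i => l i < 0 ∧ i ≠ k) with hS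
  have hβ := hBmem S ⟨l, hl, fun i hi => by simp [hS] at hi; exact hi.1⟩
  have hsum := hΓ.add_mem havg (hΓ.smul_mem κ hκ _ hβ)
  refine hΓ.mono hsum (fun i => ?_)
  have hav : (∑ j ∈ P, (P.card : ℝ)⁻¹ • (l + r • (Pi.single k 1 - Pi.single j 1))
      : Fin N → ℝ) i = l i + r * (Pi.single k 1 : Fin N → ℝ) i
        - (if i ∈ P then (B + 1) * κ else 0) := by
    rw [Finset.sum_apply]
    simp only [Pi.smul_apply, Pi.add_apply, Pi.sub_apply, smul_eq_mul]
    rw [← Finset.mul_sum, Finset.sum_add_distrib, ← Finset.mul_sum, Finset.sum_sub_distrib]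
    simp only [Finset.sum_const, nsmul_eq_mul, Pi.single_apply]
    rw [Finset.sum_ite_eq]
    split_ifs <;> (rw [hr]; field_simp; try ring)
  simp only [Pi.add_apply, hav, Pi.smul_apply, smul_eq_mul, Pi.sub_apply]
  have hBS := hBle S
  rcases eq_or_ne i k with rfl | hik
  · have h1 : i ∉ P := by simp [hP]; exact hk
    have h2 : i ∉ S := by simp [hS]
    simp only [h1, h2, if_false, Pi.single_eq_same]
    nlinarith
  · simp only [Pi.single_eq_of_ne hik]
    by_cases hi : l i < 0
    · have h1 : i ∉ P := by simp [hP]; exact hi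
      have h2 : i ∈ S := by simp [hS, hi, hik]
      simp only [h1, h2, if_true, if_false]
      linarith
    · have h1 : i ∈ P := by simp [hP]; linarith
      have h2 : i ∉ S := by simp [hS, hi]
      simp only [h1, h2, if_true, if_false]
      nlinarith

end Cone

section Concave

variable {N : ℕ} {Γ : Set (Fin N → ℝ)} {f : (Fin N → ℝ) → ℝ}

theorem fderiv_eq_sum_partialD (f : (Fin N → ℝ) → ℝ) (a h : Fin N → ℝ) :
    fderiv ℝ f a h = ∑ i, partialD f i a * h i := by
  conv_lhs => rw [← Finset.univ_sum_single h]
  rw [map_sum]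
  refine Finset.sum_congr rfl (fun i _ => ?_)
  rw [partialD, mul_comm, ← smul_eq_mul, ← map_smul, ← Pi.single_smul]
  simp

/-- The gradient inequality for `f` at the endpoint of a segment. -/
theorem sum_partialD_mul_le_sub (hΓ : IsConeDomain Γ) (hf : IsSymmSmooth Γ f)
    (hconc : ConcaveOn ℝ Γ f) {a b : Fin N → ℝ} (ha : a ∈ Γ) (hb : b ∈ Γ) :
    ∑ i, partialD f i b * (b i - a i) ≤ f b - f a := by
  let g : ℝ →ᵃ[ℝ] (Fin N → ℝ) := AffineMap.lineMap a b
  have hg : ConcaveOn ℝ (g ⁻¹' Γ) (f ∘ g) := hconc.comp_affineMap g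
  have hdiff : DifferentiableAt ℝ f b :=
    ((hf.smooth.contDiffAt (hΓ.isOpen.mem_nhds hb)).differentiableAt (by simp))
  have hgd : HasDerivAt g (b - a) 1 := AffineMap.hasDerivAt_lineMap
  have hb1 : g 1 = b := AffineMap.lineMap_apply_one a b
  have hd : HasDerivAt (f ∘ g) (fderiv ℝ f b (b - a)) 1 := by
    refine HasFDerivAt.comp_hasDerivAt (1 : ℝ) ?_ hgd
    rw [hb1]; exact hdiff.hasFDerivAt
  have h := hg.le_slope_of_hasDerivAt (x := 0) (y := 1) (by simpa [g] using ha)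
    (by simpa [g] using hb) one_pos hd
  rw [fderiv_eq_sum_partialD] at h
  simpa [slope_def_field, g] using h

theorem le_of_le_of_mem (hΓ : IsConeDomain Γ) (hf : IsSymmSmooth Γ f)
    (hconc : ConcaveOn ℝ Γ f) (hmono : ∀ l ∈ Γ, ∀ i, 0 < partialD f i l)
    {a b : Fin N → ℝ} (ha : a ∈ Γ) (hab : a ≤ b) : f a ≤ f b := by
  have hb := hΓ.mono ha hab
  have h := sum_partialD_mul_le_sub hΓ hf hconc ha hb
  have : 0 ≤ ∑ i, partialD f i b * (b i - a i) := Finset.sum_nonneg (fun i _ =>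
    mul_nonneg (hmono b hb i).le (sub_nonneg.2 (hab i)))
  linarith

/-- Averaging the entries other than the last one by a doubly stochastic matrix stays in `Γ` and
does not decrease a symmetric concave function (Birkhoff's theorem). -/
theorem snoc_mulVec_mem_and_le {n : ℕ} {Γ : Set (Fin (n + 1) → ℝ)} {f : (Fin (n + 1) → ℝ) → ℝ}
    (hΓ : IsConeDomain Γ) (hf : IsSymmSmooth Γ f) (hconc : ConcaveOn ℝ Γ f)
    {D : Matrix (Fin n) (Fin n) ℝ} (hD : D ∈ doublyStochastic ℝ (Fin n)) {l : Fin n → ℝ} {τ : ℝ}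
    (hl : (Fin.snoc l τ : Fin (n + 1) → ℝ) ∈ Γ) :
    (Fin.snoc (D.mulVec l) τ : Fin (n + 1) → ℝ) ∈ Γ ∧
      f (Fin.snoc l τ : Fin (n + 1) → ℝ) ≤ f (Fin.snoc (D.mulVec l) τ : Fin (n + 1) → ℝ) := by
  obtain ⟨w, hw0, hw1, hwD⟩ := exists_eq_sum_perm_of_mem_doublyStochastic hD
  -- a permutation of the first entries, extended by fixing the last one
  have hperm : ∀ σ : Equiv.Perm (Fin n), ∃ σ' : Equiv.Perm (Fin (n + 1)),
      (Fin.snoc (l ∘ σ) τ : Fin (n + 1) → ℝ) = (Fin.snoc l τ : Fin (n + 1) → ℝ) ∘ σ' := by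
    intro σ
    let F : Equiv.Perm (Fin n) → Fin (n + 1) → Fin (n + 1) := fun σ =>
      Fin.lastCases (motive := fun _ => Fin (n + 1)) (Fin.last n) (fun i => (σ i).castSucc)
    have hF : ∀ σ : Equiv.Perm (Fin n), Function.LeftInverse (F σ⁻¹) (F σ) := by
      intro σ i
      refine Fin.lastCases ?_ (fun i => ?_) i <;> simp [F]
    refine ⟨⟨F σ, F σ⁻¹, hF σ, by have h := hF σ⁻¹; rwa [inv_inv] at h⟩, ?_⟩
    ext i
    refine Fin.lastCases ?_ (fun i => ?_) i <;> simp [F]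
  have hmem : ∀ σ : Equiv.Perm (Fin n), (Fin.snoc (l ∘ σ) τ : Fin (n + 1) → ℝ) ∈ Γ := by
    intro σ
    obtain ⟨σ', h⟩ := hperm σ
    rw [h]; exact hΓ.perm_mem σ' _ hl
  have hval : ∀ σ : Equiv.Perm (Fin n), f (Fin.snoc (l ∘ σ) τ : Fin (n + 1) → ℝ)
      = f (Fin.snoc l τ : Fin (n + 1) → ℝ) := by
    intro σ
    obtain ⟨σ', h⟩ := hperm σ
    rw [h]; exact hf.perm σ' _ hl
  have heq : (Fin.snoc (D.mulVec l) τ : Fin (n + 1) → ℝ)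
      = ∑ σ, w σ • (Fin.snoc (l ∘ σ) τ : Fin (n + 1) → ℝ) := by
    ext i
    rw [Finset.sum_apply]
    refine Fin.lastCases ?_ (fun i => ?_) i
    · simp [← Finset.sum_mul, hw1]
    · simp only [Fin.snoc_castSucc, Pi.smul_apply, smul_eq_mul, Function.comp]
      rw [← hwD, Matrix.sum_mulVec, Finset.sum_apply]
      refine Finset.sum_congr rfl (fun σ _ => ?_)
      rw [Matrix.smul_mulVec, Matrix.permMatrix_mulVec]
      simp
  rw [heq]
  refine ⟨hΓ.convex.sum_mem (fun σ _ => hw0 σ) hw1 (fun σ _ => hmem σ), ?_⟩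
  have h := hconc.le_map_sum (t := Finset.univ) (w := w)
    (p := fun σ : Equiv.Perm (Fin n) => (Fin.snoc (l ∘ σ) τ : Fin (n + 1) → ℝ))
    (fun σ _ => hw0 σ) hw1 (fun σ _ => hmem σ)
  simp only [hval, smul_eq_mul, ← Finset.sum_mul, hw1, one_mul] at h
  exact h

end Concave

/-! ### Concave functions of eigenvalues -/

section Spectral

open scoped InnerProductSpace

variable {n : ℕ}

/-- `l` lists the diagonal of the bilinear form `Z` in the orthonormal basis `b`, in which `Z` is
diagonal. -/
def DiagIn (Z : Model n →L[ℝ] Model n →L[ℝ] ℝ) (b : OrthonormalBasis (Fin n) ℝ (Model n))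
    (l : Fin n → ℝ) : Prop :=
  ∀ i j, Z (b i) (b j) = if i = j then l i else 0

theorem DiagIn.apply_eq_sum {Z : Model n →L[ℝ] Model n →L[ℝ] ℝ}
    {b : OrthonormalBasis (Fin n) ℝ (Model n)} {l : Fin n → ℝ} (h : DiagIn Z b l) (x y : Model n) :
    Z x y = ∑ i, l i * ⟪b i, x⟫_ℝ * ⟪b i, y⟫_ℝ := by
  conv_lhs => rw [← b.sum_repr' x, ← b.sum_repr' y]
  simp only [map_sum, map_smul, sum_apply, smul_apply, smul_eq_mul, h _ _]
  simp only [mul_ite, mul_zero]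
  refine Finset.sum_congr rfl (fun i _ => ?_)
  simp only [Finset.sum_ite_eq', Finset.mem_univ, if_true]
  ring

theorem exists_diagIn (Z : Model n →L[ℝ] Model n →L[ℝ] ℝ) (hZ : ∀ x y, Z x y = Z y x) :
    ∃ (b : OrthonormalBasis (Fin n) ℝ (Model n)) (l : Fin n → ℝ), DiagIn Z b l := by
  let T : Model n →ₗ[ℝ] Model n :=
    ((InnerProductSpace.toDual ℝ (Model n)).symm.toContinuousLinearEquiv.toContinuousLinearMap
      ∘L Z : Model n →L[ℝ] Model n).toLinearMap
  have hT : ∀ x y, ⟪T x, y⟫_ℝ = Z x y := by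
    intro x y
    change ⟪(InnerProductSpace.toDual ℝ (Model n)).symm (Z x), y⟫_ℝ = Z x y
    exact InnerProductSpace.toDual_symm_apply
  have hs : T.IsSymmetric := by
    intro x y
    rw [hT, real_inner_comm, hT, hZ]
  have hn : Module.finrank ℝ (Model n) = n := by simp
  refine ⟨hs.eigenvectorBasis hn, hs.eigenvalues hn, fun i j => ?_⟩
  rw [← hT, hs.apply_eigenvectorBasis, inner_smul_left]
  simp [OrthonormalBasis.inner_eq_ite]

theorem sum_inner_sq (b : OrthonormalBasis (Fin n) ℝ (Model n)) (x : Model n) :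
    ∑ i, ⟪b i, x⟫_ℝ ^ 2 = ‖x‖ ^ 2 := by
  rw [← b.sum_sq_norm_inner_right x]
  simp

/-- The diagonal of a form in one orthonormal basis arises from its eigenvalues by a doubly
stochastic matrix. -/
theorem DiagIn.exists_doublyStochastic {Z : Model n →L[ℝ] Model n →L[ℝ] ℝ}
    {b : OrthonormalBasis (Fin n) ℝ (Model n)} {l : Fin n → ℝ} (h : DiagIn Z b l)
    (b' : OrthonormalBasis (Fin n) ℝ (Model n)) :
    ∃ D ∈ doublyStochastic ℝ (Fin n), D.mulVec l = fun i => Z (b' i) (b' i) := by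
  refine ⟨Matrix.of fun i j => ⟪b j, b' i⟫_ℝ ^ 2, ?_, ?_⟩
  · rw [mem_doublyStochastic_iff_sum]
    simp only [Matrix.of_apply]
    refine ⟨fun _ _ => sq_nonneg _, fun i => ?_, fun j => ?_⟩
    · rw [sum_inner_sq]; simp
    · simp_rw [real_inner_comm (b' _) (b j)]
      rw [sum_inner_sq]; simp
  · ext i
    rw [h.apply_eq_sum]
    simp only [Matrix.mulVec, dotProduct, Matrix.of_apply]
    exact Finset.sum_congr rfl (fun j _ => by ring)

theorem diag_mem_and_le {Γ : Set (Fin (n + 1) → ℝ)} {f : (Fin (n + 1) → ℝ) → ℝ}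
    (hΓ : IsConeDomain Γ) (hf : IsSymmSmooth Γ f) (hconc : ConcaveOn ℝ Γ f)
    {Z : Model n →L[ℝ] Model n →L[ℝ] ℝ}
    {b : OrthonormalBasis (Fin n) ℝ (Model n)} {l : Fin n → ℝ} (h : DiagIn Z b l) {τ : ℝ}
    (hl : (Fin.snoc l τ : Fin (n + 1) → ℝ) ∈ Γ) (b' : OrthonormalBasis (Fin n) ℝ (Model n)) :
    (Fin.snoc (fun i => Z (b' i) (b' i)) τ : Fin (n + 1) → ℝ) ∈ Γ ∧
      f (Fin.snoc l τ : Fin (n + 1) → ℝ)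
        ≤ f (Fin.snoc (fun i => Z (b' i) (b' i)) τ : Fin (n + 1) → ℝ) := by
  obtain ⟨D, hD, hDl⟩ := h.exists_doublyStochastic b'
  rw [← hDl]
  exact snoc_mulVec_mem_and_le hΓ hf hconc hD hl

/-- A form `T` that exceeds `Z` by a rank one gain `G w ⊗ w` in a direction in which `Z` is
negative, up to a loss `κ`, has a larger value of `f` on its eigenvalues, provided that `κ` is small
compared with `G ^ 2 / Λ`, where `-Λ` bounds the eigenvalues of `Z` from below. The gain survives in
the eigenbasis of `Z + G w ⊗ w - κ` because `w` meets its negative eigenspaces. -/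
theorem exists_lt_of_rank_one_gain (hn : 0 < n) {Γ : Set (Fin (n + 1) → ℝ)}
    {f : (Fin (n + 1) → ℝ) → ℝ}
    (hΓ : IsConeDomain Γ) (hf : IsSymmSmooth Γ f) (hconc : ConcaveOn ℝ Γ f)
    (hmono : ∀ l ∈ Γ, ∀ i, 0 < partialD f i l) {ν : ℝ} (hν : 0 < ν)
    (hneg : ∀ l ∈ Γ, ∀ j, l j < 0 → ν * (1 + ∑ i, partialD f i l) ≤ partialD f j l) :
    ∃ C : ℝ, 0 < C ∧ ∀ (Z T : Model n →L[ℝ] Model n →L[ℝ] ℝ)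
      (b b' : OrthonormalBasis (Fin n) ℝ (Model n)) (l l' : Fin n → ℝ) (τ τ' : ℝ) (w : Model n)
      (G Λ κ : ℝ), DiagIn Z b l → DiagIn T b' l' →
      (Fin.snoc l τ : Fin (n + 1) → ℝ) ∈ Γ → τ ≤ τ' → ‖w‖ = 1 → 0 < G → 0 < κ →
      Z w w ≤ - (2 * G) → (∀ i, - Λ ≤ l i) →
      (∀ x, Z x x + G * ⟪w, x⟫_ℝ ^ 2 - κ * ‖x‖ ^ 2 ≤ T x x) → C * (κ * (Λ + κ)) ≤ G ^ 2 →
      f (Fin.snoc l τ : Fin (n + 1) → ℝ) + κ < f (Fin.snoc l' τ' : Fin (n + 1) → ℝ) := by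
  obtain ⟨CΓ, hCΓ, htrade⟩ := hΓ.exists_trade
  have hn' : (0 : ℝ) < n := by exact_mod_cast hn
  refine ⟨n * (2 * CΓ + 4 + 4 / ν), by positivity, ?_⟩
  intro Z T b b' l l' τ τ' w G Λ κ hZ hT hl hτ hw hG hκ hZw hΛ hZT hC
  have hZsymm : ∀ x y, Z x y = Z y x := by
    intro x y
    rw [hZ.apply_eq_sum, hZ.apply_eq_sum]
    exact Finset.sum_congr rfl (fun i _ => by ring)
  have hZlow : ∀ x, - Λ * ‖x‖ ^ 2 ≤ Z x x := by
    intro x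
    rw [hZ.apply_eq_sum, ← sum_inner_sq b x, Finset.mul_sum]
    refine Finset.sum_le_sum (fun i _ => ?_)
    nlinarith [hΛ i, sq_nonneg ⟪b i, x⟫_ℝ]
  have hΛG : 2 * G ≤ Λ := by
    have := hZlow w
    rw [hw] at this; linarith
  set Λ' := Λ + κ with hΛ'
  have hΛ'pos : 0 < Λ' := by linarith
  -- the intermediate form
  let I₂ : Model n →L[ℝ] Model n →L[ℝ] ℝ := innerSL ℝ
  let Z' : Model n →L[ℝ] Model n →L[ℝ] ℝ :=
    Z + G • ((innerSL ℝ w).smulRight (innerSL ℝ w)) - κ • I₂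
  have hZ' : ∀ x y, Z' x y = Z x y + G * (⟪w, x⟫_ℝ * ⟪w, y⟫_ℝ) - κ * ⟪x, y⟫_ℝ := by
    intro x y
    simp only [Z', I₂, sub_apply, add_apply, smul_apply, smul_eq_mul,
      ContinuousLinearMap.smulRight_apply]
    rfl
  have hZ'sq : ∀ x, Z' x x = Z x x + G * ⟪w, x⟫_ℝ ^ 2 - κ * ‖x‖ ^ 2 := by
    intro x; rw [hZ', real_inner_self_eq_norm_sq]; ring
  obtain ⟨e, μ, hμ⟩ := exists_diagIn Z' (fun x y => by
    rw [hZ', hZ', hZsymm x y, real_inner_comm x y]; ring)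
  have hμlow : ∀ i, - Λ' ≤ μ i := by
    intro i
    have h1 := hμ i i
    simp only [if_true] at h1
    have h2 := hZlow (e i)
    have h3 := hZ'sq (e i)
    simp only [OrthonormalBasis.norm_eq_one] at h2 h3
    nlinarith [sq_nonneg ⟪w, e i⟫_ℝ]
  -- a negative eigenvalue of the intermediate form whose eigenvector meets `w`
  obtain ⟨k, hk, hkw⟩ : ∃ k, μ k < 0 ∧ G ≤ n * (Λ' * ⟪e k, w⟫_ℝ ^ 2) := by
    by_contra! hcon
    have h1 : Z' w w ≤ - G := by
      have h2 : ⟪w, w⟫_ℝ = 1 := by rw [real_inner_self_eq_norm_sq, hw]; norm_num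
      rw [hZ', h2]; linarith
    have h3 : Z' w w = ∑ i, μ i * ⟪e i, w⟫_ℝ ^ 2 := by
      rw [hμ.apply_eq_sum]; exact Finset.sum_congr rfl (fun i _ => by ring)
    have h4 : ∑ _i : Fin n, (-(G / n)) < ∑ i, μ i * ⟪e i, w⟫_ℝ ^ 2 := by
      refine Finset.sum_lt_sum_of_nonempty ⟨⟨0, hn⟩, Finset.mem_univ _⟩ (fun i _ => ?_)
      have hGn : 0 < G / n := by positivity
      rcases lt_or_ge (μ i) 0 with h | h
      · have h5 := hcon i h
        have h6 : Λ' * ⟪e i, w⟫_ℝ ^ 2 < G / n := by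
          rw [lt_div_iff₀ hn']; linarith
        nlinarith [hμlow i, sq_nonneg ⟪e i, w⟫_ℝ]
      · nlinarith [sq_nonneg ⟪e i, w⟫_ℝ]
    rw [Finset.sum_const, Finset.card_univ, Fintype.card_fin, nsmul_eq_mul] at h4
    have h5 : (n : ℝ) * -(G / n) = - G := by field_simp
    linarith
  set g₀ : ℝ := G ^ 2 / (n * Λ') with hg₀
  have hg₀κ : (2 * CΓ + 4 + 4 / ν) * κ ≤ g₀ := by
    rw [hg₀, le_div_iff₀ (by positivity)]
    calc _ = n * (2 * CΓ + 4 + 4 / ν) * (κ * (Λ + κ)) := by rw [hΛ']; ring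
      _ ≤ _ := hC
  have hgk : g₀ ≤ G * ⟪e k, w⟫_ℝ ^ 2 := by
    rw [hg₀, div_le_iff₀ (by positivity)]
    nlinarith
  set d : Fin n → ℝ := fun i => Z (e i) (e i) with hd
  have hdμ : ∀ i, d i = μ i - G * ⟪e i, w⟫_ℝ ^ 2 + κ := by
    intro i
    have h1 := hμ i i
    simp only [if_true] at h1
    have h3 := hZ'sq (e i)
    rw [OrthonormalBasis.norm_eq_one, real_inner_comm (e i) w] at h3
    simp only [hd]
    linarith
  obtain ⟨hdΓ, hfd⟩ := diag_mem_and_le hΓ hf hconc hZ hl e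
  have h4ν : 0 < 4 / ν := by positivity
  have hCκ : 0 < CΓ * κ := by positivity
  have h4κ : 0 < 4 / ν * κ := by positivity
  have hdk : d k < - g₀ + κ := by rw [hdμ]; linarith
  have hmem := htrade _ hdΓ k.castSucc (by simp only [Fin.snoc_castSucc]; linarith) κ (g₀ / 2) hκ
    (by linarith) (by simp only [Fin.snoc_castSucc]; linarith)
  set D : Fin (n + 1) → ℝ := Fin.snoc d τ with hD
  set D' : Fin (n + 1) → ℝ := D + (g₀ / 2) • Pi.single k.castSucc 1 - (fun _ => κ) with hD'
  -- the gain in `f`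
  have hgain : f D + κ < f D' := by
    have h1 := sum_partialD_mul_le_sub hΓ hf hconc hdΓ hmem
    have h2 : ∑ i, partialD f i D' * (D' i - D i)
        = (g₀ / 2) * partialD f k.castSucc D' - κ * ∑ i, partialD f i D' := by
      have : ∀ i, partialD f i D' * (D' i - D i)
          = (g₀ / 2) * (partialD f i D' * (Pi.single k.castSucc (1 : ℝ) : Fin (n + 1) → ℝ) i)
            - κ * partialD f i D' := by
        intro i
        simp only [hD', Pi.add_apply, Pi.sub_apply, Pi.smul_apply, smul_eq_mul]
        ring
      simp_rw [this]
      rw [Finset.sum_sub_distrib, ← Finset.mul_sum, ← Finset.mul_sum]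
      simp [Pi.single_apply]
    have h3 := hneg D' hmem k.castSucc (by
      simp only [hD', hD, Pi.add_apply, Pi.sub_apply, Pi.smul_apply, smul_eq_mul,
        Pi.single_eq_same, Fin.snoc_castSucc]
      linarith)
    have h4 : 0 ≤ ∑ i, partialD f i D' := Finset.sum_nonneg (fun i _ => (hmono D' hmem i).le)
    have h5 : 4 * κ ≤ ν * g₀ := by
      have : 4 / ν * κ * ν = 4 * κ := by field_simp
      nlinarith
    have h6 : g₀ / 2 * (ν * (1 + ∑ i, partialD f i D')) ≤ g₀ / 2 * partialD f k.castSucc D' :=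
      mul_le_mul_of_nonneg_left h3 (by linarith)
    have h7 : f D' - f D ≥ (g₀ / 2) * partialD f k.castSucc D' - κ * ∑ i, partialD f i D' := by
      rw [← h2]; exact h1
    nlinarith
  have hle : D' ≤ (Fin.snoc μ τ : Fin (n + 1) → ℝ) := by
    intro i
    refine Fin.lastCases ?_ (fun i => ?_) i
    · have h : (Pi.single k.castSucc (1 : ℝ) : Fin (n + 1) → ℝ) (Fin.last n) = 0 :=
        Pi.single_eq_of_ne (Fin.castSucc_lt_last k).ne' _
      simp only [hD', hD, Pi.add_apply, Pi.sub_apply, Pi.smul_apply, smul_eq_mul, h,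
        Fin.snoc_last]
      linarith
    · simp only [hD', hD, Pi.add_apply, Pi.sub_apply, Pi.smul_apply, smul_eq_mul,
        Fin.snoc_castSucc, hdμ]
      rcases eq_or_ne i k with rfl | hik
      · rw [Pi.single_eq_same]; linarith
      · rw [Pi.single_eq_of_ne (fun h => hik (Fin.castSucc_injective n h))]
        nlinarith [sq_nonneg ⟪e i, w⟫_ℝ]
  have hμΓ := hΓ.mono hmem hle
  have hfμ := le_of_le_of_mem hΓ hf hconc hmono hmem hle
  obtain ⟨hbΓ, hfb⟩ := diag_mem_and_le hΓ hf hconc hμ hμΓ b'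
  have hle2 : (Fin.snoc (fun i => Z' (b' i) (b' i)) τ : Fin (n + 1) → ℝ)
      ≤ (Fin.snoc l' τ' : Fin (n + 1) → ℝ) := by
    intro i
    refine Fin.lastCases ?_ (fun i => ?_) i
    · simpa using hτ
    · simp only [Fin.snoc_castSucc]
      have h1 := hT i i
      simp only [if_true] at h1
      rw [hZ'sq, ← h1]; exact hZT _
  have hfl := le_of_le_of_mem hΓ hf hconc hmono hbΓ hle2
  linarith

end Spectral

/-! ### The algebraic two-point inequality -/

section TwoPoint

open scoped InnerProductSpace

variable {n : ℕ}

/-- The gain from pairing `x` with its reflection `y` in the direction `ε`. -/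
theorem add_sq_le_of_reflection {a C θ Q C₃ : ℝ} (ha : 0 < a) (hC : 0 < C) (hθ : 0 < θ)
    (hQ : 0 < Q) {ε : Model n} (hε : ‖ε‖ = 1) (hC₃ : 12 * C ^ 2 / a + 3 * C ≤ C₃)
    {X Y A B : Model n →L[ℝ] Model n →L[ℝ] ℝ}
    (hXY : ∀ x y, X x x - Y y y ≤ - (a * Q * θ) * ⟪ε, x - y⟫_ℝ ^ 2
        + Q * (‖x - y‖ ^ 2 - ⟪ε, x - y⟫_ℝ ^ 2) + C * Q * θ ^ 2 * ‖x - y‖ * (‖x‖ + ‖y‖)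
        + C * Q * θ ^ 3 * (‖x‖ ^ 2 + ‖y‖ ^ 2))
    (hB : ∀ x y, |B x y| ≤ C * Q * θ ^ 2 * ‖x‖ * ‖y‖)
    (hAB : ∀ x, A x x - B x x ≤ C * Q * θ ^ 3 * ‖x‖ ^ 2) {x y : Model n}
    (hR : y = x - (2 * ⟪ε, x⟫_ℝ) • ε) :
    (X + A) x x + a * Q * θ / 4 * ⟪ε, x⟫_ℝ ^ 2 - C₃ * (Q * θ ^ 3) * ‖x‖ ^ 2 ≤ Y y y + B y y := by
  have hyn : ‖y‖ = ‖x‖ := by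
    have h1 : ‖y‖ ^ 2 = ‖x‖ ^ 2 := by
      rw [hR, norm_sub_sq_real, inner_smul_right, norm_smul, hε, real_inner_comm,
        Real.norm_eq_abs, mul_one, sq_abs]
      ring
    exact (pow_left_inj₀ (norm_nonneg _) (norm_nonneg _) two_ne_zero).1 h1
  set s := ⟪ε, x⟫_ℝ with hs
  have hxy : x - y = (2 * s) • ε := by rw [hR]; abel
  have hn1 : ‖x - y‖ = 2 * |s| := by
    rw [hxy, norm_smul, hε, mul_one, Real.norm_eq_abs, abs_mul]; norm_num
  have hi : ⟪ε, x - y⟫_ℝ = 2 * s := by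
    rw [hxy, inner_smul_right, real_inner_self_eq_norm_sq, hε]; ring
  have h1 := hXY x y
  rw [hi, hn1, hyn] at h1
  have h2 := hAB x
  have h3 : B (y) (y) = B x x - 2 * s * B x ε - 2 * s * B ε x + 4 * s ^ 2 * B ε ε := by
    rw [hR]
    simp only [map_sub, map_smul, sub_apply, smul_apply, smul_eq_mul]
    ring
  have hsx : |s| ≤ ‖x‖ := by
    have := abs_real_inner_le_norm ε x
    rwa [hε, one_mul] at this
  have h4 := hB x ε
  have h5 := hB ε x
  have h6 := hB ε ε
  simp only [hε, mul_one] at h4 h5 h6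
  have hs2 : |s| ^ 2 = s ^ 2 := sq_abs s
  set c := C * Q * θ ^ 2 with hc
  have hc0 : 0 < c := by positivity
  have e1 : 2 * s * B x ε ≤ 2 * |s| * (c * ‖x‖) := by
    calc 2 * s * B x ε ≤ |2 * s * B x ε| := le_abs_self _
      _ = 2 * |s| * |B x ε| := by rw [abs_mul, abs_mul]; norm_num
      _ ≤ _ := mul_le_mul_of_nonneg_left h4 (by positivity)
  have e2 : 2 * s * B ε x ≤ 2 * |s| * (c * ‖x‖) := by
    calc 2 * s * B ε x ≤ |2 * s * B ε x| := le_abs_self _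
      _ = 2 * |s| * |B ε x| := by rw [abs_mul, abs_mul]; norm_num
      _ ≤ _ := mul_le_mul_of_nonneg_left h5 (by positivity)
  have e3 : - (4 * s ^ 2 * B ε ε) ≤ 4 * (|s| * ‖x‖) * c := by
    have h7 := (abs_le.1 h6).1
    have h8 : s ^ 2 ≤ |s| * ‖x‖ := by rw [← hs2, sq]; gcongr
    have : - (4 * s ^ 2 * B ε ε) ≤ 4 * s ^ 2 * c := by nlinarith [sq_nonneg s]
    exact this.trans (by gcongr)
  -- the cross terms are absorbed by the gain
  have e4 : 12 * (c * |s| * ‖x‖) ≤ 3 * (a * Q * θ) * s ^ 2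
      + 12 * C ^ 2 / a * (Q * θ ^ 3) * ‖x‖ ^ 2 := by
    have : 0 ≤ 3 * Q * θ / a * (a * |s| - 2 * C * θ * ‖x‖) ^ 2 := by positivity
    have h9 : 3 * Q * θ / a * (a * |s| - 2 * C * θ * ‖x‖) ^ 2
        = 3 * (a * Q * θ) * |s| ^ 2 - 12 * (c * |s| * ‖x‖)
          + 12 * C ^ 2 / a * (Q * θ ^ 3) * ‖x‖ ^ 2 := by
      rw [hc]; field_simp; ring
    rw [← hs2]; linarith
  have e5 : (12 * C ^ 2 / a + 3 * C) * ((Q * θ ^ 3) * ‖x‖ ^ 2)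
      ≤ C₃ * ((Q * θ ^ 3) * ‖x‖ ^ 2) := mul_le_mul_of_nonneg_right hC₃ (by positivity)
  have e7 : (X + A) x x = X x x + A x x := rfl
  have e8 : 0 ≤ a * Q * θ * s ^ 2 := by positivity
  have e9 : C * Q * θ ^ 3 * (‖x‖ ^ 2 + ‖x‖ ^ 2) + C * Q * θ ^ 3 * ‖x‖ ^ 2
      = 3 * C * ((Q * θ ^ 3) * ‖x‖ ^ 2) := by ring
  have e10 : c * (2 * |s|) * (‖x‖ + ‖x‖) = 4 * (c * |s| * ‖x‖) := by ring
  have e13 : (2 * |s|) ^ 2 = 4 * s ^ 2 := by rw [mul_pow, hs2]; norm_num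
  rw [e13, e10] at h1
  rw [e7]
  have e11 : X x x + A x x - Y y y - B y y ≤ - (a * Q * θ) * s ^ 2
      + C₃ * ((Q * θ ^ 3) * ‖x‖ ^ 2) := by
    have e12 : 4 * (c * |s| * ‖x‖) + 2 * |s| * (c * ‖x‖) + 2 * |s| * (c * ‖x‖)
      + 4 * (|s| * ‖x‖) * c = 12 * (c * |s| * ‖x‖) + 4 * (c * |s| * ‖x‖) * 0 := by ring
    clear_value c
    linarith
  linarith

/-- The gain from projecting off an eigenvector of a very negative eigenvalue `-Λ`. -/
theorem add_sq_le_of_projection {a C θ Q C₃ Λ : ℝ} (ha : 0 < a) (hC : 0 < C) (hθ : 0 < θ)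
    (hθ1 : θ ≤ 1) (hQ : 0 < Q) {ε : Model n} {b : OrthonormalBasis (Fin n) ℝ (Model n)}
    {l : Fin n → ℝ} {i : Fin n} (hv : ‖b i‖ = 1) (hΛQ : 4 * Q < Λ) (hΛ : l i = -Λ)
    (hC₃ : 25 * C ^ 2 + 3 * C ≤ C₃)
    {X Y A B : Model n →L[ℝ] Model n →L[ℝ] ℝ} (hZ : DiagIn (X + A) b l)
    (hXY : ∀ x y, X x x - Y y y ≤ - (a * Q * θ) * ⟪ε, x - y⟫_ℝ ^ 2
        + Q * (‖x - y‖ ^ 2 - ⟪ε, x - y⟫_ℝ ^ 2) + C * Q * θ ^ 2 * ‖x - y‖ * (‖x‖ + ‖y‖)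
        + C * Q * θ ^ 3 * (‖x‖ ^ 2 + ‖y‖ ^ 2))
    (hA : ∀ x y, |A x y| ≤ C * Q * θ ^ 2 * ‖x‖ * ‖y‖)
    (hAB : ∀ x, A x x - B x x ≤ C * Q * θ ^ 3 * ‖x‖ ^ 2) (y : Model n) :
    (X + A) y y + Λ / 2 * ⟪b i, y⟫_ℝ ^ 2 - C₃ * (Q * θ ^ 3) * ‖y‖ ^ 2 ≤ (Y + B) y y := by
  have hvv : (X + A) (b i) (b i) = - Λ := by rw [hZ i i]; simp [hΛ]
  set s := ⟪b i, y⟫_ℝ with hs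
  set x := y - s • b i with hx
  have hxy : x - y = (-s) • b i := by rw [hx, neg_smul]; abel
  have hn1 : ‖x - y‖ = |s| := by
    rw [hxy, norm_smul, hv, mul_one, Real.norm_eq_abs, abs_neg]
  have hxn : ‖x‖ ≤ ‖y‖ := by
    have h1 : ‖x‖ ^ 2 = ‖y‖ ^ 2 - s ^ 2 := by
      rw [hx, norm_sub_sq_real, inner_smul_right, norm_smul, hv, real_inner_comm, ← hs,
        Real.norm_eq_abs, mul_one, sq_abs]
      ring
    exact abs_le_of_sq_le_sq' (by nlinarith [sq_nonneg s]) (norm_nonneg y) |>.2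
  have hsx : |s| ≤ ‖y‖ := by
    have := abs_real_inner_le_norm (b i) y
    rwa [hv, one_mul] at this
  have h1 := hXY x y
  rw [hn1] at h1
  have hZv : ∀ z, (X + A) (b i) z = - Λ * ⟪b i, z⟫_ℝ ∧ (X + A) z (b i) = - Λ * ⟪b i, z⟫_ℝ := by
    intro z
    rw [hZ.apply_eq_sum, hZ.apply_eq_sum]
    simp [OrthonormalBasis.inner_eq_ite, hΛ]
  have h2 : (X + A) x x = (X + A) y y + Λ * s ^ 2 := by
    rw [hx]
    simp only [map_sub, map_smul, sub_apply, smul_apply, smul_eq_mul, (hZv y).1, (hZv y).2, hvv]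
    rw [← hs]; ring
  have h3 := hAB y
  have h4 : A x x = A y y - s * A y (b i) - s * A (b i) y + s ^ 2 * A (b i) (b i) := by
    rw [hx]
    simp only [map_sub, map_smul, sub_apply, smul_apply, smul_eq_mul]
    ring
  have h5 := hA y (b i)
  have h6 := hA (b i) y
  have h7 := hA (b i) (b i)
  simp only [hv, mul_one] at h5 h6 h7
  have hs2 : |s| ^ 2 = s ^ 2 := sq_abs s
  set c := C * Q * θ ^ 2 with hc
  have hc0 : 0 < c := by positivity
  have e1 : - (s * A y (b i)) ≤ |s| * (c * ‖y‖) := by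
    calc - (s * A y (b i)) ≤ |s * A y (b i)| := neg_le_abs _
      _ = |s| * |A y (b i)| := abs_mul _ _
      _ ≤ _ := mul_le_mul_of_nonneg_left h5 (by positivity)
  have e2 : - (s * A (b i) y) ≤ |s| * (c * ‖y‖) := by
    calc - (s * A (b i) y) ≤ |s * A (b i) y| := neg_le_abs _
      _ = |s| * |A (b i) y| := abs_mul _ _
      _ ≤ _ := mul_le_mul_of_nonneg_left h6 (by positivity)
  have e3 : s ^ 2 * A (b i) (b i) ≤ |s| * ‖y‖ * c := by
    have h8 : s ^ 2 ≤ |s| * ‖y‖ := by rw [← hs2, sq]; gcongr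
    have : s ^ 2 * A (b i) (b i) ≤ s ^ 2 * c :=
      mul_le_mul_of_nonneg_left (abs_le.1 h7).2 (sq_nonneg _)
    exact this.trans (by gcongr)
  have e4 : c * |s| * (‖x‖ + ‖y‖) ≤ 2 * (c * |s| * ‖y‖) := by
    have := mul_le_mul_of_nonneg_left hxn (show 0 ≤ c * |s| by positivity)
    linarith
  have e5 : C * Q * θ ^ 3 * (‖x‖ ^ 2 + ‖y‖ ^ 2) ≤ 2 * (C * Q * θ ^ 3 * ‖y‖ ^ 2) := by
    have h8 : ‖x‖ ^ 2 ≤ ‖y‖ ^ 2 := by gcongr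
    have := mul_le_mul_of_nonneg_left h8 (show 0 ≤ C * Q * θ ^ 3 by positivity)
    linarith
  have e6 : 5 * (c * |s| * ‖y‖) ≤ Q * s ^ 2 + 25 * C ^ 2 * (Q * θ ^ 3) * ‖y‖ ^ 2 := by
    have h8 : 0 ≤ Q * (|s| - 5 / 2 * C * θ ^ 2 * ‖y‖) ^ 2 := by positivity
    have h9 : Q * (|s| - 5 / 2 * C * θ ^ 2 * ‖y‖) ^ 2 = Q * |s| ^ 2 - 5 * (c * |s| * ‖y‖)
        + 25 / 4 * C ^ 2 * (Q * θ ^ 4) * ‖y‖ ^ 2 := by rw [hc]; ring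
    have h10 : 25 / 4 * C ^ 2 * (Q * θ ^ 4) * ‖y‖ ^ 2
        ≤ 25 * C ^ 2 * (Q * θ ^ 3) * ‖y‖ ^ 2 := by
      have : θ ^ 4 ≤ θ ^ 3 := pow_le_pow_of_le_one hθ.le hθ1 (by norm_num)
      gcongr
      norm_num
    rw [← hs2]; linarith
  have e7 : (25 * C ^ 2 + 3 * C) * ((Q * θ ^ 3) * ‖y‖ ^ 2)
      ≤ C₃ * ((Q * θ ^ 3) * ‖y‖ ^ 2) := mul_le_mul_of_nonneg_right hC₃ (by positivity)
  have e9 : 0 ≤ a * Q * θ * ⟪ε, x - y⟫_ℝ ^ 2 := by positivity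
  have e10 : 0 ≤ Q * ⟪ε, x - y⟫_ℝ ^ 2 := by positivity
  have e11 : (X + A) x x = X x x + A x x := rfl
  have e12 : (Y + B) y y = Y y y + B y y := rfl
  have e13 : 4 * Q * s ^ 2 ≤ Λ * s ^ 2 := mul_le_mul_of_nonneg_right hΛQ.le (sq_nonneg _)
  rw [hs2] at h1
  rw [e12]
  clear_value c x
  linarith

/-- The algebraic core of the two-point argument. Let `X + A` and `Y + B` be the augmented Hessians
at the two ends of a geodesic of length `s` with unit direction `ε`, in orthonormal frames. In the
units `Q = K / s` and `θ = s ^ α`, the second variation bounds `X x x - Y y y`, with a gain `a Q θ`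
in the direction of `ε`. This is incompatible with `f` being almost as large at `X + A` as at
`Y + B`. If the eigenvalues of `X + A` are at least `-4 Q`, then the gain comes from pairing `x` with
its reflection in `ε`; otherwise, it comes from projecting off the lowest eigenvector. -/
theorem exists_two_point_contradiction (hn : 0 < n) {Γ : Set (Fin (n + 1) → ℝ)}
    {f : (Fin (n + 1) → ℝ) → ℝ}
    (hΓ : IsConeDomain Γ) (hf : IsSymmSmooth Γ f) (hconc : ConcaveOn ℝ Γ f)
    (hmono : ∀ l ∈ Γ, ∀ i, 0 < partialD f i l) {ν : ℝ} (hν : 0 < ν)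
    (hneg : ∀ l ∈ Γ, ∀ j, l j < 0 → ν * (1 + ∑ i, partialD f i l) ≤ partialD f j l)
    {a C : ℝ} (ha : 0 < a) (hC : 0 < C) :
    ∃ θ₁ : ℝ, 0 < θ₁ ∧ ∀ (θ Q : ℝ) (X Y A B : Model n →L[ℝ] Model n →L[ℝ] ℝ)
      (b b' : OrthonormalBasis (Fin n) ℝ (Model n)) (l l' : Fin n → ℝ) (τ τ' : ℝ) (ε : Model n),
      0 < θ → θ ≤ θ₁ → 0 < Q → ‖ε‖ = 1 → DiagIn (X + A) b l → DiagIn (Y + B) b' l' →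
      (Fin.snoc l τ : Fin (n + 1) → ℝ) ∈ Γ → τ ≤ τ' →
      (∀ x y, X x x - Y y y ≤ - (a * Q * θ) * ⟪ε, x - y⟫_ℝ ^ 2
        + Q * (‖x - y‖ ^ 2 - ⟪ε, x - y⟫_ℝ ^ 2) + C * Q * θ ^ 2 * ‖x - y‖ * (‖x‖ + ‖y‖)
        + C * Q * θ ^ 3 * (‖x‖ ^ 2 + ‖y‖ ^ 2)) →
      (∀ x y, |A x y| ≤ C * Q * θ ^ 2 * ‖x‖ * ‖y‖) →
      (∀ x y, |B x y| ≤ C * Q * θ ^ 2 * ‖x‖ * ‖y‖) →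
      (∀ x, A x x - B x x ≤ C * Q * θ ^ 3 * ‖x‖ ^ 2) →
      f (Fin.snoc l' τ' : Fin (n + 1) → ℝ) ≤ f (Fin.snoc l τ : Fin (n + 1) → ℝ) + C * Q * θ ^ 3 →
      False := by
  obtain ⟨CK, hCK, hmain⟩ := exists_lt_of_rank_one_gain hn hΓ hf hconc hmono hν hneg
  set C₃ : ℝ := 12 * C ^ 2 / a + 25 * C ^ 2 + 3 * C with hC₃
  have hC₃pos : 0 < C₃ := by positivity
  refine ⟨min (min 1 (a / (6 * C))) (min (a ^ 2 / (16 * (CK * C₃ * (4 + C₃))))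
    (min (1 / (2 * CK * C₃)) (4 / C₃))), by positivity, ?_⟩
  intro θ Q X Y A B b b' l l' τ τ' ε hθ hθ₁ hQ hε hZ hT hl hτ hXY hA hB hAB hfle
  simp only [le_min_iff] at hθ₁
  obtain ⟨⟨hθ1, hθa⟩, hθb, hθc, hθd⟩ := hθ₁
  rw [le_div_iff₀ (by positivity)] at hθa hθb hθc hθd
  set κ : ℝ := C₃ * (Q * θ ^ 3) with hκ
  have hκpos : 0 < κ := by positivity
  have hκC : C * Q * θ ^ 3 ≤ κ := by
    have : 0 ≤ (12 * C ^ 2 / a + 25 * C ^ 2 + 2 * C) * (Q * θ ^ 3) := by positivity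
    rw [hκ, hC₃]; nlinarith
  have hθ3 : θ ^ 3 ≤ θ := by nlinarith [mul_pos hθ hθ, mul_pos (mul_pos hθ hθ) hθ]
  by_cases hcase : ∀ i, - (4 * Q) ≤ l i
  · -- reflection in `ε`
    let R : Model n ≃ₗᵢ[ℝ] Model n := (ℝ ∙ ε)ᗮ.reflection
    have hR : ∀ x, R x = x - (2 * ⟪ε, x⟫_ℝ) • ε := by
      intro x
      simp only [R, Submodule.reflection_orthogonal_apply, Submodule.reflection_singleton_apply, hε]
      rw [neg_sub, two_smul, ← add_smul]
      congr 2
      simp; ring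
    have hRR : ∀ x, R (R x) = x := fun x => Submodule.reflection_reflection _ x
    let T' : Model n →L[ℝ] Model n →L[ℝ] ℝ :=
      (Y + B).bilinearComp R.toContinuousLinearEquiv.toContinuousLinearMap
        R.toContinuousLinearEquiv.toContinuousLinearMap
    have hT' : ∀ x y, T' x y = Y (R x) (R y) + B (R x) (R y) := fun x y => rfl
    refine absurd hfle (not_le.2 ?_)
    refine lt_of_le_of_lt (by linarith) (hmain (X + A) T' b (b'.map R) l l' τ τ' ε
      (a * Q * θ / 4) (4 * Q) κ hZ ?_ hl hτ hε (by positivity) hκpos ?_ hcase ?_ ?_)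
    · intro i j
      have := hT i j
      rw [hT']
      simpa [hRR] using this
    · have h1 := hXY ε 0
      have h2 := (abs_le.1 (hA ε ε)).2
      have h3 : ⟪ε, ε⟫_ℝ = 1 := by rw [real_inner_self_eq_norm_sq, hε]; norm_num
      simp only [map_zero, sub_zero, hε, norm_zero, h3] at h1 h2
      have h4 : C * Q * θ ^ 3 ≤ C * Q * θ ^ 2 := by
        have : θ ^ 3 ≤ θ ^ 2 := by nlinarith [mul_pos hθ hθ]
        exact mul_le_mul_of_nonneg_left this (by positivity)
      have h5 : 6 * (C * Q * θ ^ 2) ≤ a * Q * θ := by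
        have := mul_le_mul_of_nonneg_left hθa (show 0 ≤ Q * θ by positivity)
        nlinarith
      have h6 : (X + A) ε ε = X ε ε + A ε ε := rfl
      rw [h6]
      norm_num at h1
      linarith
    · intro x
      rw [hT']
      exact add_sq_le_of_reflection ha hC hθ hQ hε
        (by rw [hC₃]; linarith [show 0 ≤ 25 * C ^ 2 by positivity]) hXY hB hAB
        (hR x)
    · have h1 : CK * (κ * (4 * Q + κ)) ≤ CK * (C₃ * (Q * θ ^ 3) * (4 * Q + C₃ * Q)) := by
        rw [hκ]
        gcongr
        nlinarith [mul_pos hC₃pos hQ]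
      refine h1.trans ?_
      have h2 : CK * (C₃ * (Q * θ ^ 3) * (4 * Q + C₃ * Q))
          = (θ * (CK * C₃ * (4 + C₃))) * (Q ^ 2 * θ ^ 2) := by ring
      have h3 : (a * Q * θ / 4) ^ 2 = (a ^ 2 / 16) * (Q ^ 2 * θ ^ 2) := by ring
      rw [h2, h3]
      exact mul_le_mul_of_nonneg_right (by linarith) (by positivity)
  · -- projection off the lowest eigenvector
    push Not at hcase
    obtain ⟨i₀, hi₀⟩ := hcase
    obtain ⟨i, -, hi⟩ := Finset.exists_min_image Finset.univ l ⟨i₀, Finset.mem_univ _⟩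
    have hli : l i < - (4 * Q) := (hi i₀ (Finset.mem_univ _)).trans_lt hi₀
    set Λ : ℝ := - l i with hΛ
    have hΛQ : 4 * Q < Λ := by linarith
    have hv : ‖b i‖ = 1 := b.orthonormal.1 i
    have hvv : (X + A) (b i) (b i) = - Λ := by rw [hZ i i]; simp [hΛ]
    refine absurd hfle (not_le.2 ?_)
    refine lt_of_le_of_lt (by linarith) (hmain (X + A) (Y + B) b b' l l' τ τ' (b i)
      (Λ / 2) Λ κ hZ hT hl hτ hv (by linarith) hκpos ?_ (fun j => ?_) ?_ ?_)
    · rw [hvv]; linarith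
    · have := hi j (Finset.mem_univ _)
      rw [hΛ]; linarith
    · intro y
      have hC₃' : 25 * C ^ 2 + 3 * C ≤ C₃ := by
        rw [hC₃]; linarith [show 0 ≤ 12 * C ^ 2 / a by positivity]
      have hli' : l i = - Λ := by rw [hΛ, neg_neg]
      have := add_sq_le_of_projection ha hC hθ hθ1 hQ hv hΛQ hli' hC₃' hZ hXY hA hAB y
      exact this
    · have h1 : κ ≤ (C₃ * θ) * Q := by
        rw [hκ]
        have : C₃ * (Q * θ ^ 3) ≤ C₃ * (Q * θ) := by gcongr
        linarith
      have h2 : κ ≤ Λ := by nlinarith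
      have h3 : κ ≤ (C₃ * θ) * (Λ / 4) := h1.trans (by
        have : 0 ≤ C₃ * θ := by positivity
        nlinarith)
      have hΛ0 : 0 < Λ := by linarith
      calc CK * (κ * (Λ + κ)) ≤ CK * ((C₃ * θ) * (Λ / 4) * (Λ + Λ)) := by gcongr
        _ = (θ * (2 * CK * C₃)) * (Λ ^ 2 / 4) := by ring
        _ ≤ 1 * (Λ ^ 2 / 4) := by gcongr
        _ = (Λ / 2) ^ 2 := by ring

end TwoPoint

/-! ### Variations of the energy of a curve -/

section Calculus

open MeasureTheory Topology Filter

set_option maxSynthPendingDepth 3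

/-- The necessary conditions of first and second order at a local maximum. -/
theorem eq_zero_and_nonpos_of_isLocalMax {h h₁ : ℝ → ℝ} {h₂ : ℝ} (hmax : IsLocalMax h 0)
    (hd : ∀ᶠ ε in 𝓝 0, HasDerivAt h (h₁ ε) ε) (hd₁ : HasDerivAt h₁ h₂ 0) :
    h₁ 0 = 0 ∧ h₂ ≤ 0 := by
  have h0 : h₁ 0 = 0 := hmax.hasDerivAt_eq_zero hd.self_of_nhds
  refine ⟨h0, ?_⟩
  by_contra! hpos
  have hpos' : ∀ᶠ ε in 𝓝[>] (0 : ℝ), 0 < h₁ ε := by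
    have h3 := hasDerivAt_iff_tendsto_slope.1 hd₁
    have h4 : ∀ᶠ ε in 𝓝[≠] (0 : ℝ), 0 < slope h₁ 0 ε := h3.eventually (lt_mem_nhds hpos)
    have h5 : ∀ᶠ ε in 𝓝[>] (0 : ℝ), 0 < slope h₁ 0 ε :=
      h4.filter_mono (nhdsWithin_mono _ (fun x hx => (ne_of_gt hx)))
    filter_upwards [h5, self_mem_nhdsWithin] with ε hε hε0
    rw [slope_def_field, h0, sub_zero, sub_zero] at hε
    have hε0' : (0 : ℝ) < ε := hε0
    exact (div_pos_iff_of_pos_right hε0').1 hε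
  have hall : ∀ᶠ ε in 𝓝[>] (0 : ℝ), 0 < h₁ ε ∧ HasDerivAt h (h₁ ε) ε ∧ h ε ≤ h 0 := by
    filter_upwards [hpos', nhdsWithin_le_nhds hd, nhdsWithin_le_nhds hmax] with ε h1 h2 h3
    exact ⟨h1, h2, h3⟩
  obtain ⟨δ, hδ, hball⟩ := mem_nhdsGT_iff_exists_Ioo_subset.1 hall
  have hδ' : (0 : ℝ) < δ := hδ
  have hmono : StrictMonoOn h (Ico 0 δ) := by
    refine strictMonoOn_of_deriv_pos (convex_Ico _ _) ?_ ?_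
    · intro ε hε
      rcases eq_or_lt_of_le hε.1 with h1 | h1
      · rw [← h1]; exact hd.self_of_nhds.continuousAt.continuousWithinAt
      · exact (hball ⟨h1, hε.2⟩).2.1.continuousAt.continuousWithinAt
    · intro ε hε
      rw [interior_Ico] at hε
      rw [(hball hε).2.1.deriv]
      exact (hball hε).1
  have h1 : h 0 < h (δ / 2) := hmono ⟨le_rfl, hδ'⟩ ⟨by linarith, by linarith⟩ (by linarith)
  have h2 := (hball (show δ / 2 ∈ Ioo 0 δ from ⟨by linarith, by linarith⟩)).2.2
  linarith

/-- Differentiation under the integral over `[0, 1]`. -/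
theorem hasDerivAt_integral_unit {F F' : ℝ → ℝ → ℝ} {U : Set ℝ} (hU : IsOpen U)
    (hF : ContinuousOn (Function.uncurry F) (U ×ˢ Icc 0 1))
    (hF' : ContinuousOn (Function.uncurry F') (U ×ˢ Icc 0 1))
    (hd : ∀ ε ∈ U, ∀ τ ∈ Icc (0 : ℝ) 1, HasDerivAt (fun ε => F ε τ) (F' ε τ) ε) {ε₀ : ℝ}
    (hε₀ : ε₀ ∈ U) :
    HasDerivAt (fun ε => ∫ τ in (0 : ℝ)..1, F ε τ) (∫ τ in (0 : ℝ)..1, F' ε₀ τ) ε₀ := by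
  obtain ⟨δ, hδ, hball⟩ := Metric.nhds_basis_closedBall.mem_iff.1 (hU.mem_nhds hε₀)
  have hcomp : IsCompact (Metric.closedBall ε₀ δ ×ˢ Icc (0 : ℝ) 1) :=
    (isCompact_closedBall _ _).prod isCompact_Icc
  obtain ⟨C, hC⟩ := hcomp.exists_bound_of_continuousOn (hF'.mono (prod_mono hball le_rfl))
  have hslice : ∀ {H : ℝ → ℝ → ℝ}, ContinuousOn (Function.uncurry H) (U ×ˢ Icc 0 1) → ∀ ε ∈ U,
      IntervalIntegrable (H ε) volume 0 1 := by
    intro H hH ε hε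
    refine ContinuousOn.intervalIntegrable ?_
    rw [uIcc_of_le zero_le_one]
    exact hH.comp (f := fun τ => (ε, τ)) (by fun_prop) (fun τ hτ => ⟨hε, hτ⟩)
  have hsub : uIoc (0 : ℝ) 1 ⊆ Icc 0 1 := by
    rw [uIoc_of_le zero_le_one]; exact Ioc_subset_Icc_self
  refine (intervalIntegral.hasDerivAt_integral_of_dominated_loc_of_deriv_le
    (bound := fun _ => C) (Metric.ball_mem_nhds ε₀ hδ) ?_ (hslice hF ε₀ hε₀)
    (hslice hF' ε₀ hε₀).aestronglyMeasurable_restrict_uIoc ?_ intervalIntegrable_const ?_).2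
  · filter_upwards [hU.mem_nhds hε₀] with ε hε
    exact (hslice hF ε hε).aestronglyMeasurable_restrict_uIoc
  · refine Eventually.of_forall (fun τ hτ ε hε => ?_)
    exact hC (ε, τ) ⟨Metric.ball_subset_closedBall hε, hsub hτ⟩
  · refine Eventually.of_forall (fun τ hτ ε hε => ?_)
    exact hd ε (hball (Metric.ball_subset_closedBall hε)) τ (hsub hτ)

variable {E : Type*} [NormedAddCommGroup E] [NormedSpace ℝ E]

theorem HasFDerivAt.form_apply {G : E → E →L[ℝ] E →L[ℝ] ℝ} {G' : E →L[ℝ] E →L[ℝ] E →L[ℝ] ℝ}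
    {z : E} (h : HasFDerivAt G G' z) (a b : E) :
    HasFDerivAt (fun z => G z a b) ((G'.flip a).flip b) z := by
  refine ((h.clm_apply (hasFDerivAt_const a z)).clm_apply (hasFDerivAt_const b z)).congr_fderiv ?_
  ext w; simp

/-- The derivative of a field of symmetric forms is symmetric. -/
theorem HasFDerivAt.apply_comm {G : E → E →L[ℝ] E →L[ℝ] ℝ} {G' : E →L[ℝ] E →L[ℝ] E →L[ℝ] ℝ}
    {O : Set E} {z : E} (hO : O ∈ 𝓝 z) (hsymm : ∀ z ∈ O, ∀ a b, G z a b = G z b a)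
    (h : HasFDerivAt G G' z) (w a b : E) : G' w a b = G' w b a := by
  have h3 : (fun z => G z a b) =ᶠ[𝓝 z] fun z => G z b a := by
    filter_upwards [hO] with y hy using hsymm y hy a b
  have h4 := ((HasFDerivAt.form_apply h b a).congr_of_eventuallyEq h3).unique
    (HasFDerivAt.form_apply h a b)
  have := congrArg (fun L : E →L[ℝ] ℝ => L w) h4
  simpa using this.symm

/-- The integrand of the second variation of the energy of the metric `G` along the curves
`c + ε V + ε² W` with velocities `v + ε V' + ε² W'`. -/
def secondVariation (G : E → E →L[ℝ] E →L[ℝ] ℝ) (c v V V' W W' : E) : ℝ :=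
  fderiv ℝ (fderiv ℝ G) c V V v v + 2 * fderiv ℝ G c W v v + 4 * fderiv ℝ G c V v V'
    + 4 * G c v W' + 2 * G c V' V'

/-- First and second variation of the energy. -/
theorem exists_hasDerivAt_energy {G : E → E →L[ℝ] E →L[ℝ] ℝ} {O : Set E} (hO : IsOpen O)
    (hG : ContDiffOn ℝ ∞ G O) (hsymm : ∀ z ∈ O, ∀ a b, G z a b = G z b a)
    {c v V V' W W' : ℝ → E} (hc : ContinuousOn c (Icc 0 1)) (hv : ContinuousOn v (Icc 0 1))
    (hV : ContinuousOn V (Icc 0 1)) (hV' : ContinuousOn V' (Icc 0 1))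
    (hW : ContinuousOn W (Icc 0 1)) (hW' : ContinuousOn W' (Icc 0 1))
    (hcO : ∀ τ ∈ Icc (0 : ℝ) 1, c τ ∈ O) :
    ∃ e₁ : ℝ → ℝ,
      (∀ᶠ ε in 𝓝 (0 : ℝ), HasDerivAt (fun ε => ∫ τ in (0 : ℝ)..1, G (c τ + ε • V τ + ε ^ 2 • W τ)
        (v τ + ε • V' τ + ε ^ 2 • W' τ) (v τ + ε • V' τ + ε ^ 2 • W' τ)) (e₁ ε) ε) ∧
      e₁ 0 = ∫ τ in (0 : ℝ)..1, (fderiv ℝ G (c τ) (V τ) (v τ) (v τ) + 2 * G (c τ) (v τ) (V' τ)) ∧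
      HasDerivAt e₁ (∫ τ in (0 : ℝ)..1,
        secondVariation G (c τ) (v τ) (V τ) (V' τ) (W τ) (W' τ)) 0 := by
  -- the deformed curves stay in `O` for small `ε`
  obtain ⟨U, hU, h0U, hUO⟩ : ∃ U : Set ℝ, IsOpen U ∧ (0 : ℝ) ∈ U ∧
      ∀ ε ∈ U, ∀ τ ∈ Icc (0 : ℝ) 1, c τ + ε • V τ + ε ^ 2 • W τ ∈ O := by
    have hcont : ContinuousOn (fun r : ℝ × ℝ => c r.2 + r.1 • V r.2 + r.1 ^ 2 • W r.2)
        (univ ×ˢ Icc 0 1) := by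
      have h2 : MapsTo (Prod.snd : ℝ × ℝ → ℝ) (univ ×ˢ Icc 0 1) (Icc 0 1) := fun r hr => hr.2
      exact ((hc.comp continuousOn_snd h2).add
        (continuousOn_fst.smul (hV.comp continuousOn_snd h2))).add
        ((continuousOn_fst.pow 2).smul (hW.comp continuousOn_snd h2))
    obtain ⟨N, hN, hNO⟩ := (continuousOn_iff'.1 hcont O hO)
    have hsub : ({0} : Set ℝ) ×ˢ Icc (0 : ℝ) 1 ⊆ N := by
      rintro ⟨ε, τ⟩ ⟨hε, hτ⟩
      rw [mem_singleton_iff] at hε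
      have : ((ε, τ) : ℝ × ℝ) ∈ N ∩ univ ×ˢ Icc 0 1 := by
        rw [← hNO]
        refine ⟨?_, mem_univ _, hτ⟩
        have := hcO τ hτ
        simp only at hε
        simpa [hε] using this
      exact this.1
    obtain ⟨U, U', hU, hU', hsU, hsU', hUU'⟩ :=
      generalized_tube_lemma isCompact_singleton isCompact_Icc hN hsub
    refine ⟨U, hU, hsU rfl, fun ε hε τ hτ => ?_⟩
    have : ((ε, τ) : ℝ × ℝ) ∈ N ∩ univ ×ˢ Icc 0 1 := ⟨hUU' ⟨hε, hsU' hτ⟩, mem_univ _, hτ⟩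
    rw [← hNO] at this
    exact this.1
  have hG1 : ContDiffOn ℝ ∞ (fderiv ℝ G) O := hG.fderiv_of_isOpen hO (by simp)
  have hG2 : ContDiffOn ℝ ∞ (fderiv ℝ (fderiv ℝ G)) O := hG1.fderiv_of_isOpen hO (by simp)
  have hGd : ∀ z ∈ O, HasFDerivAt G (fderiv ℝ G z) z := fun z hz =>
    ((hG.contDiffAt (hO.mem_nhds hz)).differentiableAt (by simp)).hasFDerivAt
  have hGd1 : ∀ z ∈ O, HasFDerivAt (fderiv ℝ G) (fderiv ℝ (fderiv ℝ G) z) z := fun z hz =>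
    ((hG1.contDiffAt (hO.mem_nhds hz)).differentiableAt (by simp)).hasFDerivAt
  let p : ℝ → ℝ → E := fun ε τ => c τ + ε • V τ + ε ^ 2 • W τ
  let q : ℝ → ℝ → E := fun ε τ => v τ + ε • V' τ + ε ^ 2 • W' τ
  let p' : ℝ → ℝ → E := fun ε τ => V τ + (2 * ε) • W τ
  let q' : ℝ → ℝ → E := fun ε τ => V' τ + (2 * ε) • W' τ
  have hpoly : ∀ (a b d : E) (ε : ℝ),
      HasDerivAt (fun ε : ℝ => a + ε • b + ε ^ 2 • d) (b + (2 * ε) • d) ε := by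
    intro a b d ε
    have h1 : HasDerivAt (fun ε : ℝ => ε • b) b ε := by
      simpa using (hasDerivAt_id ε).smul_const b
    have h2 : HasDerivAt (fun ε : ℝ => ε ^ 2 • d) ((2 * ε) • d) ε := by
      simpa using (hasDerivAt_pow 2 ε).smul_const d
    exact (h1.const_add a).add h2
  have hlin : ∀ (b d : E) (ε : ℝ), HasDerivAt (fun ε : ℝ => b + (2 * ε) • d) ((2 : ℝ) • d) ε := by
    intro b d ε
    have h1 : HasDerivAt (fun ε : ℝ => (2 * ε) • d) ((2 * 1 : ℝ) • d) ε :=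
      ((hasDerivAt_id ε).const_mul 2).smul_const d
    simpa using h1.const_add b
  let F : ℝ → ℝ → ℝ := fun ε τ => G (p ε τ) (q ε τ) (q ε τ)
  let F₁ : ℝ → ℝ → ℝ := fun ε τ => fderiv ℝ G (p ε τ) (p' ε τ) (q ε τ) (q ε τ)
    + G (p ε τ) (q' ε τ) (q ε τ) + G (p ε τ) (q ε τ) (q' ε τ)
  let F₂ : ℝ → ℝ → ℝ := fun ε τ =>
    (fderiv ℝ (fderiv ℝ G) (p ε τ) (p' ε τ) (p' ε τ) (q ε τ) (q ε τ)
      + fderiv ℝ G (p ε τ) ((2 : ℝ) • W τ) (q ε τ) (q ε τ)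
      + fderiv ℝ G (p ε τ) (p' ε τ) (q' ε τ) (q ε τ)
      + fderiv ℝ G (p ε τ) (p' ε τ) (q ε τ) (q' ε τ))
    + (fderiv ℝ G (p ε τ) (p' ε τ) (q' ε τ) (q ε τ) + G (p ε τ) ((2 : ℝ) • W' τ) (q ε τ)
      + G (p ε τ) (q' ε τ) (q' ε τ))
    + (fderiv ℝ G (p ε τ) (p' ε τ) (q ε τ) (q' ε τ) + G (p ε τ) (q' ε τ) (q' ε τ)
      + G (p ε τ) (q ε τ) ((2 : ℝ) • W' τ))
  have hdG : ∀ ε ∈ U, ∀ τ ∈ Icc (0 : ℝ) 1,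
      HasDerivAt (fun ε => G (p ε τ)) (fderiv ℝ G (p ε τ) (p' ε τ)) ε := fun ε hε τ hτ =>
    (hGd _ (hUO ε hε τ hτ)).comp_hasDerivAt (f := fun ε => p ε τ) ε (hpoly (c τ) (V τ) (W τ) ε)
  have hdG1 : ∀ ε ∈ U, ∀ τ ∈ Icc (0 : ℝ) 1, HasDerivAt (fun ε => fderiv ℝ G (p ε τ))
      (fderiv ℝ (fderiv ℝ G) (p ε τ) (p' ε τ)) ε := fun ε hε τ hτ =>
    (hGd1 _ (hUO ε hε τ hτ)).comp_hasDerivAt (f := fun ε => p ε τ) ε (hpoly (c τ) (V τ) (W τ) ε)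
  have hdF : ∀ ε ∈ U, ∀ τ ∈ Icc (0 : ℝ) 1, HasDerivAt (fun ε => F ε τ) (F₁ ε τ) ε := by
    intro ε hε τ hτ
    have h := ((hdG ε hε τ hτ).clm_apply (hpoly (v τ) (V' τ) (W' τ) ε)).clm_apply
      (hpoly (v τ) (V' τ) (W' τ) ε)
    exact h
  have hdF₁ : ∀ ε ∈ U, ∀ τ ∈ Icc (0 : ℝ) 1, HasDerivAt (fun ε => F₁ ε τ) (F₂ ε τ) ε := by
    intro ε hε τ hτ
    have hq := hpoly (v τ) (V' τ) (W' τ) ε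
    have hq' := hlin (V' τ) (W' τ) ε
    have hp' := hlin (V τ) (W τ) ε
    have h1 := (((hdG1 ε hε τ hτ).clm_apply hp').clm_apply hq).clm_apply hq
    have h2 := ((hdG ε hε τ hτ).clm_apply hq').clm_apply hq
    have h3 := ((hdG ε hε τ hτ).clm_apply hq).clm_apply hq'
    exact (h1.add h2).add h3
  -- joint continuity
  have hsnd : MapsTo (Prod.snd : ℝ × ℝ → ℝ) (U ×ˢ Icc 0 1) (Icc 0 1) := fun r hr => hr.2
  have hcurve : ∀ {a b d : ℝ → E}, ContinuousOn a (Icc 0 1) → ContinuousOn b (Icc 0 1) →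
      ContinuousOn d (Icc 0 1) →
      ContinuousOn (fun r : ℝ × ℝ => a r.2 + r.1 • b r.2 + r.1 ^ 2 • d r.2) (U ×ˢ Icc 0 1) :=
    fun ha hb hd => ((ha.comp continuousOn_snd hsnd).add
        (continuousOn_fst.smul (hb.comp continuousOn_snd hsnd))).add
        ((continuousOn_fst.pow 2).smul (hd.comp continuousOn_snd hsnd))
  have hcurve' : ∀ {b d : ℝ → E}, ContinuousOn b (Icc 0 1) → ContinuousOn d (Icc 0 1) →
      ContinuousOn (fun r : ℝ × ℝ => b r.2 + (2 * r.1) • d r.2) (U ×ˢ Icc 0 1) :=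
    fun hb hd => (hb.comp continuousOn_snd hsnd).add
        ((continuousOn_const.mul continuousOn_fst).smul (hd.comp continuousOn_snd hsnd))
  have cp := hcurve hc hV hW
  have cq := hcurve hv hV' hW'
  have cp' := hcurve' hV hW
  have cq' := hcurve' hV' hW'
  have cW : ContinuousOn (fun r : ℝ × ℝ => (2 : ℝ) • W r.2) (U ×ˢ Icc 0 1) :=
    continuousOn_const.smul (hW.comp continuousOn_snd hsnd)
  have cW' : ContinuousOn (fun r : ℝ × ℝ => (2 : ℝ) • W' r.2) (U ×ˢ Icc 0 1) :=
    continuousOn_const.smul (hW'.comp continuousOn_snd hsnd)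
  have hmaps : MapsTo (fun r : ℝ × ℝ => c r.2 + r.1 • V r.2 + r.1 ^ 2 • W r.2) (U ×ˢ Icc 0 1) O :=
    fun r hr => hUO r.1 hr.1 r.2 hr.2
  have cG := hG.continuousOn.comp cp hmaps
  have cG1 := hG1.continuousOn.comp cp hmaps
  have cG2 := hG2.continuousOn.comp cp hmaps
  have cF : ContinuousOn (Function.uncurry F) (U ×ˢ Icc 0 1) := (cG.clm_apply cq).clm_apply cq
  have cF₁ : ContinuousOn (Function.uncurry F₁) (U ×ˢ Icc 0 1) :=
    ((((cG1.clm_apply cp').clm_apply cq).clm_apply cq).add ((cG.clm_apply cq').clm_apply cq)).add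
      ((cG.clm_apply cq).clm_apply cq')
  have cF₂ : ContinuousOn (Function.uncurry F₂) (U ×ˢ Icc 0 1) :=
    ((((((((cG2.clm_apply cp').clm_apply cp').clm_apply cq).clm_apply cq).add
      (((cG1.clm_apply cW).clm_apply cq).clm_apply cq)).add
      (((cG1.clm_apply cp').clm_apply cq').clm_apply cq)).add
      (((cG1.clm_apply cp').clm_apply cq).clm_apply cq')).add
      (((((cG1.clm_apply cp').clm_apply cq').clm_apply cq).add
      ((cG.clm_apply cW').clm_apply cq)).add ((cG.clm_apply cq').clm_apply cq'))).add
      (((((cG1.clm_apply cp').clm_apply cq).clm_apply cq').add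
      ((cG.clm_apply cq').clm_apply cq')).add ((cG.clm_apply cq).clm_apply cW'))
  have hsymm1 : ∀ z ∈ O, ∀ w a b, fderiv ℝ G z w a b = fderiv ℝ G z w b a :=
    fun z hz w a b => HasFDerivAt.apply_comm (hO.mem_nhds hz) hsymm (hGd z hz) w a b
  refine ⟨fun ε => ∫ τ in (0 : ℝ)..1, F₁ ε τ, ?_, ?_, ?_⟩
  · filter_upwards [hU.mem_nhds h0U] with ε hε
    exact hasDerivAt_integral_unit hU cF cF₁ hdF hε
  · refine intervalIntegral.integral_congr (fun τ hτ => ?_)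
    rw [uIcc_of_le zero_le_one] at hτ
    simp only [F₁, p, q, p', q', zero_smul, mul_zero, add_zero, zero_pow two_ne_zero]
    rw [hsymm _ (hcO τ hτ) (V' τ) (v τ)]; ring
  · have h := hasDerivAt_integral_unit hU cF₁ cF₂ hdF₁ h0U
    convert h using 1
    refine intervalIntegral.integral_congr (fun τ hτ => ?_)
    rw [uIcc_of_le zero_le_one] at hτ
    simp only [F₂, p, q, p', q', zero_smul, mul_zero, add_zero, zero_pow two_ne_zero,
      secondVariation, map_smul, smul_apply, smul_eq_mul]
    rw [hsymm _ (hcO τ hτ) (W' τ) (v τ), hsymm1 _ (hcO τ hτ) (V τ) (V' τ) (v τ)]; ring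

end Calculus

/-! ### Metrics on open sets of a vector space -/

section LocalMetric

open MeasureTheory Topology Filter

set_option maxSynthPendingDepth 3

variable {E : Type*} [NormedAddCommGroup E] [NormedSpace ℝ E]

/-- `G` is a smooth Riemannian metric on the convex open set `O` of a vector space, uniformly
equivalent to the norm, with bounds on its first two derivatives; one constant `C` serves for
everything. -/
structure MetricBounds (G : E → E →L[ℝ] E →L[ℝ] ℝ) (O : Set E) (C : ℝ) : Prop where
  isOpen : IsOpen O
  convex : Convex ℝ O
  smooth : ContDiffOn ℝ ∞ G O
  symm : ∀ z ∈ O, ∀ a b, G z a b = G z b a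
  one_le : 1 ≤ C
  sq_norm_le : ∀ z ∈ O, ∀ a, ‖a‖ ^ 2 ≤ C * G z a a
  norm_le : ∀ z ∈ O, ‖G z‖ ≤ C
  norm_fderiv_le : ∀ z ∈ O, ‖fderiv ℝ G z‖ ≤ C
  norm_fderiv_fderiv_le : ∀ z ∈ O, ‖fderiv ℝ (fderiv ℝ G) z‖ ≤ C

/-- The covector `c ↦ (D a b c + D b a c - D c a b) / 2`. -/
def koszul (D : E →L[ℝ] E →L[ℝ] E →L[ℝ] ℝ) (a b : E) : E →L[ℝ] ℝ :=
  (1 / 2 : ℝ) • (D a b + D b a - (D.flip a).flip b)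

theorem koszul_apply (D : E →L[ℝ] E →L[ℝ] E →L[ℝ] ℝ) (a b c : E) :
    koszul D a b c = (D a b c + D b a c - D c a b) / 2 := by
  simp [koszul]; ring

theorem abs_form_le (L : E →L[ℝ] E →L[ℝ] ℝ) {C : ℝ} (hL : ‖L‖ ≤ C) (a b : E) :
    |L a b| ≤ C * ‖a‖ * ‖b‖ :=
  (L.le_opNorm₂ a b).trans (by gcongr)

theorem abs_trilinear_le (D : E →L[ℝ] E →L[ℝ] E →L[ℝ] ℝ) {C : ℝ} (hD : ‖D‖ ≤ C) (a b c : E) :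
    |D a b c| ≤ C * ‖a‖ * ‖b‖ * ‖c‖ := by
  refine abs_form_le (D a) (C := C * ‖a‖) ?_ b c
  exact (D.le_opNorm a).trans (by gcongr)

theorem abs_koszul_le (D : E →L[ℝ] E →L[ℝ] E →L[ℝ] ℝ) {C : ℝ} (hD : ‖D‖ ≤ C) (a b c : E) :
    |koszul D a b c| ≤ 3 / 2 * C * ‖a‖ * ‖b‖ * ‖c‖ := by
  rw [koszul_apply]
  have h1 := abs_le.1 (abs_trilinear_le D hD a b c)
  have h2 := abs_le.1 (abs_trilinear_le D hD b a c)
  have h3 := abs_le.1 (abs_trilinear_le D hD c a b)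
  rw [abs_le]
  constructor <;> nlinarith [h1.1, h1.2, h2.1, h2.2, h3.1, h3.2]

/-- The Christoffel symbols of `G` at `z` as a vector. -/
def chris (G : E → E →L[ℝ] E →L[ℝ] ℝ) (z a b : E) : E :=
  (G z).inverse (koszul (fderiv ℝ G z) a b)

/-- A positive definite form on a finite-dimensional space represents every covector. -/
theorem form_inverse_apply [FiniteDimensional ℝ E] {B : E →L[ℝ] E →L[ℝ] ℝ}
    (hB : ∀ a, B a a = 0 → a = 0) (q : E →L[ℝ] ℝ) : B (B.inverse q) = q := by
  let L : E →ₗ[ℝ] Module.Dual ℝ E :=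
    (LinearMap.toContinuousLinearMap (𝕜 := ℝ) (E := E) (F' := ℝ)).symm.toLinearMap ∘ₗ B.toLinearMap
  have hL : ∀ a b, L a b = B a b := fun a b => rfl
  have hinj : Function.Injective L := by
    rw [injective_iff_map_eq_zero]
    intro a ha
    exact hB a (by rw [← hL, ha]; rfl)
  have hsurj : Function.Surjective L :=
    (LinearMap.injective_iff_surjective_of_finrank_eq_finrank
      (Subspace.dual_finrank_eq (K := ℝ) (V := E)).symm).1 hinj
  have hbij : Function.Bijective B.toLinearMap := by
    constructor
    · intro a b hab
      refine hinj ?_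
      ext c
      rw [hL, hL]
      exact congrArg (fun q : E →L[ℝ] ℝ => q c) hab
    · intro q
      obtain ⟨a, ha⟩ := hsurj q.toLinearMap
      exact ⟨a, by ext c; exact congrArg (fun q : Module.Dual ℝ E => q c) ha⟩
  let e : E ≃L[ℝ] (E →L[ℝ] ℝ) :=
    (LinearEquiv.ofBijective B.toLinearMap hbij).toContinuousLinearEquiv
  have he : (e : E →L[ℝ] (E →L[ℝ] ℝ)) = B := by
    ext a b; rfl
  have h1 : B.inverse = (e.symm : (E →L[ℝ] ℝ) →L[ℝ] E) := by
    rw [← he, ContinuousLinearMap.inverse_equiv]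
  rw [h1, ← he]
  exact e.apply_symm_apply q

namespace MetricBounds

variable {G : E → E →L[ℝ] E →L[ℝ] ℝ} {O : Set E} {C : ℝ}

theorem pos (hG : MetricBounds G O C) : 0 < C := one_pos.trans_le hG.one_le

theorem hasFDerivAt (hG : MetricBounds G O C) {z : E} (hz : z ∈ O) :
    HasFDerivAt G (fderiv ℝ G z) z :=
  ((hG.smooth.contDiffAt (hG.isOpen.mem_nhds hz)).differentiableAt (by simp)).hasFDerivAt

theorem hasFDerivAt_fderiv (hG : MetricBounds G O C) {z : E} (hz : z ∈ O) :
    HasFDerivAt (fderiv ℝ G) (fderiv ℝ (fderiv ℝ G) z) z :=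
  (((hG.smooth.fderiv_of_isOpen hG.isOpen (m := ∞) (by simp)).contDiffAt
    (hG.isOpen.mem_nhds hz)).differentiableAt (by simp)).hasFDerivAt

theorem norm_sub_le (hG : MetricBounds G O C) {x y : E} (hx : x ∈ O) (hy : y ∈ O) :
    ‖G x - G y‖ ≤ C * ‖x - y‖ :=
  hG.convex.norm_image_sub_le_of_norm_hasFDerivWithin_le
    (fun _ hz => (hG.hasFDerivAt hz).hasFDerivWithinAt) hG.norm_fderiv_le hy hx

theorem norm_fderiv_sub_le (hG : MetricBounds G O C) {x y : E} (hx : x ∈ O) (hy : y ∈ O) :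
    ‖fderiv ℝ G x - fderiv ℝ G y‖ ≤ C * ‖x - y‖ :=
  hG.convex.norm_image_sub_le_of_norm_hasFDerivWithin_le
    (fun _ hz => (hG.hasFDerivAt_fderiv hz).hasFDerivWithinAt) hG.norm_fderiv_fderiv_le hy hx

/-- A vector is bounded by the covector that it represents. -/
theorem norm_le_of_forall (hG : MetricBounds G O C) {z : E} (hz : z ∈ O) {w : E} {r : ℝ}
    (hr : 0 ≤ r) (h : |G z w w| ≤ r * ‖w‖) : ‖w‖ ≤ C * r := by
  by_contra! hlt
  have h1 := hG.sq_norm_le z hz w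
  have h2 := le_abs_self (G z w w)
  have hC := hG.pos
  have h0 : 0 < ‖w‖ := (mul_nonneg hC.le hr).trans_lt hlt
  nlinarith [mul_le_mul_of_nonneg_left (h2.trans h) hC.le]

variable [FiniteDimensional ℝ E]

theorem apply_inverse (hG : MetricBounds G O C) {z : E} (hz : z ∈ O) (q : E →L[ℝ] ℝ) :
    G z ((G z).inverse q) = q := by
  refine form_inverse_apply (fun a ha => ?_) q
  have := hG.sq_norm_le z hz a
  rw [ha, mul_zero] at this
  exact norm_eq_zero.1 (by nlinarith [norm_nonneg a])

theorem apply_chris (hG : MetricBounds G O C) {z : E} (hz : z ∈ O) (a b c : E) :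
    G z (chris G z a b) c =
      (fderiv ℝ G z a b c + fderiv ℝ G z b a c - fderiv ℝ G z c a b) / 2 := by
  rw [chris, hG.apply_inverse hz, koszul_apply]

theorem apply_chris_self (hG : MetricBounds G O C) {z : E} (hz : z ∈ O) (a c : E) :
    G z (chris G z a a) c = fderiv ℝ G z a a c - fderiv ℝ G z c a a / 2 := by
  rw [hG.apply_chris hz]; ring

theorem norm_chris_le (hG : MetricBounds G O C) {z : E} (hz : z ∈ O) (a b : E) :
    ‖chris G z a b‖ ≤ 2 * C ^ 2 * ‖a‖ * ‖b‖ := by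
  have h1 : |G z (chris G z a b) (chris G z a b)|
      ≤ 3 / 2 * C * ‖a‖ * ‖b‖ * ‖chris G z a b‖ := by
    conv_lhs => rw [chris, hG.apply_inverse hz]
    exact abs_koszul_le _ (hG.norm_fderiv_le z hz) _ _ _
  have h2 := hG.norm_le_of_forall hz (by have := hG.pos; positivity) h1
  nlinarith [mul_nonneg (mul_nonneg (sq_nonneg C) (norm_nonneg a)) (norm_nonneg b)]

theorem norm_chris_sub_chris_le (hG : MetricBounds G O C) {x y : E} (hx : x ∈ O) (hy : y ∈ O)
    (a b : E) : ‖chris G x a a - chris G y b b‖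
      ≤ 4 * C ^ 4 * (‖x - y‖ * (‖a‖ ^ 2 + ‖b‖ ^ 2) + ‖a - b‖ * (‖a‖ + ‖b‖)) := by
  set w := chris G x a a - chris G y b b with hw
  have hC := hG.one_le
  have hC0 := hG.pos
  have key : G x w w = ((fderiv ℝ G x - fderiv ℝ G y) a a w + fderiv ℝ G y (a - b) a w
      + fderiv ℝ G y b (a - b) w) - ((fderiv ℝ G x - fderiv ℝ G y) w a a
      + fderiv ℝ G y w (a - b) a + fderiv ℝ G y w b (a - b)) / 2
      - (G x - G y) (chris G y b b) w := by
    have h1 := hG.apply_chris_self hx a w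
    have h2 := hG.apply_chris_self hy b w
    have h3 : G x w w = G x (chris G x a a) w - G x (chris G y b b) w := by
      rw [← sub_apply, ← map_sub]
    rw [h3, h1]
    simp only [sub_apply, map_sub]
    linarith
  have hD := hG.norm_fderiv_sub_le hx hy
  have hDy := hG.norm_fderiv_le y hy
  have b1 := abs_le.1 (abs_trilinear_le _ hD a a w)
  have b2 := abs_le.1 (abs_trilinear_le _ hDy (a - b) a w)
  have b3 := abs_le.1 (abs_trilinear_le _ hDy b (a - b) w)
  have b4 := abs_le.1 (abs_trilinear_le _ hD w a a)
  have b5 := abs_le.1 (abs_trilinear_le _ hDy w (a - b) a)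
  have b6 := abs_le.1 (abs_trilinear_le _ hDy w b (a - b))
  have b7 := abs_le.1 (abs_form_le _ (hG.norm_sub_le hx hy) (chris G y b b) w)
  have b8 : C * ‖x - y‖ * ‖chris G y b b‖ * ‖w‖
      ≤ C * ‖x - y‖ * (2 * C ^ 2 * ‖b‖ * ‖b‖) * ‖w‖ := by
    gcongr; exact hG.norm_chris_le hy b b
  have main : |G x w w| ≤ (3 / 2 * C * ‖x - y‖ * ‖a‖ ^ 2 + 3 / 2 * C * ‖a - b‖ * (‖a‖ + ‖b‖)
      + 2 * C ^ 3 * ‖x - y‖ * ‖b‖ ^ 2) * ‖w‖ := by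
    rw [key, abs_le]
    constructor <;> linarith [b1.1, b1.2, b2.1, b2.2, b3.1, b3.2, b4.1, b4.2, b5.1, b5.2,
      b6.1, b6.2, b7.1, b7.2, b8]
  refine (hG.norm_le_of_forall hx (by positivity) main).trans ?_
  clear_value w
  clear key main b1 b2 b3 b4 b5 b6 b7 b8 hD hDy
  have e1 : C ^ 2 ≤ C ^ 4 := pow_le_pow_right₀ hC (by norm_num)
  have p1 : 0 ≤ ‖x - y‖ * ‖a‖ ^ 2 := by positivity
  have p2 : 0 ≤ ‖x - y‖ * ‖b‖ ^ 2 := by positivity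
  have p3 : 0 ≤ ‖a - b‖ * (‖a‖ + ‖b‖) := by positivity
  have e2 : 0 ≤ C ^ 4 := by positivity
  linarith [mul_le_mul_of_nonneg_right e1 p1, mul_le_mul_of_nonneg_right e1 p3,
    mul_nonneg e2 p1, mul_nonneg e2 p2, mul_nonneg e2 p3]

theorem continuousOn_chris (hG : MetricBounds G O C) {X : Type*} [TopologicalSpace X] {S : Set X}
    {c v : X → E} (hc : ContinuousOn c S) (hv : ContinuousOn v S) (hcO : MapsTo c S O) :
    ContinuousOn (fun τ => chris G (c τ) (v τ) (v τ)) S := by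
  intro τ₀ hτ₀
  rw [ContinuousWithinAt, tendsto_iff_norm_sub_tendsto_zero]
  have h1 : ContinuousWithinAt (fun τ => 4 * C ^ 4 * (‖c τ - c τ₀‖ * (‖v τ‖ ^ 2 + ‖v τ₀‖ ^ 2)
      + ‖v τ - v τ₀‖ * (‖v τ‖ + ‖v τ₀‖))) S τ₀ := by
    have hc' := hc τ₀ hτ₀
    have hv' := hv τ₀ hτ₀
    fun_prop
  have h2 : Tendsto (fun τ => 4 * C ^ 4 * (‖c τ - c τ₀‖ * (‖v τ‖ ^ 2 + ‖v τ₀‖ ^ 2)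
      + ‖v τ - v τ₀‖ * (‖v τ‖ + ‖v τ₀‖))) (𝓝[S] τ₀) (𝓝 0) := by
    have := h1.tendsto
    simpa using this
  refine squeeze_zero' (Eventually.of_forall fun _ => norm_nonneg _) ?_ h2
  filter_upwards [self_mem_nhdsWithin] with τ hτ
  exact hG.norm_chris_sub_chris_le (hcO hτ) (hcO hτ₀) _ _

end MetricBounds

end LocalMetric

/-! ### Geodesics as minimizers of the energy -/

section Geodesic

open MeasureTheory Topology Filter

set_option maxSynthPendingDepth 3

variable {E : Type*} [NormedAddCommGroup E] [NormedSpace ℝ E]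

/-- The energy of a curve `c` with velocity `v` over `[0, 1]`. -/
def energy (G : E → E →L[ℝ] E →L[ℝ] ℝ) (c v : ℝ → E) : ℝ :=
  ∫ τ in (0 : ℝ)..1, G (c τ) (v τ) (v τ)

/-- `c` is a geodesic of `G` on `[0, 1]`, with velocity `v`. -/
structure IsGeodesic (G : E → E →L[ℝ] E →L[ℝ] ℝ) (c v : ℝ → E) : Prop where
  hasDerivWithinAt : ∀ τ ∈ Icc (0 : ℝ) 1, HasDerivWithinAt c (v τ) (Icc 0 1) τ
  hasDerivWithinAt_velocity : ∀ τ ∈ Icc (0 : ℝ) 1,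
    HasDerivWithinAt v (- chris G (c τ) (v τ) (v τ)) (Icc 0 1) τ

/-- Differentiation of a form along a curve. -/
theorem MetricBounds.hasDerivWithinAt_apply {G : E → E →L[ℝ] E →L[ℝ] ℝ} {O : Set E} {C : ℝ}
    (hG : MetricBounds G O C) {c a b : ℝ → E} {c' a' b' : E} {S : Set ℝ} {τ : ℝ} (hcO : c τ ∈ O)
    (hc : HasDerivWithinAt c c' S τ) (ha : HasDerivWithinAt a a' S τ)
    (hb : HasDerivWithinAt b b' S τ) :
    HasDerivWithinAt (fun τ => G (c τ) (a τ) (b τ))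
      (fderiv ℝ G (c τ) c' (a τ) (b τ) + G (c τ) a' (b τ) + G (c τ) (a τ) b') S τ :=
  (((hG.hasFDerivAt hcO).comp_hasDerivWithinAt τ hc).clm_apply ha).clm_apply hb

theorem integral_eq_sub_of_hasDerivWithinAt {h h' : ℝ → ℝ}
    (hd : ∀ τ ∈ Icc (0 : ℝ) 1, HasDerivWithinAt h (h' τ) (Icc 0 1) τ)
    (hc : ContinuousOn h' (Icc 0 1)) : ∫ τ in (0 : ℝ)..1, h' τ = h 1 - h 0 := by
  refine intervalIntegral.integral_eq_sub_of_hasDerivAt_of_le zero_le_one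
    (fun τ hτ => (hd τ hτ).continuousWithinAt) (fun τ hτ => ?_) ?_
  · exact (hd τ (Ioo_subset_Icc_self hτ)).hasDerivAt (Icc_mem_nhds hτ.1 hτ.2)
  · exact ContinuousOn.intervalIntegrable (by rwa [uIcc_of_le zero_le_one])

theorem intervalIntegrable_unit {h : ℝ → ℝ} (hc : ContinuousOn h (Icc 0 1)) :
    IntervalIntegrable h volume 0 1 :=
  ContinuousOn.intervalIntegrable (by rwa [uIcc_of_le zero_le_one])

/-- A function vanishing at `0` is small in comparison with its derivative. -/
theorem integral_norm_mul_norm_le {r r' : ℝ → E} [CompleteSpace E] (hr' : Continuous r')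
    (hr : ∀ τ, HasDerivAt r (r' τ) τ) (h0 : r 0 = 0) :
    ∫ τ in (0 : ℝ)..1, ‖r' τ‖ * ‖r τ‖ ≤ ∫ τ in (0 : ℝ)..1, ‖r' τ‖ ^ 2 := by
  have hrc : Continuous r := continuous_iff_continuousAt.2 fun τ => (hr τ).continuousAt
  set S := ∫ τ in (0 : ℝ)..1, ‖r' τ‖ with hS
  have h1 : ∀ τ ∈ Icc (0 : ℝ) 1, ‖r τ‖ ≤ S := by
    intro τ hτ
    have h2 : r τ = ∫ σ in (0 : ℝ)..τ, r' σ := by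
      rw [intervalIntegral.integral_eq_sub_of_hasDerivAt (fun σ _ => hr σ)
        (hr'.intervalIntegrable _ _), h0, sub_zero]
    rw [h2]
    refine (intervalIntegral.norm_integral_le_integral_norm hτ.1).trans ?_
    refine intervalIntegral.integral_mono_interval le_rfl hτ.1 hτ.2 ?_
      (hr'.norm.intervalIntegrable _ _)
    exact Eventually.of_forall fun σ => norm_nonneg _
  have h2 : ∫ τ in (0 : ℝ)..1, ‖r' τ‖ * ‖r τ‖ ≤ ∫ τ in (0 : ℝ)..1, ‖r' τ‖ * S := by
    refine intervalIntegral.integral_mono_on zero_le_one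
      ((hr'.norm.mul hrc.norm).intervalIntegrable _ _)
      ((hr'.norm.mul continuous_const).intervalIntegrable _ _) fun τ hτ => ?_
    exact mul_le_mul_of_nonneg_left (h1 τ hτ) (norm_nonneg _)
  have h3 : 0 ≤ ∫ τ in (0 : ℝ)..1, (‖r' τ‖ - S) ^ 2 :=
    intervalIntegral.integral_nonneg zero_le_one fun τ _ => sq_nonneg _
  have h4 : ∫ τ in (0 : ℝ)..1, (‖r' τ‖ - S) ^ 2
      = (∫ τ in (0 : ℝ)..1, ‖r' τ‖ ^ 2) - 2 * S * S + S ^ 2 := by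
    have e : (fun τ => (‖r' τ‖ - S) ^ 2) = fun τ => ‖r' τ‖ ^ 2 - 2 * S * ‖r' τ‖ + S ^ 2 := by
      funext τ; ring
    rw [e, intervalIntegral.integral_add, intervalIntegral.integral_sub,
      intervalIntegral.integral_const_mul, intervalIntegral.integral_const]
    · simp [hS]
    all_goals exact Continuous.intervalIntegrable (by fun_prop) _ _
  rw [intervalIntegral.integral_mul_const] at h2
  nlinarith

variable [FiniteDimensional ℝ E] {G : E → E →L[ℝ] E →L[ℝ] ℝ} {O : Set E} {C : ℝ}

/-- A short curve that minimizes the energy among the curves near it whose velocity has the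
Lipschitz constant `L` is a geodesic. The competitor is the curve `c + ε r` where `c + r` has the
second derivative `- Γ (v, v)`, the Christoffel symbols being taken along `c`. -/
theorem MetricBounds.isGeodesic_of_minimal (hG : MetricBounds G O C) {c v : ℝ → E} {μ L : ℝ}
    (hv : Continuous v) (hc : ∀ τ, HasDerivAt c (v τ) τ) (hcO : ∀ τ ∈ Icc (0 : ℝ) 1, c τ ∈ O)
    (hμ : ∀ τ ∈ Icc (0 : ℝ) 1, ‖v τ‖ ≤ μ) (hμC : C ^ 2 * μ < 1) (hL : 2 * C ^ 2 * μ ^ 2 ≤ L)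
    (hmin : ∀ r r' : ℝ → E, Continuous r' → (∀ τ, HasDerivAt r (r' τ) τ) → r 0 = 0 → r 1 = 0 →
      (∀ τ σ : ℝ, ‖(v τ + r' τ) - (v σ + r' σ)‖ ≤ L * |τ - σ|) →
      ∀ᶠ ε in 𝓝[>] (0 : ℝ), energy G c v ≤ energy G (fun τ => c τ + ε • r τ)
        (fun τ => v τ + ε • r' τ)) :
    IsGeodesic G c v := by
  have : CompleteSpace E := FiniteDimensional.complete ℝ E
  have hcc : Continuous c := continuous_iff_continuousAt.2 fun τ => (hc τ).continuousAt
  have hC := hG.one_le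
  let pr : ℝ → ℝ := fun τ => (projIcc (0 : ℝ) 1 zero_le_one τ : ℝ)
  have hpr : Continuous pr := continuous_subtype_val.comp continuous_projIcc
  have hprm : ∀ τ, pr τ ∈ Icc (0 : ℝ) 1 := fun τ => (projIcc (0 : ℝ) 1 zero_le_one τ).2
  have hpre : ∀ τ ∈ Icc (0 : ℝ) 1, pr τ = τ := fun τ hτ => by
    simp only [pr, projIcc_of_mem zero_le_one hτ]
  let a : ℝ → E := fun τ => - chris G (c (pr τ)) (v (pr τ)) (v (pr τ))
  have ha : Continuous a := by
    refine Continuous.neg ?_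
    rw [← continuousOn_univ]
    exact hG.continuousOn_chris (hcc.comp hpr).continuousOn (hv.comp hpr).continuousOn
      (fun τ _ => hcO _ (hprm τ))
  have hale : ∀ τ, ‖a τ‖ ≤ L := by
    intro τ
    simp only [a, norm_neg]
    refine (hG.norm_chris_le (hcO _ (hprm τ)) _ _).trans (le_trans ?_ hL)
    have h1 := hμ _ (hprm τ)
    have h2 : ‖v (pr τ)‖ * ‖v (pr τ)‖ ≤ μ * μ := mul_self_le_mul_self (norm_nonneg _) h1
    nlinarith [sq_nonneg C]
  let k : ℝ → E := fun τ => ∫ σ in (0 : ℝ)..τ, a σ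
  have hk : ∀ τ, HasDerivAt k (a τ) τ := fun τ =>
    intervalIntegral.integral_hasDerivAt_right (ha.intervalIntegrable _ _)
      ha.stronglyMeasurable.stronglyMeasurableAtFilter ha.continuousAt
  have hkc : Continuous k := continuous_iff_continuousAt.2 fun τ => (hk τ).continuousAt
  let m : E := (∫ σ in (0 : ℝ)..1, v σ) - ∫ σ in (0 : ℝ)..1, k σ
  let r' : ℝ → E := fun τ => k τ + m - v τ
  have hr'c : Continuous r' := by fun_prop
  let r : ℝ → E := fun τ => ∫ σ in (0 : ℝ)..τ, r' σ
  have hr : ∀ τ, HasDerivAt r (r' τ) τ := fun τ =>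
    intervalIntegral.integral_hasDerivAt_right (hr'c.intervalIntegrable _ _)
      hr'c.stronglyMeasurable.stronglyMeasurableAtFilter hr'c.continuousAt
  have hrc : Continuous r := continuous_iff_continuousAt.2 fun τ => (hr τ).continuousAt
  have hr0 : r 0 = 0 := by simp [r]
  have hr1 : r 1 = 0 := by
    simp only [r, r']
    rw [intervalIntegral.integral_sub, intervalIntegral.integral_add]
    · simp [m]
    all_goals exact Continuous.intervalIntegrable (by fun_prop) _ _
  have hw : ∀ τ, v τ + r' τ = k τ + m := fun τ => by simp [r']
  have hLip : ∀ τ σ : ℝ, ‖(v τ + r' τ) - (v σ + r' σ)‖ ≤ L * |τ - σ| := by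
    intro τ σ
    rw [hw, hw, add_sub_add_right_eq_sub]
    have := Convex.norm_image_sub_le_of_norm_hasDerivWithin_le (f := k) (f' := a) (s := univ)
      (x := σ) (y := τ) (C := L) (fun x _ => (hk x).hasDerivWithinAt) (fun x _ => hale x)
      convex_univ (mem_univ _) (mem_univ _)
    simpa [Real.norm_eq_abs] using this
  have hcon := hcc.continuousOn (s := Icc 0 1)
  obtain ⟨e₁, he, he0, -⟩ := exists_hasDerivAt_energy hG.isOpen hG.smooth hG.symm
    (V := r) (V' := r') (W := fun _ => 0) (W' := fun _ => 0) hcon hv.continuousOn hrc.continuousOn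
    hr'c.continuousOn continuousOn_const continuousOn_const hcO
  have he1 := he.self_of_nhds
  -- the first variation along `r` is nonnegative
  have hpos : 0 ≤ e₁ 0 := by
    have h2 := (hasDerivAt_iff_tendsto_slope.1 he1).mono_left (show 𝓝[>] (0 : ℝ) ≤ 𝓝[≠] 0 from
      nhdsWithin_mono _ (fun x (hx : 0 < x) => ne_of_gt hx))
    refine ge_of_tendsto h2 ?_
    filter_upwards [hmin r r' hr'c hr hr0 hr1 hLip, self_mem_nhdsWithin] with ε hε hε0
    have hε0' : (0 : ℝ) < ε := hε0
    rw [slope_def_field]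
    refine div_nonneg ?_ (by linarith)
    simp only [energy] at hε
    simpa using hε
  rw [he0] at hpos
  -- continuity of the integrands
  have cG : ContinuousOn (fun τ => G (c τ)) (Icc 0 1) := hG.smooth.continuousOn.comp hcon hcO
  have cD : ContinuousOn (fun τ => fderiv ℝ G (c τ)) (Icc 0 1) :=
    (hG.smooth.fderiv_of_isOpen hG.isOpen (m := ∞) (by simp)).continuousOn.comp hcon hcO
  have cv := hv.continuousOn (s := Icc (0 : ℝ) 1)
  have cr := hrc.continuousOn (s := Icc (0 : ℝ) 1)
  have cr' := hr'c.continuousOn (s := Icc (0 : ℝ) 1)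
  have ca := ha.continuousOn (s := Icc (0 : ℝ) 1)
  have cw : ContinuousOn (fun τ => k τ + m) (Icc (0 : ℝ) 1) := by fun_prop
  have i1 : ContinuousOn (fun τ => fderiv ℝ G (c τ) (r τ) (v τ) (v τ)
      + 2 * G (c τ) (v τ) (r' τ)) (Icc 0 1) :=
    (((cD.clm_apply cr).clm_apply cv).clm_apply cv).add
      (continuousOn_const.mul ((cG.clm_apply cv).clm_apply cr'))
  have i2 : ContinuousOn (fun τ => fderiv ℝ G (c τ) (v τ) (k τ + m) (r τ)
      + G (c τ) (a τ) (r τ) + G (c τ) (k τ + m) (r' τ)) (Icc 0 1) :=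
    ((((cD.clm_apply cv).clm_apply cw).clm_apply cr).add ((cG.clm_apply ca).clm_apply cr)).add
      ((cG.clm_apply cw).clm_apply cr')
  have i3 : ContinuousOn (fun τ => G (c τ) (r' τ) (r' τ)) (Icc 0 1) :=
    (cG.clm_apply cr').clm_apply cr'
  have h0 : ∫ τ in (0 : ℝ)..1, (fderiv ℝ G (c τ) (v τ) (k τ + m) (r τ)
      + G (c τ) (a τ) (r τ) + G (c τ) (k τ + m) (r' τ)) = 0 := by
    rw [integral_eq_sub_of_hasDerivWithinAt (h := fun τ => G (c τ) (k τ + m) (r τ))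
      (fun τ hτ => hG.hasDerivWithinAt_apply (hcO τ hτ) (hc τ).hasDerivWithinAt
        ((hk τ).add_const m).hasDerivWithinAt (hr τ).hasDerivWithinAt) i2]
    simp [hr0, hr1]
  have hN : ∫ τ in (0 : ℝ)..1, ‖r' τ‖ ^ 2 ≤ C ^ 2 * μ * ∫ τ in (0 : ℝ)..1, ‖r' τ‖ ^ 2 := by
    have h1 : ∫ τ in (0 : ℝ)..1, ‖r' τ‖ ^ 2 ≤ ∫ τ in (0 : ℝ)..1,
        (C ^ 2 * μ * (‖r' τ‖ * ‖r τ‖) - C / 2 * ((fderiv ℝ G (c τ) (r τ) (v τ) (v τ)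
          + 2 * G (c τ) (v τ) (r' τ)) - 2 * (fderiv ℝ G (c τ) (v τ) (k τ + m) (r τ)
          + G (c τ) (a τ) (r τ) + G (c τ) (k τ + m) (r' τ)))) := by
      refine intervalIntegral.integral_mono_on zero_le_one
        ((hr'c.norm.pow 2).intervalIntegrable _ _)
        (intervalIntegrable_unit ?_) fun τ hτ => ?_
      · exact (continuousOn_const.mul (cr'.norm.mul cr.norm)).sub
          (continuousOn_const.mul (i1.sub (continuousOn_const.mul i2)))
      · have e1 : a τ = - chris G (c τ) (v τ) (v τ) := by simp only [a, hpre τ hτ]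
        have e2 : G (c τ) (a τ) (r τ) = - (fderiv ℝ G (c τ) (v τ) (v τ) (r τ)
            - fderiv ℝ G (c τ) (r τ) (v τ) (v τ) / 2) := by
          rw [e1, map_neg, neg_apply, hG.apply_chris_self (hcO τ hτ)]
        have e3 : k τ + m = v τ + r' τ := (hw τ).symm
        rw [e2, e3]
        simp only [map_add, add_apply]
        have h2 := hG.sq_norm_le _ (hcO τ hτ) (r' τ)
        have h3 := (abs_le.1 (abs_trilinear_le _ (hG.norm_fderiv_le _ (hcO τ hτ)) (v τ) (r' τ)
          (r τ))).1
        have h4 : C * ‖v τ‖ * ‖r' τ‖ * ‖r τ‖ ≤ C * μ * ‖r' τ‖ * ‖r τ‖ := by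
          have := hμ τ hτ
          have := hG.pos
          gcongr
        nlinarith [hG.pos, mul_le_mul_of_nonneg_left (h4.trans' (neg_le.1 h3)) hG.pos.le]
    rw [intervalIntegral.integral_sub, intervalIntegral.integral_const_mul,
      intervalIntegral.integral_const_mul, intervalIntegral.integral_sub,
      intervalIntegral.integral_const_mul, h0] at h1
    · have h2 := integral_norm_mul_norm_le hr'c hr hr0
      have h3 : 0 ≤ C ^ 2 * μ :=
        mul_nonneg (sq_nonneg C) ((norm_nonneg _).trans (hμ 0 (by simp)))
      nlinarith [mul_le_mul_of_nonneg_left h2 h3, mul_nonneg hG.pos.le hpos]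
    · exact intervalIntegrable_unit i1
    · exact intervalIntegrable_unit (continuousOn_const.mul i2)
    · exact Continuous.intervalIntegrable (by fun_prop) _ _
    · exact intervalIntegrable_unit
        (continuousOn_const.mul (i1.sub (continuousOn_const.mul i2)))
  have hzero : ∀ τ ∈ Icc (0 : ℝ) 1, r' τ = 0 := by
    by_contra! hne
    obtain ⟨τ, hτ, hτ0⟩ := hne
    have := intervalIntegral.integral_pos (f := fun τ => ‖r' τ‖ ^ 2) zero_lt_one
      (hr'c.norm.pow 2).continuousOn (fun _ _ => sq_nonneg _)
      ⟨τ, hτ, pow_pos (norm_pos_iff.2 hτ0) 2⟩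
    nlinarith
  refine ⟨fun τ _ => (hc τ).hasDerivWithinAt, fun τ hτ => ?_⟩
  have h1 : ∀ τ ∈ Icc (0 : ℝ) 1, v τ = k τ + m := fun τ hτ => by
    have := hw τ
    rwa [hzero τ hτ, add_zero] at this
  have h2 : HasDerivWithinAt v (a τ) (Icc 0 1) τ :=
    ((hk τ).add_const m).hasDerivWithinAt.congr h1 (h1 τ hτ)
  simpa only [a, hpre τ hτ] using h2

end Geodesic

/-! ### The two-point function at a maximizing geodesic -/

section Variation

open MeasureTheory Topology Filter

set_option maxSynthPendingDepth 3

variable {E : Type*} [NormedAddCommGroup E] [NormedSpace ℝ E]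
  {G : E → E →L[ℝ] E →L[ℝ] ℝ} {O : Set E} {C : ℝ} {c v : ℝ → E}

namespace IsGeodesic

theorem continuousOn (h : IsGeodesic G c v) : ContinuousOn c (Icc 0 1) :=
  fun τ hτ => (h.hasDerivWithinAt τ hτ).continuousWithinAt

theorem continuousOn_velocity (h : IsGeodesic G c v) : ContinuousOn v (Icc 0 1) :=
  fun τ hτ => (h.hasDerivWithinAt_velocity τ hτ).continuousWithinAt

variable [FiniteDimensional ℝ E]

/-- First variation along a geodesic: only the end points contribute. -/
theorem hasDerivWithinAt_apply_velocity (h : IsGeodesic G c v) (hG : MetricBounds G O C)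
    (hcO : ∀ τ ∈ Icc (0 : ℝ) 1, c τ ∈ O) {V : ℝ → E} {V' : E} {τ : ℝ} (hτ : τ ∈ Icc (0 : ℝ) 1)
    (hV : HasDerivWithinAt V V' (Icc 0 1) τ) :
    HasDerivWithinAt (fun τ => G (c τ) (v τ) (V τ))
      (fderiv ℝ G (c τ) (V τ) (v τ) (v τ) / 2 + G (c τ) (v τ) V') (Icc 0 1) τ := by
  refine (hG.hasDerivWithinAt_apply (hcO τ hτ) (h.hasDerivWithinAt τ hτ)
    (h.hasDerivWithinAt_velocity τ hτ) hV).congr_deriv ?_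
  rw [map_neg, neg_apply, hG.apply_chris_self (hcO τ hτ)]
  ring

theorem apply_velocity_self (h : IsGeodesic G c v) (hG : MetricBounds G O C)
    (hcO : ∀ τ ∈ Icc (0 : ℝ) 1, c τ ∈ O) {τ : ℝ} (hτ : τ ∈ Icc (0 : ℝ) 1) :
    G (c τ) (v τ) (v τ) = G (c 0) (v 0) (v 0) := by
  refine (convex_Icc (0 : ℝ) 1).is_const_of_fderivWithin_eq_zero (𝕜 := ℝ)
    (f := fun τ => G (c τ) (v τ) (v τ)) ?_ ?_ hτ (by simp)
  · exact fun σ hσ => (h.hasDerivWithinAt_apply_velocity hG hcO hσ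
      (h.hasDerivWithinAt_velocity σ hσ)).differentiableWithinAt
  · intro σ hσ
    have h1 := h.hasDerivWithinAt_apply_velocity hG hcO hσ (h.hasDerivWithinAt_velocity σ hσ)
    have h2 : fderiv ℝ G (c σ) (v σ) (v σ) (v σ) / 2
        + G (c σ) (v σ) (- chris G (c σ) (v σ) (v σ)) = 0 := by
      rw [map_neg, hG.symm _ (hcO σ hσ), hG.apply_chris_self (hcO σ hσ)]
      ring
    rw [h2] at h1
    have h3 := h1.hasFDerivWithinAt.fderivWithin (uniqueDiffOn_Icc_zero_one σ hσ)
    rw [h3]; ext; simp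

theorem energy_eq (h : IsGeodesic G c v) (hG : MetricBounds G O C)
    (hcO : ∀ τ ∈ Icc (0 : ℝ) 1, c τ ∈ O) : energy G c v = G (c 0) (v 0) (v 0) := by
  rw [energy, intervalIntegral.integral_congr (g := fun _ => G (c 0) (v 0) (v 0)) (fun τ hτ => ?_)]
  · simp
  · rw [uIcc_of_le zero_le_one] at hτ
    exact h.apply_velocity_self hG hcO hτ

theorem integral_firstVariation (h : IsGeodesic G c v) (hG : MetricBounds G O C)
    (hcO : ∀ τ ∈ Icc (0 : ℝ) 1, c τ ∈ O) {V V' : ℝ → E} (hV' : ContinuousOn V' (Icc 0 1))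
    (hV : ∀ τ ∈ Icc (0 : ℝ) 1, HasDerivWithinAt V (V' τ) (Icc 0 1) τ) :
    ∫ τ in (0 : ℝ)..1, (fderiv ℝ G (c τ) (V τ) (v τ) (v τ) + 2 * G (c τ) (v τ) (V' τ))
      = 2 * (G (c 1) (v 1) (V 1) - G (c 0) (v 0) (V 0)) := by
  have cG : ContinuousOn (fun τ => G (c τ)) (Icc 0 1) :=
    hG.smooth.continuousOn.comp h.continuousOn hcO
  have cD : ContinuousOn (fun τ => fderiv ℝ G (c τ)) (Icc 0 1) :=
    (hG.smooth.fderiv_of_isOpen hG.isOpen (m := ∞) (by simp)).continuousOn.comp h.continuousOn hcO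
  have cv := h.continuousOn_velocity
  have cV : ContinuousOn V (Icc 0 1) := fun τ hτ => (hV τ hτ).continuousWithinAt
  rw [← integral_eq_sub_of_hasDerivWithinAt (h := fun τ => G (c τ) (v τ) (V τ))
    (fun τ hτ => h.hasDerivWithinAt_apply_velocity hG hcO hτ (hV τ hτ)),
    ← intervalIntegral.integral_const_mul]
  · refine intervalIntegral.integral_congr fun τ _ => ?_
    ring
  · exact ((((cD.clm_apply cV).clm_apply cv).clm_apply cv).div_const 2).add
      ((cG.clm_apply cv).clm_apply hV')

theorem sq_norm_velocity_le (h : IsGeodesic G c v) (hG : MetricBounds G O C)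
    (hcO : ∀ τ ∈ Icc (0 : ℝ) 1, c τ ∈ O) {s : ℝ} (hs : energy G c v = s ^ 2) {τ : ℝ}
    (hτ : τ ∈ Icc (0 : ℝ) 1) : ‖v τ‖ ^ 2 ≤ C * s ^ 2 := by
  have := hG.sq_norm_le _ (hcO τ hτ) (v τ)
  rwa [h.apply_velocity_self hG hcO hτ, ← h.energy_eq hG hcO, hs] at this

theorem norm_velocity_le (h : IsGeodesic G c v) (hG : MetricBounds G O C)
    (hcO : ∀ τ ∈ Icc (0 : ℝ) 1, c τ ∈ O) {s : ℝ} (hs0 : 0 ≤ s) (hs : energy G c v = s ^ 2) {τ : ℝ}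
    (hτ : τ ∈ Icc (0 : ℝ) 1) : ‖v τ‖ ≤ C * s := by
  have h1 := h.sq_norm_velocity_le hG hcO hs hτ
  have hC := hG.one_le
  have h2 : C * s ^ 2 ≤ (C * s) ^ 2 := by
    nlinarith [mul_nonneg (mul_nonneg (sub_nonneg.2 hC) hG.pos.le) (sq_nonneg s)]
  exact (abs_le_of_sq_le_sq' (h1.trans h2) (mul_nonneg hG.pos.le hs0)).2

theorem norm_sub_le (h : IsGeodesic G c v) (hG : MetricBounds G O C)
    (hcO : ∀ τ ∈ Icc (0 : ℝ) 1, c τ ∈ O) {s : ℝ} (hs0 : 0 ≤ s) (hs : energy G c v = s ^ 2)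
    {τ σ : ℝ} (hτ : τ ∈ Icc (0 : ℝ) 1) (hσ : σ ∈ Icc (0 : ℝ) 1) : ‖c τ - c σ‖ ≤ C * s := by
  have h1 := (convex_Icc (0 : ℝ) 1).norm_image_sub_le_of_norm_hasDerivWithin_le (f := c) (f' := v)
    (C := C * s) h.hasDerivWithinAt (fun ρ hρ => h.norm_velocity_le hG hcO hs0 hs hρ) hσ hτ
  have h2 : ‖τ - σ‖ ≤ 1 := by
    rw [Real.norm_eq_abs, abs_le]; constructor <;> linarith [hτ.1, hτ.2, hσ.1, hσ.2]
  have := mul_nonneg hG.pos.le hs0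
  nlinarith

/-- The second variation of the energy for a field which is affine in `τ`, up to terms of higher
order in the length `s`. -/
theorem secondVariation_le (h : IsGeodesic G c v) (hG : MetricBounds G O C)
    (hcO : ∀ τ ∈ Icc (0 : ℝ) 1, c τ ∈ O) {s : ℝ} (hs0 : 0 ≤ s) (hs : energy G c v = s ^ 2)
    (a b : E) {τ : ℝ} (hτ : τ ∈ Icc (0 : ℝ) 1) :
    secondVariation G (c τ) (v τ) (b + τ • (a - b)) (a - b)
      (-((1 / 2 : ℝ) • chris G (c 0) b b)
        + τ • (-((1 / 2 : ℝ) • chris G (c 1) a a) - -((1 / 2 : ℝ) • chris G (c 0) b b)))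
      (-((1 / 2 : ℝ) • chris G (c 1) a a) - -((1 / 2 : ℝ) • chris G (c 0) b b))
      ≤ 2 * (G (c 0) (a - b) (a - b) + 20 * C ^ 7 *
        (s ^ 2 * (‖a‖ ^ 2 + ‖b‖ ^ 2) + s * ‖a - b‖ * (‖a‖ + ‖b‖))) := by
  have m0 : (0 : ℝ) ∈ Icc (0 : ℝ) 1 := by simp
  have m1 : (1 : ℝ) ∈ Icc (0 : ℝ) 1 := by simp
  have hC := hG.one_le
  have hC0 := hG.pos
  set V : E := b + τ • (a - b) with hV
  set D : E := -((1 / 2 : ℝ) • chris G (c 1) a a) - -((1 / 2 : ℝ) • chris G (c 0) b b) with hD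
  set W : E := -((1 / 2 : ℝ) • chris G (c 0) b b) + τ • D with hW
  set N : ℝ := ‖a‖ ^ 2 + ‖b‖ ^ 2 with hN
  set m : ℝ := ‖a‖ + ‖b‖ with hm
  set d : ℝ := ‖a - b‖ with hd
  have hN0 : 0 ≤ N := by positivity
  have hm0 : 0 ≤ m := by positivity
  have hd0 : 0 ≤ d := norm_nonneg _
  have hmN : m ^ 2 ≤ 2 * N := by rw [hm, hN]; nlinarith [sq_nonneg (‖a‖ - ‖b‖)]
  have hdm : d ≤ m := _root_.norm_sub_le a b
  have hcomb : ∀ p q : E, ‖p + τ • (q - p)‖ ≤ ‖q‖ + ‖p‖ := by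
    intro p q
    have e : p + τ • (q - p) = (1 - τ) • p + τ • q := by
      rw [smul_sub, sub_smul, one_smul]; abel
    rw [e]
    refine (norm_add_le _ _).trans ?_
    rw [norm_smul, norm_smul, Real.norm_of_nonneg (by linarith [hτ.2] : (0 : ℝ) ≤ 1 - τ),
      Real.norm_of_nonneg hτ.1]
    nlinarith [norm_nonneg p, norm_nonneg q, hτ.1, hτ.2]
  have hVm : ‖V‖ ≤ m := by
    simpa only [hV, hm, add_comm] using hcomb b a
  have half : ∀ w : E, ‖-((1 / 2 : ℝ) • w)‖ = ‖w‖ / 2 := by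
    intro w
    rw [norm_neg, norm_smul, Real.norm_of_nonneg (by norm_num : (0 : ℝ) ≤ 1 / 2)]; ring
  have hWN : ‖W‖ ≤ C ^ 2 * N := by
    have h1 := hcomb (-((1 / 2 : ℝ) • chris G (c 0) b b)) (-((1 / 2 : ℝ) • chris G (c 1) a a))
    rw [half, half] at h1
    have h2 := hG.norm_chris_le (hcO 0 m0) b b
    have h3 := hG.norm_chris_le (hcO 1 m1) a a
    refine h1.trans ?_
    rw [hN]
    nlinarith
  have hDN : ‖D‖ ≤ 2 * C ^ 5 * (s * N + d * m) := by
    have h1 : ‖D‖ = ‖chris G (c 1) a a - chris G (c 0) b b‖ / 2 := by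
      have : D = -((1 / 2 : ℝ) • (chris G (c 1) a a - chris G (c 0) b b)) := by
        rw [hD, smul_sub]; abel
      rw [this, half]
    have h2 := hG.norm_chris_sub_chris_le (hcO 1 m1) (hcO 0 m0) a b
    have h3 := h.norm_sub_le hG hcO hs0 hs m1 m0
    have h4 : ‖c 1 - c 0‖ * N + d * m ≤ C * (s * N + d * m) := by
      have : 0 ≤ d * m := by positivity
      nlinarith
    rw [h1]
    have h5 : (0 : ℝ) ≤ 4 * C ^ 4 := by positivity
    nlinarith [mul_le_mul_of_nonneg_left h4 h5]
  have hv2 := h.sq_norm_velocity_le hG hcO hs hτ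
  have hv1 := h.norm_velocity_le hG hcO hs0 hs hτ
  have hcτ := hcO τ hτ
  have b1 : fderiv ℝ (fderiv ℝ G) (c τ) V V (v τ) (v τ) ≤ 2 * C ^ 2 * (s ^ 2 * N) := by
    have h1 : ‖fderiv ℝ (fderiv ℝ G) (c τ) V‖ ≤ C * ‖V‖ :=
      ((fderiv ℝ (fderiv ℝ G) (c τ)).le_opNorm V).trans
        (by gcongr; exact hG.norm_fderiv_fderiv_le _ hcτ)
    refine (le_abs_self _).trans ((abs_trilinear_le _ h1 V (v τ) (v τ)).trans ?_)
    calc C * ‖V‖ * ‖V‖ * ‖v τ‖ * ‖v τ‖ = C * ‖V‖ ^ 2 * ‖v τ‖ ^ 2 := by ring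
      _ ≤ C * (2 * N) * (C * s ^ 2) := by
          gcongr
          exact (pow_le_pow_left₀ (norm_nonneg _) hVm 2).trans hmN
      _ = 2 * C ^ 2 * (s ^ 2 * N) := by ring
  have b2 : fderiv ℝ G (c τ) W (v τ) (v τ) ≤ C ^ 4 * (s ^ 2 * N) := by
    refine (le_abs_self _).trans ((abs_trilinear_le _ (hG.norm_fderiv_le _ hcτ) _ _ _).trans ?_)
    calc C * ‖W‖ * ‖v τ‖ * ‖v τ‖ = C * ‖W‖ * ‖v τ‖ ^ 2 := by ring
      _ ≤ C * (C ^ 2 * N) * (C * s ^ 2) := by gcongr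
      _ = C ^ 4 * (s ^ 2 * N) := by ring
  have b3 : fderiv ℝ G (c τ) V (v τ) (a - b) ≤ C ^ 2 * (s * d * m) := by
    refine (le_abs_self _).trans ((abs_trilinear_le _ (hG.norm_fderiv_le _ hcτ) _ _ _).trans ?_)
    calc C * ‖V‖ * ‖v τ‖ * ‖a - b‖ ≤ C * m * (C * s) * d := by gcongr
      _ = C ^ 2 * (s * d * m) := by ring
  have b4 : G (c τ) (v τ) D ≤ 2 * C ^ 7 * (s ^ 2 * N + s * d * m) := by
    refine (le_abs_self _).trans ((abs_form_le _ (hG.norm_le _ hcτ) _ _).trans ?_)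
    calc C * ‖v τ‖ * ‖D‖ ≤ C * (C * s) * (2 * C ^ 5 * (s * N + d * m)) := by gcongr
      _ = 2 * C ^ 7 * (s ^ 2 * N + s * d * m) := by ring
  have b5 : G (c τ) (a - b) (a - b) ≤ G (c 0) (a - b) (a - b) + C ^ 2 * (s * d * m) := by
    have h1 := le_abs_self ((G (c τ) - G (c 0)) (a - b) (a - b))
    have h2 := abs_form_le _ (hG.norm_sub_le hcτ (hcO 0 m0)) (a - b) (a - b)
    have h3 : C * ‖c τ - c 0‖ * ‖a - b‖ * ‖a - b‖ ≤ C * (C * s) * d * m := by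
      gcongr
      · exact h.norm_sub_le hG hcO hs0 hs hτ m0
    simp only [sub_apply] at h1 h2
    linarith
  have hsN : 0 ≤ s ^ 2 * N := by positivity
  have hsd : 0 ≤ s * d * m := by positivity
  have p1 : C ^ 2 ≤ C ^ 7 := pow_le_pow_right₀ hC (by norm_num)
  have p2 : C ^ 4 ≤ C ^ 7 := pow_le_pow_right₀ hC (by norm_num)
  rw [secondVariation]
  nlinarith [mul_le_mul_of_nonneg_right p1 hsN, mul_le_mul_of_nonneg_right p2 hsN,
    mul_le_mul_of_nonneg_right p1 hsd, mul_nonneg (pow_nonneg hC0.le 7) hsN,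
    mul_nonneg (pow_nonneg hC0.le 7) hsd]

end IsGeodesic

/-- Conditions of first and second order at a geodesic `c` that maximizes
`U (c 1) - U (c 0) - K φ (length of c)` under variations which are affine in the parameter. -/
theorem IsGeodesic.two_point_conditions [FiniteDimensional ℝ E] (h : IsGeodesic G c v)
    (hG : MetricBounds G O C)
    (hcO : ∀ τ ∈ Icc (0 : ℝ) 1, c τ ∈ O) {s : ℝ} (hs0 : 0 < s) (hs : energy G c v = s ^ 2)
    {U : E → ℝ} (hU : ContDiffOn ℝ 2 U O) {φ φ₁ : ℝ → ℝ} {φ₂ K : ℝ} (hK : 0 ≤ K)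
    (hφ : ∀ᶠ σ in 𝓝 s, HasDerivAt φ (φ₁ σ) σ) (hφ₁ : HasDerivAt φ₁ φ₂ s) (hφ0 : 0 ≤ φ₁ s)
    (hmax : ∀ a b w w' : E, ∀ᶠ ε in 𝓝 (0 : ℝ),
      U (c 1 + ε • a + ε ^ 2 • (w + w')) - U (c 0 + ε • b + ε ^ 2 • w)
        - K * φ (Real.sqrt (energy G (fun τ => c τ + ε • (b + τ • (a - b)) + ε ^ 2 • (w + τ • w'))
          (fun τ => v τ + ε • (a - b) + ε ^ 2 • w')))
        ≤ U (c 1) - U (c 0) - K * φ s) :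
    (∀ a, fderiv ℝ U (c 1) a = K * φ₁ s / s * G (c 1) (v 1) a) ∧
    (∀ b, fderiv ℝ U (c 0) b = K * φ₁ s / s * G (c 0) (v 0) b) ∧
    ∀ a b, fderiv ℝ (fderiv ℝ U) (c 1) a a - fderiv ℝ U (c 1) (chris G (c 1) a a)
      - (fderiv ℝ (fderiv ℝ U) (c 0) b b - fderiv ℝ U (c 0) (chris G (c 0) b b))
      ≤ K * (φ₂ * ((G (c 1) (v 1) a - G (c 0) (v 0) b) / s) ^ 2
        + φ₁ s / s * (G (c 0) (a - b) (a - b) - ((G (c 1) (v 1) a - G (c 0) (v 0) b) / s) ^ 2)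
        + φ₁ s / s * (20 * C ^ 7 *
          (s ^ 2 * (‖a‖ ^ 2 + ‖b‖ ^ 2) + s * ‖a - b‖ * (‖a‖ + ‖b‖)))) := by
  have m0 : (0 : ℝ) ∈ Icc (0 : ℝ) 1 := by simp
  have m1 : (1 : ℝ) ∈ Icc (0 : ℝ) 1 := by simp
  have hO := hG.isOpen
  have hU1 : ContDiffOn ℝ 1 (fderiv ℝ U) O := hU.fderiv_of_isOpen hO (by norm_num)
  have hUd : ∀ z ∈ O, HasFDerivAt U (fderiv ℝ U z) z := fun z hz =>
    ((hU.contDiffAt (hO.mem_nhds hz)).differentiableAt (by norm_num)).hasFDerivAt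
  have hUd1 : ∀ z ∈ O, HasFDerivAt (fderiv ℝ U) (fderiv ℝ (fderiv ℝ U) z) z := fun z hz =>
    ((hU1.contDiffAt (hO.mem_nhds hz)).differentiableAt (by norm_num)).hasFDerivAt
  -- derivatives along parabolas
  have hpar : ∀ z ∈ O, ∀ a w : E,
      (∀ᶠ ε in 𝓝 (0 : ℝ), HasDerivAt (fun ε => U (z + ε • a + ε ^ 2 • w))
        (fderiv ℝ U (z + ε • a + ε ^ 2 • w) (a + (2 * ε) • w)) ε) ∧
      HasDerivAt (fun ε : ℝ => fderiv ℝ U (z + ε • a + ε ^ 2 • w) (a + (2 * ε) • w))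
        (fderiv ℝ (fderiv ℝ U) z a a + fderiv ℝ U z ((2 : ℝ) • w)) 0 := by
    intro z hz a w
    have hp : ∀ ε : ℝ, HasDerivAt (fun ε : ℝ => z + ε • a + ε ^ 2 • w) (a + (2 * ε) • w) ε := by
      intro ε
      have h1 : HasDerivAt (fun ε : ℝ => ε • a) a ε := by
        simpa using (hasDerivAt_id ε).smul_const a
      have h2 : HasDerivAt (fun ε : ℝ => ε ^ 2 • w) ((2 * ε) • w) ε := by
        simpa using (hasDerivAt_pow 2 ε).smul_const w
      exact (h1.const_add z).add h2
    have hq : HasDerivAt (fun ε : ℝ => a + (2 * ε) • w) ((2 : ℝ) • w) 0 := by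
      have h1 : HasDerivAt (fun ε : ℝ => (2 * ε) • w) ((2 * 1 : ℝ) • w) 0 :=
        ((hasDerivAt_id (0 : ℝ)).const_mul 2).smul_const w
      simpa using h1.const_add a
    have hc : Continuous (fun ε : ℝ => z + ε • a + ε ^ 2 • w) := by fun_prop
    have h0 : z + (0 : ℝ) • a + (0 : ℝ) ^ 2 • w = z := by simp
    constructor
    · have : ∀ᶠ ε in 𝓝 (0 : ℝ), z + ε • a + ε ^ 2 • w ∈ O := by
        exact hc.continuousAt.eventually (hO.mem_nhds (by simpa using hz))
      filter_upwards [this] with ε hε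
      exact (hUd _ hε).comp_hasDerivAt ε (hp ε)
    · have h1 : HasDerivAt (fun ε : ℝ => fderiv ℝ U (z + ε • a + ε ^ 2 • w))
          (fderiv ℝ (fderiv ℝ U) z a) 0 := by
        have h2 : HasFDerivAt (fderiv ℝ U) (fderiv ℝ (fderiv ℝ U) z)
            (z + (0 : ℝ) • a + (0 : ℝ) ^ 2 • w) := by rw [h0]; exact hUd1 z hz
        exact (h2.comp_hasDerivAt (f := fun ε : ℝ => z + ε • a + ε ^ 2 • w) 0 (hp 0)).congr_deriv
          (by simp)
      have := h1.clm_apply hq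
      simpa using this
  -- the basic computation for one variation
  have key : ∀ a b w w' : E, ∀ q : ℝ, q = (G (c 1) (v 1) a - G (c 0) (v 0) b) / s →
      fderiv ℝ U (c 1) a - fderiv ℝ U (c 0) b - K * (φ₁ s * q) = 0 ∧
      (fderiv ℝ (fderiv ℝ U) (c 1) a a + fderiv ℝ U (c 1) ((2 : ℝ) • (w + w')))
        - (fderiv ℝ (fderiv ℝ U) (c 0) b b + fderiv ℝ U (c 0) ((2 : ℝ) • w))
        - K * (φ₂ * q ^ 2 + φ₁ s / s * ((∫ τ in (0 : ℝ)..1, secondVariation G (c τ) (v τ)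
          (b + τ • (a - b)) (a - b) (w + τ • w') w') / 2 - q ^ 2)) ≤ 0 := by
    intro a b w w' q hq
    obtain ⟨e₁, he, he0, he2⟩ := exists_hasDerivAt_energy hO hG.smooth hG.symm
      (V := fun τ => b + τ • (a - b)) (V' := fun _ => a - b) (W := fun τ => w + τ • w')
      (W' := fun _ => w') h.continuousOn h.continuousOn_velocity (by fun_prop) (by fun_prop)
      (by fun_prop) (by fun_prop) hcO
    have he1 : e₁ 0 = 2 * s * q := by
      rw [he0, h.integral_firstVariation hG hcO (V := fun τ => b + τ • (a - b))
        (V' := fun _ => a - b) (by fun_prop) (fun τ _ => ?_), hq]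
      · simp only [one_smul, add_sub_cancel, zero_smul, add_zero]
        field_simp
      · have := ((hasDerivAt_id τ).smul_const (a - b)).const_add b
        simpa using this.hasDerivWithinAt
    set e₂ := ∫ τ in (0 : ℝ)..1, secondVariation G (c τ) (v τ)
          (b + τ • (a - b)) (a - b) (w + τ • w') w' with he₂
    let e : ℝ → ℝ := fun ε => energy G (fun τ => c τ + ε • (b + τ • (a - b)) + ε ^ 2 • (w + τ • w'))
          (fun τ => v τ + ε • (a - b) + ε ^ 2 • w')
    have hee : ∀ᶠ ε in 𝓝 (0 : ℝ), HasDerivAt e (e₁ ε) ε := he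
    have hes : e 0 = s ^ 2 := by rw [← hs]; simp [e]
    have hec : ContinuousAt e 0 := hee.self_of_nhds.continuousAt
    have hs2 : 0 < s ^ 2 := by positivity
    have hepos : ∀ᶠ ε in 𝓝 (0 : ℝ), 0 < e ε := hec.eventually (lt_mem_nhds (by rw [hes]; exact hs2))
    have hrt0 : Real.sqrt (e 0) = s := by rw [hes, Real.sqrt_sq hs0.le]
    have hrc : ContinuousAt (fun ε => Real.sqrt (e ε)) 0 := hec.sqrt
    have hφe : ∀ᶠ ε in 𝓝 (0 : ℝ), HasDerivAt φ (φ₁ (Real.sqrt (e ε))) (Real.sqrt (e ε)) := by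
      have hφ' : ∀ᶠ σ in 𝓝 (Real.sqrt (e 0)), HasDerivAt φ (φ₁ σ) σ := by rwa [hrt0]
      exact hrc.eventually hφ'
    have hd : ∀ᶠ ε in 𝓝 (0 : ℝ), HasDerivAt (fun ε => φ (Real.sqrt (e ε)))
        (φ₁ (Real.sqrt (e ε)) * (e₁ ε / (2 * Real.sqrt (e ε)))) ε := by
      filter_upwards [hee, hepos, hφe] with ε h1 h2 h3
      exact h3.comp ε (h1.sqrt h2.ne')
    have hd1 : HasDerivAt (fun ε => φ₁ (Real.sqrt (e ε)) * (e₁ ε / (2 * Real.sqrt (e ε))))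
        (φ₂ * q ^ 2 + φ₁ s / s * (e₂ / 2 - q ^ 2)) 0 := by
      have h1 : HasDerivAt (fun ε => Real.sqrt (e ε)) q 0 := by
        refine (hee.self_of_nhds.sqrt hepos.self_of_nhds.ne').congr_deriv ?_
        rw [hrt0, he1]; field_simp
      have h2 : HasDerivAt (fun ε => φ₁ (Real.sqrt (e ε))) (φ₂ * q) 0 := by
        have h3 : HasDerivAt φ₁ φ₂ (Real.sqrt (e 0)) := by rwa [hrt0]
        exact h3.comp 0 h1
      refine (h2.mul (he2.div (h1.const_mul 2) (by rw [hrt0]; positivity))).congr_deriv ?_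
      simp only [Pi.div_apply]
      rw [hrt0, he1]; field_simp
    obtain ⟨hx0, hx1⟩ := hpar _ (hcO 1 m1) a (w + w')
    obtain ⟨hy0, hy1⟩ := hpar _ (hcO 0 m0) b w
    have hloc : IsLocalMax (fun ε : ℝ => U (c 1 + ε • a + ε ^ 2 • (w + w'))
        - U (c 0 + ε • b + ε ^ 2 • w) - K * φ (Real.sqrt (e ε))) 0 := by
      filter_upwards [hmax a b w w'] with ε hε
      simp only [zero_smul, add_zero, ne_eq, OfNat.ofNat_ne_zero, not_false_eq_true, zero_pow, hrt0]
      exact hε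
    have := eq_zero_and_nonpos_of_isLocalMax hloc
      (h₁ := fun ε => fderiv ℝ U (c 1 + ε • a + ε ^ 2 • (w + w')) (a + (2 * ε) • (w + w'))
        - fderiv ℝ U (c 0 + ε • b + ε ^ 2 • w) (b + (2 * ε) • w)
        - K * (φ₁ (Real.sqrt (e ε)) * (e₁ ε / (2 * Real.sqrt (e ε)))))
      (by filter_upwards [hx0, hy0, hd] with ε h1 h2 h3 using (h1.sub h2).sub (h3.const_mul K))
      ((hx1.sub hy1).sub (hd1.const_mul K))
    refine ⟨?_, this.2⟩
    have h1 := this.1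
    simp only [zero_smul, add_zero, mul_zero, ne_eq, OfNat.ofNat_ne_zero, not_false_eq_true,
      zero_pow, hrt0, he1] at h1
    have h2 : 2 * s * q / (2 * s) = q := by field_simp
    rwa [h2] at h1
  refine ⟨fun a => ?_, fun b => ?_, fun a b => ?_⟩
  · have := (key a 0 0 0 _ rfl).1
    simp only [map_zero, sub_zero] at this
    rw [sub_eq_zero.1 this]; ring
  · have := (key 0 b 0 0 _ rfl).1
    simp only [map_zero, zero_sub] at this
    have h2 : K * (φ₁ s * (-(G (c 0) (v 0) b) / s)) = - (K * φ₁ s / s * G (c 0) (v 0) b) := by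
      ring
    rw [h2] at this
    linarith
  · set q := (G (c 1) (v 1) a - G (c 0) (v 0) b) / s with hq
    have h1 := (key a b (-((1 / 2 : ℝ) • chris G (c 0) b b))
      (-((1 / 2 : ℝ) • chris G (c 1) a a) - -((1 / 2 : ℝ) • chris G (c 0) b b)) q hq).2
    have e1 : ∀ w : E, (2 : ℝ) • -((1 / 2 : ℝ) • w) = - w := by
      intro w
      rw [smul_neg, smul_smul]; norm_num
    rw [add_sub_cancel, e1, e1, map_neg, map_neg] at h1
    have h2 : (∫ τ in (0 : ℝ)..1, secondVariation G (c τ) (v τ) (b + τ • (a - b)) (a - b)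
      (-((1 / 2 : ℝ) • chris G (c 0) b b)
        + τ • (-((1 / 2 : ℝ) • chris G (c 1) a a) - -((1 / 2 : ℝ) • chris G (c 0) b b)))
      (-((1 / 2 : ℝ) • chris G (c 1) a a) - -((1 / 2 : ℝ) • chris G (c 0) b b)))
      ≤ 2 * (G (c 0) (a - b) (a - b) + 20 * C ^ 7 *
        (s ^ 2 * (‖a‖ ^ 2 + ‖b‖ ^ 2) + s * ‖a - b‖ * (‖a‖ + ‖b‖))) := by
      have h3 : ∀ R : ℝ, R = ∫ _ in (0 : ℝ)..1, R := by intro R; simp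
      rw [h3 (2 * _)]
      refine intervalIntegral.integral_mono_on zero_le_one (intervalIntegrable_unit ?_)
        intervalIntegrable_const (fun τ hτ => h.secondVariation_le hG hcO hs0.le hs a b hτ)
      have cc := h.continuousOn
      have cv := h.continuousOn_velocity
      have cG : ContinuousOn (fun τ => G (c τ)) (Icc 0 1) := hG.smooth.continuousOn.comp cc hcO
      have hG1 : ContDiffOn ℝ ∞ (fderiv ℝ G) O := hG.smooth.fderiv_of_isOpen hO (by simp)
      have cD : ContinuousOn (fun τ => fderiv ℝ G (c τ)) (Icc 0 1) := hG1.continuousOn.comp cc hcO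
      have cD2 : ContinuousOn (fun τ => fderiv ℝ (fderiv ℝ G) (c τ)) (Icc 0 1) :=
        (hG1.fderiv_of_isOpen hO (m := ∞) (by simp)).continuousOn.comp cc hcO
      have cV : ContinuousOn (fun τ : ℝ => b + τ • (a - b)) (Icc 0 1) := by fun_prop
      have cW : ∀ p q : E, ContinuousOn (fun τ : ℝ => p + τ • q) (Icc 0 1) := fun p q => by fun_prop
      have cc : ∀ p : E, ContinuousOn (fun _ : ℝ => p) (Icc 0 1) := fun p => continuousOn_const
      exact ((((((cD2.clm_apply cV).clm_apply cV).clm_apply cv).clm_apply cv).add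
        (continuousOn_const.mul (((cD.clm_apply (cW _ _)).clm_apply cv).clm_apply cv))).add
        (continuousOn_const.mul (((cD.clm_apply cV).clm_apply cv).clm_apply (cc _)))).add
        (continuousOn_const.mul ((cG.clm_apply cv).clm_apply (cc _))) |>.add
        (continuousOn_const.mul ((cG.clm_apply (cc _)).clm_apply (cc _)))
    have h4 : 0 ≤ K * (φ₁ s / s) := mul_nonneg hK (div_nonneg hφ0 hs0.le)
    have h5 := mul_le_mul_of_nonneg_left h2 h4
    linarith

end Variation

/-! ### Parallel transport of the structure conditions -/

section Transport

open MeasureTheory Topology Filter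

set_option maxSynthPendingDepth 3

variable {E : Type*} [NormedAddCommGroup E] [NormedSpace ℝ E]

/-- The covector `b ↦ D b w w / 2`. For `D` the derivative of the metric this is the derivative of
the covector dual to `w` under parallel transport in the direction `w`. -/
def halfDeriv (D : E →L[ℝ] E →L[ℝ] E →L[ℝ] ℝ) (w : E) : E →L[ℝ] ℝ :=
  (1 / 2 : ℝ) • (D.flip w).flip w

theorem halfDeriv_apply (D : E →L[ℝ] E →L[ℝ] E →L[ℝ] ℝ) (w b : E) :
    halfDeriv D w b = D b w w / 2 := by
  simp [halfDeriv]; ring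

/-- The structure conditions on the coefficients `ψ (z, t, q)` and `A (z, t, q)`, in coordinates.
The covector `q` is represented by the vector `w` and has the length `P`. -/
structure CoeffBounds (G : E → E →L[ℝ] E →L[ℝ] ℝ) (O : Set E) (C T R γ γ₁ : ℝ)
    (ψ : E → ℝ → (E →L[ℝ] ℝ) → ℝ) (A : E → ℝ → (E →L[ℝ] ℝ) → E →L[ℝ] E →L[ℝ] ℝ) : Prop where
  differentiableAt : ∀ z ∈ O, ∀ t ∈ Icc 0 T, ∀ q : E →L[ℝ] ℝ,
    DifferentiableAt ℝ (fun r : E × (E →L[ℝ] ℝ) => ψ r.1 t r.2) (z, q)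
  differentiableAt_tensor : ∀ z ∈ O, ∀ t ∈ Icc 0 T, ∀ (q : E →L[ℝ] ℝ) (ξ : E),
    DifferentiableAt ℝ (fun r : E × (E →L[ℝ] ℝ) => A r.1 t r.2 ξ ξ) (z, q)
  radial_le : ∀ z ∈ O, ∀ t ∈ Icc 0 T, ∀ (w : E) (P : ℝ), R ≤ P → 0 < P → G z w w = P ^ 2 →
    - fderiv ℝ (fun r : E × (E →L[ℝ] ℝ) => ψ r.1 t r.2) (z, G z w)
      (w, halfDeriv (fderiv ℝ G z) w) ≤ C * (1 + P ^ γ)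
  radial_tensor_le : ∀ z ∈ O, ∀ t ∈ Icc 0 T, ∀ (w : E) (P : ℝ), R ≤ P → 0 < P → G z w w = P ^ 2 →
    ∀ ξ, fderiv ℝ (fun r : E × (E →L[ℝ] ℝ) => A r.1 t r.2 ξ ξ) (z, G z w)
      (w, halfDeriv (fderiv ℝ G z) w) - A z t (G z w) (chris G z w ξ) ξ
      - A z t (G z w) ξ (chris G z w ξ) ≤ C * ‖ξ‖ ^ 2 * (1 + P ^ γ)
  tensor_le : ∀ z ∈ O, ∀ t ∈ Icc 0 T, ∀ (w : E) (P : ℝ), R ≤ P → 0 < P → G z w w = P ^ 2 →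
    ∀ ξ η, |A z t (G z w) ξ η| ≤ C * ‖ξ‖ * ‖η‖ * (1 + P ^ γ₁)

theorem sub_le_of_hasDerivWithinAt_le {h h' : ℝ → ℝ} {B : ℝ}
    (hd : ∀ τ ∈ Icc (0 : ℝ) 1, HasDerivWithinAt h (h' τ) (Icc 0 1) τ)
    (hB : ∀ τ ∈ Icc (0 : ℝ) 1, h' τ ≤ B) : h 1 - h 0 ≤ B := by
  obtain ⟨τ, hτ, h1⟩ := exists_hasDerivAt_eq_slope h h' zero_lt_one
    (fun τ hτ => (hd τ hτ).continuousWithinAt)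
    (fun τ hτ => (hd τ (Ioo_subset_Icc_self hτ)).hasDerivAt (Icc_mem_nhds hτ.1 hτ.2))
  rw [sub_zero, div_one] at h1
  rw [← h1]
  exact hB τ (Ioo_subset_Icc_self hτ)

variable [FiniteDimensional ℝ E] {G : E → E →L[ℝ] E →L[ℝ] ℝ} {O : Set E} {C : ℝ} {c v : ℝ → E}

/-- Along a geodesic, the covector dual to a multiple of the velocity is transported parallelly. -/
theorem IsGeodesic.hasDerivWithinAt_transport (h : IsGeodesic G c v) (hG : MetricBounds G O C)
    (hcO : ∀ τ ∈ Icc (0 : ℝ) 1, c τ ∈ O) {F : E × (E →L[ℝ] ℝ) → ℝ} {κ : ℝ} (hκ : κ ≠ 0)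
    {τ : ℝ} (hτ : τ ∈ Icc (0 : ℝ) 1) (hF : DifferentiableAt ℝ F (c τ, G (c τ) (κ • v τ))) :
    HasDerivWithinAt (fun τ => F (c τ, G (c τ) (κ • v τ)))
      (κ⁻¹ * fderiv ℝ F (c τ, G (c τ) (κ • v τ))
        (κ • v τ, halfDeriv (fderiv ℝ G (c τ)) (κ • v τ))) (Icc 0 1) τ := by
  have h1 : HasDerivWithinAt (fun τ => G (c τ) (κ • v τ))
      (fderiv ℝ G (c τ) (v τ) (κ • v τ) + G (c τ) (κ • - chris G (c τ) (v τ) (v τ)))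
      (Icc 0 1) τ :=
    ((hG.hasFDerivAt (hcO τ hτ)).comp_hasDerivWithinAt τ (h.hasDerivWithinAt τ hτ)).clm_apply
      ((h.hasDerivWithinAt_velocity τ hτ).const_smul κ)
  have h2 := hF.hasFDerivAt.comp_hasDerivWithinAt (f := fun τ => (c τ, G (c τ) (κ • v τ))) τ
    ((h.hasDerivWithinAt τ hτ).prodMk h1)
  refine h2.congr_deriv ?_
  rw [← smul_eq_mul, ← map_smul, Prod.smul_mk, smul_smul, inv_mul_cancel₀ hκ, one_smul]
  congr 2
  ext b
  simp only [add_apply, map_smul, smul_apply, halfDeriv_apply, map_neg, neg_apply, smul_eq_mul,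
    hG.apply_chris_self (hcO τ hτ)]
  field_simp
  ring

variable {T R γ γ₁ : ℝ} {ψ : E → ℝ → (E →L[ℝ] ℝ) → ℝ}
  {A : E → ℝ → (E →L[ℝ] ℝ) → E →L[ℝ] E →L[ℝ] ℝ}

theorem IsGeodesic.transport_aux (h : IsGeodesic G c v) (hG : MetricBounds G O C)
    (hcO : ∀ τ ∈ Icc (0 : ℝ) 1, c τ ∈ O) {s : ℝ} (hs0 : 0 < s) (hs : energy G c v = s ^ 2) (P : ℝ)
    {τ : ℝ} (hτ : τ ∈ Icc (0 : ℝ) 1) :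
    G (c τ) ((P / s) • v τ) ((P / s) • v τ) = P ^ 2 := by
  simp only [map_smul, smul_apply, smul_eq_mul]
  rw [h.apply_velocity_self hG hcO hτ, ← h.energy_eq hG hcO, hs]
  field_simp

/-- Change of `ψ` along a geodesic of length `s`, for the transported covector of length `P`. -/
theorem IsGeodesic.scalar_le (h : IsGeodesic G c v) (hG : MetricBounds G O C)
    (hcO : ∀ τ ∈ Icc (0 : ℝ) 1, c τ ∈ O) {s : ℝ} (hs0 : 0 < s) (hs : energy G c v = s ^ 2)
    (hAψ : CoeffBounds G O C T R γ γ₁ ψ A) {t : ℝ} (ht : t ∈ Icc 0 T) {P : ℝ} (hP : 0 < P)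
    (hRP : R ≤ P) :
    ψ (c 0) t (G (c 0) ((P / s) • v 0)) ≤ ψ (c 1) t (G (c 1) ((P / s) • v 1))
      + s / P * (C * (1 + P ^ γ)) := by
  have hκ : P / s ≠ 0 := by positivity
  have := sub_le_of_hasDerivWithinAt_le (B := s / P * (C * (1 + P ^ γ)))
    (fun τ hτ => (h.hasDerivWithinAt_transport hG hcO hκ hτ
      (hAψ.differentiableAt _ (hcO τ hτ) t ht _)).neg) (fun τ hτ => ?_)
  · simp only [Pi.neg_apply] at this
    linarith
  · rw [inv_div, ← mul_neg]
    refine mul_le_mul_of_nonneg_left ?_ (by positivity)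
    exact hAψ.radial_le _ (hcO τ hτ) t ht _ P hRP hP (h.transport_aux hG hcO hs0 hs P hτ)

/-- Change of `A` along a geodesic of length `s`, for the transported covector of length `P` and an
argument `ξ` with constant coordinates. -/
theorem IsGeodesic.tensor_sub_le (h : IsGeodesic G c v) (hG : MetricBounds G O C)
    (hcO : ∀ τ ∈ Icc (0 : ℝ) 1, c τ ∈ O) {s : ℝ} (hs0 : 0 < s) (hs : energy G c v = s ^ 2)
    (hAψ : CoeffBounds G O C T R γ γ₁ ψ A) {t : ℝ} (ht : t ∈ Icc 0 T) {P : ℝ} (hP : 0 < P)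
    (hRP : R ≤ P) (ξ : E) :
    A (c 1) t (G (c 1) ((P / s) • v 1)) ξ ξ - A (c 0) t (G (c 0) ((P / s) • v 0)) ξ ξ
      ≤ (s / P * (C * (1 + P ^ γ)) + 4 * C ^ 4 * s * (1 + P ^ γ₁)) * ‖ξ‖ ^ 2 := by
  have hκ : P / s ≠ 0 := by positivity
  have hC := hG.pos
  refine sub_le_of_hasDerivWithinAt_le
    (fun τ hτ => (h.hasDerivWithinAt_transport (F := fun r => A r.1 t r.2 ξ ξ) hG hcO hκ hτ
      (hAψ.differentiableAt_tensor _ (hcO τ hτ) t ht _ ξ))) (fun τ hτ => ?_)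
  have hz := hcO τ hτ
  have hw := h.transport_aux hG hcO hs0 hs P hτ
  set w := (P / s) • v τ with hwd
  have h1 := hAψ.radial_tensor_le _ hz t ht w P hRP hP hw ξ
  have h2 := (abs_le.1 (hAψ.tensor_le _ hz t ht w P hRP hP hw (chris G (c τ) w ξ) ξ)).2
  have h3 := (abs_le.1 (hAψ.tensor_le _ hz t ht w P hRP hP hw ξ (chris G (c τ) w ξ))).2
  have hwP : ‖w‖ ≤ C * P := by
    rw [hwd, norm_smul, Real.norm_of_nonneg (by positivity)]
    calc P / s * ‖v τ‖ ≤ P / s * (C * s) := by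
          gcongr; exact h.norm_velocity_le hG hcO hs0.le hs hτ
      _ = C * P := by field_simp
  have h4 : ‖chris G (c τ) w ξ‖ ≤ 2 * C ^ 3 * P * ‖ξ‖ := by
    calc _ ≤ 2 * C ^ 2 * ‖w‖ * ‖ξ‖ := hG.norm_chris_le hz w ξ
      _ ≤ 2 * C ^ 2 * (C * P) * ‖ξ‖ := by gcongr
      _ = 2 * C ^ 3 * P * ‖ξ‖ := by ring
  have h5 : C * ‖chris G (c τ) w ξ‖ * ‖ξ‖ * (1 + P ^ γ₁)
      ≤ C * (2 * C ^ 3 * P * ‖ξ‖) * ‖ξ‖ * (1 + P ^ γ₁) := by gcongr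
  have h6 : fderiv ℝ (fun r : E × (E →L[ℝ] ℝ) => A r.1 t r.2 ξ ξ) (c τ, G (c τ) w)
      (w, halfDeriv (fderiv ℝ G (c τ)) w) ≤ C * ‖ξ‖ ^ 2 * (1 + P ^ γ)
        + 4 * C ^ 4 * P * (1 + P ^ γ₁) * ‖ξ‖ ^ 2 := by linarith
  rw [inv_div]
  calc _ ≤ s / P * (C * ‖ξ‖ ^ 2 * (1 + P ^ γ) + 4 * C ^ 4 * P * (1 + P ^ γ₁) * ‖ξ‖ ^ 2) :=
        mul_le_mul_of_nonneg_left h6 (by positivity)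
    _ = _ := by field_simp

end Transport

/-! ### Frames that are close to each other -/

section Frames

open Topology Filter
open scoped InnerProductSpace

set_option maxSynthPendingDepth 3

variable {n : ℕ}

/-- `Ψ` is an isometry from the Euclidean space onto the inner product `g`. -/
def IsFrame (g : Model n →L[ℝ] Model n →L[ℝ] ℝ) (Ψ : Model n →L[ℝ] Model n) : Prop :=
  ∀ α β, g (Ψ α) (Ψ β) = ⟪α, β⟫_ℝ

/-- The linear map with prescribed values on the standard basis. -/
def frameMap (e : Fin n → Model n) : Model n →L[ℝ] Model n :=
  ∑ i, (EuclideanSpace.proj i : Model n →L[ℝ] ℝ).smulRight (e i)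

theorem frameMap_apply (e : Fin n → Model n) (α : Model n) : frameMap e α = ∑ i, α i • e i := by
  simp [frameMap]

theorem form_frameMap_apply (g : Model n →L[ℝ] Model n →L[ℝ] ℝ) (e : Fin n → Model n)
    {σ : Fin n → ℝ} (he : ∀ i j, g (e i) (e j) = if i = j then σ i else 0) (α β : Model n) :
    g (frameMap e α) (frameMap e β) = ∑ i, σ i * (α i * β i) := by
  simp only [frameMap_apply, map_sum, map_smul, sum_apply, smul_apply, smul_eq_mul, he]
  refine Finset.sum_congr rfl fun i _ => ?_
  rw [Finset.sum_eq_single i]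
  · rw [if_pos rfl]; ring
  · intro j _ hj; rw [if_neg hj]; ring
  · simp

theorem isFrame_frameMap {g : Model n →L[ℝ] Model n →L[ℝ] ℝ} {e : Fin n → Model n}
    (he : ∀ i j, g (e i) (e j) = if i = j then 1 else 0) : IsFrame g (frameMap e) := by
  intro α β
  rw [form_frameMap_apply g e (σ := fun _ => 1) he, PiLp.inner_apply]
  refine Finset.sum_congr rfl fun i _ => ?_
  simp; ring

namespace IsFrame

variable {g : Model n →L[ℝ] Model n →L[ℝ] ℝ} {Ψ : Model n →L[ℝ] Model n}

theorem apply_self (h : IsFrame g Ψ) (α : Model n) : g (Ψ α) (Ψ α) = ‖α‖ ^ 2 := by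
  rw [h, real_inner_self_eq_norm_sq]

theorem norm_le (h : IsFrame g Ψ) {C : ℝ} (hC : 1 ≤ C) (hg : ∀ a, ‖a‖ ^ 2 ≤ C * g a a)
    (α : Model n) : ‖Ψ α‖ ≤ C * ‖α‖ := by
  have h1 := hg (Ψ α)
  rw [h.apply_self] at h1
  have h2 : C * ‖α‖ ^ 2 ≤ (C * ‖α‖) ^ 2 := by
    nlinarith [mul_nonneg (mul_nonneg (sub_nonneg.2 hC) (one_pos.le.trans hC)) (sq_nonneg ‖α‖)]
  exact (abs_le_of_sq_le_sq' (h1.trans h2) (by positivity)).2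

theorem surjective (h : IsFrame g Ψ) : Function.Surjective Ψ := by
  refine LinearMap.surjective_of_injective (f := Ψ.toLinearMap) ?_
  rw [injective_iff_map_eq_zero]
  intro α hα
  have hα' : Ψ α = 0 := hα
  have := h.apply_self α
  rw [hα', map_zero] at this
  exact norm_eq_zero.1 (pow_eq_zero_iff two_ne_zero |>.1 this.symm)

/-- An orthonormal basis for `g` is the image of an orthonormal basis. -/
theorem exists_orthonormalBasis [NeZero n] (h : IsFrame g Ψ) {e : Fin n → Model n}
    (he : ∀ i j, g (e i) (e j) = if i = j then 1 else 0) :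
    ∃ b : OrthonormalBasis (Fin n) ℝ (Model n), ∀ i, Ψ (b i) = e i := by
  choose p hp using fun i => h.surjective (e i)
  have ho : Orthonormal ℝ p := by
    rw [orthonormal_iff_ite]
    intro i j
    rw [← h, hp, hp, he]
  have hcard : Fintype.card (Fin n) = Module.finrank ℝ (Model n) := by simp
  let b := basisOfOrthonormalOfCardEqFinrank ho hcard
  have hb : ⇑b = p := coe_basisOfOrthonormalOfCardEqFinrank ho hcard
  refine ⟨b.toOrthonormalBasis (by rwa [hb]), fun i => ?_⟩
  rw [Module.Basis.coe_toOrthonormalBasis, hb, hp]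

end IsFrame

theorem abs_inv_sqrt_sub_one_le {σ : ℝ} (h : |σ - 1| ≤ 1 / 2) :
    |(Real.sqrt σ)⁻¹ - 1| ≤ 2 * |σ - 1| := by
  have h1 := abs_le.1 h
  have hσ : 0 < σ := by linarith
  set r := Real.sqrt σ with hr
  have hr2 : r ^ 2 = σ := Real.sq_sqrt hσ.le
  have hr1 : 1 / 2 ≤ r := by
    rw [hr]; refine Real.le_sqrt_of_sq_le ?_; nlinarith
  have hr0 : 0 < r := by linarith
  have e : r⁻¹ - 1 = (1 - r) / r := by field_simp
  rw [e, abs_div, abs_of_pos hr0, div_le_iff₀ hr0, ← hr2]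
  have e2 : r ^ 2 - 1 = -((1 - r) * (1 + r)) := by ring
  rw [e2, abs_neg, abs_mul, abs_of_pos (by linarith : 0 < 1 + r)]
  nlinarith [abs_nonneg (1 - r)]

/-- Two inner products that are close to each other have frames that are close to each other:
rescale a basis which is orthonormal for one and orthogonal for the other. -/
theorem exists_frames {gx gy : Model n →L[ℝ] Model n →L[ℝ] ℝ} {C r : ℝ} (hC : 1 ≤ C) (hr0 : 0 ≤ r)
    (hsx : ∀ a b, gx a b = gx b a) (hy : ∀ a, ‖a‖ ^ 2 ≤ C * gy a a)
    (hxy : ‖gx - gy‖ ≤ C * r) (hr : C ^ 2 * r ≤ 1 / 2) {e : Fin n → Model n}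
    (he : ∀ i j, gy (e i) (e j) = if i = j then 1 else 0) :
    ∃ Ψx Ψy : Model n →L[ℝ] Model n, IsFrame gx Ψx ∧ IsFrame gy Ψy ∧
      ∀ α, ‖Ψx α - Ψy α‖ ≤ 2 * C ^ 3 * r * ‖α‖ := by
  have hC0 : 0 < C := by linarith
  have hΨ := isFrame_frameMap he
  obtain ⟨b, σ, hb⟩ := exists_diagIn (gx.bilinearComp (frameMap e) (frameMap e))
    (fun x y => hsx _ _)
  let e' : Fin n → Model n := fun i => frameMap e (b i)
  have he' : ∀ i j, gy (e' i) (e' j) = if i = j then 1 else 0 := by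
    intro i j
    rw [hΨ, orthonormal_iff_ite.1 b.orthonormal]
  have hex : ∀ i j, gx (e' i) (e' j) = if i = j then σ i else 0 := hb
  have hσ : ∀ i, |σ i - 1| ≤ C ^ 2 * r := by
    intro i
    have h1 : σ i - 1 = (gx - gy) (e' i) (e' i) := by
      rw [sub_apply, sub_apply, hex, he', if_pos rfl, if_pos rfl]
    have h2 := hy (e' i)
    rw [he', if_pos rfl, mul_one] at h2
    rw [h1]
    refine (abs_form_le _ hxy _ _).trans ?_
    calc C * r * ‖e' i‖ * ‖e' i‖ = C * r * ‖e' i‖ ^ 2 := by ring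
      _ ≤ C * r * C := by gcongr
      _ = C ^ 2 * r := by ring
  have hσ' : ∀ i, |σ i - 1| ≤ 1 / 2 := fun i => (hσ i).trans hr
  have hσ0 : ∀ i, 0 < σ i := fun i => by linarith [(abs_le.1 (hσ' i)).1]
  let e'' : Fin n → Model n := fun i => (Real.sqrt (σ i))⁻¹ • e' i
  refine ⟨frameMap e'', frameMap e', isFrame_frameMap ?_, isFrame_frameMap he', fun α => ?_⟩
  · intro i j
    simp only [e'', map_smul, smul_apply, smul_eq_mul, hex]
    split_ifs with hij
    · subst hij
      have h1 := Real.sq_sqrt (hσ0 i).le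
      have h2 := Real.sqrt_pos.2 (hσ0 i)
      field_simp
      exact h1.symm
    · ring
  · let α' : Model n := WithLp.toLp 2 (fun i => ((Real.sqrt (σ i))⁻¹ - 1) * α i)
    have h1 : frameMap e'' α - frameMap e' α = frameMap e' α' := by
      simp only [frameMap_apply, ← Finset.sum_sub_distrib]
      refine Finset.sum_congr rfl fun i _ => ?_
      simp only [e'', α', smul_smul, ← sub_smul]
      congr 1
      ring
    have h2 : ‖α'‖ ≤ 2 * C ^ 2 * r * ‖α‖ := by
      rw [EuclideanSpace.norm_eq]
      refine Real.sqrt_le_iff.2 ⟨by positivity, ?_⟩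
      rw [mul_pow, EuclideanSpace.norm_sq_eq, Finset.mul_sum]
      refine Finset.sum_le_sum fun i _ => ?_
      change ‖((Real.sqrt (σ i))⁻¹ - 1) * α i‖ ^ 2 ≤ _
      rw [norm_mul, mul_pow ‖(Real.sqrt (σ i))⁻¹ - 1‖]
      refine mul_le_mul_of_nonneg_right ?_ (sq_nonneg _)
      refine pow_le_pow_left₀ (a := ‖(Real.sqrt (σ i))⁻¹ - 1‖) (norm_nonneg _) ?_ 2
      rw [Real.norm_eq_abs]
      linarith [abs_inv_sqrt_sub_one_le (hσ' i), hσ i]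
    rw [h1]
    refine ((isFrame_frameMap he').norm_le hC hy α').trans ?_
    calc C * ‖α'‖ ≤ C * (2 * C ^ 2 * r * ‖α‖) := by gcongr
      _ = _ := by ring

/-- The bilinear form `(a, b) ↦ (D a b w + D b a w - D w a b) / 2`. -/
def koszulForm (D : Model n →L[ℝ] Model n →L[ℝ] Model n →L[ℝ] ℝ) (w : Model n) :
    Model n →L[ℝ] Model n →L[ℝ] ℝ :=
  let S := (ContinuousLinearMap.compL ℝ (Model n) (Model n →L[ℝ] ℝ) ℝ
    (ContinuousLinearMap.apply ℝ ℝ w)).comp D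
  (1 / 2 : ℝ) • (S + S.flip - D w)

theorem koszulForm_apply (D : Model n →L[ℝ] Model n →L[ℝ] Model n →L[ℝ] ℝ) (w a b : Model n) :
    koszulForm D w a b = koszul D a b w := by
  rw [koszul_apply]
  simp [koszulForm]
  ring

end Frames

/-! ### Error terms in the second order condition -/

section Interior

open Topology Filter
open scoped InnerProductSpace

set_option maxSynthPendingDepth 3

/-- The concave function of the length used for the comparison. -/
def lengthFn (α σ : ℝ) : ℝ := σ - σ ^ (1 + α)

theorem hasDerivAt_lengthFn {α s : ℝ} (hs : 0 < s) :
    HasDerivAt (lengthFn α) (1 - (1 + α) * s ^ α) s := by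
  have h := (hasDerivAt_id s).sub (Real.hasDerivAt_rpow_const (p := 1 + α) (Or.inl hs.ne'))
  rw [add_sub_cancel_left] at h
  exact h

theorem hasDerivAt_deriv_lengthFn {α s : ℝ} (hs : 0 < s) :
    HasDerivAt (fun σ : ℝ => 1 - (1 + α) * σ ^ α) (-((α * (1 + α)) * s ^ (α - 1))) s := by
  have h := ((Real.hasDerivAt_rpow_const (p := α) (Or.inl hs.ne')).const_mul (1 + α)).const_sub 1
  refine h.congr_deriv ?_
  ring

theorem rpow_le_of_mul_le {K s D p β : ℝ} (hK : 1 ≤ K) (hs : 0 < s) (hs1 : s ≤ 1)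
    (hD : K * s ≤ D) (hp : 1 ≤ p) (hβ : β ≤ 2 - p) :
    K ^ p ≤ D ^ (p - 1) * (K * s ^ (β - 1)) := by
  have hK0 : 0 < K := by linarith
  have hD0 : 0 < D := (mul_pos hK0 hs).trans_le hD
  have h1 : K ^ p = K * K ^ (p - 1) := by
    rw [← Real.rpow_one_add' hK0.le (by linarith)]; congr 1; ring
  have h2 : K ^ (p - 1) ≤ (D / s) ^ (p - 1) :=
    Real.rpow_le_rpow hK0.le (by rwa [le_div_iff₀ hs]) (by linarith)
  have h3 : (D / s) ^ (p - 1) = D ^ (p - 1) * s ^ (1 - p) := by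
    rw [Real.div_rpow hD0.le hs.le, div_eq_mul_inv, ← Real.rpow_neg hs.le]; congr 2; ring
  have h4 : s ^ (1 - p) ≤ s ^ (β - 1) :=
    Real.rpow_le_rpow_of_exponent_ge hs hs1 (by linarith)
  rw [h1]
  calc K * K ^ (p - 1) ≤ K * (D ^ (p - 1) * s ^ (β - 1)) := by
        refine mul_le_mul_of_nonneg_left (h2.trans ?_) hK0.le
        rw [h3]
        exact mul_le_mul_of_nonneg_left h4 (by positivity)
    _ = _ := by ring

variable {n : ℕ} {G : Model n → Model n →L[ℝ] Model n →L[ℝ] ℝ} {O : Set (Model n)} {C : ℝ}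
  {c v : ℝ → Model n}

/-- The velocity of a geodesic of length `s` changes by `O (s²)`. -/
theorem IsGeodesic.norm_velocity_sub_le (h : IsGeodesic G c v) (hG : MetricBounds G O C)
    (hcO : ∀ τ ∈ Icc (0 : ℝ) 1, c τ ∈ O) {s : ℝ} (hs0 : 0 ≤ s) (hs : energy G c v = s ^ 2) {τ σ : ℝ}
    (hτ : τ ∈ Icc (0 : ℝ) 1) (hσ : σ ∈ Icc (0 : ℝ) 1) :
    ‖v τ - v σ‖ ≤ 2 * C ^ 4 * s ^ 2 * |τ - σ| := by
  have hC := hG.pos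
  refine (convex_Icc (0 : ℝ) 1).norm_image_sub_le_of_norm_hasDerivWithin_le (f := v)
    h.hasDerivWithinAt_velocity (fun ρ hρ => ?_) hσ hτ
  rw [norm_neg]
  calc _ ≤ 2 * C ^ 2 * ‖v ρ‖ * ‖v ρ‖ := hG.norm_chris_le (hcO ρ hρ) _ _
    _ ≤ 2 * C ^ 2 * (C * s) * (C * s) := by
        have := h.norm_velocity_le hG hcO hs0 hs hρ
        gcongr
    _ = _ := by ring

section FrameEstimates

variable {s : ℝ} {Ψx Ψy : Model n →L[ℝ] Model n}

theorem abs_firstVariation_sub_inner_le (h : IsGeodesic G c v) (hG : MetricBounds G O C)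
    (hcO : ∀ τ ∈ Icc (0 : ℝ) 1, c τ ∈ O) (hs0 : 0 < s) (hs : energy G c v = s ^ 2)
    (hx : IsFrame (G (c 1)) Ψx) (hy : IsFrame (G (c 0)) Ψy)
    (hxy : ∀ α, ‖Ψx α - Ψy α‖ ≤ 2 * C ^ 4 * s * ‖α‖) {ε : Model n} (hε : Ψy ε = s⁻¹ • v 0)
    (α β : Model n) :
    |(G (c 1) (v 1) (Ψx α) - G (c 0) (v 0) (Ψy β)) / s - ⟪ε, α - β⟫_ℝ| ≤ 5 * C ^ 6 * s * ‖α‖ := by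
  have m0 : (0 : ℝ) ∈ Icc (0 : ℝ) 1 := by simp
  have m1 : (1 : ℝ) ∈ Icc (0 : ℝ) 1 := by simp
  have hC := hG.one_le
  have hC0 := hG.pos
  have e1 : ∀ γ, ⟪ε, γ⟫_ℝ = s⁻¹ * G (c 0) (v 0) (Ψy γ) := by
    intro γ
    rw [← hy, hε, map_smul, smul_apply, smul_eq_mul]
  have e2 : (G (c 1) (v 1) (Ψx α) - G (c 0) (v 0) (Ψy β)) / s - ⟪ε, α - β⟫_ℝ
      = s⁻¹ * ((G (c 1) - G (c 0)) (v 1) (Ψx α) + G (c 0) (v 1 - v 0) (Ψx α)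
        + G (c 0) (v 0) (Ψx α - Ψy α)) := by
    rw [inner_sub_right, e1, e1]
    simp only [sub_apply, map_sub]
    ring
  have hΨ := hx.norm_le hC (hG.sq_norm_le _ (hcO 1 m1)) α
  have hv1 := h.norm_velocity_le hG hcO hs0.le hs m1
  have hv0 := h.norm_velocity_le hG hcO hs0.le hs m0
  have b1 : |(G (c 1) - G (c 0)) (v 1) (Ψx α)| ≤ C ^ 4 * s ^ 2 * ‖α‖ := by
    refine (abs_form_le _ (hG.norm_sub_le (hcO 1 m1) (hcO 0 m0)) _ _).trans ?_
    calc C * ‖c 1 - c 0‖ * ‖v 1‖ * ‖Ψx α‖ ≤ C * (C * s) * (C * s) * (C * ‖α‖) := by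
          gcongr; exact h.norm_sub_le hG hcO hs0.le hs m1 m0
      _ = _ := by ring
  have b2 : |G (c 0) (v 1 - v 0) (Ψx α)| ≤ 2 * C ^ 6 * s ^ 2 * ‖α‖ := by
    refine (abs_form_le _ (hG.norm_le _ (hcO 0 m0)) _ _).trans ?_
    calc C * ‖v 1 - v 0‖ * ‖Ψx α‖ ≤ C * (2 * C ^ 4 * s ^ 2 * |1 - 0|) * (C * ‖α‖) := by
          gcongr; exact h.norm_velocity_sub_le hG hcO hs0.le hs m1 m0
      _ = _ := by rw [sub_zero, abs_one]; ring
  have b3 : |G (c 0) (v 0) (Ψx α - Ψy α)| ≤ 2 * C ^ 6 * s ^ 2 * ‖α‖ := by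
    refine (abs_form_le _ (hG.norm_le _ (hcO 0 m0)) _ _).trans ?_
    calc C * ‖v 0‖ * ‖Ψx α - Ψy α‖ ≤ C * (C * s) * (2 * C ^ 4 * s * ‖α‖) := by
          gcongr; exact hxy α
      _ = _ := by ring
  rw [e2, abs_mul, abs_of_pos (inv_pos.2 hs0), inv_mul_le_iff₀ hs0]
  have p1 : C ^ 4 * (s ^ 2 * ‖α‖) ≤ C ^ 6 * (s ^ 2 * ‖α‖) :=
    mul_le_mul_of_nonneg_right (pow_le_pow_right₀ hC (by norm_num)) (by positivity)
  refine ((abs_add_le _ _).trans (add_le_add_left (abs_add_le _ _) _)).trans ?_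
  linarith

theorem apply_sub_self_le (hG : MetricBounds G O C) {y : Model n} (hyO : y ∈ O) (hs0 : 0 < s)
    (hy : IsFrame (G y) Ψy)
    (hxy : ∀ α, ‖Ψx α - Ψy α‖ ≤ 2 * C ^ 4 * s * ‖α‖) (α β : Model n) :
    G y (Ψx α - Ψy β) (Ψx α - Ψy β) ≤ ‖α - β‖ ^ 2
      + 4 * C ^ 9 * (s * ‖α - β‖ * (‖α‖ + ‖β‖) + s ^ 2 * (‖α‖ ^ 2 + ‖β‖ ^ 2)) := by
  have hC := hG.one_le
  have hC0 := hG.pos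
  set δ := Ψx α - Ψy α with hδ
  have e1 : Ψx α - Ψy β = Ψy (α - β) + δ := by rw [hδ, map_sub]; abel
  have hd := hxy α
  have hΨ := hy.norm_le hC (hG.sq_norm_le _ hyO) (α - β)
  have b1 : G y (Ψy (α - β)) δ ≤ 2 * C ^ 6 * (s * ‖α - β‖ * ‖α‖) := by
    refine (le_abs_self _).trans ((abs_form_le _ (hG.norm_le _ hyO) _ _).trans ?_)
    calc C * ‖Ψy (α - β)‖ * ‖δ‖ ≤ C * (C * ‖α - β‖) * (2 * C ^ 4 * s * ‖α‖) := by gcongr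
      _ = _ := by ring
  have b2 : G y δ δ ≤ 4 * C ^ 9 * (s ^ 2 * ‖α‖ ^ 2) := by
    refine (le_abs_self _).trans ((abs_form_le _ (hG.norm_le _ hyO) _ _).trans ?_)
    calc C * ‖δ‖ * ‖δ‖ ≤ C * (2 * C ^ 4 * s * ‖α‖) * (2 * C ^ 4 * s * ‖α‖) := by gcongr
      _ = _ := by ring
  have e2 : G y (Ψx α - Ψy β) (Ψx α - Ψy β) = ‖α - β‖ ^ 2 + 2 * G y (Ψy (α - β)) δ + G y δ δ := by
    rw [e1, ← hy.apply_self (α - β)]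
    simp only [map_add, add_apply]
    rw [hG.symm _ hyO δ]
    ring
  have p1 : C ^ 6 * (s * ‖α - β‖ * ‖α‖) ≤ C ^ 9 * (s * ‖α - β‖ * ‖α‖) :=
    mul_le_mul_of_nonneg_right (pow_le_pow_right₀ hC (by norm_num)) (by positivity)
  have p2 : 0 ≤ C ^ 9 * (s * ‖α - β‖ * ‖β‖) := by positivity
  have p3 : 0 ≤ C ^ 9 * (s ^ 2 * ‖β‖ ^ 2) := by positivity
  rw [e2]
  linarith

theorem frame_error_le (hC : 1 ≤ C) (hs0 : 0 < s) (hx : ∀ α, ‖Ψx α‖ ≤ C * ‖α‖)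
    (hy : ∀ α, ‖Ψy α‖ ≤ C * ‖α‖)
    (hxy : ∀ α, ‖Ψx α - Ψy α‖ ≤ 2 * C ^ 4 * s * ‖α‖) (α β : Model n) :
    s ^ 2 * (‖Ψx α‖ ^ 2 + ‖Ψy β‖ ^ 2) + s * ‖Ψx α - Ψy β‖ * (‖Ψx α‖ + ‖Ψy β‖)
      ≤ 5 * C ^ 5 * (s * ‖α - β‖ * (‖α‖ + ‖β‖) + s ^ 2 * (‖α‖ ^ 2 + ‖β‖ ^ 2)) := by
  have hC0 : 0 < C := by linarith
  have h1 : ‖Ψx α - Ψy β‖ ≤ C * ‖α - β‖ + 2 * C ^ 4 * s * ‖α‖ := by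
    have e1 : Ψx α - Ψy β = Ψy (α - β) + (Ψx α - Ψy α) := by rw [map_sub]; abel
    rw [e1]
    exact (norm_add_le _ _).trans (add_le_add (hy _) (hxy _))
  have h2 : s * ‖Ψx α - Ψy β‖ * (‖Ψx α‖ + ‖Ψy β‖)
      ≤ s * (C * ‖α - β‖ + 2 * C ^ 4 * s * ‖α‖) * (C * ‖α‖ + C * ‖β‖) := by
    gcongr
    · exact hx α
    · exact hy β
  have h3 : s ^ 2 * (‖Ψx α‖ ^ 2 + ‖Ψy β‖ ^ 2) ≤ s ^ 2 * ((C * ‖α‖) ^ 2 + (C * ‖β‖) ^ 2) := by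
    gcongr
    · exact hx α
    · exact hy β
  have p1 : C ^ 2 * (s * ‖α - β‖ * (‖α‖ + ‖β‖)) ≤ C ^ 5 * (s * ‖α - β‖ * (‖α‖ + ‖β‖)) :=
    mul_le_mul_of_nonneg_right (pow_le_pow_right₀ hC (by norm_num)) (by positivity)
  have p2 : C ^ 2 * (s ^ 2 * (‖α‖ ^ 2 + ‖β‖ ^ 2)) ≤ C ^ 5 * (s ^ 2 * (‖α‖ ^ 2 + ‖β‖ ^ 2)) :=
    mul_le_mul_of_nonneg_right (pow_le_pow_right₀ hC (by norm_num)) (by positivity)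
  have p3 : C ^ 5 * s ^ 2 * (2 * ‖α‖ * ‖β‖) ≤ C ^ 5 * s ^ 2 * (‖α‖ ^ 2 + ‖β‖ ^ 2) :=
    mul_le_mul_of_nonneg_left (two_mul_le_add_sq _ _) (by positivity)
  have p4 : 0 ≤ C ^ 5 * (s * ‖α - β‖ * (‖α‖ + ‖β‖)) := by positivity
  have p5 : 0 ≤ C ^ 5 * (s ^ 2 * ‖β‖ ^ 2) := by positivity
  have p6 : 0 ≤ C ^ 5 * (s ^ 2 * ‖α‖ ^ 2) := by positivity
  linarith

end FrameEstimates

/-- Collecting the error terms in the second order condition. -/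
theorem second_order_collect {K s α k g q q₀ X d m N C₁ C₂ C₃ C₄ : ℝ} (hK : 0 < K) (hs : 0 < s)
    (hs1 : s ≤ 1) (hα0 : 0 < α) (hα : α ≤ 1 / 4) (hk0 : 0 ≤ k) (hk1 : k ≤ 1)
    (hd : 0 ≤ d) (hm : 0 ≤ m) (hN : 0 ≤ N) (hC₁ : 0 ≤ C₁) (hC₂ : 0 ≤ C₂) (hC₃ : 0 ≤ C₃)
    (hC₄ : 0 ≤ C₄) (hq₀ : |q₀| ≤ d) (hq : |q - q₀| ≤ C₁ * s * m)
    (hg : g ≤ d ^ 2 + C₂ * (s * d * m + s ^ 2 * N)) (hX : X ≤ C₃ * (s * d * m + s ^ 2 * N)) :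
    K * (-((α * (1 + α)) * s ^ (α - 1)) * q ^ 2 + k / s * (g - q ^ 2) + k / s * (C₄ * X))
      ≤ - (α * (1 + α) * (K / s) * s ^ α) * q₀ ^ 2 + K / s * (d ^ 2 - q₀ ^ 2)
        + (4 * C₁ + C₂ + C₄ * C₃) * (K / s) * (s ^ α) ^ 2 * d * m
        + (4 * C₁ + C₂ + C₄ * C₃) * (K / s) * (s ^ α) ^ 3 * N := by
  set θ := s ^ α with hθ
  set Q := K / s with hQ
  have hθ0 : 0 < θ := Real.rpow_pos_of_pos hs α
  have hθ1 : θ ≤ 1 := Real.rpow_le_one hs.le hs1 hα0.le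
  have hQ0 : 0 < Q := by positivity
  have e1 : s ^ (α - 1) = θ / s := by rw [Real.rpow_sub_one hs.ne']
  have e2 : s ≤ θ ^ 2 := by
    rw [hθ, ← Real.rpow_natCast, ← Real.rpow_mul hs.le]
    conv_lhs => rw [← Real.rpow_one s]
    refine Real.rpow_le_rpow_of_exponent_ge hs hs1 ?_
    push_cast; linarith
  have e3 : s ^ 2 ≤ θ ^ 3 := by
    rw [hθ, ← Real.rpow_natCast, ← Real.rpow_natCast, ← Real.rpow_mul hs.le]
    refine Real.rpow_le_rpow_of_exponent_ge hs hs1 ?_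
    push_cast; linarith
  have hsq : - q ^ 2 ≤ - q₀ ^ 2 + 2 * C₁ * (s * d * m) := by
    have h1 : |q₀| * |q - q₀| ≤ d * (C₁ * s * m) := by gcongr
    rw [← abs_mul] at h1
    have h2 := (abs_le.1 h1).1
    nlinarith [sq_nonneg (q - q₀)]
  have hdq : 0 ≤ d ^ 2 - q₀ ^ 2 := by
    rw [← sq_abs q₀]; nlinarith [abs_nonneg q₀]
  set Z := s * d * m + s ^ 2 * N with hZ
  have hZ0 : 0 ≤ Z := by positivity
  have hZ1 : s * d * m ≤ Z := by rw [hZ]; nlinarith [mul_nonneg (sq_nonneg s) hN]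
  have ha0 : 0 ≤ α * (1 + α) * θ := by positivity
  have ha1 : α * (1 + α) * θ ≤ 1 := by
    have : α * (1 + α) ≤ 1 := by nlinarith
    nlinarith
  have t1 : α * (1 + α) * θ * (- q ^ 2) ≤ α * (1 + α) * θ * (- q₀ ^ 2) + 2 * C₁ * Z := by
    have h1 := mul_le_mul_of_nonneg_left hsq ha0
    have h2 : α * (1 + α) * θ * (2 * C₁ * (s * d * m)) ≤ 1 * (2 * C₁ * Z) := by gcongr
    linarith
  have t2 : k * (g - q ^ 2) ≤ (d ^ 2 - q₀ ^ 2) + (C₂ + 2 * C₁) * Z := by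
    have h1 : g - q ^ 2 ≤ (d ^ 2 - q₀ ^ 2) + (C₂ + 2 * C₁) * Z := by
      have : 2 * C₁ * (s * d * m) ≤ 2 * C₁ * Z := by gcongr
      linarith
    have h2 : 0 ≤ (d ^ 2 - q₀ ^ 2) + (C₂ + 2 * C₁) * Z := by positivity
    calc _ ≤ k * ((d ^ 2 - q₀ ^ 2) + (C₂ + 2 * C₁) * Z) := mul_le_mul_of_nonneg_left h1 hk0
      _ ≤ 1 * ((d ^ 2 - q₀ ^ 2) + (C₂ + 2 * C₁) * Z) := mul_le_mul_of_nonneg_right hk1 h2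
      _ = _ := one_mul _
  have t3 : k * (C₄ * X) ≤ C₄ * C₃ * Z := by
    calc k * (C₄ * X) ≤ k * (C₄ * (C₃ * Z)) := by gcongr
      _ ≤ 1 * (C₄ * (C₃ * Z)) := by gcongr
      _ = _ := by ring
  have t4 : (4 * C₁ + C₂ + C₄ * C₃) * Z
      ≤ (4 * C₁ + C₂ + C₄ * C₃) * (θ ^ 2 * d * m + θ ^ 3 * N) := by
    rw [hZ]; gcongr
  have e4 : K * (-((α * (1 + α)) * s ^ (α - 1)) * q ^ 2 + k / s * (g - q ^ 2) + k / s * (C₄ * X))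
      = Q * (α * (1 + α) * θ * (- q ^ 2) + k * (g - q ^ 2) + k * (C₄ * X)) := by
    rw [e1, hQ]; ring
  rw [e4]
  have t5 : α * (1 + α) * θ * (- q ^ 2) + k * (g - q ^ 2) + k * (C₄ * X)
      ≤ α * (1 + α) * θ * (- q₀ ^ 2) + (d ^ 2 - q₀ ^ 2)
        + (4 * C₁ + C₂ + C₄ * C₃) * (θ ^ 2 * d * m + θ ^ 3 * N) := by linarith
  refine (mul_le_mul_of_nonneg_left t5 hQ0.le).trans (le_of_eq ?_)
  ring

end Interior

/-! ### The contradiction in the interior -/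

section Interior

open Topology Filter
open scoped InnerProductSpace

set_option maxSynthPendingDepth 3

variable {n : ℕ}

/-- `l` lists the eigenvalues of `∇²U + A (z, t, ∇U)` with respect to `G` at `z`, in coordinates. -/
def IsAugDiag (G : Model n → Model n →L[ℝ] Model n →L[ℝ] ℝ)
    (A : Model n → ℝ → (Model n →L[ℝ] ℝ) → Model n →L[ℝ] Model n →L[ℝ] ℝ)
    (U : Model n → ℝ) (z : Model n) (t : ℝ) (l : Fin n → ℝ) : Prop :=
  ∃ e : Fin n → Model n, (∀ i j, G z (e i) (e j) = if i = j then 1 else 0) ∧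
    ∀ i j, fderiv ℝ (fderiv ℝ U) z (e i) (e j) - fderiv ℝ U z (chris G z (e i) (e j))
      + A z t (fderiv ℝ U z) (e i) (e j) = if i = j then l i else 0

theorem IsAugDiag.exists_diagIn [NeZero n] {G : Model n → Model n →L[ℝ] Model n →L[ℝ] ℝ}
    {A : Model n → ℝ → (Model n →L[ℝ] ℝ) → Model n →L[ℝ] Model n →L[ℝ] ℝ}
    {U : Model n → ℝ} {z : Model n} {t : ℝ} {l : Fin n → ℝ} (h : IsAugDiag G A U z t l)
    {X : Model n →L[ℝ] Model n →L[ℝ] ℝ}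
    (hX : ∀ a b, X a b = fderiv ℝ (fderiv ℝ U) z a b - fderiv ℝ U z (chris G z a b))
    {Ψ : Model n →L[ℝ] Model n} (hΨ : IsFrame (G z) Ψ) :
    ∃ b, DiagIn (X.bilinearComp Ψ Ψ + (A z t (fderiv ℝ U z)).bilinearComp Ψ Ψ) b l := by
  obtain ⟨e, he, hl⟩ := h
  obtain ⟨b, hb⟩ := hΨ.exists_orthonormalBasis he
  refine ⟨b, fun i j => ?_⟩
  rw [← hl i j, ← hb i, ← hb j, ← hX]
  rfl

theorem one_add_rpow_le {P γ g : ℝ} (hP : 1 ≤ P) (hg : 0 ≤ g) (hγ : γ ≤ g) :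
    1 + P ^ γ ≤ 2 * P ^ g := by
  have h1 := Real.one_le_rpow hP hg
  have h2 := Real.rpow_le_rpow_of_exponent_le hP hγ
  linarith

set_option maxHeartbeats 2000000 in
/-- At a geodesic that maximizes the two-point function with a large constant `K`, the equation at
the two end points is contradictory. -/
theorem exists_interior_contradiction [NeZero n] {Γ : Set (Fin (n + 1) → ℝ)}
    {f : (Fin (n + 1) → ℝ) → ℝ}
    (hΓ : IsConeDomain Γ) (hf : IsSymmSmooth Γ f) (hconc : ConcaveOn ℝ Γ f)
    (hmono : ∀ l ∈ Γ, ∀ i, 0 < partialD f i l) {ν : ℝ} (hν : 0 < ν)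
    (hneg : ∀ l ∈ Γ, ∀ j, l j < 0 → ν * (1 + ∑ i, partialD f i l) ≤ partialD f j l)
    {C D T R γ γ₁ α : ℝ} (hC : 1 ≤ C) (hD : 0 < D) (hα0 : 0 < α) (hα : α ≤ 1 / 4)
    (hαγ : 3 * α ≤ 4 - max γ 2) (hαγ₁ : 2 * α ≤ 2 - max γ₁ 1) :
    ∃ K₀ : ℝ, ∀ (G : Model n → Model n →L[ℝ] Model n →L[ℝ] ℝ) (O : Set (Model n))
      (ψ : Model n → ℝ → (Model n →L[ℝ] ℝ) → ℝ)
      (A : Model n → ℝ → (Model n →L[ℝ] ℝ) → Model n →L[ℝ] Model n →L[ℝ] ℝ)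
      (c v : ℝ → Model n) (U : Model n → ℝ) (K s t τx τy : ℝ),
      MetricBounds G O C → CoeffBounds G O C T R γ γ₁ ψ A → IsGeodesic G c v →
      (∀ τ ∈ Icc (0 : ℝ) 1, c τ ∈ O) → 0 < s → energy G c v = s ^ 2 → ContDiffOn ℝ 2 U O →
      t ∈ Icc 0 T → K₀ ≤ K → K * s ≤ D →
      (∀ a b w w' : Model n, ∀ᶠ ε in 𝓝 (0 : ℝ),
        U (c 1 + ε • a + ε ^ 2 • (w + w')) - U (c 0 + ε • b + ε ^ 2 • w)
          - K * lengthFn α (Real.sqrt (energy G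
            (fun τ => c τ + ε • (b + τ • (a - b)) + ε ^ 2 • (w + τ • w'))
            (fun τ => v τ + ε • (a - b) + ε ^ 2 • w')))
          ≤ U (c 1) - U (c 0) - K * lengthFn α s) →
      (∃ l, IsAugDiag G A U (c 1) t l ∧ (Fin.snoc l τx : Fin (n + 1) → ℝ) ∈ Γ) →
      (∃ l, IsAugDiag G A U (c 1) t l ∧
        f (Fin.snoc l τx : Fin (n + 1) → ℝ) = ψ (c 1) t (fderiv ℝ U (c 1))) →
      (∃ l, IsAugDiag G A U (c 0) t l ∧
        f (Fin.snoc l τy : Fin (n + 1) → ℝ) = ψ (c 0) t (fderiv ℝ U (c 0))) →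
      τx ≤ τy → False := by
  set g := max γ 2 with hg
  set g₁ := max γ₁ 1 with hg₁
  have hg2 : 2 ≤ g := le_max_right _ _
  have hg1 : 1 ≤ g₁ := le_max_right _ _
  set Dg : ℝ := D ^ (g₁ - 1) + D ^ (g - 2) with hDg
  have hDg1 : D ^ (g₁ - 1) ≤ Dg := le_add_of_nonneg_right (by positivity)
  have hDg2 : D ^ (g - 2) ≤ Dg := le_add_of_nonneg_left (by positivity)
  have hDg0 : 0 < Dg := by positivity
  set Ct : ℝ := 124 * C ^ 12 + 20 * C ^ 6 * Dg with hCt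
  have hC0 : 0 < C := by linarith
  have hCt0 : 0 < Ct := by positivity
  obtain ⟨θ₁, hθ₁, hmain⟩ := exists_two_point_contradiction (NeZero.pos n) hΓ hf hconc hmono hν hneg
    (a := α * (1 + α)) (C := Ct) (by positivity) hCt0
  set s₁ : ℝ := min (min 1 (θ₁ ^ α⁻¹)) (min ((1 / 4) ^ α⁻¹) (1 / (2 * C ^ 3))) with hs₁
  have hs₁0 : 0 < s₁ := by positivity
  refine ⟨max (max 2 (2 * R)) (D / s₁), ?_⟩
  intro G O ψ A c v U K s t τx τy hG hAψ h hcO hs0 hs hU ht hK hKs hmax hadm hsolx hsoly hτ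
  have m0 : (0 : ℝ) ∈ Icc (0 : ℝ) 1 := by simp
  have m1 : (1 : ℝ) ∈ Icc (0 : ℝ) 1 := by simp
  simp only [max_le_iff] at hK
  obtain ⟨⟨hK2, hKR⟩, hKD⟩ := hK
  have hK0 : 0 < K := by linarith
  have hss : s ≤ s₁ := by
    rw [div_le_iff₀ hs₁0] at hKD
    by_contra! hlt
    exact absurd (hKD.trans_lt (mul_lt_mul_of_pos_left hlt hK0)) (not_lt.2 hKs)
  simp only [hs₁, le_min_iff] at hss
  obtain ⟨⟨hs1, hsθ⟩, hs4, hsC⟩ := hss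
  have hpow : ∀ {r : ℝ}, 0 < r → s ≤ r ^ α⁻¹ → s ^ α ≤ r := by
    intro r hr hsr
    have := Real.rpow_le_rpow hs0.le hsr hα0.le
    rwa [Real.rpow_inv_rpow hr.le hα0.ne'] at this
  set θ := s ^ α with hθ
  have hθ0 : 0 < θ := Real.rpow_pos_of_pos hs0 α
  have hθθ₁ : θ ≤ θ₁ := hpow hθ₁ hsθ
  have hθ4 : θ ≤ 1 / 4 := hpow (by norm_num) hs4
  have hsθ' : s ≤ θ := by
    conv_lhs => rw [← Real.rpow_one s]
    exact Real.rpow_le_rpow_of_exponent_ge hs0 hs1 (by linarith)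
  set k : ℝ := 1 - (1 + α) * θ with hk
  have hk1 : k ≤ 1 := by
    have : 0 ≤ (1 + α) * θ := by positivity
    linarith
  have hk2 : 1 / 2 ≤ k := by
    have : (1 + α) * θ ≤ 5 / 4 * (1 / 4) := by
      gcongr
      linarith
    linarith
  set P : ℝ := K * k with hP
  have hP0 : 0 < P := mul_pos hK0 (by linarith)
  have hPK2 : K * (1 / 2) ≤ P := mul_le_mul_of_nonneg_left hk2 hK0.le
  have hP1 : 1 ≤ P := by linarith
  have hPR : R ≤ P := by linarith
  have hPK : P ≤ K := mul_le_of_le_one_right hK0.le hk1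
  set Q : ℝ := K / s with hQ
  have hQ0 : 0 < Q := by positivity
  -- the conditions at the maximum
  obtain ⟨hgx, hgy, hsec⟩ := h.two_point_conditions hG hcO hs0 hs hU hK0.le
    (φ₁ := fun σ => 1 - (1 + α) * σ ^ α)
    ((lt_mem_nhds hs0).mono fun σ hσ => hasDerivAt_lengthFn hσ) (hasDerivAt_deriv_lengthFn hs0)
    (by rw [← hθ]; linarith) hmax
  simp only [← hθ, ← hk] at hgx hgy hsec
  have hUx : fderiv ℝ U (c 1) = G (c 1) ((P / s) • v 1) := by
    ext a; rw [hgx, map_smul, smul_apply, smul_eq_mul]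
  have hUy : fderiv ℝ U (c 0) = G (c 0) ((P / s) • v 0) := by
    ext a; rw [hgy, map_smul, smul_apply, smul_eq_mul]
  -- frames
  obtain ⟨ly, hly, hfy⟩ := hsoly
  obtain ⟨lx, hlx, hfx⟩ := hsolx
  obtain ⟨lx', hlx', hmem⟩ := hadm
  obtain ⟨Ψx, Ψy, hx, hy, hxy⟩ := exists_frames (gx := G (c 1)) (gy := G (c 0)) (C := C)
    (r := C * s) hC (by positivity) (hG.symm _ (hcO 1 m1)) (hG.sq_norm_le _ (hcO 0 m0))
    ((hG.norm_sub_le (hcO 1 m1) (hcO 0 m0)).trans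
      (mul_le_mul_of_nonneg_left (h.norm_sub_le hG hcO hs0.le hs m1 m0) hC0.le))
    (by rw [le_div_iff₀ (by positivity)] at hsC; linarith) hly.choose_spec.1
  have hxy' : ∀ α, ‖Ψx α - Ψy α‖ ≤ 2 * C ^ 4 * s * ‖α‖ := fun α =>
    (hxy α).trans (le_of_eq (by ring))
  have hΨx := hx.norm_le hC (hG.sq_norm_le _ (hcO 1 m1))
  have hΨy := hy.norm_le hC (hG.sq_norm_le _ (hcO 0 m0))
  obtain ⟨ε, hε⟩ := hy.surjective (s⁻¹ • v 0)
  have hε1 : ‖ε‖ = 1 := by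
    have h1 := hy.apply_self ε
    rw [hε] at h1
    simp only [map_smul, smul_apply, smul_eq_mul] at h1
    rw [← h.energy_eq hG hcO, hs] at h1
    have h2 : s⁻¹ * (s⁻¹ * s ^ 2) = 1 := by field_simp
    rw [h2] at h1
    exact (pow_eq_one_iff_of_nonneg (norm_nonneg _) two_ne_zero).1 h1.symm
  -- the Hessians
  have hess : ∀ z ∈ O, ∀ w, fderiv ℝ U z = G z w → ∀ a b,
      (fderiv ℝ (fderiv ℝ U) z - koszulForm (fderiv ℝ G z) w) a b
        = fderiv ℝ (fderiv ℝ U) z a b - fderiv ℝ U z (chris G z a b) := by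
    intro z hz w hw a b
    rw [sub_apply, sub_apply, koszulForm_apply, hw, hG.symm z hz w, chris, hG.apply_inverse hz]
  have hX := hess _ (hcO 1 m1) _ hUx
  have hY := hess _ (hcO 0 m0) _ hUy
  set X := fderiv ℝ (fderiv ℝ U) (c 1) - koszulForm (fderiv ℝ G (c 1)) ((P / s) • v 1) with hXd
  set Y := fderiv ℝ (fderiv ℝ U) (c 0) - koszulForm (fderiv ℝ G (c 0)) ((P / s) • v 0) with hYd
  obtain ⟨bx, hbx⟩ := hlx.exists_diagIn hX hx
  obtain ⟨bx', hbx'⟩ := hlx'.exists_diagIn hX hx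
  obtain ⟨bB, hbB⟩ := hly.exists_diagIn hY hy
  have hmem' : (Fin.snoc lx τx : Fin (n + 1) → ℝ) ∈ Γ := by
    have h1 := (diag_mem_and_le hΓ hf hconc hbx' hmem bx).1
    have h2 : (fun i => (X.bilinearComp Ψx Ψx
        + (A (c 1) t (fderiv ℝ U (c 1))).bilinearComp Ψx Ψx) (bx i) (bx i)) = lx := by
      funext i; rw [hbx i i, if_pos rfl]
    rwa [h2] at h1
  -- sizes of the coefficients
  have hK1 : 1 ≤ K := by linarith
  have eQ2 : K * s ^ (2 * α - 1) = Q * θ ^ 2 := by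
    rw [Real.rpow_sub_one hs0.ne', hQ, hθ, ← Real.rpow_natCast, ← Real.rpow_mul hs0.le]
    push_cast; rw [mul_comm α 2]; ring
  have eQ3 : s * (K * s ^ (3 * α - 1 - 1)) = Q * θ ^ 3 := by
    rw [Real.rpow_sub_one hs0.ne', Real.rpow_sub_one hs0.ne', hQ, hθ, ← Real.rpow_natCast,
      ← Real.rpow_mul hs0.le]
    push_cast; rw [mul_comm α 3]; field_simp
  have sz1 : 1 + P ^ γ₁ ≤ 2 * Dg * (Q * θ ^ 2) := by
    have h1 := one_add_rpow_le hP1 (by linarith) (le_max_left γ₁ 1)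
    have h2 : P ^ g₁ ≤ K ^ g₁ := Real.rpow_le_rpow hP0.le hPK (by linarith)
    have h3 := rpow_le_of_mul_le hK1 hs0 hs1 hKs hg1 hαγ₁
    rw [eQ2] at h3
    have h4 : D ^ (g₁ - 1) * (Q * θ ^ 2) ≤ Dg * (Q * θ ^ 2) := by gcongr
    linarith
  have sz2 : s / P * (1 + P ^ γ) ≤ 2 * Dg * (Q * θ ^ 3) := by
    have h1 := one_add_rpow_le hP1 (by linarith) (le_max_left γ 2)
    have h2 : P ^ (g - 1) ≤ K ^ (g - 1) := Real.rpow_le_rpow hP0.le hPK (by linarith)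
    have h3 := rpow_le_of_mul_le (p := g - 1) (β := 3 * α - 1) hK1 hs0 hs1 hKs (by linarith)
      (by linarith)
    have h4 : s / P * (2 * P ^ g) = 2 * (s * P ^ (g - 1)) := by
      rw [Real.rpow_sub_one hP0.ne']; ring
    have h5 : g - 1 - 1 = g - 2 := by ring
    rw [h5] at h3
    calc s / P * (1 + P ^ γ) ≤ s / P * (2 * P ^ g) := by gcongr
      _ = 2 * (s * P ^ (g - 1)) := h4
      _ ≤ 2 * (s * (D ^ (g - 2) * (K * s ^ (3 * α - 1 - 1)))) := by
          have := h2.trans h3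
          gcongr
      _ = 2 * D ^ (g - 2) * (Q * θ ^ 3) := by rw [← eQ3]; ring
      _ ≤ 2 * Dg * (Q * θ ^ 3) := by gcongr
  have sz3 : s * (1 + P ^ γ₁) ≤ 2 * Dg * (Q * θ ^ 3) := by
    calc s * (1 + P ^ γ₁) ≤ θ * (2 * Dg * (Q * θ ^ 2)) := by gcongr
      _ = _ := by ring
  have hp1 : 0 ≤ 1 + P ^ γ₁ := by positivity
  have hwx := h.transport_aux hG hcO hs0 hs P m1
  have hwy := h.transport_aux hG hcO hs0 hs P m0
  have hAx : ∀ ξ η, |A (c 1) t (fderiv ℝ U (c 1)) ξ η| ≤ C * ‖ξ‖ * ‖η‖ * (1 + P ^ γ₁) := by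
    rw [hUx]; exact hAψ.tensor_le _ (hcO 1 m1) t ht _ P hPR hP0 hwx
  have hAy : ∀ ξ η, |A (c 0) t (fderiv ℝ U (c 0)) ξ η| ≤ C * ‖ξ‖ * ‖η‖ * (1 + P ^ γ₁) := by
    rw [hUy]; exact hAψ.tensor_le _ (hcO 0 m0) t ht _ P hPR hP0 hwy
  have hC36 : C ^ 3 ≤ C ^ 6 := pow_le_pow_right₀ hC (by norm_num)
  have hC16 : C ≤ C ^ 6 := le_self_pow₀ hC (by norm_num)
  have szA : ∀ (B : Model n →L[ℝ] Model n →L[ℝ] ℝ) (Ψ : Model n →L[ℝ] Model n),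
      (∀ ξ η, |B ξ η| ≤ C * ‖ξ‖ * ‖η‖ * (1 + P ^ γ₁)) → (∀ α, ‖Ψ α‖ ≤ C * ‖α‖) →
      ∀ x y, |B.bilinearComp Ψ Ψ x y| ≤ Ct * Q * θ ^ 2 * ‖x‖ * ‖y‖ := by
    intro B Ψ hB hΨ x y
    calc |B (Ψ x) (Ψ y)| ≤ C * ‖Ψ x‖ * ‖Ψ y‖ * (1 + P ^ γ₁) := hB _ _
      _ ≤ C * (C * ‖x‖) * (C * ‖y‖) * (2 * Dg * (Q * θ ^ 2)) := by
          gcongr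
          · exact hΨ x
          · exact hΨ y
      _ = (2 * C ^ 3 * Dg) * (Q * θ ^ 2 * ‖x‖ * ‖y‖) := by ring
      _ ≤ Ct * (Q * θ ^ 2 * ‖x‖ * ‖y‖) := by
          refine mul_le_mul_of_nonneg_right ?_ (by positivity)
          have : C ^ 3 * Dg ≤ C ^ 6 * Dg := by gcongr
          have h12 : 0 ≤ C ^ 12 := by positivity
          have : 0 ≤ C ^ 6 * Dg := by positivity
          rw [hCt]; linarith
      _ = _ := by ring
  refine hmain θ Q (X.bilinearComp Ψx Ψx) (Y.bilinearComp Ψy Ψy)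
    ((A (c 1) t (fderiv ℝ U (c 1))).bilinearComp Ψx Ψx)
    ((A (c 0) t (fderiv ℝ U (c 0))).bilinearComp Ψy Ψy) bx bB lx ly τx τy ε hθ0 hθθ₁ hQ0 hε1
    hbx hbB hmem' hτ ?_ (szA _ _ hAx hΨx) (szA _ _ hAy hΨy) ?_ ?_
  · intro x y
    have h1 := hsec (Ψx x) (Ψy y)
    rw [← hX, ← hY] at h1
    have hb1 := abs_firstVariation_sub_inner_le h hG hcO hs0 hs hx hy hxy' hε x y
    have hb2 := apply_sub_self_le hG (hcO 0 m0) hs0 hy hxy' x y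
    have hb3 := frame_error_le hC hs0 hΨx hΨy hxy' x y
    have hb4 : |⟪ε, x - y⟫_ℝ| ≤ ‖x - y‖ := by
      have := abs_real_inner_le_norm ε (x - y)
      rwa [hε1, one_mul] at this
    have hb5 : 5 * C ^ 6 * s * ‖x‖ ≤ 5 * C ^ 6 * s * (‖x‖ + ‖y‖) := by
      gcongr; exact le_add_of_nonneg_right (norm_nonneg _)
    have h2 := second_order_collect hK0 hs0 hs1 hα0 hα (by linarith : 0 ≤ k) hk1
      (norm_nonneg (x - y)) (by positivity : 0 ≤ ‖x‖ + ‖y‖) (by positivity : 0 ≤ ‖x‖ ^ 2 + ‖y‖ ^ 2)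
      (C₁ := 5 * C ^ 6) (by positivity) (by positivity) (by positivity)
      (C₄ := 20 * C ^ 7) (by positivity) hb4 (hb1.trans hb5) hb2 hb3
    rw [← hθ, ← hQ] at h2
    have hCC : 4 * (5 * C ^ 6) + 4 * C ^ 9 + 20 * C ^ 7 * (5 * C ^ 5) ≤ Ct := by
      have q1 : C ^ 6 ≤ C ^ 12 := pow_le_pow_right₀ hC (by norm_num)
      have q2 : C ^ 9 ≤ C ^ 12 := pow_le_pow_right₀ hC (by norm_num)
      have q3 : 20 * C ^ 7 * (5 * C ^ 5) = 100 * C ^ 12 := by ring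
      have q4 : 0 ≤ C ^ 6 * Dg := by positivity
      rw [hCt, q3]; linarith
    have h3 : (4 * (5 * C ^ 6) + 4 * C ^ 9 + 20 * C ^ 7 * (5 * C ^ 5)) * Q * θ ^ 2 * ‖x - y‖
        * (‖x‖ + ‖y‖) ≤ Ct * Q * θ ^ 2 * ‖x - y‖ * (‖x‖ + ‖y‖) := by gcongr
    have h4 : (4 * (5 * C ^ 6) + 4 * C ^ 9 + 20 * C ^ 7 * (5 * C ^ 5)) * Q * θ ^ 3
        * (‖x‖ ^ 2 + ‖y‖ ^ 2) ≤ Ct * Q * θ ^ 3 * (‖x‖ ^ 2 + ‖y‖ ^ 2) := by gcongr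
    have h5 : (X.bilinearComp Ψx Ψx) x x - (Y.bilinearComp Ψy Ψy) y y
      = X (Ψx x) (Ψx x) - Y (Ψy y) (Ψy y) := rfl
    rw [h5]
    refine h1.trans (h2.trans ?_)
    linarith
  · intro x
    have h1 := h.tensor_sub_le hG hcO hs0 hs hAψ ht hP0 hPR (Ψy x)
    rw [← hUx, ← hUy] at h1
    set Bx := A (c 1) t (fderiv ℝ U (c 1)) with hBx
    set By := A (c 0) t (fderiv ℝ U (c 0)) with hBy
    have e1 : Bx.bilinearComp Ψx Ψx x x - By.bilinearComp Ψy Ψy x x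
        = Bx (Ψx x - Ψy x) (Ψx x) + Bx (Ψy x) (Ψx x - Ψy x)
          + (Bx (Ψy x) (Ψy x) - By (Ψy x) (Ψy x)) := by
      change Bx (Ψx x) (Ψx x) - By (Ψy x) (Ψy x) = _
      simp only [map_sub, sub_apply]; ring
    have b1 : Bx (Ψx x - Ψy x) (Ψx x) ≤ 4 * C ^ 6 * Dg * (Q * θ ^ 3) * ‖x‖ ^ 2 := by
      calc _ ≤ C * ‖Ψx x - Ψy x‖ * ‖Ψx x‖ * (1 + P ^ γ₁) := (le_abs_self _).trans (hAx _ _)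
        _ ≤ C * (2 * C ^ 4 * s * ‖x‖) * (C * ‖x‖) * (1 + P ^ γ₁) := by
            gcongr
            · exact hxy' x
            · exact hΨx x
        _ = 2 * C ^ 6 * ‖x‖ ^ 2 * (s * (1 + P ^ γ₁)) := by ring
        _ ≤ 2 * C ^ 6 * ‖x‖ ^ 2 * (2 * Dg * (Q * θ ^ 3)) := by gcongr
        _ = _ := by ring
    have b2 : Bx (Ψy x) (Ψx x - Ψy x) ≤ 4 * C ^ 6 * Dg * (Q * θ ^ 3) * ‖x‖ ^ 2 := by
      calc _ ≤ C * ‖Ψy x‖ * ‖Ψx x - Ψy x‖ * (1 + P ^ γ₁) := (le_abs_self _).trans (hAx _ _)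
        _ ≤ C * (C * ‖x‖) * (2 * C ^ 4 * s * ‖x‖) * (1 + P ^ γ₁) := by
            gcongr
            · exact hΨy x
            · exact hxy' x
        _ = 2 * C ^ 6 * ‖x‖ ^ 2 * (s * (1 + P ^ γ₁)) := by ring
        _ ≤ 2 * C ^ 6 * ‖x‖ ^ 2 * (2 * Dg * (Q * θ ^ 3)) := by gcongr
        _ = _ := by ring
    have b3 : (s / P * (C * (1 + P ^ γ)) + 4 * C ^ 4 * s * (1 + P ^ γ₁)) * ‖Ψy x‖ ^ 2
        ≤ 10 * C ^ 6 * Dg * (Q * θ ^ 3) * ‖x‖ ^ 2 := by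
      have q1 : s / P * (C * (1 + P ^ γ)) ≤ C ^ 4 * (2 * Dg * (Q * θ ^ 3)) := by
        calc s / P * (C * (1 + P ^ γ)) = C * (s / P * (1 + P ^ γ)) := by ring
          _ ≤ C ^ 4 * (2 * Dg * (Q * θ ^ 3)) := by
              gcongr; exact le_self_pow₀ hC (by norm_num)
      have q2 : 4 * C ^ 4 * s * (1 + P ^ γ₁) ≤ 4 * C ^ 4 * (2 * Dg * (Q * θ ^ 3)) := by
        rw [mul_assoc (4 * C ^ 4)]; gcongr
      calc _ ≤ (5 * C ^ 4 * (2 * Dg * (Q * θ ^ 3))) * (C * ‖x‖) ^ 2 := by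
            gcongr
            · linarith
            · exact hΨy x
        _ = _ := by ring
    have b4 : 18 * C ^ 6 * Dg * (Q * θ ^ 3) * ‖x‖ ^ 2 ≤ Ct * (Q * θ ^ 3) * ‖x‖ ^ 2 := by
      gcongr
      have : 0 ≤ C ^ 12 := by positivity
      have : 0 ≤ C ^ 6 * Dg := by positivity
      rw [hCt]; linarith
    rw [e1]
    linarith
  · have h1 := h.scalar_le hG hcO hs0 hs hAψ ht hP0 hPR
    rw [← hUx, ← hUy, ← hfx, ← hfy] at h1
    have h2 : s / P * (C * (1 + P ^ γ)) ≤ Ct * Q * θ ^ 3 := by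
      calc s / P * (C * (1 + P ^ γ)) = C * (s / P * (1 + P ^ γ)) := by ring
        _ ≤ C ^ 6 * (2 * Dg * (Q * θ ^ 3)) := by gcongr
        _ = (2 * C ^ 6 * Dg) * (Q * θ ^ 3) := by ring
        _ ≤ Ct * (Q * θ ^ 3) := by
            gcongr
            have : 0 ≤ C ^ 12 := by positivity
            have : 0 ≤ C ^ 6 * Dg := by positivity
            rw [hCt]; linarith
        _ = _ := by ring
    linarith

end Interior

/-! ### Changes of coordinates -/

section Transition

open Topology Filter

set_option maxSynthPendingDepth 3

variable {E : Type*} [NormedAddCommGroup E] [NormedSpace ℝ E]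

/-- `T` is a change of coordinates near `z`, with inverse `R`. -/
structure IsTransition (T R : E → E) (z : E) : Prop where
  contDiffAt : ContDiffAt ℝ 2 T z
  contDiffAt_inv : ContDiffAt ℝ 2 R (T z)
  left_inv : ∀ᶠ x in 𝓝 z, R (T x) = x
  right_inv : ∀ᶠ y in 𝓝 (T z), T (R y) = y

namespace IsTransition

variable {T R : E → E} {z : E}

theorem hasFDerivAt (h : IsTransition T R z) : HasFDerivAt T (fderiv ℝ T z) z :=
  (h.contDiffAt.differentiableAt (by norm_num)).hasFDerivAt

theorem hasFDerivAt_inv (h : IsTransition T R z) : HasFDerivAt R (fderiv ℝ R (T z)) (T z) :=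
  (h.contDiffAt_inv.differentiableAt (by norm_num)).hasFDerivAt

theorem hasFDerivAt_fderiv (h : IsTransition T R z) :
    HasFDerivAt (fderiv ℝ T) (fderiv ℝ (fderiv ℝ T) z) z :=
  ((h.contDiffAt.fderiv_right (m := 1) (by norm_num)).differentiableAt (by norm_num)).hasFDerivAt

theorem hasFDerivAt_fderiv_inv (h : IsTransition T R z) :
    HasFDerivAt (fderiv ℝ R) (fderiv ℝ (fderiv ℝ R) (T z)) (T z) :=
  ((h.contDiffAt_inv.fderiv_right (m := 1) (by norm_num)).differentiableAt
    (by norm_num)).hasFDerivAt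

theorem symm_snd (h : IsTransition T R z) (a b : E) :
    fderiv ℝ (fderiv ℝ T) z a b = fderiv ℝ (fderiv ℝ T) z b a :=
  (h.contDiffAt.isSymmSndFDerivAt (by simp)).eq a b

theorem fderiv_inv_apply (h : IsTransition T R z) (a : E) :
    fderiv ℝ R (T z) (fderiv ℝ T z a) = a := by
  have h1 := (h.hasFDerivAt_inv.comp z h.hasFDerivAt).congr_of_eventuallyEq
    (f₁ := fun x => x) (by filter_upwards [h.left_inv] with x hx using hx.symm)
  exact congrArg (fun L : E →L[ℝ] E => L a) (h1.unique (hasFDerivAt_id z))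

theorem fderiv_apply_inv (h : IsTransition T R z) (a : E) :
    fderiv ℝ T z (fderiv ℝ R (T z) a) = a := by
  have h0 : R (T z) = z := h.left_inv.self_of_nhds
  have hT : HasFDerivAt T (fderiv ℝ T z) (R (T z)) := by rw [h0]; exact h.hasFDerivAt
  have h1 := (hT.comp (T z) h.hasFDerivAt_inv).congr_of_eventuallyEq
    (f₁ := fun x => x) (by filter_upwards [h.right_inv] with x hx using hx.symm)
  exact congrArg (fun L : E →L[ℝ] E => L a) (h1.unique (hasFDerivAt_id (T z)))

theorem eventually (h : IsTransition T R z) : ∀ᶠ x in 𝓝 z, IsTransition T R x := by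
  have hc : ContinuousAt T z := h.hasFDerivAt.continuousAt
  filter_upwards [h.contDiffAt.eventually (by simp),
    hc.eventually (h.contDiffAt_inv.eventually (by simp)), h.left_inv.eventually_nhds,
    hc.eventually h.right_inv.eventually_nhds] with x h1 h2 h3 h4
  exact ⟨h1, h2, h3, h4⟩

variable {G G' : E → E →L[ℝ] E →L[ℝ] ℝ}

/-- Derivative of a form in new coordinates. -/
theorem fderiv_form (h : IsTransition T R z) (hG : DifferentiableAt ℝ G z)
    (hG' : DifferentiableAt ℝ G' (T z))
    (hGG : ∀ᶠ x in 𝓝 z, ∀ a b, G x a b = G' (T x) (fderiv ℝ T x a) (fderiv ℝ T x b)) (c a b : E) :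
    fderiv ℝ G z c a b = fderiv ℝ G' (T z) (fderiv ℝ T z c) (fderiv ℝ T z a) (fderiv ℝ T z b)
      + G' (T z) (fderiv ℝ (fderiv ℝ T) z c a) (fderiv ℝ T z b)
      + G' (T z) (fderiv ℝ T z a) (fderiv ℝ (fderiv ℝ T) z c b) := by
  have h1 := HasFDerivAt.form_apply hG.hasFDerivAt a b
  have hD : ∀ a, HasFDerivAt (fun x => fderiv ℝ T x a) ((fderiv ℝ (fderiv ℝ T) z).flip a) z := by
    intro a
    refine (h.hasFDerivAt_fderiv.clm_apply (hasFDerivAt_const a z)).congr_fderiv ?_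
    ext c; simp
  have h2 := ((hG'.hasFDerivAt.comp z h.hasFDerivAt).clm_apply (hD a)).clm_apply (hD b)
  have h3 := h2.congr_of_eventuallyEq (f₁ := fun x => G x a b)
    (by filter_upwards [hGG] with x hx using hx a b)
  have h4 := congrArg (fun L : E →L[ℝ] ℝ => L c) (h1.unique h3)
  simp only [ContinuousLinearMap.flip_apply, add_apply, ContinuousLinearMap.comp_apply,
    Function.comp_apply] at h4
  rw [h4]
  ring

/-- Transformation law of the Christoffel symbols. -/
theorem fderiv_chris [FiniteDimensional ℝ E] (h : IsTransition T R z)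
    (hG : DifferentiableAt ℝ G z)
    (hG' : DifferentiableAt ℝ G' (T z))
    (hGG : ∀ᶠ x in 𝓝 z, ∀ a b, G x a b = G' (T x) (fderiv ℝ T x a) (fderiv ℝ T x b))
    (hsymm : ∀ a b, G' (T z) a b = G' (T z) b a) (hpos : ∀ a, G' (T z) a a = 0 → a = 0) (a b : E) :
    fderiv ℝ T z (chris G z a b) = chris G' (T z) (fderiv ℝ T z a) (fderiv ℝ T z b)
      + fderiv ℝ (fderiv ℝ T) z a b := by
  have hposG : ∀ a, G z a a = 0 → a = 0 := by
    intro a ha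
    rw [hGG.self_of_nhds] at ha
    rw [← h.fderiv_inv_apply a, hpos _ ha, map_zero]
  have key : ∀ c, G' (T z) (fderiv ℝ T z (chris G z a b)) c
      = G' (T z) (chris G' (T z) (fderiv ℝ T z a) (fderiv ℝ T z b)
        + fderiv ℝ (fderiv ℝ T) z a b) c := by
    intro c
    obtain ⟨c, rfl⟩ : ∃ c', fderiv ℝ T z c' = c := ⟨_, h.fderiv_apply_inv c⟩
    rw [← hGG.self_of_nhds, chris, form_inverse_apply hposG, map_add, add_apply, chris,
      form_inverse_apply hpos, koszul_apply, koszul_apply, h.fderiv_form hG hG' hGG,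
      h.fderiv_form hG hG' hGG, h.fderiv_form hG hG' hGG, h.symm_snd b a, h.symm_snd c a,
      h.symm_snd c b, hsymm (fderiv ℝ T z a) (fderiv ℝ (fderiv ℝ T) z b c),
      hsymm (fderiv ℝ (fderiv ℝ T) z a c)]
    ring
  rw [← sub_eq_zero]
  refine hpos _ ?_
  have h0 : G' (T z) (fderiv ℝ T z (chris G z a b) - (chris G' (T z) (fderiv ℝ T z a)
      (fderiv ℝ T z b) + fderiv ℝ (fderiv ℝ T) z a b)) = 0 := by
    rw [map_sub]
    ext c
    rw [sub_apply, key, sub_self, zero_apply]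
  rw [h0, zero_apply]

/-- The Hessian is independent of the coordinates. -/
theorem hessian_eq [FiniteDimensional ℝ E] (h : IsTransition T R z)
    (hG : DifferentiableAt ℝ G z)
    (hG' : DifferentiableAt ℝ G' (T z))
    (hGG : ∀ᶠ x in 𝓝 z, ∀ a b, G x a b = G' (T x) (fderiv ℝ T x a) (fderiv ℝ T x b))
    (hsymm : ∀ a b, G' (T z) a b = G' (T z) b a) (hpos : ∀ a, G' (T z) a a = 0 → a = 0)
    {U U' : E → ℝ} (hU' : ContDiffAt ℝ 2 U' (T z)) (hUU : ∀ᶠ x in 𝓝 z, U x = U' (T x)) (a b : E) :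
    fderiv ℝ (fderiv ℝ U) z a b - fderiv ℝ U z (chris G z a b)
      = fderiv ℝ (fderiv ℝ U') (T z) (fderiv ℝ T z a) (fderiv ℝ T z b)
        - fderiv ℝ U' (T z) (chris G' (T z) (fderiv ℝ T z a) (fderiv ℝ T z b)) := by
  have hc : ContinuousAt T z := h.hasFDerivAt.continuousAt
  have h1 : ∀ᶠ x in 𝓝 z, fderiv ℝ U x = (fderiv ℝ U' (T x)).comp (fderiv ℝ T x) := by
    filter_upwards [hUU.eventually_nhds, hc.eventually (hU'.eventually (by simp)),
      h.eventually] with x hx1 hx2 hx3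
    refine HasFDerivAt.fderiv ?_
    exact ((hx2.differentiableAt (by norm_num)).hasFDerivAt.comp x
      hx3.hasFDerivAt).congr_of_eventuallyEq hx1
  have h2 : HasFDerivAt (fderiv ℝ U') (fderiv ℝ (fderiv ℝ U') (T z)) (T z) :=
    ((hU'.fderiv_right (m := 1) (by norm_num)).differentiableAt (by norm_num)).hasFDerivAt
  have h3 := ((h2.comp z h.hasFDerivAt).clm_comp h.hasFDerivAt_fderiv).congr_of_eventuallyEq h1
  rw [h3.fderiv, h1.self_of_nhds]
  simp only [add_apply, ContinuousLinearMap.comp_apply, Function.comp_apply,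
    ContinuousLinearMap.flip_apply, ContinuousLinearMap.compL_apply]
  rw [h.fderiv_chris hG hG' hGG hsymm hpos, map_add]
  ring

/-- Derivative of the change of coordinates of the cotangent bundle. -/
theorem hasFDerivAt_cotangent (h : IsTransition T R z) (q : E →L[ℝ] ℝ) :
    HasFDerivAt (fun r : E × (E →L[ℝ] ℝ) => (T r.1, r.2.comp (fderiv ℝ R (T r.1))))
      (((fderiv ℝ T z).comp (ContinuousLinearMap.fst ℝ E (E →L[ℝ] ℝ))).prod
        ((ContinuousLinearMap.compL ℝ E E ℝ q).comp
          ((fderiv ℝ (fderiv ℝ R) (T z)).comp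
            ((fderiv ℝ T z).comp (ContinuousLinearMap.fst ℝ E (E →L[ℝ] ℝ))))
          + ((ContinuousLinearMap.compL ℝ E E ℝ).flip (fderiv ℝ R (T z))).comp
            (ContinuousLinearMap.snd ℝ E (E →L[ℝ] ℝ)))) (z, q) := by
  have h0 : HasFDerivAt (Prod.fst : E × (E →L[ℝ] ℝ) → E)
      (ContinuousLinearMap.fst ℝ E (E →L[ℝ] ℝ)) (z, q) := hasFDerivAt_fst
  have h1 : HasFDerivAt (fun r : E × (E →L[ℝ] ℝ) => T r.1)
      ((fderiv ℝ T z).comp (ContinuousLinearMap.fst ℝ E (E →L[ℝ] ℝ))) (z, q) :=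
    HasFDerivAt.comp (z, q) (g := T) h.hasFDerivAt h0
  have h2 : HasFDerivAt (fun r : E × (E →L[ℝ] ℝ) => fderiv ℝ R (T r.1))
      ((fderiv ℝ (fderiv ℝ R) (T z)).comp
        ((fderiv ℝ T z).comp (ContinuousLinearMap.fst ℝ E (E →L[ℝ] ℝ)))) (z, q) :=
    HasFDerivAt.comp (z, q) (g := fderiv ℝ R) h.hasFDerivAt_fderiv_inv h1
  have h3 : HasFDerivAt (Prod.snd : E × (E →L[ℝ] ℝ) → (E →L[ℝ] ℝ))
      (ContinuousLinearMap.snd ℝ E (E →L[ℝ] ℝ)) (z, q) := hasFDerivAt_snd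
  have h4 := h3.clm_comp h2
  exact h1.prodMk h4

theorem form_comp_fderiv_inv (h : IsTransition T R z)
    (hGG : ∀ᶠ x in 𝓝 z, ∀ a b, G x a b = G' (T x) (fderiv ℝ T x a) (fderiv ℝ T x b)) (w : E) :
    (G z w).comp (fderiv ℝ R (T z)) = G' (T z) (fderiv ℝ T z w) := by
  ext b
  rw [ContinuousLinearMap.comp_apply, hGG.self_of_nhds, h.fderiv_apply_inv]

/-- The derivative along the geodesic flow of a form depending on position and covector is
independent of the coordinates. -/
theorem radial_eq [FiniteDimensional ℝ E] (h : IsTransition T R z)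
    (hG : DifferentiableAt ℝ G z)
    (hG' : DifferentiableAt ℝ G' (T z))
    (hGG : ∀ᶠ x in 𝓝 z, ∀ a b, G x a b = G' (T x) (fderiv ℝ T x a) (fderiv ℝ T x b))
    (hsymm : ∀ a b, G' (T z) a b = G' (T z) b a)
    {F F' : E × (E →L[ℝ] ℝ) → ℝ} (w : E)
    (hF : DifferentiableAt ℝ F (z, G z w))
    (hF' : DifferentiableAt ℝ F' (T z, G' (T z) (fderiv ℝ T z w)))
    (hFF : ∀ᶠ x in 𝓝 z, ∀ q, F (x, q) = F' (T x, q.comp (fderiv ℝ R (T x)))) :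
    fderiv ℝ F (z, G z w) (w, halfDeriv (fderiv ℝ G z) w)
      = fderiv ℝ F' (T z, G' (T z) (fderiv ℝ T z w))
        (fderiv ℝ T z w, halfDeriv (fderiv ℝ G' (T z)) (fderiv ℝ T z w)) := by
  -- differentiate `DR (T x) (DT x b) = b`
  have hinv : ∀ a b, fderiv ℝ (fderiv ℝ R) (T z) (fderiv ℝ T z a) (fderiv ℝ T z b)
      = - fderiv ℝ R (T z) (fderiv ℝ (fderiv ℝ T) z a b) := by
    intro a b
    have h1 := (h.hasFDerivAt_fderiv_inv.comp z h.hasFDerivAt).clm_apply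
      (h.hasFDerivAt_fderiv.clm_apply (hasFDerivAt_const b z))
    have h2 := h1.congr_of_eventuallyEq (f₁ := fun _ => b)
      (by filter_upwards [h.eventually] with x hx using (hx.fderiv_inv_apply b).symm)
    have h3 := congrArg (fun L : E →L[ℝ] E => L a) (h2.unique (hasFDerivAt_const b z))
    simp only [add_apply, ContinuousLinearMap.comp_apply, Function.comp_apply,
      ContinuousLinearMap.flip_apply, zero_apply, map_zero, zero_add] at h3
    exact eq_neg_of_add_eq_zero_right h3
  let q₀ := G z w
  have hq₀ : q₀.comp (fderiv ℝ R (T z)) = G' (T z) (fderiv ℝ T z w) :=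
    h.form_comp_fderiv_inv hGG w
  have hS := h.hasFDerivAt_cotangent q₀
  have hF'' : HasFDerivAt F' (fderiv ℝ F' (T z, G' (T z) (fderiv ℝ T z w)))
      (T z, q₀.comp (fderiv ℝ R (T z))) := by
    rw [hq₀]; exact hF'.hasFDerivAt
  have h1 : F =ᶠ[𝓝 (z, q₀)] fun r => F' (T r.1, r.2.comp (fderiv ℝ R (T r.1))) := by
    filter_upwards [continuousAt_fst.eventually hFF] with r hr using hr r.2
  have h2 := (HasFDerivAt.comp (z, q₀) (g := F')
    (f := fun r : E × (E →L[ℝ] ℝ) => (T r.1, r.2.comp (fderiv ℝ R (T r.1))))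
    hF'' hS).congr_of_eventuallyEq h1
  have h3 := congrArg (fun L : E × (E →L[ℝ] ℝ) →L[ℝ] ℝ => L (w, halfDeriv (fderiv ℝ G z) w))
    (hF.hasFDerivAt.unique h2)
  refine h3.trans ?_
  simp only [ContinuousLinearMap.comp_apply, ContinuousLinearMap.prod_apply, add_apply,
    ContinuousLinearMap.flip_apply, ContinuousLinearMap.compL_apply, ContinuousLinearMap.coe_fst',
    ContinuousLinearMap.coe_snd']
  congr 2
  ext b
  obtain ⟨b, rfl⟩ : ∃ b', fderiv ℝ T z b' = b := ⟨_, h.fderiv_apply_inv b⟩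
  simp only [add_apply, ContinuousLinearMap.comp_apply, halfDeriv_apply, hinv,
    h.fderiv_inv_apply, q₀, map_neg]
  rw [hGG.self_of_nhds, h.fderiv_apply_inv, h.fderiv_form hG hG' hGG, h.symm_snd w b,
    hsymm (fderiv ℝ T z w) (fderiv ℝ (fderiv ℝ T) z b w)]
  ring

/-- The derivative along the geodesic flow of a tensor, the arguments of the tensor being
transported parallelly, is independent of the coordinates. -/
theorem radial_tensor_eq [FiniteDimensional ℝ E] (h : IsTransition T R z)
    (hG : DifferentiableAt ℝ G z)
    (hG' : DifferentiableAt ℝ G' (T z))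
    (hGG : ∀ᶠ x in 𝓝 z, ∀ a b, G x a b = G' (T x) (fderiv ℝ T x a) (fderiv ℝ T x b))
    (hsymm : ∀ a b, G' (T z) a b = G' (T z) b a) (hpos : ∀ a, G' (T z) a a = 0 → a = 0)
    {A A' : E × (E →L[ℝ] ℝ) → E →L[ℝ] E →L[ℝ] ℝ} (w ξ : E)
    (hA' : DifferentiableAt ℝ A' (T z, G' (T z) (fderiv ℝ T z w)))
    (hAA : ∀ᶠ x in 𝓝 z, ∀ q a b,
      A (x, q) a b = A' (T x, q.comp (fderiv ℝ R (T x))) (fderiv ℝ T x a) (fderiv ℝ T x b)) :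
    fderiv ℝ (fun r => A r ξ ξ) (z, G z w) (w, halfDeriv (fderiv ℝ G z) w)
        - A (z, G z w) (chris G z w ξ) ξ - A (z, G z w) ξ (chris G z w ξ)
      = fderiv ℝ (fun r => A' r (fderiv ℝ T z ξ) (fderiv ℝ T z ξ))
          (T z, G' (T z) (fderiv ℝ T z w))
          (fderiv ℝ T z w, halfDeriv (fderiv ℝ G' (T z)) (fderiv ℝ T z w))
        - A' (T z, G' (T z) (fderiv ℝ T z w))
          (chris G' (T z) (fderiv ℝ T z w) (fderiv ℝ T z ξ)) (fderiv ℝ T z ξ)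
        - A' (T z, G' (T z) (fderiv ℝ T z w)) (fderiv ℝ T z ξ)
          (chris G' (T z) (fderiv ℝ T z w) (fderiv ℝ T z ξ)) := by
  let S : E × (E →L[ℝ] ℝ) → E × (E →L[ℝ] ℝ) := fun r => (T r.1, r.2.comp (fderiv ℝ R (T r.1)))
  let H : E × (E →L[ℝ] ℝ) → E →L[ℝ] E →L[ℝ] ℝ := fun r => A' (S r)
  have hSz : S (z, G z w) = (T z, G' (T z) (fderiv ℝ T z w)) := by
    simp only [S, h.form_comp_fderiv_inv hGG w]
  have hH : DifferentiableAt ℝ H (z, G z w) := by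
    have h1 : DifferentiableAt ℝ A' (S (z, G z w)) := by rwa [hSz]
    exact DifferentiableAt.comp (z, G z w) (g := A') (f := S) h1
      (h.hasFDerivAt_cotangent _).differentiableAt
  have hev : ∀ᶠ r in 𝓝 (z, G z w), ∀ a b,
      A r a b = H r (fderiv ℝ T r.1 a) (fderiv ℝ T r.1 b) := by
    filter_upwards [continuousAt_fst.eventually hAA] with r hr using hr r.2
  have hD : HasFDerivAt (fun r : E × (E →L[ℝ] ℝ) => fderiv ℝ T r.1 ξ)
      (((fderiv ℝ (fderiv ℝ T) z).flip ξ).comp (ContinuousLinearMap.fst ℝ E (E →L[ℝ] ℝ)))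
      (z, G z w) := by
    refine ((HasFDerivAt.comp (z, G z w) (f := Prod.fst) (g := fderiv ℝ T) h.hasFDerivAt_fderiv
      hasFDerivAt_fst).clm_apply (hasFDerivAt_const ξ _)).congr_fderiv ?_
    ext c <;> simp
  have h1 := ((hH.hasFDerivAt.clm_apply hD).clm_apply hD).congr_of_eventuallyEq
    (f₁ := fun r => A r ξ ξ) (by filter_upwards [hev] with r hr using hr ξ ξ)
  have hdH : HasFDerivAt (fun r => H r (fderiv ℝ T z ξ) (fderiv ℝ T z ξ))
      (((fderiv ℝ H (z, G z w)).flip (fderiv ℝ T z ξ)).flip (fderiv ℝ T z ξ)) (z, G z w) := by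
    refine ((hH.hasFDerivAt.clm_apply (hasFDerivAt_const _ _)).clm_apply
      (hasFDerivAt_const _ _)).congr_fderiv ?_
    ext c <;> simp
  have h2 := h.radial_eq hG hG' hGG hsymm
    (F := fun r => H r (fderiv ℝ T z ξ) (fderiv ℝ T z ξ))
    (F' := fun r => A' r (fderiv ℝ T z ξ) (fderiv ℝ T z ξ)) w hdH.differentiableAt
    ((hA'.clm_apply (differentiableAt_const _)).clm_apply (differentiableAt_const _))
    (Eventually.of_forall fun x q => rfl)
  rw [← h2, h1.fderiv, hdH.fderiv, hev.self_of_nhds, hev.self_of_nhds,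
    h.fderiv_chris hG hG' hGG hsymm hpos]
  have h3 : H (z, G z w) = A' (T z, G' (T z) (fderiv ℝ T z w)) := by simp only [H, hSz]
  simp only [add_apply, ContinuousLinearMap.comp_apply, ContinuousLinearMap.flip_apply,
    ContinuousLinearMap.coe_fst', map_add, h3]
  ring

end IsTransition

end Transition

/-! ### Charts of a manifold with boundary -/

section Charts

open Topology Filter Bundle

set_option maxSynthPendingDepth 3

theorem mem_range_model_iff {n : ℕ} [NeZero n] {z : Model n} :
    z ∈ range (𝓡∂ n) ↔ 0 ≤ z 0 := by
  rw [range_modelWithCornersEuclideanHalfSpace]; rfl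

theorem range_model_mem_nhds {n : ℕ} [NeZero n] {z : Model n} (hz : 0 < z 0) :
    range (𝓡∂ n) ∈ 𝓝 z := by
  rw [mem_nhds_iff]
  refine ⟨_, interior_subset, isOpen_interior, ?_⟩
  rw [interior_range_modelWithCornersEuclideanHalfSpace]
  exact hz

variable {n : ℕ} [NeZero n] {M : Type*} [TopologicalSpace M]
  [ChartedSpace (EuclideanHalfSpace n) M]

theorem target_subset_range (x₀ : M) : (extChartAt (𝓡∂ n) x₀).target ⊆ range (𝓡∂ n) :=
  extChartAt_target_subset_range x₀

theorem target_mem_nhds {x₀ : M} {z : Model n} (hz : z ∈ (extChartAt (𝓡∂ n) x₀).target)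
    (hz0 : 0 < z 0) : (extChartAt (𝓡∂ n) x₀).target ∈ 𝓝 z :=
  nhdsWithin_eq_nhds.2 (range_model_mem_nhds hz0) ▸
    extChartAt_target_mem_nhdsWithin_of_mem (I := 𝓡∂ n) hz

/-- The transition map from the preferred chart at `x₀` to the preferred chart at `y₀`. -/
def transition (n : ℕ) [NeZero n] {M : Type*} [TopologicalSpace M]
    [ChartedSpace (EuclideanHalfSpace n) M] (x₀ y₀ : M) : Model n → Model n :=
  extChartAt (𝓡∂ n) y₀ ∘ (extChartAt (𝓡∂ n) x₀).symm

theorem continuousAt_symm {x₀ : M} {z : Model n} (hz : z ∈ (extChartAt (𝓡∂ n) x₀).target) :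
    ContinuousWithinAt (extChartAt (𝓡∂ n) x₀).symm (range (𝓡∂ n)) z :=
  (continuousAt_extChartAt_symm'' (I := 𝓡∂ n) hz).continuousWithinAt

theorem transition_mem_target {x₀ y₀ : M} {z : Model n}
    (hy : (extChartAt (𝓡∂ n) x₀).symm z ∈ (extChartAt (𝓡∂ n) y₀).source) :
    transition n x₀ y₀ z ∈ (extChartAt (𝓡∂ n) y₀).target :=
  (extChartAt (𝓡∂ n) y₀).map_source hy

theorem symm_transition {x₀ y₀ : M} {z : Model n}
    (hy : (extChartAt (𝓡∂ n) x₀).symm z ∈ (extChartAt (𝓡∂ n) y₀).source) :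
    (extChartAt (𝓡∂ n) y₀).symm (transition n x₀ y₀ z) = (extChartAt (𝓡∂ n) x₀).symm z :=
  (extChartAt (𝓡∂ n) y₀).left_inv hy

/-- Near an interior point the points of the chart at `x₀` that also lie in the chart at `y₀` form a
neighbourhood. -/
theorem eventually_transition {x₀ y₀ : M} {z : Model n}
    (hz : z ∈ (extChartAt (𝓡∂ n) x₀).target) (hz0 : 0 < z 0)
    (hy : (extChartAt (𝓡∂ n) x₀).symm z ∈ (extChartAt (𝓡∂ n) y₀).source) :
    ∀ᶠ x in 𝓝 z, x ∈ (extChartAt (𝓡∂ n) x₀).target ∧ 0 < x 0 ∧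
      (extChartAt (𝓡∂ n) x₀).symm x ∈ (extChartAt (𝓡∂ n) y₀).source := by
  have h1 := continuousAt_extChartAt_symm'' (I := 𝓡∂ n) hz
  have h2 : ∀ᶠ x : Model n in 𝓝 z, 0 < x 0 :=
    (isOpen_lt continuous_const (EuclideanSpace.proj (𝕜 := ℝ) (0 : Fin n)).continuous).mem_nhds hz0
  filter_upwards [target_mem_nhds hz hz0, h2,
    h1 ((isOpen_extChartAt_source (I := 𝓡∂ n) y₀).mem_nhds hy)] with x h3 h4 h5
  exact ⟨h3, h4, h5⟩

variable [IsManifold (𝓡∂ n) ∞ M]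

theorem contDiffWithinAt_transition {x₀ y₀ : M} {z : Model n}
    (hz : z ∈ (extChartAt (𝓡∂ n) x₀).target)
    (hy : (extChartAt (𝓡∂ n) x₀).symm z ∈ (extChartAt (𝓡∂ n) y₀).source) :
    ContDiffWithinAt ℝ ∞ (transition n x₀ y₀) (range (𝓡∂ n)) z := by
  refine contDiffWithinAt_ext_coord_change (I := 𝓡∂ n) (n := ∞) y₀ x₀ ?_
  rw [PartialEquiv.trans_source]
  exact ⟨hz, hy⟩

theorem interior_iff {x₀ : M} {z : Model n} (hz : z ∈ (extChartAt (𝓡∂ n) x₀).target) :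
    (extChartAt (𝓡∂ n) x₀).symm z ∈ (𝓡∂ n).interior M ↔ 0 < z 0 := by
  have h1 : (extChartAt (𝓡∂ n) x₀).symm z ∈ (chartAt (EuclideanHalfSpace n) x₀).source := by
    rw [← extChartAt_source (𝓡∂ n)]
    exact (extChartAt (𝓡∂ n) x₀).map_target hz
  have h2 := ModelWithCorners.isInteriorPoint_iff_of_mem_atlas (I := 𝓡∂ n) (n := ∞)
    (by simp) (chart_mem_atlas (EuclideanHalfSpace n) x₀) h1
  have h3 : (chartAt (EuclideanHalfSpace n) x₀).extend (𝓡∂ n)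
      ((extChartAt (𝓡∂ n) x₀).symm z) = z := (extChartAt (𝓡∂ n) x₀).right_inv hz
  rw [h3] at h2
  refine h2.trans ⟨fun h => ?_, fun h => ?_⟩
  · have h4 := OpenPartialHomeomorph.interior_extend_target_subset_interior_range _ h
    rw [interior_range_modelWithCornersEuclideanHalfSpace] at h4
    exact h4
  · exact mem_interior_iff_mem_nhds.2 (target_mem_nhds hz h)

theorem boundary_iff {x₀ : M} {z : Model n} (hz : z ∈ (extChartAt (𝓡∂ n) x₀).target) :
    (extChartAt (𝓡∂ n) x₀).symm z ∈ (𝓡∂ n).boundary M ↔ z 0 = 0 := by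
  rw [← ModelWithCorners.compl_interior, mem_compl_iff, interior_iff hz, not_lt]
  have := mem_range_model_iff.1 (target_subset_range x₀ hz)
  exact ⟨fun h => le_antisymm h this, fun h => h.le⟩

theorem transition_pos {x₀ y₀ : M} {z : Model n} (hz : z ∈ (extChartAt (𝓡∂ n) x₀).target)
    (hy : (extChartAt (𝓡∂ n) x₀).symm z ∈ (extChartAt (𝓡∂ n) y₀).source) (hz0 : 0 < z 0) :
    0 < transition n x₀ y₀ z 0 := by
  rw [← interior_iff (transition_mem_target hy), symm_transition hy]
  exact (interior_iff hz).2 hz0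

theorem isTransition {x₀ y₀ : M} {z : Model n}
    (hz : z ∈ (extChartAt (𝓡∂ n) x₀).target) (hz0 : 0 < z 0)
    (hy : (extChartAt (𝓡∂ n) x₀).symm z ∈ (extChartAt (𝓡∂ n) y₀).source) :
    IsTransition (transition n x₀ y₀) (transition n y₀ x₀) z := by
  have key : ∀ {x₀ y₀ : M} {z : Model n}, z ∈ (extChartAt (𝓡∂ n) x₀).target → 0 < z 0 →
      (extChartAt (𝓡∂ n) x₀).symm z ∈ (extChartAt (𝓡∂ n) y₀).source →
      ContDiffAt ℝ 2 (transition n x₀ y₀) z ∧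
        ∀ᶠ x in 𝓝 z, transition n y₀ x₀ (transition n x₀ y₀ x) = x := by
    intro x₀ y₀ z hz hz0 hy
    refine ⟨((contDiffWithinAt_transition hz hy).contDiffAt (range_model_mem_nhds hz0)).of_le
      ENat.LEInfty.out, ?_⟩
    filter_upwards [eventually_transition hz hz0 hy] with x hx
    change extChartAt (𝓡∂ n) x₀ ((extChartAt (𝓡∂ n) y₀).symm (transition n x₀ y₀ x)) = x
    rw [symm_transition hx.2.2, (extChartAt (𝓡∂ n) x₀).right_inv hx.1]
  have h1 := key hz hz0 hy
  have h2 := key (x₀ := y₀) (y₀ := x₀) (transition_mem_target hy) (transition_pos hz hy hz0)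
    (by rw [symm_transition hy]; exact (extChartAt (𝓡∂ n) x₀).map_target hz)
  exact ⟨h1.1, h2.1, h1.2, h2.2⟩

theorem hasFDerivWithinAt_transition {x₀ y₀ : M} {z : Model n}
    (hz : z ∈ (extChartAt (𝓡∂ n) x₀).target)
    (hy : (extChartAt (𝓡∂ n) x₀).symm z ∈ (extChartAt (𝓡∂ n) y₀).source) :
    HasFDerivWithinAt (transition n x₀ y₀)
      (tangentCoordChange (𝓡∂ n) x₀ y₀ ((extChartAt (𝓡∂ n) x₀).symm z)) (range (𝓡∂ n)) z := by
  have h := hasFDerivWithinAt_tangentCoordChange (I := 𝓡∂ n) (x := x₀) (y := y₀)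
    (z := (extChartAt (𝓡∂ n) x₀).symm z) ⟨(extChartAt (𝓡∂ n) x₀).map_target hz, hy⟩
  rwa [(extChartAt (𝓡∂ n) x₀).right_inv hz] at h

theorem fderiv_transition {x₀ y₀ : M} {z : Model n}
    (hz : z ∈ (extChartAt (𝓡∂ n) x₀).target) (hz0 : 0 < z 0)
    (hy : (extChartAt (𝓡∂ n) x₀).symm z ∈ (extChartAt (𝓡∂ n) y₀).source) :
    fderiv ℝ (transition n x₀ y₀) z
      = tangentCoordChange (𝓡∂ n) x₀ y₀ ((extChartAt (𝓡∂ n) x₀).symm z) :=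
  ((hasFDerivWithinAt_transition hz hy).hasFDerivAt (range_model_mem_nhds hz0)).fderiv

/-- The coordinates in the chart at `y₀` and in the chart at `x₀` describe the same vector. -/
theorem vecFrom_tangentCoordChange {x₀ y₀ y : M} (hx : y ∈ (extChartAt (𝓡∂ n) x₀).source)
    (hy : y ∈ (extChartAt (𝓡∂ n) y₀).source) (a : Model n) :
    vecFrom y₀ y (tangentCoordChange (𝓡∂ n) x₀ y₀ y a) = vecFrom x₀ y a :=
  tangentCoordChange_comp (I := 𝓡∂ n) ⟨⟨hx, hy⟩, mem_extChartAt_source y⟩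

theorem covecFrom_comp_tangentCoordChange {x₀ y₀ y : M} (hx : y ∈ (extChartAt (𝓡∂ n) x₀).source)
    (hy : y ∈ (extChartAt (𝓡∂ n) y₀).source) (q : Model n →L[ℝ] ℝ) :
    covecFrom y₀ y (q.comp (tangentCoordChange (𝓡∂ n) y₀ x₀ y)) = covecFrom x₀ y q := by
  ext a
  exact congrArg q (tangentCoordChange_comp (I := 𝓡∂ n) (v := a)
    ⟨⟨mem_extChartAt_source y, hy⟩, hx⟩)

theorem covecFrom_vecFrom {x₀ y : M} (hx : y ∈ (extChartAt (𝓡∂ n) x₀).source)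
    (q : Model n →L[ℝ] ℝ) (a : Model n) : covecFrom x₀ y q (vecFrom x₀ y a) = q a := by
  refine congrArg q ((tangentCoordChange_comp (I := 𝓡∂ n) (v := a)
    ⟨⟨hx, mem_extChartAt_source y⟩, hx⟩).trans ?_)
  exact tangentCoordChange_self (I := 𝓡∂ n) hx

theorem vecFrom_coord {x₀ y : M} (hx : y ∈ (extChartAt (𝓡∂ n) x₀).source)
    (v : TangentSpace (𝓡∂ n) y) :
    vecFrom x₀ y (tangentCoordChange (𝓡∂ n) y x₀ y v) = v := by
  refine (tangentCoordChange_comp (I := 𝓡∂ n) (v := v)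
    ⟨⟨mem_extChartAt_source y, hx⟩, mem_extChartAt_source y⟩).trans ?_
  exact tangentCoordChange_self (I := 𝓡∂ n) (mem_extChartAt_source y)

theorem vecFrom_self {y : M} (v : TangentSpace (𝓡∂ n) y) : vecFrom y y v = v :=
  tangentCoordChange_self (I := 𝓡∂ n) (mem_extChartAt_source y)

theorem covecFrom_self {y : M} (q : Model n →L[ℝ] ℝ) : covecFrom y y q = q := by
  ext v
  exact congrArg q (tangentCoordChange_self (I := 𝓡∂ n) (mem_extChartAt_source y))

variable (g : Metric n M)

theorem chartMetric_apply (x₀ : M) (z a b : Model n) :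
    chartMetric g x₀ z a b = g.inner ((extChartAt (𝓡∂ n) x₀).symm z)
      (vecFrom x₀ ((extChartAt (𝓡∂ n) x₀).symm z) a)
      (vecFrom x₀ ((extChartAt (𝓡∂ n) x₀).symm z) b) := rfl

theorem chartMetric_symm (x₀ : M) (z a b : Model n) :
    chartMetric g x₀ z a b = chartMetric g x₀ z b a :=
  g.symm _ _ _

theorem chartMetric_pos {x₀ : M} {z : Model n} (hz : z ∈ (extChartAt (𝓡∂ n) x₀).target)
    {a : Model n} (ha : a ≠ 0) : 0 < chartMetric g x₀ z a a := by
  rw [chartMetric_apply]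
  refine g.pos _ _ fun h => ha ?_
  have h1 : tangentCoordChange (𝓡∂ n) ((extChartAt (𝓡∂ n) x₀).symm z) x₀
      ((extChartAt (𝓡∂ n) x₀).symm z)
      (vecFrom x₀ ((extChartAt (𝓡∂ n) x₀).symm z) a) = a := by
    have hs := (extChartAt (𝓡∂ n) x₀).map_target hz
    refine (tangentCoordChange_comp (I := 𝓡∂ n) (v := a)
      ⟨⟨hs, mem_extChartAt_source _⟩, hs⟩).trans ?_
    exact tangentCoordChange_self (I := 𝓡∂ n) hs
  rw [h] at h1
  exact h1.symm.trans (map_zero _)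

theorem chartMetric_transition {x₀ y₀ : M} {z : Model n}
    (hz : z ∈ (extChartAt (𝓡∂ n) x₀).target)
    (hy : (extChartAt (𝓡∂ n) x₀).symm z ∈ (extChartAt (𝓡∂ n) y₀).source) (a b : Model n) :
    chartMetric g x₀ z a b = chartMetric g y₀ (transition n x₀ y₀ z)
      (tangentCoordChange (𝓡∂ n) x₀ y₀ ((extChartAt (𝓡∂ n) x₀).symm z) a)
      (tangentCoordChange (𝓡∂ n) x₀ y₀ ((extChartAt (𝓡∂ n) x₀).symm z) b) := by
  have hs := (extChartAt (𝓡∂ n) x₀).map_target hz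
  rw [chartMetric_apply, chartMetric_apply, symm_transition hy,
    vecFrom_tangentCoordChange hs hy, vecFrom_tangentCoordChange hs hy]

/-- The metric of the chart at `x₀` is the pull-back of the metric of the chart at `y₀`. -/
theorem eventually_chartMetric {x₀ y₀ : M} {z : Model n}
    (hz : z ∈ (extChartAt (𝓡∂ n) x₀).target) (hz0 : 0 < z 0)
    (hy : (extChartAt (𝓡∂ n) x₀).symm z ∈ (extChartAt (𝓡∂ n) y₀).source) :
    ∀ᶠ x in 𝓝 z, ∀ a b, chartMetric g x₀ x a b = chartMetric g y₀ (transition n x₀ y₀ x)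
      (fderiv ℝ (transition n x₀ y₀) x a) (fderiv ℝ (transition n x₀ y₀) x b) := by
  filter_upwards [eventually_transition hz hz0 hy] with x hx a b
  rw [fderiv_transition hx.1 hx.2.1 hx.2.2]
  exact chartMetric_transition g hx.1 hx.2.2 a b

theorem contMDiffOn_vecFrom (x₀ : M) (a : Model n) :
    ContMDiffOn (𝓡∂ n) ((𝓡∂ n).prod 𝓘(ℝ, Model n)) ∞
      (fun y => TotalSpace.mk' (Model n) (E := fun y : M => TangentSpace (𝓡∂ n) y) y
        (vecFrom x₀ y a)) (extChartAt (𝓡∂ n) x₀).source := by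
  have hs : (extChartAt (𝓡∂ n) x₀).source
      = (trivializationAt (Model n) (TangentSpace (𝓡∂ n)) x₀).baseSet := by
    rw [TangentBundle.trivializationAt_baseSet, extChartAt_source]
  rw [hs, Trivialization.contMDiffOn_section_baseSet_iff]
  refine (contMDiffOn_const (c := a)).congr fun y hy => ?_
  rw [← hs] at hy
  change tangentCoordChange (𝓡∂ n) y x₀ y (tangentCoordChange (𝓡∂ n) x₀ y y a) = a
  rw [tangentCoordChange_comp (I := 𝓡∂ n) ⟨⟨hy, mem_extChartAt_source y⟩, hy⟩]
  exact tangentCoordChange_self (I := 𝓡∂ n) hy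

theorem contMDiffOn_inner (x₀ : M) (a b : Model n) :
    ContMDiffOn (𝓡∂ n) 𝓘(ℝ, ℝ) ∞ (fun y => g.inner y (vecFrom x₀ y a) (vecFrom x₀ y b))
      (extChartAt (𝓡∂ n) x₀).source := by
  have h := ContMDiffOn.clm_bundle_apply₂ (F₁ := Model n) (F₂ := Model n) (F₃ := ℝ)
    (E₁ := fun y : M => TangentSpace (𝓡∂ n) y) (E₂ := fun y : M => TangentSpace (𝓡∂ n) y)
    (E₃ := Bundle.Trivial M ℝ) (b := fun y : M => y) (ψ := fun y => g.inner y)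
    (g.contMDiff.contMDiffOn (s := (extChartAt (𝓡∂ n) x₀).source)) (contMDiffOn_vecFrom x₀ a)
    (contMDiffOn_vecFrom x₀ b)
  intro y hy
  exact (contMDiffWithinAt_totalSpace.1 (h y hy)).2

theorem contDiffOn_chartMetric (x₀ : M) :
    ContDiffOn ℝ ∞ (chartMetric g x₀) (extChartAt (𝓡∂ n) x₀).target := by
  rw [contDiffOn_clm_apply]
  intro a
  rw [contDiffOn_clm_apply]
  intro b
  rw [← contMDiffOn_iff_contDiffOn]
  exact (contMDiffOn_inner g x₀ a b).comp (contMDiffOn_extChartAt_symm x₀)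
    fun z hz => (extChartAt (𝓡∂ n) x₀).map_target hz

end Charts

/-! ### Gradient, Hessian and coefficients in charts -/

section Coordinates

open Topology Filter Bundle

set_option maxSynthPendingDepth 3

variable {n : ℕ} [NeZero n] {M : Type*} [TopologicalSpace M]
  [ChartedSpace (EuclideanHalfSpace n) M]

/-- The coefficient `ψ` in the coordinates of the preferred chart at `x₀`. -/
def coordScalar (ψ : ScalarCoeff n M) [IsManifold (𝓡∂ n) ∞ M] (x₀ : M) (z : Model n) (t : ℝ)
    (q : Model n →L[ℝ] ℝ) : ℝ :=
  ψ ((extChartAt (𝓡∂ n) x₀).symm z) t (covecFrom x₀ ((extChartAt (𝓡∂ n) x₀).symm z) q)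

/-- The coefficient `A` in the coordinates of the preferred chart at `x₀`. -/
def coordTensor (A : TensorCoeff n M) [IsManifold (𝓡∂ n) ∞ M] (x₀ : M) (z : Model n) (t : ℝ)
    (q : Model n →L[ℝ] ℝ) : Model n →L[ℝ] Model n →L[ℝ] ℝ :=
  let y : M := (extChartAt (𝓡∂ n) x₀).symm z
  let B : Model n →L[ℝ] Model n →L[ℝ] ℝ := A y t (covecFrom x₀ y q)
  B.bilinearComp (tangentCoordChange (𝓡∂ n) x₀ y y) (tangentCoordChange (𝓡∂ n) x₀ y y)

theorem uniqueDiffWithinAt_model {x₀ : M} {z : Model n}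
    (hz : z ∈ (extChartAt (𝓡∂ n) x₀).target) :
    UniqueDiffWithinAt ℝ (range (𝓡∂ n)) z :=
  (𝓡∂ n).uniqueDiffOn z (target_subset_range x₀ hz)

theorem symm_mem_source_self (x₀ : M) (z : Model n) : (extChartAt (𝓡∂ n) x₀).symm z
    ∈ (extChartAt (𝓡∂ n) ((extChartAt (𝓡∂ n) x₀).symm z)).source :=
  mem_extChartAt_source _

variable [IsManifold (𝓡∂ n) ∞ M]

theorem coordTensor_apply (A : TensorCoeff n M) (x₀ : M) (z : Model n) (t : ℝ)
    (q : Model n →L[ℝ] ℝ) (a b : Model n) :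
    coordTensor A x₀ z t q a b = A ((extChartAt (𝓡∂ n) x₀).symm z) t
      (covecFrom x₀ ((extChartAt (𝓡∂ n) x₀).symm z) q)
      (vecFrom x₀ ((extChartAt (𝓡∂ n) x₀).symm z) a)
      (vecFrom x₀ ((extChartAt (𝓡∂ n) x₀).symm z) b) := rfl

theorem coordScalar_eq (ψ : ScalarCoeff n M) {x₀ y : M} {z : Model n}
    (h : (extChartAt (𝓡∂ n) x₀).symm z = y) (t : ℝ) (q : Model n →L[ℝ] ℝ) :
    coordScalar ψ x₀ z t q = ψ y t (covecFrom x₀ y q) := by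
  subst h; rfl

theorem coordTensor_eq (A : TensorCoeff n M) {x₀ y : M} {z : Model n}
    (h : (extChartAt (𝓡∂ n) x₀).symm z = y) (t : ℝ) (q : Model n →L[ℝ] ℝ) (a b : Model n) :
    coordTensor A x₀ z t q a b = A y t (covecFrom x₀ y q) (vecFrom x₀ y a) (vecFrom x₀ y b) := by
  subst h; rfl

theorem chartMetric_eq (g : Metric n M) {x₀ y : M} {z : Model n}
    (h : (extChartAt (𝓡∂ n) x₀).symm z = y) (a b : Model n) :
    chartMetric g x₀ z a b = g.inner y (vecFrom x₀ y a) (vecFrom x₀ y b) := by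
  subst h; rfl

theorem chartMetric_self (g : Metric n M) (y : M) (a b : Model n) :
    chartMetric g y (extChartAt (𝓡∂ n) y y) a b = g.inner y a b :=
  (chartMetric_eq g (extChartAt_to_inv (I := 𝓡∂ n) y) a b).trans
    (congrArg₂ (fun a b : TangentSpace (𝓡∂ n) y => g.inner y a b) (vecFrom_self a)
      (vecFrom_self b))

theorem coordTensor_self (A : TensorCoeff n M) (y : M) (t : ℝ) (q : Model n →L[ℝ] ℝ)
    (a b : Model n) : coordTensor A y (extChartAt (𝓡∂ n) y y) t q a b = A y t q a b := by
  have h := coordTensor_eq A (extChartAt_to_inv (I := 𝓡∂ n) y) t q a b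
  have h1 : (A y t (covecFrom y y q) : Tensor02 n y) = A y t q :=
    congrArg (A y t) (covecFrom_self q)
  rw [h1] at h
  exact h.trans (congrArg₂ (fun a b : TangentSpace (𝓡∂ n) y => A y t q a b) (vecFrom_self a)
    (vecFrom_self b))

section Gradient

variable {x₀ : M} {z : Model n}

/-- The differential of a function in a chart. -/
theorem hasFDerivWithinAt_coord {v : M → ℝ} (hz : z ∈ (extChartAt (𝓡∂ n) x₀).target)
    (hv : MDifferentiableAt (𝓡∂ n) 𝓘(ℝ, ℝ) v ((extChartAt (𝓡∂ n) x₀).symm z)) :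
    HasFDerivWithinAt (v ∘ (extChartAt (𝓡∂ n) x₀).symm)
      (ContinuousLinearMap.comp (grad v ((extChartAt (𝓡∂ n) x₀).symm z) : Model n →L[ℝ] ℝ)
        (tangentCoordChange (𝓡∂ n) x₀ ((extChartAt (𝓡∂ n) x₀).symm z)
        ((extChartAt (𝓡∂ n) x₀).symm z))) (range (𝓡∂ n)) z := by
  set y := (extChartAt (𝓡∂ n) x₀).symm z with hy
  have h1 : HasFDerivWithinAt (v ∘ (extChartAt (𝓡∂ n) y).symm) (grad v y : Model n →L[ℝ] ℝ)
      (range (𝓡∂ n)) (transition n x₀ y z) := hv.hasMFDerivAt.2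
  have hs : y ∈ (extChartAt (𝓡∂ n) y).source := mem_extChartAt_source y
  have h2 := hasFDerivWithinAt_transition (x₀ := x₀) (y₀ := y) hz hs
  have h3 := h1.comp z h2 (fun x _ => mem_range_self (f := 𝓡∂ n) _)
  refine h3.congr_of_eventuallyEq ?_ ?_
  · have hc : ContinuousWithinAt (extChartAt (𝓡∂ n) x₀).symm (range (𝓡∂ n)) z :=
      continuousAt_symm hz
    filter_upwards [hc ((isOpen_extChartAt_source (I := 𝓡∂ n) y).mem_nhds hs)] with x hx
    exact congrArg v ((extChartAt (𝓡∂ n) y).left_inv hx).symm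
  · exact congrArg v ((extChartAt (𝓡∂ n) y).left_inv hs).symm

theorem grad_eq_covecFrom {v : M → ℝ} (hz : z ∈ (extChartAt (𝓡∂ n) x₀).target)
    (hv : MDifferentiableAt (𝓡∂ n) 𝓘(ℝ, ℝ) v ((extChartAt (𝓡∂ n) x₀).symm z)) :
    grad v ((extChartAt (𝓡∂ n) x₀).symm z)
      = covecFrom x₀ ((extChartAt (𝓡∂ n) x₀).symm z)
        (fderivWithin ℝ (v ∘ (extChartAt (𝓡∂ n) x₀).symm) (range (𝓡∂ n)) z) := by
  rw [(hasFDerivWithinAt_coord hz hv).fderivWithin (uniqueDiffWithinAt_model hz)]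
  ext a
  exact (congrArg (grad v ((extChartAt (𝓡∂ n) x₀).symm z))
    (vecFrom_coord ((extChartAt (𝓡∂ n) x₀).map_target hz) a)).symm

end Gradient

section Metric

variable (g : Metric n M)

theorem form_injective {x₀ : M} {z : Model n} (hz : z ∈ (extChartAt (𝓡∂ n) x₀).target)
    (a : Model n) (ha : chartMetric g x₀ z a a = 0) : a = 0 := by
  by_contra h
  exact (chartMetric_pos g hz h).ne' ha

theorem eq_of_inner_eq (y : M) {a b : TangentSpace (𝓡∂ n) y}
    (h : ∀ c, g.inner y a c = g.inner y b c) : a = b := by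
  by_contra hne
  have h1 := g.pos y (a - b) (sub_ne_zero.2 hne)
  have h2 : g.inner y (a - b) (a - b) = g.inner y a (a - b) - g.inner y b (a - b) := by
    exact congrArg (fun L : Cotangent n y => L (a - b)) (map_sub (g.inner y) a b)
  rw [h2, h, sub_self] at h1
  exact lt_irrefl _ h1

theorem differentiableAt_chartMetric {x₀ : M} {z : Model n}
    (hz : z ∈ (extChartAt (𝓡∂ n) x₀).target) (hz0 : 0 < z 0) :
    DifferentiableAt ℝ (chartMetric g x₀) z :=
  ((contDiffOn_chartMetric g x₀).contDiffAt (target_mem_nhds hz hz0)).differentiableAt (by simp)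

theorem chartMetricDeriv_eq {y : M} (hy : 0 < extChartAt (𝓡∂ n) y y 0) :
    chartMetricDeriv g y = fderiv ℝ (chartMetric g y) (extChartAt (𝓡∂ n) y y) :=
  fderivWithin_of_mem_nhds (range_model_mem_nhds hy)

theorem christoffel_eq {y : M} (hy : 0 < extChartAt (𝓡∂ n) y y 0) (a b : Model n) :
    christoffel g y a b = chris (chartMetric g y) (extChartAt (𝓡∂ n) y y) a b := by
  refine eq_of_inner_eq g y fun c => ?_
  have h1 : g.inner y (christoffel g y a b) c = koszul (chartMetricDeriv g y) a b c :=
    inner_sharp g y _ c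
  refine h1.trans (Eq.trans ?_ (chartMetric_self g y _ c))
  rw [chris, form_inverse_apply (form_injective g (mem_extChartAt_target (I := 𝓡∂ n) y)),
    chartMetricDeriv_eq g hy]

theorem christoffelDual_eq {y : M} (hy : 0 < extChartAt (𝓡∂ n) y y 0) (p : Cotangent n y) :
    christoffelDual g y (sharp g y p) p
      = halfDeriv (fderiv ℝ (chartMetric g y) (extChartAt (𝓡∂ n) y y)) (sharp g y p) := by
  rw [← chartMetricDeriv_eq g hy]
  ext b
  have hs : ∀ a b c, chartMetricDeriv g y a b c = chartMetricDeriv g y a c b := by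
    intro a b c
    rw [chartMetricDeriv_eq g hy]
    have hd := (differentiableAt_chartMetric g (mem_extChartAt_target (I := 𝓡∂ n) y) hy).hasFDerivAt
    have h1 := HasFDerivAt.form_apply hd b c
    have h2 := (HasFDerivAt.form_apply hd c b).congr_of_eventuallyEq
      (f₁ := fun x => chartMetric g y x b c)
      (Eventually.of_forall fun x => chartMetric_symm g y x b c)
    have h3 := congrArg (fun L : Model n →L[ℝ] ℝ => L a) (h1.unique h2)
    simpa using h3
  have h1 : ∀ w : Model n, 1 / 2 * (chartMetricDeriv g y w b w + chartMetricDeriv g y b w w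
      - chartMetricDeriv g y w w b) = chartMetricDeriv g y b w w / 2 := by
    intro w
    rw [hs w b w]
    ring
  exact (h1 (sharp g y p)).trans (halfDeriv_apply _ _ b).symm

end Metric

section Equation

variable (g : Metric n M) {x₀ : M} {z : Model n}

theorem contDiffAt_coord {k : WithTop ℕ∞} (hk : k ≤ ∞) {v : M → ℝ}
    (hz : z ∈ (extChartAt (𝓡∂ n) x₀).target) (hz0 : 0 < z 0)
    (hv : ContMDiffAt (𝓡∂ n) 𝓘(ℝ, ℝ) k v ((extChartAt (𝓡∂ n) x₀).symm z)) :
    ContDiffAt ℝ k (v ∘ (extChartAt (𝓡∂ n) x₀).symm) z := by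
  have : IsManifold (𝓡∂ n) k M := IsManifold.of_le hk
  rw [← contMDiffAt_iff_contDiffAt]
  refine hv.comp z ?_
  exact (contMDiffOn_extChartAt_symm x₀).contMDiffAt (target_mem_nhds hz hz0)

/-- The Hessian in a chart. -/
theorem hess_eq {v : M → ℝ} (hz : z ∈ (extChartAt (𝓡∂ n) x₀).target) (hz0 : 0 < z 0)
    (hv : ContMDiffAt (𝓡∂ n) 𝓘(ℝ, ℝ) 2 v ((extChartAt (𝓡∂ n) x₀).symm z)) (a b : Model n) :
    hess g v ((extChartAt (𝓡∂ n) x₀).symm z) (vecFrom x₀ ((extChartAt (𝓡∂ n) x₀).symm z) a)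
        (vecFrom x₀ ((extChartAt (𝓡∂ n) x₀).symm z) b)
      = fderiv ℝ (fderiv ℝ (v ∘ (extChartAt (𝓡∂ n) x₀).symm)) z a b
        - fderiv ℝ (v ∘ (extChartAt (𝓡∂ n) x₀).symm) z (chris (chartMetric g x₀) z a b) := by
  have hs := symm_mem_source_self x₀ z
  have hs0 := (extChartAt (𝓡∂ n) x₀).map_target hz
  set y := (extChartAt (𝓡∂ n) x₀).symm z with hy
  have hy0 : 0 < extChartAt (𝓡∂ n) y y 0 := transition_pos hz hs hz0
  have hyt : extChartAt (𝓡∂ n) y y ∈ (extChartAt (𝓡∂ n) y).target := mem_extChartAt_target y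
  have hT := isTransition hz hz0 hs
  have hU' : ContDiffAt ℝ 2 (v ∘ (extChartAt (𝓡∂ n) y).symm) (extChartAt (𝓡∂ n) y y) := by
    refine contDiffAt_coord ENat.LEInfty.out hyt hy0 ?_
    rwa [extChartAt_to_inv (I := 𝓡∂ n) y]
  have hUU : ∀ᶠ x in 𝓝 z, (v ∘ (extChartAt (𝓡∂ n) x₀).symm) x
      = (v ∘ (extChartAt (𝓡∂ n) y).symm) (transition n x₀ y x) := by
    filter_upwards [eventually_transition hz hz0 hs] with x hx
    exact congrArg v (symm_transition hx.2.2).symm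
  have key := hT.hessian_eq (differentiableAt_chartMetric g hz hz0)
    (differentiableAt_chartMetric g (x₀ := y) hyt hy0) (eventually_chartMetric g hz hz0 hs)
    (chartMetric_symm g y _) (form_injective g hyt) hU' hUU a b
  rw [key, fderiv_transition hz hz0 hs]
  have hr : range (𝓡∂ n) ∈ 𝓝 (extChartAt (𝓡∂ n) y y) := range_model_mem_nhds hy0
  have hfd : fderivWithin ℝ (fderivWithin ℝ (v ∘ (extChartAt (𝓡∂ n) y).symm) (range (𝓡∂ n)))
      (range (𝓡∂ n)) (extChartAt (𝓡∂ n) y y)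
      = fderiv ℝ (fderiv ℝ (v ∘ (extChartAt (𝓡∂ n) y).symm)) (extChartAt (𝓡∂ n) y y) := by
    rw [fderivWithin_of_mem_nhds hr]
    refine Filter.EventuallyEq.fderiv_eq ?_
    filter_upwards [eventually_mem_nhds_iff.2 hr] with x hx
    exact fderivWithin_of_mem_nhds hx
  have e1 : ∀ a b : Model n, hess g v y a b
      = fderiv ℝ (fderiv ℝ (v ∘ (extChartAt (𝓡∂ n) y).symm)) (extChartAt (𝓡∂ n) y y) a b
      - fderiv ℝ (v ∘ (extChartAt (𝓡∂ n) y).symm) (extChartAt (𝓡∂ n) y y)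
        (chris (chartMetric g y) (extChartAt (𝓡∂ n) y y) a b) := by
    intro a b
    rw [← hfd, ← fderivWithin_of_mem_nhds (f := v ∘ (extChartAt (𝓡∂ n) y).symm) hr,
      ← christoffel_eq g hy0]
    rfl
  exact e1 _ _

end Equation

end Coordinates

/-! ### The structure conditions and the equation in charts -/

section Coefficients

open Topology Filter Bundle

set_option maxSynthPendingDepth 3

variable {n : ℕ} [NeZero n] {M : Type*} [TopologicalSpace M]
  [ChartedSpace (EuclideanHalfSpace n) M] {x₀ : M} {z : Model n}

theorem prod_target_mem_nhds (hz : z ∈ (extChartAt (𝓡∂ n) x₀).target) (hz0 : 0 < z 0)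
    (q : Model n →L[ℝ] ℝ) :
    (extChartAt (𝓡∂ n) x₀).target ×ˢ (univ : Set (Model n →L[ℝ] ℝ)) ∈ 𝓝 (z, q) :=
  prod_mem_nhds (target_mem_nhds hz hz0) univ_mem

variable [IsManifold (𝓡∂ n) ∞ M]

theorem contDiffOn_coordScalar {T t : ℝ} {ψ : ScalarCoeff n M} (hψ : SmoothNear T x₀ ψ)
    (ht : t ∈ Icc 0 T) :
    ContDiffOn ℝ ∞ (fun r : Model n × (Model n →L[ℝ] ℝ) => coordScalar ψ x₀ r.1 t r.2)
      ((extChartAt (𝓡∂ n) x₀).target ×ˢ univ) := by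
  have h1 : ContDiffOn ℝ ∞ (fun r : Model n × (Model n →L[ℝ] ℝ) => (r.1, t, r.2))
      ((extChartAt (𝓡∂ n) x₀).target ×ˢ univ) := by fun_prop
  exact ContDiffOn.comp hψ h1 (fun r hr => ⟨hr.1, ht, mem_univ _⟩)

theorem contDiffOn_coordTensor {T t : ℝ} {A : TensorCoeff n M} (hA : SmoothTensor T A)
    (x₀ : M) (ht : t ∈ Icc 0 T) :
    ContDiffOn ℝ ∞ (fun r : Model n × (Model n →L[ℝ] ℝ) => coordTensor A x₀ r.1 t r.2)
      ((extChartAt (𝓡∂ n) x₀).target ×ˢ univ) := by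
  rw [contDiffOn_clm_apply]
  intro a
  rw [contDiffOn_clm_apply]
  intro b
  exact contDiffOn_coordScalar (hA x₀ a b) ht

theorem differentiableAt_coordScalar {T t : ℝ} {ψ : ScalarCoeff n M} (hψ : SmoothNear T x₀ ψ)
    (hz : z ∈ (extChartAt (𝓡∂ n) x₀).target) (hz0 : 0 < z 0) (ht : t ∈ Icc 0 T)
    (q : Model n →L[ℝ] ℝ) :
    DifferentiableAt ℝ (fun r : Model n × (Model n →L[ℝ] ℝ) => coordScalar ψ x₀ r.1 t r.2)
      (z, q) :=
  ((contDiffOn_coordScalar hψ ht).contDiffAt (prod_target_mem_nhds hz hz0 q)).differentiableAt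
    (by simp)

theorem differentiableAt_coordTensor {T t : ℝ} {A : TensorCoeff n M} (hA : SmoothTensor T A)
    (hz : z ∈ (extChartAt (𝓡∂ n) x₀).target) (hz0 : 0 < z 0) (ht : t ∈ Icc 0 T)
    (q : Model n →L[ℝ] ℝ) :
    DifferentiableAt ℝ (fun r : Model n × (Model n →L[ℝ] ℝ) => coordTensor A x₀ r.1 t r.2)
      (z, q) :=
  ((contDiffOn_coordTensor hA x₀ ht).contDiffAt (prod_target_mem_nhds hz hz0 q)).differentiableAt
    (by simp)

theorem coordScalar_transition (ψ : ScalarCoeff n M) {y₀ : M}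
    (hz : z ∈ (extChartAt (𝓡∂ n) x₀).target) (hz0 : 0 < z 0)
    (hy : (extChartAt (𝓡∂ n) x₀).symm z ∈ (extChartAt (𝓡∂ n) y₀).source) (t : ℝ)
    (q : Model n →L[ℝ] ℝ) :
    coordScalar ψ x₀ z t q = coordScalar ψ y₀ (transition n x₀ y₀ z) t
      (q.comp (fderiv ℝ (transition n y₀ x₀) (transition n x₀ y₀ z))) := by
  have hs := (extChartAt (𝓡∂ n) x₀).map_target hz
  rw [coordScalar_eq ψ (symm_transition hy), fderiv_transition (transition_mem_target hy)
    (transition_pos hz hy hz0) (by rwa [symm_transition hy]), symm_transition hy,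
    covecFrom_comp_tangentCoordChange hs hy]
  rfl

theorem coordTensor_transition (A : TensorCoeff n M) {y₀ : M}
    (hz : z ∈ (extChartAt (𝓡∂ n) x₀).target) (hz0 : 0 < z 0)
    (hy : (extChartAt (𝓡∂ n) x₀).symm z ∈ (extChartAt (𝓡∂ n) y₀).source) (t : ℝ)
    (q : Model n →L[ℝ] ℝ) (a b : Model n) :
    coordTensor A x₀ z t q a b = coordTensor A y₀ (transition n x₀ y₀ z) t
      (q.comp (fderiv ℝ (transition n y₀ x₀) (transition n x₀ y₀ z)))
      (fderiv ℝ (transition n x₀ y₀) z a) (fderiv ℝ (transition n x₀ y₀) z b) := by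
  have hs := (extChartAt (𝓡∂ n) x₀).map_target hz
  rw [coordTensor_eq A (symm_transition hy), fderiv_transition (transition_mem_target hy)
    (transition_pos hz hy hz0) (by rwa [symm_transition hy]), symm_transition hy,
    covecFrom_comp_tangentCoordChange hs hy, fderiv_transition hz hz0 hy,
    vecFrom_tangentCoordChange hs hy, vecFrom_tangentCoordChange hs hy]
  rfl

variable (g : Metric n M)

theorem sharp_inner (y : M) (w : TangentSpace (𝓡∂ n) y) : sharp g y (g.inner y w) = w :=
  eq_of_inner_eq g y fun c => inner_sharp g y _ c

theorem radialDx_eq {t : ℝ} {ψ : ScalarCoeff n M} {y : M} (hy : 0 < extChartAt (𝓡∂ n) y y 0)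
    (p : Cotangent n y) :
    radialDx g ψ y t p
      = fderiv ℝ (fun r : Model n × (Model n →L[ℝ] ℝ) => coordScalar ψ y r.1 t r.2)
        (extChartAt (𝓡∂ n) y y, p)
        (sharp g y p, halfDeriv (fderiv ℝ (chartMetric g y) (extChartAt (𝓡∂ n) y y))
          (sharp g y p)) := by
  rw [← christoffelDual_eq g hy]
  have h : range (𝓡∂ n) ×ˢ (univ : Set (Model n →L[ℝ] ℝ))
      ∈ 𝓝 (extChartAt (𝓡∂ n) y y, (p : Model n →L[ℝ] ℝ)) :=
    prod_mem_nhds (range_model_mem_nhds hy) univ_mem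
  exact congrArg (fun L : (Model n × (Model n →L[ℝ] ℝ)) →L[ℝ] ℝ =>
    L (sharp g y p, christoffelDual g y (sharp g y p) p)) (fderivWithin_of_mem_nhds h)

/-- The covector dual to the vector with coordinates `w`, in the two charts. -/
theorem chartMetric_transition_self (hz : z ∈ (extChartAt (𝓡∂ n) x₀).target) (hz0 : 0 < z 0)
    (w : Model n) :
    chartMetric g ((extChartAt (𝓡∂ n) x₀).symm z)
        (transition n x₀ ((extChartAt (𝓡∂ n) x₀).symm z) z)
        (fderiv ℝ (transition n x₀ ((extChartAt (𝓡∂ n) x₀).symm z)) z w)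
      = g.inner ((extChartAt (𝓡∂ n) x₀).symm z)
        (vecFrom x₀ ((extChartAt (𝓡∂ n) x₀).symm z) w) := by
  rw [fderiv_transition hz hz0 (symm_mem_source_self x₀ z)]
  ext b
  exact chartMetric_self g _ _ b

/-- `p · ∇_x ψ` in a chart. -/
theorem radialDx_coord {T t : ℝ} {ψ : ScalarCoeff n M} (hψ : SmoothScalar T ψ)
    (ht : t ∈ Icc 0 T) (hz : z ∈ (extChartAt (𝓡∂ n) x₀).target) (hz0 : 0 < z 0) (w : Model n) :
    fderiv ℝ (fun r : Model n × (Model n →L[ℝ] ℝ) => coordScalar ψ x₀ r.1 t r.2)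
        (z, chartMetric g x₀ z w) (w, halfDeriv (fderiv ℝ (chartMetric g x₀) z) w)
      = radialDx g ψ ((extChartAt (𝓡∂ n) x₀).symm z) t
        (g.inner ((extChartAt (𝓡∂ n) x₀).symm z)
          (vecFrom x₀ ((extChartAt (𝓡∂ n) x₀).symm z) w)) := by
  have hs := symm_mem_source_self x₀ z
  have hco := chartMetric_transition_self g hz hz0 w
  set y := (extChartAt (𝓡∂ n) x₀).symm z with hy
  have hy0 : 0 < extChartAt (𝓡∂ n) y y 0 := transition_pos hz hs hz0
  have hyt : extChartAt (𝓡∂ n) y y ∈ (extChartAt (𝓡∂ n) y).target := mem_extChartAt_target y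
  have hT := isTransition hz hz0 hs
  have key := hT.radial_eq (differentiableAt_chartMetric g hz hz0)
    (differentiableAt_chartMetric g (x₀ := y) hyt hy0) (eventually_chartMetric g hz hz0 hs)
    (chartMetric_symm g y _) (F := fun r => coordScalar ψ x₀ r.1 t r.2)
    (F' := fun r => coordScalar ψ y r.1 t r.2) w
    (differentiableAt_coordScalar (hψ x₀) hz hz0 ht _)
    (differentiableAt_coordScalar (hψ y) hyt hy0 ht _)
    (by
      filter_upwards [eventually_transition hz hz0 hs] with x hx q
      exact coordScalar_transition ψ hx.1 hx.2.1 hx.2.2 t q)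
  rw [key, radialDx_eq g hy0, sharp_inner, hco, fderiv_transition hz hz0 hs]
  rfl

/-- `p · ∇_x A^{ξξ}` in a chart. -/
theorem radialDxTensor_coord {T t : ℝ} {A : TensorCoeff n M} (hA : SmoothTensor T A)
    (ht : t ∈ Icc 0 T) (hz : z ∈ (extChartAt (𝓡∂ n) x₀).target) (hz0 : 0 < z 0) (w ξ : Model n) :
    fderiv ℝ (fun r : Model n × (Model n →L[ℝ] ℝ) => coordTensor A x₀ r.1 t r.2 ξ ξ)
        (z, chartMetric g x₀ z w) (w, halfDeriv (fderiv ℝ (chartMetric g x₀) z) w)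
        - coordTensor A x₀ z t (chartMetric g x₀ z w) (chris (chartMetric g x₀) z w ξ) ξ
        - coordTensor A x₀ z t (chartMetric g x₀ z w) ξ (chris (chartMetric g x₀) z w ξ)
      = radialDxTensor g A ((extChartAt (𝓡∂ n) x₀).symm z) t
        (g.inner ((extChartAt (𝓡∂ n) x₀).symm z)
          (vecFrom x₀ ((extChartAt (𝓡∂ n) x₀).symm z) w))
        (vecFrom x₀ ((extChartAt (𝓡∂ n) x₀).symm z) ξ) := by
  have hs := symm_mem_source_self x₀ z
  have hco := chartMetric_transition_self g hz hz0 w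
  set y := (extChartAt (𝓡∂ n) x₀).symm z with hy
  have hy0 : 0 < extChartAt (𝓡∂ n) y y 0 := transition_pos hz hs hz0
  have hyt : extChartAt (𝓡∂ n) y y ∈ (extChartAt (𝓡∂ n) y).target := mem_extChartAt_target y
  have hT := isTransition hz hz0 hs
  have key := hT.radial_tensor_eq (differentiableAt_chartMetric g hz hz0)
    (differentiableAt_chartMetric g (x₀ := y) hyt hy0) (eventually_chartMetric g hz hz0 hs)
    (chartMetric_symm g y _) (form_injective g hyt) (A := fun r => coordTensor A x₀ r.1 t r.2)
    (A' := fun r => coordTensor A y r.1 t r.2) w ξ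
    (differentiableAt_coordTensor hA hyt hy0 ht _)
    (by
      filter_upwards [eventually_transition hz hz0 hs] with x hx q a b
      exact coordTensor_transition A hx.1 hx.2.1 hx.2.2 t q a b)
  rw [key, radialDxTensor, radialDx_eq g hy0, sharp_inner, hco,
    fderiv_transition hz hz0 hs]
  congr 1
  · congr 1
    refine (coordTensor_self A y t _ _ _).trans ?_
    exact congrArg (fun c : Model n => A y t (g.inner y (vecFrom x₀ y w)) c (vecFrom x₀ y ξ))
      (christoffel_eq g hy0 _ _).symm
  · refine (coordTensor_self A y t _ _ _).trans ?_
    exact congrArg (fun c : Model n => A y t (g.inner y (vecFrom x₀ y w)) (vecFrom x₀ y ξ) c)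
      (christoffel_eq g hy0 _ _).symm

theorem isAugDiag_of_isEigenvalues {A : TensorCoeff n M} {u : M → ℝ → ℝ} {t : ℝ}
    (hz : z ∈ (extChartAt (𝓡∂ n) x₀).target) (hz0 : 0 < z 0)
    (hu : ContMDiffAt (𝓡∂ n) 𝓘(ℝ, ℝ) 2 (fun x => u x t) ((extChartAt (𝓡∂ n) x₀).symm z))
    {l : Fin n → ℝ}
    (h : IsEigenvalues g ((extChartAt (𝓡∂ n) x₀).symm z)
      (augHess g A u ((extChartAt (𝓡∂ n) x₀).symm z) t) l) :
    IsAugDiag (chartMetric g x₀) (coordTensor A x₀)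
      (fun x => u ((extChartAt (𝓡∂ n) x₀).symm x) t) z t l := by
  have hs := (extChartAt (𝓡∂ n) x₀).map_target hz
  have hg := grad_eq_covecFrom hz (hu.mdifferentiableAt (by norm_num))
  have hhess := hess_eq g hz hz0 hu
  set y := (extChartAt (𝓡∂ n) x₀).symm z with hy
  rw [fderivWithin_of_mem_nhds (range_model_mem_nhds hz0)] at hg
  obtain ⟨e, he, hl⟩ := h
  have hc : ∀ i, vecFrom x₀ y (tangentCoordChange (𝓡∂ n) y x₀ y (e i)) = e i :=
    fun i => vecFrom_coord hs (e i)
  refine ⟨fun i => tangentCoordChange (𝓡∂ n) y x₀ y (e i), fun i j => ?_, fun i j => ?_⟩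
  · rw [chartMetric_eq g hy.symm, hc, hc, he]
  · rw [← hl i j, augHess, coordTensor_eq A hy.symm, hc, hc]
    congr 1
    · have := hhess (tangentCoordChange (𝓡∂ n) y x₀ y (e i))
        (tangentCoordChange (𝓡∂ n) y x₀ y (e j))
      rw [hc, hc] at this
      exact this.symm
    · rw [hg]
      rfl

end Coefficients

/-! ### Finite covers by controlled half balls -/

section GoodCharts

open Topology Filter Bundle

set_option maxSynthPendingDepth 3

variable {n : ℕ} [NeZero n] {M : Type*} [TopologicalSpace M]
  [ChartedSpace (EuclideanHalfSpace n) M]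

/-- The closed half ball of radius `3 * ρ` around the centre of the preferred chart at `x₀`. -/
def halfBall (n : ℕ) [NeZero n] {M : Type*} [TopologicalSpace M]
    [ChartedSpace (EuclideanHalfSpace n) M] (x₀ : M) (ρ : ℝ) : Set (Model n) :=
  Metric.closedBall (extChartAt (𝓡∂ n) x₀ x₀) (3 * ρ) ∩ range (𝓡∂ n)

/-- The interior of `halfBall n x₀ ρ`. -/
def openHalfBall (n : ℕ) [NeZero n] {M : Type*} [TopologicalSpace M]
    [ChartedSpace (EuclideanHalfSpace n) M] (x₀ : M) (ρ : ℝ) : Set (Model n) :=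
  Metric.ball (extChartAt (𝓡∂ n) x₀ x₀) (3 * ρ) ∩ {z | 0 < z 0}

theorem isCompact_halfBall (x₀ : M) (ρ : ℝ) : IsCompact (halfBall n x₀ ρ) :=
  (isCompact_closedBall _ _).inter_right (𝓡∂ n).isClosed_range

theorem convex_halfBall (x₀ : M) (ρ : ℝ) : Convex ℝ (halfBall n x₀ ρ) :=
  (convex_closedBall _ _).inter (𝓡∂ n).convex_range

theorem openHalfBall_subset (x₀ : M) (ρ : ℝ) : openHalfBall n x₀ ρ ⊆ halfBall n x₀ ρ :=
  fun _ hz => ⟨Metric.ball_subset_closedBall hz.1, mem_range_model_iff.2 hz.2.le⟩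

theorem isOpen_pos : IsOpen {z : Model n | 0 < z 0} :=
  isOpen_lt continuous_const (EuclideanSpace.proj (𝕜 := ℝ) (0 : Fin n)).continuous

theorem isOpen_openHalfBall (x₀ : M) (ρ : ℝ) : IsOpen (openHalfBall n x₀ ρ) :=
  Metric.isOpen_ball.inter isOpen_pos

theorem convex_openHalfBall (x₀ : M) (ρ : ℝ) : Convex ℝ (openHalfBall n x₀ ρ) :=
  (convex_ball _ _).inter (convex_halfSpace_gt
    (EuclideanSpace.proj (𝕜 := ℝ) (0 : Fin n)).toLinearMap.isLinear 0)

variable [IsManifold (𝓡∂ n) ∞ M]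

/-- A half ball in the preferred chart at `x₀` on which the metric is controlled by `C`. -/
structure GoodChart (g : Metric n M) (x₀ : M) (ρ C : ℝ) : Prop where
  pos : 0 < ρ
  subset_target : halfBall n x₀ ρ ⊆ (extChartAt (𝓡∂ n) x₀).target
  metricBounds : MetricBounds (chartMetric g x₀) (openHalfBall n x₀ ρ) C
  sq_norm_le : ∀ z ∈ halfBall n x₀ ρ, ∀ a, ‖a‖ ^ 2 ≤ C * chartMetric g x₀ z a a
  norm_le : ∀ z ∈ halfBall n x₀ ρ, ‖chartMetric g x₀ z‖ ≤ C
  norm_sub_le : ∀ z ∈ halfBall n x₀ ρ, ∀ z' ∈ halfBall n x₀ ρ,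
    ‖chartMetric g x₀ z - chartMetric g x₀ z'‖ ≤ C * ‖z - z'‖

variable {g : Metric n M}

theorem chartMetric_nonneg {x₀ : M} {z : Model n} (hz : z ∈ (extChartAt (𝓡∂ n) x₀).target)
    (a : Model n) : 0 ≤ chartMetric g x₀ z a a := by
  by_cases h : a = 0
  · simp [h]
  · exact (chartMetric_pos g hz h).le

theorem GoodChart.mono {x₀ : M} {ρ C C' : ℝ} (h : GoodChart g x₀ ρ C) (hC : C ≤ C') :
    GoodChart g x₀ ρ C' := by
  have hs : ∀ z ∈ halfBall n x₀ ρ, ∀ a, ‖a‖ ^ 2 ≤ C' * chartMetric g x₀ z a a := fun z hz a =>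
    (h.sq_norm_le z hz a).trans
      (mul_le_mul_of_nonneg_right hC (chartMetric_nonneg (h.subset_target hz) a))
  refine ⟨h.pos, h.subset_target, ?_, hs, fun z hz => (h.norm_le z hz).trans hC,
    fun z hz z' hz' => (h.norm_sub_le z hz z' hz').trans (by gcongr)⟩
  have hm := h.metricBounds
  exact ⟨hm.isOpen, hm.convex, hm.smooth, hm.symm, hm.one_le.trans hC,
    fun z hz a => hs z (openHalfBall_subset _ _ hz) a, fun z hz => (hm.norm_le z hz).trans hC,
    fun z hz => (hm.norm_fderiv_le z hz).trans hC,
    fun z hz => (hm.norm_fderiv_fderiv_le z hz).trans hC⟩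

theorem exists_bound_derivatives {E F : Type*} [NormedAddCommGroup E] [NormedSpace ℝ E]
    [NormedAddCommGroup F] [NormedSpace ℝ F] {G : E → F} {S K : Set E} (hG : ContDiffOn ℝ ∞ G S)
    (hS : UniqueDiffOn ℝ S) (hK : IsCompact K) (hKS : K ⊆ S) :
    ∃ C, ∀ z ∈ K, ‖G z‖ ≤ C ∧ ‖fderivWithin ℝ G S z‖ ≤ C ∧
      ‖fderivWithin ℝ (fderivWithin ℝ G S) S z‖ ≤ C := by
  have h1 : ContDiffOn ℝ ∞ (fderivWithin ℝ G S) S := hG.fderivWithin hS (by simp)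
  have h2 : ContDiffOn ℝ ∞ (fderivWithin ℝ (fderivWithin ℝ G S) S) S := h1.fderivWithin hS (by simp)
  obtain ⟨C0, hC0⟩ := hK.exists_bound_of_continuousOn (hG.continuousOn.mono hKS)
  obtain ⟨C1, hC1⟩ := hK.exists_bound_of_continuousOn (h1.continuousOn.mono hKS)
  obtain ⟨C2, hC2⟩ := hK.exists_bound_of_continuousOn (h2.continuousOn.mono hKS)
  exact ⟨max C0 (max C1 C2), fun z hz => ⟨(hC0 z hz).trans (le_max_left _ _),
    (hC1 z hz).trans ((le_max_left _ _).trans (le_max_right _ _)),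
    (hC2 z hz).trans ((le_max_right _ _).trans (le_max_right _ _))⟩⟩

theorem exists_goodChart (g : Metric n M) (x₀ : M) : ∃ ρ C, GoodChart g x₀ ρ C := by
  obtain ⟨r, hr, hrt⟩ := Metric.mem_nhdsWithin_iff.1
    (extChartAt_target_mem_nhdsWithin (I := 𝓡∂ n) x₀)
  set ρ := r / 4 with hρ
  have hρ0 : 0 < ρ := by positivity
  have hsub : halfBall n x₀ ρ ⊆ (extChartAt (𝓡∂ n) x₀).target := fun z hz =>
    hrt ⟨Metric.closedBall_subset_ball (by linarith) hz.1, hz.2⟩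
  set S := (extChartAt (𝓡∂ n) x₀).target with hS
  set G := chartMetric g x₀ with hG
  have hu : UniqueDiffOn ℝ S := uniqueDiffOn_extChartAt_target x₀
  have h0 : ContDiffOn ℝ ∞ G S := contDiffOn_chartMetric g x₀
  have hK := isCompact_halfBall (n := n) x₀ ρ
  obtain ⟨C0, hC0⟩ := exists_bound_derivatives h0 hu hK hsub
  -- positive lower bound on the unit sphere
  obtain ⟨m, hm0, hm⟩ : ∃ m, 0 < m ∧
      ∀ r ∈ halfBall n x₀ ρ ×ˢ Metric.sphere (0 : Model n) 1, m ≤ G r.1 r.2 r.2 := by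
    refine (hK.prod (isCompact_sphere 0 1)).exists_forall_le' ?_ ?_
    · have hc : ContinuousOn (fun r : Model n × Model n => G r.1)
          (halfBall n x₀ ρ ×ˢ Metric.sphere (0 : Model n) 1) :=
        (h0.continuousOn.mono hsub).comp continuousOn_fst fun r hr => hr.1
      exact (hc.clm_apply continuousOn_snd).clm_apply continuousOn_snd
    · intro r hr
      refine chartMetric_pos g (hsub hr.1) fun h => ?_
      have := hr.2
      rw [h] at this
      simp at this
  have hlow : ∀ z ∈ halfBall n x₀ ρ, ∀ a, ‖a‖ ^ 2 ≤ m⁻¹ * G z a a := by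
    intro z hz a
    rcases eq_or_ne a 0 with rfl | ha
    · simp
    have hna : ‖a‖ ≠ 0 := norm_ne_zero_iff.2 ha
    have h3 := hm (z, ‖a‖⁻¹ • a) ⟨hz, by simp [norm_smul, inv_mul_cancel₀ hna]⟩
    simp only [map_smul, smul_apply, smul_eq_mul] at h3
    rw [inv_mul_eq_div, le_div_iff₀ hm0]
    have h4 : ‖a‖ ^ 2 * m ≤ ‖a‖ ^ 2 * (‖a‖⁻¹ * (‖a‖⁻¹ * G z a a)) := by gcongr
    refine h4.trans_eq ?_
    field_simp
  set C := max (max 1 m⁻¹) C0 with hC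
  have hCm : m⁻¹ ≤ C := (le_max_right _ _).trans (le_max_left _ _)
  have hCC0 : C0 ≤ C := le_max_right _ _
  have hlow' : ∀ z ∈ halfBall n x₀ ρ, ∀ a, ‖a‖ ^ 2 ≤ C * G z a a := fun z hz a =>
    (hlow z hz a).trans (mul_le_mul_of_nonneg_right hCm (chartMetric_nonneg (hsub hz) a))
  have hfd : ∀ z ∈ openHalfBall n x₀ ρ, fderiv ℝ G z = fderivWithin ℝ G S z := fun z hz =>
    (fderivWithin_of_mem_nhds (target_mem_nhds (hsub (openHalfBall_subset _ _ hz)) hz.2)).symm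
  have hfd2 : ∀ z ∈ openHalfBall n x₀ ρ, fderiv ℝ (fderiv ℝ G) z
      = fderivWithin ℝ (fderivWithin ℝ G S) S z := by
    intro z hz
    rw [fderivWithin_of_mem_nhds (target_mem_nhds (hsub (openHalfBall_subset _ _ hz)) hz.2)]
    refine Filter.EventuallyEq.fderiv_eq ?_
    filter_upwards [(isOpen_openHalfBall x₀ ρ).mem_nhds hz] with x hx using hfd x hx
  refine ⟨ρ, C, hρ0, hsub, ?_, hlow', fun z hz => (hC0 z hz).1.trans hCC0, ?_⟩
  · refine ⟨isOpen_openHalfBall x₀ ρ, convex_openHalfBall x₀ ρ,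
      h0.mono ((openHalfBall_subset _ _).trans hsub), fun z _ => chartMetric_symm g x₀ z,
      (le_max_left _ _).trans (le_max_left _ _),
      fun z hz => hlow' z (openHalfBall_subset _ _ hz),
      fun z hz => (hC0 z (openHalfBall_subset _ _ hz)).1.trans hCC0, fun z hz => ?_, fun z hz => ?_⟩
    · rw [hfd z hz]
      exact (hC0 z (openHalfBall_subset _ _ hz)).2.1.trans hCC0
    · rw [hfd2 z hz]
      exact (hC0 z (openHalfBall_subset _ _ hz)).2.2.trans hCC0
  · intro z hz z' hz'
    refine (convex_halfBall x₀ ρ).norm_image_sub_le_of_norm_hasFDerivWithin_le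
      (f' := fderivWithin ℝ G S) (fun x hx => ?_) (fun x hx => (hC0 x hx).2.1.trans hCC0) hz' hz
    exact ((h0.differentiableOn (by simp)) x (hsub hx)).hasFDerivWithinAt.mono hsub

/-- Finitely many controlled half balls cover a compact manifold. -/
theorem exists_goodCharts [CompactSpace M] (g : Metric n M) :
    ∃ (F : Finset M) (ρ : M → ℝ) (C : ℝ), (∀ x ∈ F, GoodChart g x (ρ x) C) ∧
      ∀ y, ∃ x ∈ F, y ∈ (extChartAt (𝓡∂ n) x).source ∧
        extChartAt (𝓡∂ n) x y ∈ Metric.ball (extChartAt (𝓡∂ n) x x) (ρ x) := by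
  choose ρ C hρC using exists_goodChart (n := n) (M := M) g
  have hopen : ∀ x, (extChartAt (𝓡∂ n) x).source ∩ extChartAt (𝓡∂ n) x ⁻¹'
      Metric.ball (extChartAt (𝓡∂ n) x x) (ρ x) ∈ 𝓝 x := fun x =>
    inter_mem (extChartAt_source_mem_nhds x)
      ((continuousAt_extChartAt x).preimage_mem_nhds (Metric.ball_mem_nhds _ (hρC x).pos))
  obtain ⟨F, -, hF⟩ := isCompact_univ.elim_nhds_subcover _ fun x _ => hopen x
  obtain ⟨C', hC'⟩ := (F.finite_toSet.image C).bddAbove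
  refine ⟨F, ρ, C', fun x hx => (hρC x).mono (hC' ?_), fun y => ?_⟩
  · exact mem_image_of_mem C hx
  · obtain ⟨x, hx, hy⟩ := mem_iUnion₂.1 (hF (mem_univ y))
    exact ⟨x, hx, hy.1, hy.2⟩

theorem exists_growth_bound [CompactSpace M] {T : ℝ} {φ : M → ℝ → ℝ} (h : IsGrowthBound T φ) :
    ∃ B, ∀ x, ∀ t ∈ Icc 0 T, φ x t ≤ B := by
  obtain ⟨B, hB⟩ := (isCompact_univ.prod isCompact_Icc).exists_bound_of_continuousOn h.1
  exact ⟨B, fun x t ht => (le_abs_self _).trans (hB (x, t) ⟨mem_univ _, ht⟩)⟩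

/-- The growth conditions in a controlled half ball. -/
theorem GoodChart.coeffBounds {x₀ : M} {ρ C : ℝ} (h : GoodChart g x₀ ρ C) {T γ γ₁ R B C' : ℝ}
    {A : TensorCoeff n M} {ψ : ScalarCoeff n M} (hA : SmoothTensor T A) (hψ : SmoothScalar T ψ)
    {ψ₁ ψ₃ : M → ℝ → ℝ} (hB0 : 0 ≤ B)
    (hB₁ : ∀ x, ∀ t ∈ Icc 0 T, ψ₁ x t ≤ B) (hB₃ : ∀ x, ∀ t ∈ Icc 0 T, ψ₃ x t ≤ B)
    (h1 : ∀ x, ∀ t ∈ Icc 0 T, ∀ p : Cotangent n x, R ≤ covecNorm g x p →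
      - radialDx g ψ x t p ≤ ψ₁ x t * (1 + covecNorm g x p ^ γ) ∧
      ∀ ξ, radialDxTensor g A x t p ξ
        ≤ ψ₁ x t * vecNorm g x ξ ^ 2 * (1 + covecNorm g x p ^ γ))
    (h3 : ∀ x, ∀ t ∈ Icc 0 T, ∀ p : Cotangent n x, R ≤ covecNorm g x p →
      ∀ ξ η, |A x t p ξ η|
        ≤ ψ₃ x t * vecNorm g x ξ * vecNorm g x η * (1 + covecNorm g x p ^ γ₁))
    (hC' : B * C ≤ C') :
    CoeffBounds (chartMetric g x₀) (openHalfBall n x₀ ρ) C' T R γ γ₁ (coordScalar ψ x₀)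
      (coordTensor A x₀) := by
  have ht : ∀ z ∈ openHalfBall n x₀ ρ, z ∈ (extChartAt (𝓡∂ n) x₀).target := fun z hz =>
    h.subset_target (openHalfBall_subset _ _ hz)
  have hC1 : 1 ≤ C := h.metricBounds.one_le
  have hnorm : ∀ z (w : Model n) (P : ℝ), 0 < P → chartMetric g x₀ z w w = P ^ 2 →
      covecNorm g ((extChartAt (𝓡∂ n) x₀).symm z) (g.inner ((extChartAt (𝓡∂ n) x₀).symm z)
          (vecFrom x₀ ((extChartAt (𝓡∂ n) x₀).symm z) w)) = P := by
    intro z w P hP hw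
    rw [covecNorm, sharp_inner, vecNorm, ← chartMetric_apply, hw, Real.sqrt_sq hP.le]
  have hvec : ∀ z ∈ openHalfBall n x₀ ρ, ∀ ξ : Model n,
      vecNorm g ((extChartAt (𝓡∂ n) x₀).symm z) (vecFrom x₀ ((extChartAt (𝓡∂ n) x₀).symm z) ξ) ^ 2
        ≤ C * ‖ξ‖ ^ 2 := by
    intro z hz ξ
    rw [vecNorm, ← chartMetric_apply, Real.sq_sqrt (chartMetric_nonneg (ht z hz) ξ)]
    have := abs_form_le (chartMetric g x₀ z) (h.norm_le z (openHalfBall_subset _ _ hz)) ξ ξ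
    linarith [le_abs_self (chartMetric g x₀ z ξ ξ)]
  have hcov : ∀ z ∈ openHalfBall n x₀ ρ, ∀ w : Model n,
      covecFrom x₀ ((extChartAt (𝓡∂ n) x₀).symm z) (chartMetric g x₀ z w)
        = g.inner ((extChartAt (𝓡∂ n) x₀).symm z)
          (vecFrom x₀ ((extChartAt (𝓡∂ n) x₀).symm z) w) := by
    intro z hz w
    have hs := (extChartAt (𝓡∂ n) x₀).map_target (ht z hz)
    ext a
    have h4 := covecFrom_vecFrom hs (chartMetric g x₀ z w)
      (tangentCoordChange (𝓡∂ n) ((extChartAt (𝓡∂ n) x₀).symm z) x₀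
        ((extChartAt (𝓡∂ n) x₀).symm z) a)
    rw [chartMetric_apply, vecFrom_coord hs] at h4
    exact h4
  refine ⟨fun z hz t htT q => differentiableAt_coordScalar (hψ x₀) (ht z hz) hz.2 htT q,
    fun z hz t htT q ξ => ?_, fun z hz t htT w P hR hP hw => ?_,
    fun z hz t htT w P hR hP hw ξ => ?_, fun z hz t htT w P hR hP hw ξ η => ?_⟩
  · exact differentiableAt_coordScalar (hA x₀ ξ ξ) (ht z hz) hz.2 htT q
  · rw [radialDx_coord g hψ htT (ht z hz) hz.2 w]
    have h4 := (h1 _ t htT _ (hR.trans_eq (hnorm z w P hP hw).symm)).1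
    rw [hnorm z w P hP hw] at h4
    refine h4.trans ?_
    have h5 := hB₁ ((extChartAt (𝓡∂ n) x₀).symm z) t htT
    have h6 : B ≤ C' := by nlinarith
    have := Real.rpow_nonneg hP.le γ
    gcongr
    exact h5.trans h6
  · rw [radialDxTensor_coord g hA htT (ht z hz) hz.2 w ξ]
    have h4 := (h1 _ t htT _ (hR.trans_eq (hnorm z w P hP hw).symm)).2
      (vecFrom x₀ ((extChartAt (𝓡∂ n) x₀).symm z) ξ)
    rw [hnorm z w P hP hw] at h4
    refine h4.trans ?_
    have := Real.rpow_nonneg hP.le γ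
    have h6 := mul_le_mul (hB₁ ((extChartAt (𝓡∂ n) x₀).symm z) t htT) (hvec z hz ξ)
      (sq_nonneg _) hB0
    have h7 : B * (C * ‖ξ‖ ^ 2) ≤ C' * ‖ξ‖ ^ 2 := by
      rw [← mul_assoc]; gcongr
    exact mul_le_mul_of_nonneg_right (h6.trans h7) (by positivity)
  · rw [coordTensor_apply, hcov z hz]
    have h4 := h3 _ t htT _ (hR.trans_eq (hnorm z w P hP hw).symm)
      (vecFrom x₀ ((extChartAt (𝓡∂ n) x₀).symm z) ξ) (vecFrom x₀ ((extChartAt (𝓡∂ n) x₀).symm z) η)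
    rw [hnorm z w P hP hw] at h4
    refine h4.trans ?_
    have := Real.rpow_nonneg hP.le γ₁
    have hv : ∀ ξ, vecNorm g ((extChartAt (𝓡∂ n) x₀).symm z)
        (vecFrom x₀ ((extChartAt (𝓡∂ n) x₀).symm z) ξ) ≤ Real.sqrt C * ‖ξ‖ := by
      intro ξ
      refine Real.le_sqrt_of_sq_le (hvec z hz ξ) |>.trans_eq ?_
      rw [Real.sqrt_mul (by linarith), Real.sqrt_sq (norm_nonneg _)]
    have h6 := mul_le_mul (mul_le_mul (hB₃ ((extChartAt (𝓡∂ n) x₀).symm z) t htT) (hv ξ)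
      (Real.sqrt_nonneg _) hB0) (hv η) (Real.sqrt_nonneg _) (by positivity)
    have h7 : B * (Real.sqrt C * ‖ξ‖) * (Real.sqrt C * ‖η‖) ≤ C' * ‖ξ‖ * ‖η‖ := by
      have : B * (Real.sqrt C * ‖ξ‖) * (Real.sqrt C * ‖η‖) = B * C * ‖ξ‖ * ‖η‖ := by
        rw [show B * (Real.sqrt C * ‖ξ‖) * (Real.sqrt C * ‖η‖)
          = B * (Real.sqrt C * Real.sqrt C) * ‖ξ‖ * ‖η‖ by ring, Real.mul_self_sqrt (by linarith)]
      rw [this]; gcongr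
    exact mul_le_mul_of_nonneg_right (h6.trans h7) (by positivity)

end GoodCharts

/-! ### Functions of class `C³` in charts -/

section Solutions

open Topology Filter Bundle

set_option maxSynthPendingDepth 3

variable {n : ℕ} [NeZero n] {M : Type*} [TopologicalSpace M]
  [ChartedSpace (EuclideanHalfSpace n) M] {T : ℝ} {u : M → ℝ → ℝ}

/-- The function `u` in the coordinates of the preferred chart at `x₀`. -/
def coordFn (n : ℕ) [NeZero n] {M : Type*} [TopologicalSpace M]
    [ChartedSpace (EuclideanHalfSpace n) M] (u : M → ℝ → ℝ) (x₀ : M) (t : ℝ) (z : Model n) : ℝ :=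
  u ((extChartAt (𝓡∂ n) x₀).symm z) t

/-- The spatial differential of `u` in the coordinates of the preferred chart at `x₀`. -/
def coordDeriv (n : ℕ) [NeZero n] {M : Type*} [TopologicalSpace M]
    [ChartedSpace (EuclideanHalfSpace n) M] (u : M → ℝ → ℝ) (x₀ : M) (t : ℝ) (z : Model n) :
    Model n →L[ℝ] ℝ :=
  fderivWithin ℝ (coordFn n u x₀ t) (range (𝓡∂ n)) z

theorem IsCk.contMDiff_slice {k : ℕ} (hu : IsCk n k T u) {t : ℝ} (ht : t ∈ Icc 0 T) :
    ContMDiff (𝓡∂ n) 𝓘(ℝ, ℝ) k (fun x => u x t) := by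
  have h1 : ContMDiff (𝓡∂ n) ((𝓡∂ n).prod 𝓘(ℝ, ℝ)) k (fun x : M => (x, t)) :=
    contMDiff_id.prodMk contMDiff_const
  exact hu.comp_contMDiff h1 fun x => ⟨mem_univ _, ht⟩

theorem IsCk.hasDerivWithinAt_time (hu : IsCk n 3 T u) (x : M) {t : ℝ} (ht : t ∈ Icc 0 T) :
    HasDerivWithinAt (fun s => u x s) (timeDeriv T u x t) (Icc 0 T) t := by
  have h1 : ContMDiff 𝓘(ℝ, ℝ) ((𝓡∂ n).prod 𝓘(ℝ, ℝ)) (3 : ℕ) (fun s : ℝ => (x, s)) :=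
    contMDiff_const.prodMk contMDiff_id
  have h2 : ContMDiffOn 𝓘(ℝ, ℝ) 𝓘(ℝ, ℝ) (3 : ℕ) (fun s => u x s) (Icc 0 T) :=
    hu.comp h1.contMDiffOn fun s hs => ⟨mem_univ _, hs⟩
  rw [contMDiffOn_iff_contDiffOn] at h2
  exact (h2.differentiableOn (by norm_num) t ht).hasDerivWithinAt

theorem IsCk.mdifferentiableAt (hu : IsCk n 3 T u) {t : ℝ} (ht : t ∈ Icc 0 T) (x : M) :
    MDifferentiableAt (𝓡∂ n) 𝓘(ℝ, ℝ) (fun x => u x t) x :=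
  (hu.contMDiff_slice ht).mdifferentiable (by norm_num) x

theorem symm_extChart_mem_halfBall {x y : M} {ρ : ℝ} (hy : y ∈ (extChartAt (𝓡∂ n) x).source)
    (h : extChartAt (𝓡∂ n) x y ∈ Metric.ball (extChartAt (𝓡∂ n) x x) ρ) :
    extChartAt (𝓡∂ n) x y ∈ halfBall n x ρ := by
  have hρ : 0 < ρ := dist_nonneg.trans_lt (Metric.mem_ball.1 h)
  exact ⟨Metric.closedBall_subset_closedBall (by linarith) (Metric.ball_subset_closedBall h),
    target_subset_range x ((extChartAt (𝓡∂ n) x).map_source hy)⟩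

/-- At a positive time at which a difference of two values of `u` is maximal, its time derivative is
nonnegative. -/
theorem IsCk.timeDeriv_le (hu : IsCk n 3 T u) {x y : M} {t : ℝ} (ht : t ∈ Icc 0 T) (ht0 : 0 < t)
    (hmax : ∀ s ∈ Icc 0 T, u x s - u y s ≤ u x t - u y t) :
    timeDeriv T u y t ≤ timeDeriv T u x t := by
  have h := ((hu.hasDerivWithinAt_time x ht).sub (hu.hasDerivWithinAt_time y ht)).mono
    (Icc_subset_Icc_right ht.2 : Icc 0 t ⊆ Icc 0 T)
  have h2 : IsLocalMaxOn (fun s => u x s - u y s) (Icc 0 t) t := by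
    filter_upwards [self_mem_nhdsWithin] with s hs
    exact hmax s ⟨hs.1, hs.2.trans ht.2⟩
  have h3 : 0 - t ∈ posTangentConeAt (Icc 0 t) t :=
    sub_mem_posTangentConeAt_of_segment_subset (by rw [segment_symm, segment_eq_Icc ht0.le])
  have h4 := h2.hasFDerivWithinAt_nonpos h.hasFDerivWithinAt h3
  rw [ContinuousLinearMap.toSpanSingleton_apply, smul_eq_mul] at h4
  nlinarith

variable [IsManifold (𝓡∂ n) ∞ M] {x₀ : M} {z : Model n}

theorem IsCk.contDiffOn_coord (hu : IsCk n 3 T u) (x₀ : M) :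
    ContDiffOn ℝ (3 : ℕ) (fun r : Model n × ℝ => coordFn n u x₀ r.2 r.1)
      ((extChartAt (𝓡∂ n) x₀).target ×ˢ Icc 0 T) := by
  have : IsManifold (𝓡∂ n) (3 : ℕ) M :=
    IsManifold.of_le (n := ∞) (WithTop.coe_le_coe.2 le_top)
  rw [← contMDiffOn_iff_contDiffOn]
  have h1 : ContMDiffOn 𝓘(ℝ, Model n × ℝ) (𝓡∂ n) (3 : ℕ)
      (fun r : Model n × ℝ => (extChartAt (𝓡∂ n) x₀).symm r.1)
      ((extChartAt (𝓡∂ n) x₀).target ×ˢ Icc 0 T) :=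
    (contMDiffOn_extChartAt_symm x₀).comp
      (contDiff_fst.contMDiff.contMDiffOn) fun r hr => hr.1
  have h2 : ContMDiffOn 𝓘(ℝ, Model n × ℝ) 𝓘(ℝ, ℝ) (3 : ℕ) (fun r : Model n × ℝ => r.2)
      ((extChartAt (𝓡∂ n) x₀).target ×ˢ Icc 0 T) := contDiff_snd.contMDiff.contMDiffOn
  exact hu.comp (h1.prodMk h2) fun r hr => ⟨mem_univ _, hr.2⟩

theorem IsCk.continuousOn_coord (hu : IsCk n 3 T u) (x₀ : M) :
    ContinuousOn (fun r : Model n × ℝ => coordFn n u x₀ r.2 r.1)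
      ((extChartAt (𝓡∂ n) x₀).target ×ˢ Icc 0 T) :=
  (hu.contDiffOn_coord x₀).continuousOn

theorem IsCk.contDiffOn_coordFn (hu : IsCk n 3 T u) {t : ℝ} (ht : t ∈ Icc 0 T) :
    ContDiffOn ℝ (3 : ℕ) (coordFn n u x₀ t) (extChartAt (𝓡∂ n) x₀).target := by
  have h : ContDiffOn ℝ (3 : ℕ) (fun z : Model n => (z, t)) (extChartAt (𝓡∂ n) x₀).target := by
    fun_prop
  exact (hu.contDiffOn_coord x₀).comp h fun z hz => ⟨hz, ht⟩

theorem IsCk.hasFDerivWithinAt_coordFn (hu : IsCk n 3 T u) {t : ℝ} (ht : t ∈ Icc 0 T)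
    (hz : z ∈ (extChartAt (𝓡∂ n) x₀).target) :
    HasFDerivWithinAt (coordFn n u x₀ t) (coordDeriv n u x₀ t z) (range (𝓡∂ n)) z :=
  (hasFDerivWithinAt_coord hz (hu.mdifferentiableAt ht _)).differentiableWithinAt.hasFDerivWithinAt

variable {g : Metric n M}

/-- The coordinates of the gradient. -/
theorem IsCk.exists_gradient (hu : IsCk n 3 T u) {t : ℝ} (ht : t ∈ Icc 0 T)
    (hz : z ∈ (extChartAt (𝓡∂ n) x₀).target) :
    ∃ w, (∀ a, coordDeriv n u x₀ t z a = chartMetric g x₀ z w a) ∧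
      chartMetric g x₀ z w w = gradNorm g u ((extChartAt (𝓡∂ n) x₀).symm z, t) ^ 2 := by
  have hs := (extChartAt (𝓡∂ n) x₀).map_target hz
  have hd : grad (fun x => u x t) ((extChartAt (𝓡∂ n) x₀).symm z)
      = covecFrom x₀ ((extChartAt (𝓡∂ n) x₀).symm z) (coordDeriv n u x₀ t z) :=
    grad_eq_covecFrom hz (hu.mdifferentiableAt ht _)
  have hpos := chartMetric_nonneg (g := g) hz
  set y := (extChartAt (𝓡∂ n) x₀).symm z with hy
  set s := sharp g y (grad (fun x => u x t) y) with hsd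
  have hc := vecFrom_coord hs s
  refine ⟨tangentCoordChange (𝓡∂ n) y x₀ y s, fun a => ?_, ?_⟩
  · rw [chartMetric_eq g hy.symm, hc, hsd, inner_sharp, hd, covecFrom_vecFrom hs]
  · have h1 := hpos (tangentCoordChange (𝓡∂ n) y x₀ y s)
    rw [chartMetric_eq g hy.symm, hc] at h1 ⊢
    exact (Real.sq_sqrt h1).symm

theorem gradNorm_nonneg (g : Metric n M) (u : M → ℝ → ℝ) (r : M × ℝ) : 0 ≤ gradNorm g u r :=
  Real.sqrt_nonneg _

theorem GoodChart.norm_coordDeriv_le {ρ C : ℝ} (h : GoodChart g x₀ ρ C) (hu : IsCk n 3 T u)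
    {t : ℝ} (ht : t ∈ Icc 0 T) (hz : z ∈ halfBall n x₀ ρ) :
    ‖coordDeriv n u x₀ t z‖ ≤ C ^ 2 * gradNorm g u ((extChartAt (𝓡∂ n) x₀).symm z, t) := by
  obtain ⟨w, hw, hww⟩ := hu.exists_gradient (g := g) ht (h.subset_target hz)
  have hC := h.metricBounds.one_le
  have hN := gradNorm_nonneg g u ((extChartAt (𝓡∂ n) x₀).symm z, t)
  set N := gradNorm g u ((extChartAt (𝓡∂ n) x₀).symm z, t)
  have h1 : ‖w‖ ≤ C * N := by
    refine abs_le_of_sq_le_sq' ?_ (by positivity) |>.2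
    have := h.sq_norm_le z hz w
    rw [hww] at this
    nlinarith [sq_nonneg N]
  refine ContinuousLinearMap.opNorm_le_bound _ (by positivity) fun a => ?_
  rw [hw, Real.norm_eq_abs]
  refine (abs_form_le _ (h.norm_le z hz) w a).trans ?_
  have : C * ‖w‖ ≤ C * (C * N) := by gcongr
  calc C * ‖w‖ * ‖a‖ ≤ C * (C * N) * ‖a‖ := by gcongr
    _ = C ^ 2 * N * ‖a‖ := by ring

theorem GoodChart.gradNorm_le {ρ C : ℝ} (h : GoodChart g x₀ ρ C) (hu : IsCk n 3 T u)
    {t : ℝ} (ht : t ∈ Icc 0 T) (hz : z ∈ halfBall n x₀ ρ) :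
    gradNorm g u ((extChartAt (𝓡∂ n) x₀).symm z, t) ≤ C * ‖coordDeriv n u x₀ t z‖ := by
  obtain ⟨w, hw, hww⟩ := hu.exists_gradient (g := g) ht (h.subset_target hz)
  have hC := h.metricBounds.one_le
  have hN := gradNorm_nonneg g u ((extChartAt (𝓡∂ n) x₀).symm z, t)
  set N := gradNorm g u ((extChartAt (𝓡∂ n) x₀).symm z, t)
  have h1 : ‖w‖ ≤ C * N := by
    refine abs_le_of_sq_le_sq' ?_ (by positivity) |>.2
    have := h.sq_norm_le z hz w
    rw [hww] at this
    nlinarith [sq_nonneg N]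
  have h2 : N ^ 2 ≤ ‖coordDeriv n u x₀ t z‖ * (C * N) := by
    rw [← hww, ← hw]
    exact ((le_abs_self _).trans ((coordDeriv n u x₀ t z).le_opNorm w)).trans (by gcongr)
  rcases hN.eq_or_lt with h0 | h0
  · rw [← h0]; positivity
  · refine le_of_mul_le_mul_right (a := N) ?_ h0
    linarith

theorem GoodChart.exists_gradNorm_le {ρ C : ℝ} (h : GoodChart g x₀ ρ C) (hT : 0 < T)
    (hu : IsCk n 3 T u) :
    ∃ B, ∀ z ∈ halfBall n x₀ ρ, ∀ t ∈ Icc 0 T,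
      gradNorm g u ((extChartAt (𝓡∂ n) x₀).symm z, t) ≤ B := by
  set S := (extChartAt (𝓡∂ n) x₀).target with hS
  have hSu : UniqueDiffOn ℝ (S ×ˢ Icc 0 T) :=
    (uniqueDiffOn_extChartAt_target x₀).prod (uniqueDiffOn_Icc hT)
  set F : Model n × ℝ → ℝ := fun r => coordFn n u x₀ r.2 r.1 with hF
  have hc : ContDiffOn ℝ (3 : ℕ) F (S ×ˢ Icc 0 T) := hu.contDiffOn_coord x₀
  have hc' : ContinuousOn (fderivWithin ℝ F (S ×ˢ Icc 0 T)) (S ×ˢ Icc 0 T) :=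
    hc.continuousOn_fderivWithin hSu (by norm_num)
  obtain ⟨B, hB⟩ :=
    ((isCompact_halfBall (n := n) x₀ ρ).prod isCompact_Icc).exists_bound_of_continuousOn
    (hc'.mono (prod_mono h.subset_target (Subset.refl (Icc 0 T))))
  refine ⟨C * B, fun z hz t ht => (h.gradNorm_le hu ht hz).trans ?_⟩
  have hzS := h.subset_target hz
  have hC := h.metricBounds.one_le
  refine mul_le_mul_of_nonneg_left ?_ (by linarith)
  have h1 := (hc.differentiableOn (by norm_num) (z, t) ⟨hzS, ht⟩).hasFDerivWithinAt
  have h2 : HasFDerivWithinAt (fun z : Model n => (z, t)) (ContinuousLinearMap.inl ℝ (Model n) ℝ)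
      S z := (hasFDerivAt_prodMk_left z t).hasFDerivWithinAt
  have h3 : HasFDerivWithinAt (coordFn n u x₀ t)
      ((fderivWithin ℝ F (S ×ˢ Icc 0 T) (z, t)).comp (ContinuousLinearMap.inl ℝ (Model n) ℝ)) S z :=
    HasFDerivWithinAt.comp (g := F) (t := S ×ˢ Icc 0 T) z h1 h2
      (show MapsTo (fun z : Model n => (z, t)) S (S ×ˢ Icc 0 T) from fun x hx => ⟨hx, ht⟩)
  have h4 := (hu.hasFDerivWithinAt_coordFn ht hzS).mono (target_subset_range x₀)
  have h5 := (uniqueDiffOn_extChartAt_target x₀ z hzS).eq h4 h3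
  rw [h5]
  refine (ContinuousLinearMap.opNorm_comp_le _ _).trans ?_
  have h6 := hB (z, t) ⟨hz, ht⟩
  have h7 : ‖ContinuousLinearMap.inl ℝ (Model n) ℝ‖ ≤ 1 :=
    ContinuousLinearMap.norm_inl_le_one ℝ (Model n) ℝ
  exact (mul_le_mul h6 h7 (norm_nonneg _) ((norm_nonneg _).trans h6)).trans_eq (mul_one B)

theorem exists_gradNorm_le [CompactSpace M] (hT : 0 < T) (hu : IsCk n 3 T u) :
    ∃ B, ∀ x, ∀ t ∈ Icc 0 T, gradNorm g u (x, t) ≤ B := by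
  obtain ⟨F, ρ, C, hF, hcov⟩ := exists_goodCharts g
  choose! B hB using fun x (hx : x ∈ F) => (hF x hx).exists_gradNorm_le hT hu
  obtain ⟨B', hB'⟩ := (F.finite_toSet.image B).bddAbove
  refine ⟨B', fun y t ht => ?_⟩
  obtain ⟨x, hx, hy, hyx⟩ := hcov y
  have h := hB x hx _ (symm_extChart_mem_halfBall hy hyx) t ht
  rw [(extChartAt (𝓡∂ n) x).left_inv hy] at h
  exact h.trans (hB' (mem_image_of_mem B hx))

end Solutions

/-! ### Compactness of short curves and existence of maximizers -/

section ShortCurves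

open Topology Filter MeasureTheory

set_option maxSynthPendingDepth 3

variable {n : ℕ}

theorem energy_congr {G : Model n → Model n →L[ℝ] Model n →L[ℝ] ℝ} {c v c' v' : ℝ → Model n}
    (hc : ∀ τ ∈ Icc (0 : ℝ) 1, c' τ = c τ) (hv : ∀ τ ∈ Icc (0 : ℝ) 1, v' τ = v τ) :
    energy G c' v' = energy G c v := by
  refine intervalIntegral.integral_congr fun τ hτ => ?_
  rw [uIcc_of_le zero_le_one] at hτ
  simp only [hc τ hτ, hv τ hτ]

/-- The function `U (c 1) - U (c 0) - K φ (√E)` of a curve `c` with energy `E`. -/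
def twoPoint (G : Model n → Model n →L[ℝ] Model n →L[ℝ] ℝ) (U : Model n → ℝ) (α K : ℝ)
    (c v : ℝ → Model n) : ℝ :=
  U (c 1) - U (c 0) - K * lengthFn α (Real.sqrt (energy G c v))

theorem twoPoint_congr {G : Model n → Model n →L[ℝ] Model n →L[ℝ] ℝ} {U : Model n → ℝ} {α K : ℝ}
    {c v c' v' : ℝ → Model n}
    (hc : ∀ τ ∈ Icc (0 : ℝ) 1, c' τ = c τ) (hv : ∀ τ ∈ Icc (0 : ℝ) 1, v' τ = v τ) :
    twoPoint G U α K c' v' = twoPoint G U α K c v := by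
  rw [twoPoint, twoPoint, energy_congr hc hv, hc 1 (by simp), hc 0 (by simp)]

theorem continuous_lengthFn {α : ℝ} (hα : 0 < α) : Continuous (lengthFn α) :=
  continuous_id.sub (Real.continuous_rpow_const (by linarith))

/-- The space of continuous velocities of curves parametrized by the unit interval, with the uniform
norm. -/
abbrev VelocityField (n : ℕ) : Type :=
  BoundedContinuousFunction (Icc (0 : ℝ) 1) (Model n)

/-- Constant extension of a function on the unit interval. -/
def extendVel (w : VelocityField n) (τ : ℝ) : Model n :=
  w (projIcc 0 1 zero_le_one τ)

/-- The curve starting at `x.1` with velocity `x.2`. -/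
def curveOf (x : Model n × VelocityField n) (τ : ℝ) : Model n :=
  x.1 + ∫ σ in (0 : ℝ)..τ, extendVel x.2 σ

theorem continuous_extendVel :
    Continuous fun p : VelocityField n × ℝ =>
      extendVel p.1 p.2 :=
  Continuous.eval continuous_fst (continuous_projIcc.comp continuous_snd)

theorem continuous_curveOf :
    Continuous fun p : (Model n × VelocityField n) × ℝ =>
      curveOf p.1 p.2 := by
  refine (continuous_fst.comp continuous_fst).add ?_
  refine intervalIntegral.continuous_parametric_intervalIntegral_of_continuous
    (f := fun (p : (Model n × VelocityField n) × ℝ) (σ : ℝ) =>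
      extendVel p.1.2 σ) ?_ continuous_snd
  exact continuous_extendVel.comp
    ((continuous_snd.comp (continuous_fst.comp continuous_fst)).prodMk continuous_snd)

theorem hasDerivAt_curveOf (x : Model n × VelocityField n)
    (τ : ℝ) : HasDerivAt (curveOf x) (extendVel x.2 τ) τ := by
  have hc : Continuous (extendVel x.2) :=
    continuous_extendVel.comp (continuous_const.prodMk continuous_id)
  exact (intervalIntegral.integral_hasDerivAt_right (hc.intervalIntegrable _ _)
    (hc.stronglyMeasurableAtFilter _ _) hc.continuousAt).const_add _

variable [NeZero n]

/-- Curves `c` with velocity `v` on `[0, 1]` in the closed half space that start within the distance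
`ρ` of `z₀`, have end points at distance at most `r` and are almost straight, in a scale invariant
sense measured by `η`. -/
structure IsShortCurve (z₀ : Model n) (ρ η r : ℝ) (c v : ℝ → Model n) : Prop where
  hasDerivWithinAt : ∀ τ ∈ Icc (0 : ℝ) 1, HasDerivWithinAt c (v τ) (Icc 0 1) τ
  norm_velocity_sub_le : ∀ τ ∈ Icc (0 : ℝ) 1, ∀ σ ∈ Icc (0 : ℝ) 1,
    ‖v τ - v σ‖ ≤ η * ‖c 1 - c 0‖ * |τ - σ|
  nonneg : ∀ τ ∈ Icc (0 : ℝ) 1, 0 ≤ c τ 0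
  norm_base_le : ‖c 0 - z₀‖ ≤ ρ
  norm_chord_le : ‖c 1 - c 0‖ ≤ r

namespace IsShortCurve

variable {z₀ : Model n} {ρ η r : ℝ} {c v c' v' : ℝ → Model n}

theorem congr (h : IsShortCurve z₀ ρ η r c v) (hc : ∀ τ ∈ Icc (0 : ℝ) 1, c' τ = c τ)
    (hv : ∀ τ ∈ Icc (0 : ℝ) 1, v' τ = v τ) : IsShortCurve z₀ ρ η r c' v' := by
  have m0 : (0 : ℝ) ∈ Icc (0 : ℝ) 1 := by simp
  have m1 : (1 : ℝ) ∈ Icc (0 : ℝ) 1 := by simp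
  refine ⟨fun τ hτ => ?_, fun τ hτ σ hσ => ?_, fun τ hτ => ?_, ?_, ?_⟩
  · rw [hv τ hτ]
    exact (h.hasDerivWithinAt τ hτ).congr hc (hc τ hτ)
  · rw [hv τ hτ, hv σ hσ, hc 1 m1, hc 0 m0]
    exact h.norm_velocity_sub_le τ hτ σ hσ
  · rw [hc τ hτ]; exact h.nonneg τ hτ
  · rw [hc 0 m0]; exact h.norm_base_le
  · rw [hc 1 m1, hc 0 m0]; exact h.norm_chord_le

theorem continuousOn (h : IsShortCurve z₀ ρ η r c v) : ContinuousOn c (Icc 0 1) :=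
  fun τ hτ => (h.hasDerivWithinAt τ hτ).continuousWithinAt

theorem continuousOn_velocity (h : IsShortCurve z₀ ρ η r c v) : ContinuousOn v (Icc 0 1) := by
  refine (LipschitzOnWith.of_dist_le_mul (K := (η * ‖c 1 - c 0‖).toNNReal)
    fun τ hτ σ hσ => ?_).continuousOn
  rw [dist_eq_norm, Real.dist_eq]
  refine (h.norm_velocity_sub_le τ hτ σ hσ).trans ?_
  gcongr
  exact Real.le_coe_toNNReal _

/-- The velocity is close to the chord. -/
theorem norm_chord_sub_velocity_le (h : IsShortCurve z₀ ρ η r c v) (hη : 0 ≤ η) {τ : ℝ}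
    (hτ : τ ∈ Icc (0 : ℝ) 1) : ‖c 1 - c 0 - v τ‖ ≤ η * ‖c 1 - c 0‖ := by
  have h1 := (convex_Icc (0 : ℝ) 1).norm_image_sub_le_of_norm_hasDerivWithin_le
    (f := fun σ => c σ - σ • v τ) (f' := fun σ => v σ - v τ) (C := η * ‖c 1 - c 0‖)
    (fun σ hσ => ((h.hasDerivWithinAt σ hσ).sub
      ((hasDerivAt_id σ).smul_const (v τ)).hasDerivWithinAt).congr_deriv (by simp))
    (fun σ hσ => (h.norm_velocity_sub_le σ hσ τ hτ).trans (by
      refine mul_le_of_le_one_right (by positivity) (abs_le.2 ⟨?_, ?_⟩)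
      · linarith [hσ.1, hτ.2]
      · linarith [hσ.2, hτ.1]))
    (left_mem_Icc.2 zero_le_one) (right_mem_Icc.2 zero_le_one)
  have e : c 1 - (1 : ℝ) • v τ - (c 0 - (0 : ℝ) • v τ) = c 1 - c 0 - v τ := by
    rw [one_smul, zero_smul]; abel
  simp only [e, sub_zero, norm_one, mul_one] at h1
  exact h1

theorem norm_velocity_le (h : IsShortCurve z₀ ρ η r c v) (hη : 0 ≤ η) (hη1 : η ≤ 1 / 2) {τ : ℝ}
    (hτ : τ ∈ Icc (0 : ℝ) 1) : ‖v τ‖ ≤ 2 * ‖c 1 - c 0‖ := by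
  have h1 := h.norm_chord_sub_velocity_le hη hτ
  have h2 := norm_sub_norm_le (v τ) (c 1 - c 0)
  rw [norm_sub_rev (v τ)] at h2
  nlinarith [norm_nonneg (c 1 - c 0)]

theorem norm_chord_le_velocity (h : IsShortCurve z₀ ρ η r c v) (hη : 0 ≤ η) (hη1 : η ≤ 1 / 2)
    {τ : ℝ} (hτ : τ ∈ Icc (0 : ℝ) 1) : ‖c 1 - c 0‖ ≤ 2 * ‖v τ‖ := by
  have h1 := h.norm_chord_sub_velocity_le hη hτ
  have h2 := norm_sub_norm_le (c 1 - c 0) (v τ)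
  nlinarith [norm_nonneg (c 1 - c 0)]

theorem norm_sub_le (h : IsShortCurve z₀ ρ η r c v) (hη : 0 ≤ η) (hη1 : η ≤ 1 / 2) {τ σ : ℝ}
    (hτ : τ ∈ Icc (0 : ℝ) 1) (hσ : σ ∈ Icc (0 : ℝ) 1) :
    ‖c τ - c σ‖ ≤ 2 * ‖c 1 - c 0‖ := by
  have h1 := (convex_Icc (0 : ℝ) 1).norm_image_sub_le_of_norm_hasDerivWithin_le
    (f := c) h.hasDerivWithinAt (fun σ hσ => h.norm_velocity_le hη hη1 hσ) hσ hτ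
  refine h1.trans (mul_le_of_le_one_right (by positivity) ?_)
  rw [Real.norm_eq_abs, abs_le]
  constructor
  · linarith [hσ.2, hτ.1]
  · linarith [hσ.1, hτ.2]

theorem mem_halfBall (h : IsShortCurve z₀ ρ η r c v) (hη : 0 ≤ η) (hη1 : η ≤ 1 / 2)
    {τ : ℝ} (hτ : τ ∈ Icc (0 : ℝ) 1) :
    c τ ∈ Metric.closedBall z₀ (ρ + 2 * r) ∩ range (𝓡∂ n) := by
  refine ⟨?_, mem_range_model_iff.2 (h.nonneg τ hτ)⟩
  rw [Metric.mem_closedBall, dist_eq_norm]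
  have h1 := h.norm_sub_le hη hη1 hτ (left_mem_Icc.2 zero_le_one)
  have h2 := norm_add_le (c τ - c 0) (c 0 - z₀)
  rw [sub_add_sub_cancel] at h2
  linarith [h.norm_base_le, h.norm_chord_le]

end IsShortCurve

theorem isClosed_shortCurves (z₀ : Model n) (ρ η r : ℝ) :
    IsClosed {x : Model n × VelocityField n |
      IsShortCurve z₀ ρ η r (curveOf x) (extendVel x.2)} := by
  have hcu : ∀ τ : ℝ, Continuous fun x : Model n × VelocityField n =>
      curveOf x τ := fun τ => continuous_curveOf.comp (continuous_id.prodMk continuous_const)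
  have hev : ∀ τ : ℝ, Continuous fun x : Model n × VelocityField n =>
      extendVel x.2 τ := fun τ => continuous_extendVel.comp (continuous_snd.prodMk continuous_const)
  have e : {x : Model n × VelocityField n |
      IsShortCurve z₀ ρ η r (curveOf x) (extendVel x.2)}
      = {x | ∀ τ : ℝ, τ ∈ Icc (0 : ℝ) 1 → ∀ σ : ℝ, σ ∈ Icc (0 : ℝ) 1 →
          ‖extendVel x.2 τ - extendVel x.2 σ‖ ≤ η * ‖curveOf x 1 - curveOf x 0‖ * |τ - σ|}
        ∩ {x | ∀ τ : ℝ, τ ∈ Icc (0 : ℝ) 1 → 0 ≤ curveOf x τ 0} ∩ {x | ‖curveOf x 0 - z₀‖ ≤ ρ}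
        ∩ {x | ‖curveOf x 1 - curveOf x 0‖ ≤ r} := by
    ext x
    constructor
    · intro h
      exact ⟨⟨⟨h.norm_velocity_sub_le, h.nonneg⟩, h.norm_base_le⟩, h.norm_chord_le⟩
    · rintro ⟨⟨⟨h1, h2⟩, h3⟩, h4⟩
      exact ⟨fun τ _ => (hasDerivAt_curveOf x τ).hasDerivWithinAt, h1, h2, h3, h4⟩
  rw [e]
  refine ((IsClosed.inter ?_ ?_).inter ?_).inter ?_
  · simp only [ofPred_forall]
    refine isClosed_iInter fun τ => isClosed_iInter fun _ => isClosed_iInter fun σ =>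
      isClosed_iInter fun _ => isClosed_le ((hev τ).sub (hev σ)).norm ?_
    exact (continuous_const.mul ((hcu 1).sub (hcu 0)).norm).mul continuous_const
  · simp only [ofPred_forall]
    refine isClosed_iInter fun τ => isClosed_iInter fun _ => isClosed_le continuous_const ?_
    exact (EuclideanSpace.proj (𝕜 := ℝ) (0 : Fin n)).continuous.comp (hcu τ)
  · exact isClosed_le ((hcu 0).sub continuous_const).norm continuous_const
  · exact isClosed_le ((hcu 1).sub (hcu 0)).norm continuous_const

theorem isCompact_shortCurves (z₀ : Model n) {ρ η r : ℝ} (hη : 0 ≤ η) (hη1 : η ≤ 1 / 2) :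
    IsCompact {x : Model n × VelocityField n |
      IsShortCurve z₀ ρ η r (curveOf x) (extendVel x.2)} := by
  set A : Set (VelocityField n) :=
    {w | (∀ τ : Icc (0 : ℝ) 1, ‖w τ‖ ≤ 2 * r) ∧
      ∀ τ σ : Icc (0 : ℝ) 1, ‖w τ - w σ‖ ≤ η * r * |(τ : ℝ) - σ|} with hA
  have hev : ∀ τ : (Icc (0 : ℝ) 1), Continuous fun w : VelocityField n => w τ :=
    fun τ => continuous_eval_const τ
  have hAc : IsCompact A := by
    refine BoundedContinuousFunction.arzela_ascoli₂ (Metric.closedBall 0 (2 * r))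
      (isCompact_closedBall _ _) A ?_ ?_ ?_
    · have e : A = (⋂ τ : (Icc (0 : ℝ) 1), {w | ‖w τ‖ ≤ 2 * r}) ∩
          ⋂ (τ : Icc (0 : ℝ) 1) (σ : Icc (0 : ℝ) 1), {w | ‖w τ - w σ‖ ≤ η * r * |(τ : ℝ) - σ|} := by
        ext w; simp only [hA, mem_inter_iff, mem_iInter, mem_ofPred_eq]
      rw [e]
      refine IsClosed.inter ?_ ?_
      · exact isClosed_iInter fun τ => isClosed_le (hev τ).norm continuous_const
      · exact isClosed_iInter fun τ => isClosed_iInter fun σ =>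
          isClosed_le ((hev τ).sub (hev σ)).norm continuous_const
    · intro w τ hw
      rw [mem_closedBall_zero_iff]
      exact hw.1 τ
    · refine (LipschitzWith.uniformEquicontinuous _ (η * r).toNNReal fun w => ?_).equicontinuous
      refine LipschitzWith.of_dist_le_mul fun τ σ => ?_
      rw [dist_eq_norm, Subtype.dist_eq, Real.dist_eq]
      refine (w.2.2 τ σ).trans ?_
      gcongr
      exact Real.le_coe_toNNReal _
  refine ((isCompact_closedBall z₀ ρ).prod hAc).of_isClosed_subset
    (isClosed_shortCurves z₀ ρ η r) ?_
  intro x hx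
  have h0 : curveOf x 0 = x.1 := by simp [curveOf]
  have hext : ∀ τ : (Icc (0 : ℝ) 1), extendVel x.2 (τ : ℝ) = x.2 τ := fun τ => by
    rw [extendVel, projIcc_val]
  refine ⟨?_, fun τ => ?_, fun τ σ => ?_⟩
  · have := hx.norm_base_le
    rwa [h0, ← dist_eq_norm] at this
  · rw [← hext]
    exact (hx.norm_velocity_le hη hη1 τ.2).trans (by linarith [hx.norm_chord_le])
  · rw [← hext, ← hext]
    refine (hx.norm_velocity_sub_le τ τ.2 σ σ.2).trans ?_
    have := hx.norm_chord_le
    gcongr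

theorem IsShortCurve.exists_curveOf {z₀ : Model n} {ρ η r : ℝ} {c v : ℝ → Model n}
    (h : IsShortCurve z₀ ρ η r c v) :
    ∃ x : Model n × VelocityField n,
      (∀ τ ∈ Icc (0 : ℝ) 1, curveOf x τ = c τ) ∧ ∀ τ ∈ Icc (0 : ℝ) 1, extendVel x.2 τ = v τ := by
  have hvc := h.continuousOn_velocity
  let w : VelocityField n :=
    BoundedContinuousFunction.mkOfCompact
      ⟨fun τ => v τ, continuousOn_iff_continuous_domRestrict.1 hvc⟩
  have hw : ∀ τ ∈ Icc (0 : ℝ) 1, extendVel w τ = v τ := fun τ hτ => by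
    change v (projIcc 0 1 zero_le_one τ) = v τ
    rw [projIcc_of_mem zero_le_one hτ]
  refine ⟨(c 0, w), fun τ hτ => ?_, hw⟩
  have hd : ∀ σ ∈ Icc (0 : ℝ) 1,
      HasDerivWithinAt (fun σ => curveOf (c 0, w) σ - c σ) 0 (Icc (0 : ℝ) 1) σ := fun σ hσ =>
    ((hasDerivAt_curveOf (c 0, w) σ).hasDerivWithinAt.sub (h.hasDerivWithinAt σ hσ)).congr_deriv
      (by rw [show extendVel (c 0, w).2 σ = v σ from hw σ hσ, sub_self])
  have h1 := (convex_Icc (0 : ℝ) 1).norm_image_sub_le_of_norm_hasDerivWithin_le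
    (C := 0) hd (fun σ _ => by simp) (left_mem_Icc.2 zero_le_one) hτ
  have h0 : curveOf (c 0, w) 0 = c 0 := by simp [curveOf]
  rw [zero_mul, h0, sub_self, sub_zero] at h1
  exact sub_eq_zero.1 (norm_le_zero_iff.1 h1)

/-- The two-point function, penalized at the starting point, attains its maximum over the short
curves. -/
theorem exists_max_twoPoint {z₀ : Model n} {ρ η r T α K : ℝ} (hη : 0 ≤ η) (hη1 : η ≤ 1 / 2)
    (hr : 0 ≤ r) (hρ : 0 ≤ ρ) (hz₀ : z₀ ∈ range (𝓡∂ n)) (hT : 0 ≤ T) (hα : 0 < α)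
    {G : Model n → Model n →L[ℝ] Model n →L[ℝ] ℝ} {D : Set (Model n)}
    (hD : Metric.closedBall z₀ (ρ + 2 * r) ∩ range (𝓡∂ n) ⊆ D) (hG : ContinuousOn G D)
    {U : ℝ → Model n → ℝ}
    (hU : ContinuousOn (fun p : Model n × ℝ => U p.2 p.1) (D ×ˢ Icc 0 T))
    {P : Model n → ℝ} (hP : Continuous P) :
    ∃ c v t, IsShortCurve z₀ ρ η r c v ∧ t ∈ Icc 0 T ∧ Continuous v ∧
      (∀ τ, HasDerivAt c (v τ) τ) ∧
      ∀ c' v' t', IsShortCurve z₀ ρ η r c' v' → t' ∈ Icc 0 T →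
        twoPoint G (U t') α K c' v' - P (c' 0) ≤ twoPoint G (U t) α K c v - P (c 0) := by
  set S := {x : Model n × VelocityField n |
      IsShortCurve z₀ ρ η r (curveOf x) (extendVel x.2)} with hS
  have hSc : IsCompact S := isCompact_shortCurves z₀ hη hη1
  have hmem : ∀ x ∈ S, ∀ τ ∈ Icc (0 : ℝ) 1, curveOf x τ ∈ D := fun x hx τ hτ =>
    hD (hx.mem_halfBall hη hη1 hτ)
  have hen : ContinuousOn (fun x => energy G (curveOf x) (extendVel x.2)) S := by
    rw [continuousOn_iff_continuous_domRestrict]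
    let pr : ℝ → ℝ := fun τ => (projIcc (0 : ℝ) 1 zero_le_one τ : ℝ)
    have hpr : Continuous pr := continuous_subtype_val.comp continuous_projIcc
    have hprm : ∀ τ, pr τ ∈ Icc (0 : ℝ) 1 := fun τ => (projIcc (0 : ℝ) 1 zero_le_one τ).2
    have hpre : ∀ τ ∈ Icc (0 : ℝ) 1, pr τ = τ := fun τ hτ => by
      simp only [pr, projIcc_of_mem zero_le_one hτ]
    have e : S.domRestrict (fun x => energy G (curveOf x) (extendVel x.2))
        = fun x : S => ∫ τ in (0 : ℝ)..1, G (curveOf x.1 (pr τ)) (extendVel x.1.2 τ)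
          (extendVel x.1.2 τ) := by
      funext x
      refine intervalIntegral.integral_congr fun τ hτ => ?_
      rw [uIcc_of_le zero_le_one] at hτ
      simp only [hpre τ hτ]
    rw [e]
    refine intervalIntegral.continuous_parametric_intervalIntegral_of_continuous' ?_ 0 1
    have h1 : Continuous fun p : S × ℝ => curveOf p.1.1 (pr p.2) :=
      continuous_curveOf.comp ((continuous_subtype_val.comp continuous_fst).prodMk
        (hpr.comp continuous_snd))
    have h2 : Continuous fun p : S × ℝ => extendVel p.1.1.2 p.2 :=
      continuous_extendVel.comp ((continuous_snd.comp (continuous_subtype_val.comp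
        continuous_fst)).prodMk continuous_snd)
    have h3 : Continuous fun p : S × ℝ => G (curveOf p.1.1 (pr p.2)) :=
      hG.comp_continuous h1 fun p => hmem _ p.1.2 _ (hprm _)
    exact (h3.clm_apply h2).clm_apply h2
  have hcu : ∀ τ : ℝ, Continuous fun x : (Model n × VelocityField n) × ℝ =>
      (curveOf x.1 τ, x.2) := fun τ =>
    (continuous_curveOf.comp (continuous_fst.prodMk continuous_const)).prodMk continuous_snd
  have hUc : ∀ τ ∈ Icc (0 : ℝ) 1, ContinuousOn (fun x : (Model n × VelocityField n) × ℝ =>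
      U x.2 (curveOf x.1 τ)) (S ×ˢ Icc 0 T) := fun τ hτ =>
    hU.comp (hcu τ).continuousOn fun x hx => ⟨hmem x.1 hx.1 τ hτ, hx.2⟩
  have hJ : ContinuousOn (fun x : (Model n × VelocityField n) × ℝ =>
      twoPoint G (U x.2) α K (curveOf x.1) (extendVel x.1.2) - P (curveOf x.1 0))
      (S ×ˢ Icc 0 T) := by
    refine ContinuousOn.sub ?_ (hP.comp (continuous_fst.comp (hcu 0))).continuousOn
    refine ((hUc 1 (by simp)).sub (hUc 0 (by simp))).sub (continuousOn_const.mul ?_)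
    refine (continuous_lengthFn hα).comp_continuousOn (Real.continuous_sqrt.comp_continuousOn ?_)
    exact hen.comp continuousOn_fst fun x hx => hx.1
  have hne : (S ×ˢ Icc 0 T).Nonempty := by
    have h0 : IsShortCurve z₀ ρ η r (fun _ => z₀) (fun _ => 0) := by
      refine ⟨fun τ _ => hasDerivWithinAt_const _ _ _, fun τ _ σ _ => by simp,
        fun τ _ => mem_range_model_iff.1 hz₀, by simpa using hρ, by simpa using hr⟩
    obtain ⟨x, hx1, hx2⟩ := h0.exists_curveOf
    exact ⟨(x, 0), h0.congr hx1 hx2, left_mem_Icc.2 hT⟩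
  obtain ⟨x, hx, hmax⟩ := (hSc.prod isCompact_Icc).exists_isMaxOn hne hJ
  refine ⟨curveOf x.1, extendVel x.1.2, x.2, hx.1, hx.2,
    continuous_extendVel.comp (continuous_const.prodMk continuous_id), hasDerivAt_curveOf x.1, ?_⟩
  intro c' v' t' h' ht'
  obtain ⟨x', hx1, hx2⟩ := h'.exists_curveOf
  rw [← twoPoint_congr hx1 hx2, ← hx1 0 (by simp)]
  exact hmax (a := (x', t')) ⟨h'.congr hx1 hx2, ht'⟩

end ShortCurves

/-! ### Energy and chords of short curves -/

section Boundary

open Topology Filter MeasureTheory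

set_option maxSynthPendingDepth 3

theorem le_lengthFn_sub {α a b : ℝ} (hα0 : 0 < α) (hα : α ≤ 1 / 4) (ha : 0 ≤ a) (hab : a ≤ b)
    (hb : b ^ α ≤ 2 / 5) : (b - a) / 2 ≤ lengthFn α b - lengthFn α a := by
  have h := (convex_Icc a b).mul_sub_le_image_sub_of_le_deriv (f := lengthFn α) (C := 1 / 2)
    (continuous_lengthFn hα0).continuousOn ?_ ?_ a (left_mem_Icc.2 hab) b (right_mem_Icc.2 hab) hab
  · linarith
  · rw [interior_Icc]
    exact fun σ hσ =>
      (hasDerivAt_lengthFn (ha.trans_lt hσ.1)).differentiableAt.differentiableWithinAt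
  · rw [interior_Icc]
    intro σ hσ
    have hσ0 : 0 < σ := ha.trans_lt hσ.1
    rw [(hasDerivAt_lengthFn hσ0).deriv]
    have h1 : σ ^ α ≤ 2 / 5 := (Real.rpow_le_rpow hσ0.le hσ.2.le hα0.le).trans hb
    have h2 : (1 + α) * σ ^ α ≤ (1 + 1 / 4) * (2 / 5) := by
      have := Real.rpow_nonneg hσ0.le α
      gcongr
    linarith

theorem lengthFn_zero {α : ℝ} (hα : 0 < α) : lengthFn α 0 = 0 := by
  rw [lengthFn, Real.zero_rpow (by linarith), sub_zero]

variable {n : ℕ} [NeZero n]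

section Contraction

variable {z₀ : Model n} {ρ η r : ℝ} {c v : ℝ → Model n}

/-- Contraction of a short curve towards one of its points. -/
theorem IsShortCurve.contract (h : IsShortCurve z₀ ρ η r c v) {p : Model n} (hp : 0 ≤ p 0) {ε : ℝ}
    (hε : ε ∈ Icc (0 : ℝ) 1) (hbase : ‖c 0 + ε • (p - c 0) - z₀‖ ≤ ρ) :
    IsShortCurve z₀ ρ η r (fun τ => c τ + ε • (p - c τ)) (fun τ => (1 - ε) • v τ) := by
  have hε1 : 0 ≤ 1 - ε := by linarith [hε.2]
  have e : ∀ a b : Model n, a + ε • (p - a) - (b + ε • (p - b)) = (1 - ε) • (a - b) := by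
    intro a b; module
  have hn : ∀ a : Model n, ‖(1 - ε) • a‖ = (1 - ε) * ‖a‖ := fun a => by
    rw [norm_smul, Real.norm_of_nonneg hε1]
  refine ⟨fun τ hτ => ?_, fun τ hτ σ hσ => ?_, fun τ hτ => ?_, hbase, ?_⟩
  · have h1 := h.hasDerivWithinAt τ hτ
    refine (h1.add
      (((hasDerivWithinAt_const τ (Icc (0 : ℝ) 1) p).sub h1).const_smul ε)).congr_deriv ?_
    module
  · simp only [e]
    rw [← smul_sub, hn, hn]
    have := h.norm_velocity_sub_le τ hτ σ hσ
    nlinarith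
  · have h1 := h.nonneg τ hτ
    have e1 : (c τ + ε • (p - c τ)) 0 = (1 - ε) * c τ 0 + ε * p 0 := by
      simp only [PiLp.add_apply, PiLp.smul_apply, PiLp.sub_apply, smul_eq_mul]; ring
    rw [e1]
    have := hε.1
    positivity
  · simp only [e]
    rw [hn]
    have := h.norm_chord_le
    nlinarith [norm_nonneg (c 1 - c 0), hε.1]

end Contraction

variable {M : Type*} [TopologicalSpace M] [ChartedSpace (EuclideanHalfSpace n) M] {x₀ : M}
  {ρ C η r : ℝ} {c v : ℝ → Model n}

theorem IsShortCurve.mem_halfBall_chart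
    (hc : IsShortCurve (extChartAt (𝓡∂ n) x₀ x₀) (2 * ρ) η r c v)
    (hη : 0 ≤ η) (hη1 : η ≤ 1 / 2) (hr : 4 * r ≤ ρ) {τ : ℝ} (hτ : τ ∈ Icc (0 : ℝ) 1) :
    c τ ∈ halfBall n x₀ ρ := by
  have h := hc.mem_halfBall hη hη1 hτ
  have hr0 : 0 ≤ r := (norm_nonneg _).trans hc.norm_chord_le
  exact ⟨Metric.closedBall_subset_closedBall (by linarith) h.1, h.2⟩

variable [IsManifold (𝓡∂ n) ∞ M] {g : Metric n M}

namespace GoodChart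

theorem continuousOn_chartMetric (h : GoodChart g x₀ ρ C) :
    ContinuousOn (chartMetric g x₀) (halfBall n x₀ ρ) :=
  (contDiffOn_chartMetric g x₀).continuousOn.mono h.subset_target

theorem continuousOn_energy (h : GoodChart g x₀ ρ C) (hc : ContinuousOn c (Icc 0 1))
    (hv : ContinuousOn v (Icc 0 1)) (hcD : ∀ τ ∈ Icc (0 : ℝ) 1, c τ ∈ halfBall n x₀ ρ) :
    ContinuousOn (fun τ => chartMetric g x₀ (c τ) (v τ) (v τ)) (Icc 0 1) :=
  ((h.continuousOn_chartMetric.comp hc hcD).clm_apply hv).clm_apply hv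

theorem one_le (h : GoodChart g x₀ ρ C) : 1 ≤ C := h.metricBounds.one_le

theorem energy_nonneg (h : GoodChart g x₀ ρ C)
    (hcD : ∀ τ ∈ Icc (0 : ℝ) 1, c τ ∈ halfBall n x₀ ρ) : 0 ≤ energy (chartMetric g x₀) c v :=
  intervalIntegral.integral_nonneg zero_le_one fun τ hτ =>
    chartMetric_nonneg (h.subset_target (hcD τ hτ)) _

theorem apply_le (h : GoodChart g x₀ ρ C) {z : Model n} (hz : z ∈ halfBall n x₀ ρ) (a : Model n) :
    chartMetric g x₀ z a a ≤ C * ‖a‖ ^ 2 := by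
  have := abs_form_le _ (h.norm_le z hz) a a
  linarith [le_abs_self (chartMetric g x₀ z a a)]

/-- The length of the chord is comparable with the square root of the energy. -/
theorem norm_chord_le (h : GoodChart g x₀ ρ C)
    (hc : IsShortCurve (extChartAt (𝓡∂ n) x₀ x₀) (2 * ρ) η r c v)
    (hη : 0 ≤ η) (hη1 : η ≤ 1 / 2) (hr : 4 * r ≤ ρ) :
    ‖c 1 - c 0‖ ≤ 2 * C * Real.sqrt (energy (chartMetric g x₀) c v) := by
  have hC := h.one_le
  have hcD := fun τ hτ => hc.mem_halfBall_chart hη hη1 hr (τ := τ) hτ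
  have hE := h.energy_nonneg (v := v) hcD
  have h1 : ∫ _ in (0 : ℝ)..1, ‖c 1 - c 0‖ ^ 2 / (4 * C) ≤ energy (chartMetric g x₀) c v := by
    refine intervalIntegral.integral_mono_on zero_le_one intervalIntegrable_const
      (intervalIntegrable_unit (h.continuousOn_energy hc.continuousOn hc.continuousOn_velocity hcD))
      fun τ hτ => ?_
    rw [div_le_iff₀ (by positivity)]
    have h2 := h.sq_norm_le _ (hcD τ hτ) (v τ)
    have h3 := hc.norm_chord_le_velocity hη hη1 hτ
    have h4 := pow_le_pow_left₀ (norm_nonneg _) h3 2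
    nlinarith
  rw [intervalIntegral.integral_const, sub_zero, one_smul, div_le_iff₀ (by positivity)] at h1
  refine abs_le_of_sq_le_sq' ?_ (by positivity) |>.2
  rw [mul_pow, Real.sq_sqrt hE]
  nlinarith

theorem sqrt_energy_le (h : GoodChart g x₀ ρ C)
    (hc : IsShortCurve (extChartAt (𝓡∂ n) x₀ x₀) (2 * ρ) η r c v)
    (hη : 0 ≤ η) (hη1 : η ≤ 1 / 2) (hr : 4 * r ≤ ρ) :
    Real.sqrt (energy (chartMetric g x₀) c v) ≤ 2 * C * ‖c 1 - c 0‖ := by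
  have hC := h.one_le
  have hcD := fun τ hτ => hc.mem_halfBall_chart hη hη1 hr (τ := τ) hτ
  have h1 : energy (chartMetric g x₀) c v ≤ ∫ _ in (0 : ℝ)..1, C * (2 * ‖c 1 - c 0‖) ^ 2 := by
    refine intervalIntegral.integral_mono_on zero_le_one
      (intervalIntegrable_unit (h.continuousOn_energy hc.continuousOn hc.continuousOn_velocity hcD))
      intervalIntegrable_const fun τ hτ => ?_
    refine (h.apply_le (hcD τ hτ) (v τ)).trans ?_
    have := hc.norm_velocity_le hη hη1 hτ
    gcongr
  rw [intervalIntegral.integral_const, sub_zero, one_smul] at h1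
  rw [Real.sqrt_le_left (by positivity)]
  refine h1.trans ?_
  have : 0 ≤ ‖c 1 - c 0‖ ^ 2 := by positivity
  nlinarith

theorem sqrt_energy_contract (h : GoodChart g x₀ ρ C)
    (hc : IsShortCurve (extChartAt (𝓡∂ n) x₀ x₀) (2 * ρ) η r c v)
    (hη : 0 ≤ η) (hη1 : η ≤ 1 / 2) (hr : 4 * r ≤ ρ) (hCr : 8 * C ^ 2 * r ≤ 1) {σ ε : ℝ}
    (hσ : σ ∈ Icc (0 : ℝ) 1) (hε : ε ∈ Icc (0 : ℝ) 1) :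
    Real.sqrt (energy (chartMetric g x₀) (fun τ => c τ + ε • (c σ - c τ))
      (fun τ => (1 - ε) • v τ)) ≤ (1 - ε / 2) * Real.sqrt (energy (chartMetric g x₀) c v) := by
  have hC := h.one_le
  have hcD := fun τ hτ => hc.mem_halfBall_chart hη hη1 hr (τ := τ) hτ
  have hE := h.energy_nonneg (v := v) hcD
  have hcD' : ∀ τ ∈ Icc (0 : ℝ) 1, c τ + ε • (c σ - c τ) ∈ halfBall n x₀ ρ := fun τ hτ =>
    (convex_halfBall x₀ ρ).add_smul_sub_mem (hcD τ hτ) (hcD σ hσ) hε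
  have hcc := hc.continuousOn
  have hvc := hc.continuousOn_velocity
  have h1 : energy (chartMetric g x₀) (fun τ => c τ + ε • (c σ - c τ)) (fun τ => (1 - ε) • v τ)
      ≤ ∫ τ in (0 : ℝ)..1, (1 - ε / 2) ^ 2 * chartMetric g x₀ (c τ) (v τ) (v τ) := by
    refine intervalIntegral.integral_mono_on zero_le_one
      (intervalIntegrable_unit (h.continuousOn_energy
        (hcc.add ((continuousOn_const.sub hcc).const_smul ε)) (hvc.const_smul (1 - ε)) hcD'))
      (intervalIntegrable_unit ((h.continuousOn_energy hcc hvc hcD).const_mul _)) fun τ hτ => ?_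
    have h2 := h.norm_sub_le _ (hcD' τ hτ) _ (hcD τ hτ)
    rw [add_sub_cancel_left, norm_smul, Real.norm_of_nonneg hε.1] at h2
    have h3 := hc.norm_sub_le hη hη1 hσ hτ
    have h4 := hc.norm_chord_le
    have h5 := h.sq_norm_le _ (hcD τ hτ) (v τ)
    have h6 : chartMetric g x₀ (c τ + ε • (c σ - c τ)) (v τ) (v τ)
        - chartMetric g x₀ (c τ) (v τ) (v τ) ≤ C * (ε * (2 * r)) * ‖v τ‖ * ‖v τ‖ := by
      refine (le_abs_self _).trans ?_
      have := abs_form_le (chartMetric g x₀ (c τ + ε • (c σ - c τ)) - chartMetric g x₀ (c τ))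
        (C := C * (ε * (2 * r))) (h2.trans (by have := hε.1; gcongr; linarith)) (v τ) (v τ)
      simpa only [sub_apply] using this
    have hX : 0 ≤ chartMetric g x₀ (c τ) (v τ) (v τ) :=
      chartMetric_nonneg (h.subset_target (hcD τ hτ)) _
    simp only [map_smul, smul_apply, smul_eq_mul]
    set X := chartMetric g x₀ (c τ) (v τ) (v τ)
    set Y := chartMetric g x₀ (c τ + ε • (c σ - c τ)) (v τ) (v τ)
    have hr0 : 0 ≤ r := (norm_nonneg _).trans h4
    have h7 : Y ≤ (1 + ε / 4) * X := by
      have h8 : C * (ε * (2 * r)) * ‖v τ‖ * ‖v τ‖ ≤ C * (ε * (2 * r)) * (C * X) := by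
        have : 0 ≤ C * (ε * (2 * r)) := by have := hε.1; positivity
        rw [mul_assoc, ← sq]
        exact mul_le_mul_of_nonneg_left h5 this
      have h9 : C * (ε * (2 * r)) * (C * X) ≤ ε / 4 * X := by
        have : 0 ≤ ε * X := mul_nonneg hε.1 hX
        nlinarith
      linarith
    have h10 : (1 - ε) * ((1 - ε) * Y) ≤ (1 - ε) ^ 2 * ((1 + ε / 4) * X) := by
      rw [← mul_assoc, ← sq]
      exact mul_le_mul_of_nonneg_left h7 (sq_nonneg _)
    have h11 : (1 - ε) ^ 2 * (1 + ε / 4) ≤ (1 - ε / 2) ^ 2 := by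
      nlinarith [hε.1, hε.2, mul_nonneg hε.1 (sub_nonneg.2 hε.2),
        mul_nonneg (mul_nonneg hε.1 hε.1) (sub_nonneg.2 hε.2)]
    calc (1 - ε) * ((1 - ε) * Y) ≤ (1 - ε) ^ 2 * ((1 + ε / 4) * X) := h10
      _ = (1 - ε) ^ 2 * (1 + ε / 4) * X := by ring
      _ ≤ (1 - ε / 2) ^ 2 * X := mul_le_mul_of_nonneg_right h11 hX
  rw [intervalIntegral.integral_const_mul] at h1
  refine (Real.sqrt_le_sqrt h1).trans_eq ?_
  rw [Real.sqrt_mul (sq_nonneg _), Real.sqrt_sq (by linarith [hε.2])]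
  rfl

variable {T : ℝ} {u : M → ℝ → ℝ} {t : ℝ}

/-- The variation of `u` along a segment on which its differential is bounded by `B`. -/
theorem abs_sub_le (h : GoodChart g x₀ ρ C) (hu : IsCk n 3 T u) (ht : t ∈ Icc 0 T) {B : ℝ}
    {S : Set (Model n)} (hS : Convex ℝ S) (hSD : S ⊆ halfBall n x₀ ρ)
    (hB : ∀ z ∈ S, ‖coordDeriv n u x₀ t z‖ ≤ B) {z z' : Model n} (hz : z ∈ S) (hz' : z' ∈ S) :
    |coordFn n u x₀ t z - coordFn n u x₀ t z'| ≤ B * ‖z - z'‖ :=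
  hS.norm_image_sub_le_of_norm_hasFDerivWithin_le
    (fun _ hx => (hu.hasFDerivWithinAt_coordFn ht (h.subset_target (hSD hx))).mono
      fun _ hy => (hSD hy).2) hB hz' hz

end GoodChart

end Boundary

/-! ### Maximizers of the penalized two-point function -/

section Maximizers

open Topology Filter MeasureTheory

set_option maxSynthPendingDepth 3

/-- A penalty which keeps the starting points of maximizing curves near `z₀`. -/
def penalty {n : ℕ} (z₀ : Model n) (ρ lam : ℝ) (y : Model n) : ℝ :=
  lam * max 0 (‖y - z₀‖ - ρ)

section Penalty

variable {n : ℕ} {z₀ y y' : Model n} {ρ lam : ℝ}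

theorem penalty_nonneg (h : 0 ≤ lam) : 0 ≤ penalty z₀ ρ lam y :=
  mul_nonneg h (le_max_left _ _)

theorem penalty_eq_zero (h : ‖y - z₀‖ ≤ ρ) : penalty z₀ ρ lam y = 0 := by
  rw [penalty, max_eq_left (by linarith), mul_zero]

theorem le_penalty (h : 0 ≤ lam) : lam * (‖y - z₀‖ - ρ) ≤ penalty z₀ ρ lam y :=
  mul_le_mul_of_nonneg_left (le_max_right _ _) h

theorem penalty_sub_le (h : 0 ≤ lam) :
    penalty z₀ ρ lam y' - penalty z₀ ρ lam y ≤ lam * ‖y' - y‖ := by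
  rw [penalty, penalty, ← mul_sub]
  refine mul_le_mul_of_nonneg_left ?_ h
  have h1 : ‖y' - z₀‖ ≤ ‖y' - y‖ + ‖y - z₀‖ := by
    simpa using norm_add_le (y' - y) (y - z₀)
  have h2 := le_max_left 0 (‖y - z₀‖ - ρ)
  have h3 := le_max_right 0 (‖y - z₀‖ - ρ)
  rcases max_cases 0 (‖y' - z₀‖ - ρ) with ⟨h4, -⟩ | ⟨h4, -⟩ <;> rw [h4]
  · linarith [norm_nonneg (y' - y)]
  · linarith

theorem continuous_penalty (z₀ : Model n) (ρ lam : ℝ) : Continuous (penalty z₀ ρ lam) := by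
  unfold penalty
  fun_prop

end Penalty

/-- Smallness conditions on the parameters `ρ`, `η`, `r`, `α` of the two-point function, and lower
bounds for its slope `K` in terms of the supremum `N` of the gradient and the supremum `b` of the
gradient on the parabolic boundary. -/
structure SmallParameters (C ρ η r α K N b lam C₀ : ℝ) : Prop where
  η_pos : 0 < η
  η_le : η ≤ 1 / 2
  C_η_le : 64 * C ^ 3 * η ≤ 1
  r_le : 4 * r ≤ ρ
  C_r_le : 8 * C ^ 2 * r ≤ η
  α_pos : 0 < α
  α_le : α ≤ 1 / 4
  rpow_le : (2 * C * r) ^ α ≤ 2 / 5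
  K_pos : 0 < K
  N_le : N ≤ 2 * K
  b_nonneg : 0 ≤ b
  b_le : 64 * C ^ 3 * b ≤ K
  lam_nonneg : 0 ≤ lam
  lam_le : 64 * C * lam ≤ K
  le_lam : 2 * C₀ ≤ lam * ρ

variable {n : ℕ} [NeZero n] {M : Type*} [TopologicalSpace M]
  [ChartedSpace (EuclideanHalfSpace n) M] [IsManifold (𝓡∂ n) ∞ M]

/-- Bounds for a function and its gradient. -/
structure IsBounded (g : Metric n M) (T : ℝ) (u : M → ℝ → ℝ) (N b C₀ : ℝ) : Prop where
  isCk : IsCk n 3 T u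
  abs_le : ∀ x, ∀ t ∈ Icc 0 T, |u x t| ≤ C₀
  gradNorm_le : ∀ x, ∀ t ∈ Icc 0 T, gradNorm g u (x, t) ≤ N
  gradNorm_boundary_le : ∀ r ∈ parabolicBoundary n M T, gradNorm g u r ≤ b

/-- A short curve and a time that maximize the penalized two-point function, with a positive
maximum. -/
structure IsMaximizer (g : Metric n M) (u : M → ℝ → ℝ) (x₀ : M) (T ρ η r α K lam : ℝ)
    (c v : ℝ → Model n) (t : ℝ) : Prop where
  isShortCurve : IsShortCurve (extChartAt (𝓡∂ n) x₀ x₀) (2 * ρ) η r c v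
  mem : t ∈ Icc 0 T
  le : ∀ c' v' t', IsShortCurve (extChartAt (𝓡∂ n) x₀ x₀) (2 * ρ) η r c' v' → t' ∈ Icc 0 T →
    twoPoint (chartMetric g x₀) (coordFn n u x₀ t') α K c' v'
        - penalty (extChartAt (𝓡∂ n) x₀ x₀) ρ lam (c' 0)
      ≤ twoPoint (chartMetric g x₀) (coordFn n u x₀ t) α K c v
        - penalty (extChartAt (𝓡∂ n) x₀ x₀) ρ lam (c 0)
  pos : 0 < twoPoint (chartMetric g x₀) (coordFn n u x₀ t) α K c v
        - penalty (extChartAt (𝓡∂ n) x₀ x₀) ρ lam (c 0)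

namespace IsMaximizer

variable {g : Metric n M} {x₀ : M} {u : M → ℝ → ℝ} {T C ρ η r α K N b lam C₀ t : ℝ}
  {c v : ℝ → Model n}

theorem mem_halfBall (h : IsMaximizer g u x₀ T ρ η r α K lam c v t)
    (hp : SmallParameters C ρ η r α K N b lam C₀) {τ : ℝ} (hτ : τ ∈ Icc (0 : ℝ) 1) :
    c τ ∈ halfBall n x₀ ρ :=
  h.isShortCurve.mem_halfBall_chart hp.η_pos.le hp.η_le hp.r_le hτ

theorem lt_sub (h : IsMaximizer g u x₀ T ρ η r α K lam c v t) :
    K * lengthFn α (√(energy (chartMetric g x₀) c v))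
      + penalty (extChartAt (𝓡∂ n) x₀ x₀) ρ lam (c 0)
      < coordFn n u x₀ t (c 1) - coordFn n u x₀ t (c 0) := by
  have := h.pos
  rw [twoPoint] at this
  linarith

theorem sqrt_energy_pos (h : IsMaximizer g u x₀ T ρ η r α K lam c v t)
    (hG : GoodChart g x₀ ρ C) (hp : SmallParameters C ρ η r α K N b lam C₀) :
    0 < √(energy (chartMetric g x₀) c v) := by
  refine (Real.sqrt_nonneg _).lt_of_ne fun h0 => ?_
  have h1 := hG.norm_chord_le h.isShortCurve hp.η_pos.le hp.η_le hp.r_le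
  rw [← h0, mul_zero] at h1
  have h2 := h.lt_sub
  rw [← h0, lengthFn_zero hp.α_pos, mul_zero, zero_add, sub_eq_zero.1 (norm_le_zero_iff.1 h1),
    sub_self] at h2
  exact absurd (penalty_nonneg hp.lam_nonneg) (not_le.2 h2)

theorem rpow_sqrt_energy_le (h : IsMaximizer g u x₀ T ρ η r α K lam c v t)
    (hG : GoodChart g x₀ ρ C) (hp : SmallParameters C ρ η r α K N b lam C₀) :
    √(energy (chartMetric g x₀) c v) ^ α ≤ 2 / 5 := by
  have h1 := hG.sqrt_energy_le h.isShortCurve hp.η_pos.le hp.η_le hp.r_le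
  have hC := hG.one_le
  refine (Real.rpow_le_rpow (Real.sqrt_nonneg _) (h1.trans ?_) hp.α_pos.le).trans hp.rpow_le
  have := h.isShortCurve.norm_chord_le
  gcongr

theorem mul_sqrt_energy_lt (h : IsMaximizer g u x₀ T ρ η r α K lam c v t)
    (hG : GoodChart g x₀ ρ C) (hp : SmallParameters C ρ η r α K N b lam C₀) :
    K * √(energy (chartMetric g x₀) c v) / 2
      < coordFn n u x₀ t (c 1) - coordFn n u x₀ t (c 0) := by
  have h1 := le_lengthFn_sub hp.α_pos hp.α_le le_rfl (Real.sqrt_nonneg _)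
    (h.rpow_sqrt_energy_le hG hp)
  rw [lengthFn_zero hp.α_pos, sub_zero, sub_zero] at h1
  have h2 := h.lt_sub
  have h3 := penalty_nonneg (z₀ := extChartAt (𝓡∂ n) x₀ x₀) (ρ := ρ) (y := c 0) hp.lam_nonneg
  have h4 := mul_le_mul_of_nonneg_left h1 hp.K_pos.le
  linarith

theorem sub_le (h : IsMaximizer g u x₀ T ρ η r α K lam c v t) (hu : IsBounded g T u N b C₀) :
    coordFn n u x₀ t (c 1) - coordFn n u x₀ t (c 0) ≤ 2 * C₀ := by
  have h1 := abs_le.1 (hu.abs_le ((extChartAt (𝓡∂ n) x₀).symm (c 1)) t h.mem)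
  have h2 := abs_le.1 (hu.abs_le ((extChartAt (𝓡∂ n) x₀).symm (c 0)) t h.mem)
  rw [coordFn, coordFn]
  linarith

theorem mul_sqrt_energy_le (h : IsMaximizer g u x₀ T ρ η r α K lam c v t)
    (hG : GoodChart g x₀ ρ C) (hp : SmallParameters C ρ η r α K N b lam C₀)
    (hu : IsBounded g T u N b C₀) : K * √(energy (chartMetric g x₀) c v) ≤ 4 * C₀ := by
  linarith [h.mul_sqrt_energy_lt hG hp, h.sub_le hu]

theorem norm_base_lt (h : IsMaximizer g u x₀ T ρ η r α K lam c v t)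
    (hG : GoodChart g x₀ ρ C) (hp : SmallParameters C ρ η r α K N b lam C₀)
    (hu : IsBounded g T u N b C₀) : ‖c 0 - extChartAt (𝓡∂ n) x₀ x₀‖ < 2 * ρ := by
  by_contra! h0
  have h1 := h.lt_sub
  have h2 := h.sub_le hu
  have h3 := le_penalty (z₀ := extChartAt (𝓡∂ n) x₀ x₀) (ρ := ρ) (y := c 0) hp.lam_nonneg
  have h4 := le_lengthFn_sub hp.α_pos hp.α_le le_rfl (Real.sqrt_nonneg _)
    (h.rpow_sqrt_energy_le hG hp)
  rw [lengthFn_zero hp.α_pos, sub_zero, sub_zero] at h4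
  have h5 : 0 ≤ K * lengthFn α (√(energy (chartMetric g x₀) c v)) :=
    mul_nonneg hp.K_pos.le ((by positivity : 0 ≤ √(energy (chartMetric g x₀) c v) / 2).trans h4)
  have h6 : lam * ρ ≤ lam * (‖c 0 - extChartAt (𝓡∂ n) x₀ x₀‖ - ρ) :=
    mul_le_mul_of_nonneg_left (by linarith) hp.lam_nonneg
  linarith [hp.le_lam]

/-- Comparison of a maximizer with a curve that is not longer. -/
theorem compare (h : IsMaximizer g u x₀ T ρ η r α K lam c v t)
    (hG : GoodChart g x₀ ρ C) (hp : SmallParameters C ρ η r α K N b lam C₀) {c' v' : ℝ → Model n}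
    (hc' : IsShortCurve (extChartAt (𝓡∂ n) x₀ x₀) (2 * ρ) η r c' v')
    (hs : √(energy (chartMetric g x₀) c' v') ≤ √(energy (chartMetric g x₀) c v)) :
    coordFn n u x₀ t (c' 1) - coordFn n u x₀ t (c' 0)
        + K * (√(energy (chartMetric g x₀) c v) - √(energy (chartMetric g x₀) c' v')) / 2
      ≤ coordFn n u x₀ t (c 1) - coordFn n u x₀ t (c 0) + lam * ‖c' 0 - c 0‖ := by
  have h1 := h.le c' v' t hc' h.mem
  rw [twoPoint, twoPoint] at h1
  have h2 := penalty_sub_le (z₀ := extChartAt (𝓡∂ n) x₀ x₀) (ρ := ρ) (y := c 0) (y' := c' 0)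
    hp.lam_nonneg
  have h3 := le_lengthFn_sub hp.α_pos hp.α_le (Real.sqrt_nonneg _) hs
    (h.rpow_sqrt_energy_le hG hp)
  have h4 := mul_le_mul_of_nonneg_left h3 hp.K_pos.le
  linarith

theorem norm_chord_pos (h : IsMaximizer g u x₀ T ρ η r α K lam c v t)
    (hG : GoodChart g x₀ ρ C) (hp : SmallParameters C ρ η r α K N b lam C₀) : 0 < ‖c 1 - c 0‖ := by
  have h1 := hG.sqrt_energy_le h.isShortCurve hp.η_pos.le hp.η_le hp.r_le
  have h2 := h.sqrt_energy_pos hG hp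
  have hC := hG.one_le
  by_contra! h0
  have : 2 * C * ‖c 1 - c 0‖ ≤ 0 := mul_nonpos_of_nonneg_of_nonpos (by positivity) h0
  linarith

/-- A bound for the difference of the values at the end points that is too small. -/
theorem false_of_sub_le (h : IsMaximizer g u x₀ T ρ η r α K lam c v t)
    (hG : GoodChart g x₀ ρ C) (hp : SmallParameters C ρ η r α K N b lam C₀) {B : ℝ}
    (hB : 4 * C * B ≤ K)
    (hle : coordFn n u x₀ t (c 1) - coordFn n u x₀ t (c 0) ≤ B * ‖c 1 - c 0‖) : False := by
  have h1 := h.mul_sqrt_energy_lt hG hp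
  have h2 := hG.norm_chord_le h.isShortCurve hp.η_pos.le hp.η_le hp.r_le
  have h3 := h.norm_chord_pos hG hp
  have hC := hG.one_le
  have h4 := mul_le_mul_of_nonneg_right hB h3.le
  have h5 := mul_le_mul_of_nonneg_left h2 hp.K_pos.le
  have h6 : 4 * C * (K * √(energy (chartMetric g x₀) c v) / 2) < 4 * C * (B * ‖c 1 - c 0‖) :=
    mul_lt_mul_of_pos_left (h1.trans_le hle) (by linarith)
  linarith

/-- The maximum is not attained at the initial time. -/
theorem time_pos (h : IsMaximizer g u x₀ T ρ η r α K lam c v t)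
    (hG : GoodChart g x₀ ρ C) (hp : SmallParameters C ρ η r α K N b lam C₀)
    (hu : IsBounded g T u N b C₀) : 0 < t := by
  refine h.mem.1.lt_of_ne fun h0 => ?_
  have hC := hG.one_le
  refine h.false_of_sub_le hG hp (B := C ^ 2 * b) ?_ ((le_abs_self _).trans
    (hG.abs_sub_le hu.isCk h.mem (convex_halfBall x₀ ρ) Subset.rfl (fun z hz => ?_)
      (h.mem_halfBall hp (by simp)) (h.mem_halfBall hp (by simp))))
  · have := hp.b_le
    have h1 : 0 ≤ C ^ 3 * b := by have := hp.b_nonneg; positivity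
    nlinarith
  · refine (hG.norm_coordDeriv_le hu.isCk h.mem hz).trans ?_
    gcongr
    refine hu.gradNorm_boundary_le _ (Or.inl ⟨mem_univ _, ?_⟩)
    exact h0.symm

theorem norm_coordDeriv_boundary_le (hG : GoodChart g x₀ ρ C) (hu : IsBounded g T u N b C₀)
    (ht : t ∈ Icc 0 T) {z : Model n} (hz : z ∈ halfBall n x₀ ρ) (hz0 : z 0 = 0) :
    ‖coordDeriv n u x₀ t z‖ ≤ C ^ 2 * b := by
  have hC := hG.one_le
  refine (hG.norm_coordDeriv_le hu.isCk ht hz).trans ?_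
  gcongr
  exact hu.gradNorm_boundary_le _ (Or.inr ⟨(boundary_iff (hG.subset_target hz)).2 hz0, ht⟩)

/-- One-sided derivative of `u` at a point along a segment in the half space. -/
theorem hasDerivWithinAt_segment (hG : GoodChart g x₀ ρ C) (hu : IsCk n 3 T u)
    (ht : t ∈ Icc 0 T) {z z' : Model n} (hz : z ∈ halfBall n x₀ ρ) (hz' : z' ∈ halfBall n x₀ ρ) :
    HasDerivWithinAt (fun ε : ℝ => coordFn n u x₀ t (z + ε • (z' - z)))
      (coordDeriv n u x₀ t z (z' - z)) (Icc 0 1) 0 := by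
  have h1 : HasFDerivWithinAt (coordFn n u x₀ t) (coordDeriv n u x₀ t z) (range (𝓡∂ n))
      (z + (0 : ℝ) • (z' - z)) := by
    rw [zero_smul, add_zero]
    exact hu.hasFDerivWithinAt_coordFn ht (hG.subset_target hz)
  have h2 : HasDerivWithinAt (fun ε : ℝ => z + ε • (z' - z)) (z' - z) (Icc 0 1) 0 := by
    simpa using (((hasDerivAt_id (0 : ℝ)).smul_const (z' - z)).const_add z).hasDerivWithinAt
  exact h1.comp_hasDerivWithinAt 0 h2 fun ε hε =>
    ((convex_halfBall x₀ ρ).add_smul_sub_mem hz hz' hε).2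

end IsMaximizer

/-- A function on `[0, 1]` which decays linearly near `0`. -/
theorem deriv_le_of_eventually_le {h : ℝ → ℝ} {h' m : ℝ} (hd : HasDerivWithinAt h h' (Icc 0 1) 0)
    (hle : ∀ᶠ ε in 𝓝[Icc 0 1] (0 : ℝ), h ε ≤ h 0 - m * ε) : h' ≤ -m := by
  have h1 : HasDerivWithinAt (fun ε => h ε + m * ε) (h' + m) (Icc 0 1) 0 :=
    (hd.add ((hasDerivAt_id (0 : ℝ)).const_mul m).hasDerivWithinAt).congr_deriv (by simp)
  have h2 : IsLocalMaxOn (fun ε => h ε + m * ε) (Icc 0 1) 0 := by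
    filter_upwards [hle] with ε hε
    linarith
  have h3 : (1 : ℝ) - 0 ∈ posTangentConeAt (Icc (0 : ℝ) 1) 0 :=
    sub_mem_posTangentConeAt_of_segment_subset (by rw [segment_eq_Icc zero_le_one])
  have h4 := h2.hasFDerivWithinAt_nonpos h1.hasFDerivWithinAt h3
  rw [ContinuousLinearMap.toSpanSingleton_apply, smul_eq_mul] at h4
  linarith

end Maximizers

/-! ### Maximizers do not touch the boundary -/

section BoundaryContact

open Topology Filter MeasureTheory

set_option maxSynthPendingDepth 3

variable {n : ℕ} [NeZero n] {M : Type*} [TopologicalSpace M]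
  [ChartedSpace (EuclideanHalfSpace n) M] [IsManifold (𝓡∂ n) ∞ M]

namespace IsMaximizer

variable {g : Metric n M} {x₀ : M} {u : M → ℝ → ℝ} {T C ρ η r α K N b lam C₀ t : ℝ}
  {c v : ℝ → Model n}

/-- The end point of a maximizing curve lies in the interior: otherwise a contraction towards the
starting point would increase the two-point function. -/
theorem end_pos (h : IsMaximizer g u x₀ T ρ η r α K lam c v t)
    (hG : GoodChart g x₀ ρ C) (hp : SmallParameters C ρ η r α K N b lam C₀)
    (hu : IsBounded g T u N b C₀) : 0 < c 1 0 := by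
  have m0 : (0 : ℝ) ∈ Icc (0 : ℝ) 1 := by simp
  have m1 : (1 : ℝ) ∈ Icc (0 : ℝ) 1 := by simp
  have hC := hG.one_le
  refine (h.isShortCurve.nonneg 1 m1).lt_of_ne fun h0 => ?_
  set s := √(energy (chartMetric g x₀) c v) with hs
  have hspos : 0 < s := h.sqrt_energy_pos hG hp
  have hsh := h.isShortCurve
  have hsd : ‖c 1 - c 0‖ ≤ 2 * C * s := hG.norm_chord_le hsh hp.η_pos.le hp.η_le hp.r_le
  have hr1 : 8 * C ^ 2 * r ≤ 1 := hp.C_r_le.trans (hp.η_le.trans (by norm_num))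
  have hd := hasDerivWithinAt_segment hG hu.isCk h.mem (h.mem_halfBall hp m1) (h.mem_halfBall hp m0)
  have key := deriv_le_of_eventually_le (m := K * s / 4) hd (by
    filter_upwards [self_mem_nhdsWithin] with ε hε
    have hc' := hsh.contract (hsh.nonneg 0 m0) hε (by simpa using hsh.norm_base_le)
    have hE := hG.sqrt_energy_contract hsh hp.η_pos.le hp.η_le hp.r_le hr1 m0 hε
    have h1 := h.compare hG hp hc' (hE.trans (by nlinarith [hε.1]))
    simp only [sub_self, smul_zero, add_zero, norm_zero, mul_zero, zero_smul] at h1 ⊢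
    have h2 : K * (ε / 2 * s) ≤ K * (s - √(energy (chartMetric g x₀)
        (fun τ => c τ + ε • (c 0 - c τ)) (fun τ => (1 - ε) • v τ))) :=
      mul_le_mul_of_nonneg_left (by linarith) hp.K_pos.le
    linarith)
  have h3 := (coordDeriv n u x₀ t (c 1)).le_of_opNorm_le
    (norm_coordDeriv_boundary_le hG hu h.mem (h.mem_halfBall hp m1) h0.symm) (c 0 - c 1)
  rw [norm_sub_rev, Real.norm_eq_abs] at h3
  have h4 := neg_abs_le (coordDeriv n u x₀ t (c 1) (c 0 - c 1))
  have hb := hp.b_nonneg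
  have h5 : C ^ 2 * b * ‖c 1 - c 0‖ ≤ C ^ 2 * b * (2 * C * s) := by gcongr
  have h6 : 64 * C ^ 3 * b * s ≤ K * s := mul_le_mul_of_nonneg_right hp.b_le hspos.le
  have h7 : 0 < K * s := mul_pos hp.K_pos hspos
  have h8 : C ^ 2 * b * (2 * C * s) = (64 * C ^ 3 * b * s) / 32 := by ring
  linarith

/-- The starting point of a maximizing curve lies in the interior. -/
theorem start_pos (h : IsMaximizer g u x₀ T ρ η r α K lam c v t)
    (hG : GoodChart g x₀ ρ C) (hp : SmallParameters C ρ η r α K N b lam C₀)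
    (hu : IsBounded g T u N b C₀) : 0 < c 0 0 := by
  have m0 : (0 : ℝ) ∈ Icc (0 : ℝ) 1 := by simp
  have m1 : (1 : ℝ) ∈ Icc (0 : ℝ) 1 := by simp
  have hC := hG.one_le
  refine (h.isShortCurve.nonneg 0 m0).lt_of_ne fun h0 => ?_
  set s := √(energy (chartMetric g x₀) c v) with hs
  have hspos : 0 < s := h.sqrt_energy_pos hG hp
  have hsh := h.isShortCurve
  have hsd : ‖c 1 - c 0‖ ≤ 2 * C * s := hG.norm_chord_le hsh hp.η_pos.le hp.η_le hp.r_le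
  have hr1 : 8 * C ^ 2 * r ≤ 1 := hp.C_r_le.trans (hp.η_le.trans (by norm_num))
  have hd := (hasDerivWithinAt_segment hG hu.isCk h.mem (h.mem_halfBall hp m0)
    (h.mem_halfBall hp m1)).neg
  have hbase : ∀ᶠ ε in 𝓝[Icc 0 1] (0 : ℝ),
      ‖c 0 + ε • (c 1 - c 0) - extChartAt (𝓡∂ n) x₀ x₀‖ < 2 * ρ := by
    have hcont : Continuous fun ε : ℝ => ‖c 0 + ε • (c 1 - c 0) - extChartAt (𝓡∂ n) x₀ x₀‖ := by
      fun_prop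
    refine (hcont.tendsto 0).eventually_lt_const ?_ |>.filter_mono nhdsWithin_le_nhds
    rw [zero_smul, add_zero]
    exact h.norm_base_lt hG hp hu
  have key := deriv_le_of_eventually_le (m := K * s / 4 - lam * ‖c 1 - c 0‖) hd (by
    filter_upwards [self_mem_nhdsWithin, hbase] with ε hε hb
    have hc' := hsh.contract (hsh.nonneg 1 m1) hε hb.le
    have hE := hG.sqrt_energy_contract hsh hp.η_pos.le hp.η_le hp.r_le hr1 m1 hε
    have h1 := h.compare hG hp hc' (hE.trans (by nlinarith [hε.1]))
    simp only [sub_self, smul_zero, add_zero, zero_smul, add_sub_cancel_left, norm_smul,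
      Real.norm_of_nonneg hε.1, Pi.neg_apply] at h1 ⊢
    have h2 : K * (ε / 2 * s) ≤ K * (s - √(energy (chartMetric g x₀)
        (fun τ => c τ + ε • (c 1 - c τ)) (fun τ => (1 - ε) • v τ))) :=
      mul_le_mul_of_nonneg_left (by linarith) hp.K_pos.le
    linarith)
  have h3 := (coordDeriv n u x₀ t (c 0)).le_of_opNorm_le
    (norm_coordDeriv_boundary_le hG hu h.mem (h.mem_halfBall hp m0) h0.symm) (c 1 - c 0)
  rw [Real.norm_eq_abs] at h3
  have h4 := le_abs_self (coordDeriv n u x₀ t (c 0) (c 1 - c 0))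
  have hb := hp.b_nonneg
  have hl := hp.lam_nonneg
  have h5 : C ^ 2 * b * ‖c 1 - c 0‖ ≤ C ^ 2 * b * (2 * C * s) := by gcongr
  have h5' : lam * ‖c 1 - c 0‖ ≤ lam * (2 * C * s) := by gcongr
  have h6 : 64 * C ^ 3 * b * s ≤ K * s := mul_le_mul_of_nonneg_right hp.b_le hspos.le
  have h6' : 64 * C * lam * s ≤ K * s := mul_le_mul_of_nonneg_right hp.lam_le hspos.le
  have h7 : 0 < K * s := mul_pos hp.K_pos hspos
  have h8 : C ^ 2 * b * (2 * C * s) = (64 * C ^ 3 * b * s) / 32 := by ring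
  have h9 : lam * (2 * C * s) = (64 * C * lam * s) / 32 := by ring
  linarith

/-- Points of small height are close to the boundary, where the gradient is controlled. -/
theorem sub_le_of_height_le (hG : GoodChart g x₀ ρ C) (hu : IsBounded g T u N b C₀)
    (ht : t ∈ Icc 0 T) {z z' : Model n} {δ : ℝ}
    (hz : ‖z - extChartAt (𝓡∂ n) x₀ x₀‖ ≤ 5 / 2 * ρ)
    (hz' : ‖z' - extChartAt (𝓡∂ n) x₀ x₀‖ ≤ 5 / 2 * ρ)
    (h0 : 0 ≤ z 0) (h0' : 0 ≤ z' 0) (hδ : z 0 ≤ δ) (hδ' : z' 0 ≤ δ) (hδρ : 2 * δ ≤ ρ)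
    (hN : 0 ≤ N) (hb : 0 ≤ b) :
    coordFn n u x₀ t z - coordFn n u x₀ t z'
      ≤ 2 * (C ^ 2 * N * δ) + C ^ 2 * b * (‖z - z'‖ + 2 * δ) := by
  have hC := hG.one_le
  -- the vertical projection onto the boundary
  let pr : Model n → Model n := fun y => y - y 0 • EuclideanSpace.single 0 1
  have hpr0 : ∀ y : Model n, pr y 0 = 0 := fun y => by
    simp [pr, PiLp.sub_apply, PiLp.smul_apply]
  have hprn : ∀ y : Model n, 0 ≤ y 0 → ‖y - pr y‖ = y 0 := fun y hy => by
    simp [pr, norm_smul, abs_of_nonneg hy]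
  have hmem : ∀ y : Model n, ‖y - extChartAt (𝓡∂ n) x₀ x₀‖ ≤ 5 / 2 * ρ → 0 ≤ y 0 → y 0 ≤ δ →
      y ∈ halfBall n x₀ ρ ∧ pr y ∈ halfBall n x₀ ρ := by
    intro y h1 h2 h3
    have hρ := hG.pos
    refine ⟨⟨?_, mem_range_model_iff.2 h2⟩, ?_, mem_range_model_iff.2 (hpr0 y).ge⟩
    · rw [mem_closedBall_iff_norm]
      linarith
    · rw [mem_closedBall_iff_norm]
      have h4 := norm_add_le (pr y - y) (y - extChartAt (𝓡∂ n) x₀ x₀)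
      rw [sub_add_sub_cancel, norm_sub_rev (pr y) y, hprn y h2] at h4
      linarith
  obtain ⟨hzm, hpzm⟩ := hmem z hz h0 hδ
  obtain ⟨hzm', hpzm'⟩ := hmem z' hz' h0' hδ'
  have hgr : ∀ y ∈ halfBall n x₀ ρ, ‖coordDeriv n u x₀ t y‖ ≤ C ^ 2 * N := fun y hy => by
    refine (hG.norm_coordDeriv_le hu.isCk ht hy).trans ?_
    gcongr
    exact hu.gradNorm_le _ t ht
  have h1 := hG.abs_sub_le hu.isCk ht (convex_halfBall x₀ ρ) Subset.rfl hgr hzm hpzm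
  have h2 := hG.abs_sub_le hu.isCk ht (convex_halfBall x₀ ρ) Subset.rfl hgr hzm' hpzm'
  have hS : Convex ℝ (halfBall n x₀ ρ ∩ {y : Model n | y 0 = 0}) :=
    (convex_halfBall x₀ ρ).inter (convex_hyperplane
      (EuclideanSpace.proj (𝕜 := ℝ) (0 : Fin n)).toLinearMap.isLinear 0)
  have h3 := hG.abs_sub_le hu.isCk ht hS inter_subset_left
    (fun y hy => norm_coordDeriv_boundary_le hG hu ht hy.1 hy.2) ⟨hpzm, hpr0 z⟩ ⟨hpzm', hpr0 z'⟩
  rw [hprn z h0] at h1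
  rw [hprn z' h0'] at h2
  have h4 : ‖pr z - pr z'‖ ≤ ‖z - z'‖ + 2 * δ := by
    have e : pr z - pr z' = (z - z') - (z - pr z) + (z' - pr z') := by abel
    rw [e]
    have h5 := norm_add_le ((z - z') - (z - pr z)) (z' - pr z')
    have h6 := norm_sub_le (z - z') (z - pr z)
    rw [hprn z' h0'] at h5
    rw [hprn z h0] at h6
    linarith
  have a1 := le_abs_self (coordFn n u x₀ t z - coordFn n u x₀ t (pr z))
  have a2 := neg_abs_le (coordFn n u x₀ t z' - coordFn n u x₀ t (pr z'))
  have a3 := le_abs_self (coordFn n u x₀ t (pr z) - coordFn n u x₀ t (pr z'))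
  have b1 : C ^ 2 * N * z 0 ≤ C ^ 2 * N * δ := by gcongr
  have b2 : C ^ 2 * N * z' 0 ≤ C ^ 2 * N * δ := by gcongr
  have b3 : C ^ 2 * b * ‖pr z - pr z'‖ ≤ C ^ 2 * b * (‖z - z'‖ + 2 * δ) := by gcongr
  linarith

/-- A maximizing curve lies in the interior. A curve that touches the boundary from inside stays
close to it, and the boundary gradient controls the difference of the values at its end points. -/
theorem curve_pos (h : IsMaximizer g u x₀ T ρ η r α K lam c v t)
    (hG : GoodChart g x₀ ρ C) (hp : SmallParameters C ρ η r α K N b lam C₀)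
    (hu : IsBounded g T u N b C₀) {τ : ℝ} (hτ : τ ∈ Icc (0 : ℝ) 1) : 0 < c τ 0 := by
  have m0 : (0 : ℝ) ∈ Icc (0 : ℝ) 1 := by simp
  have m1 : (1 : ℝ) ∈ Icc (0 : ℝ) 1 := by simp
  have hC := hG.one_le
  have hsh := h.isShortCurve
  have hη := hp.η_pos
  refine (hsh.nonneg τ hτ).lt_of_ne fun h0 => ?_
  have hτ' : τ ∈ Ioo (0 : ℝ) 1 := by
    refine ⟨hτ.1.lt_of_ne fun e => ?_, hτ.2.lt_of_ne fun e => ?_⟩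
    · exact absurd h0 (by rw [← e]; exact (h.start_pos hG hp hu).ne)
    · exact absurd h0 (by rw [e]; exact (h.end_pos hG hp hu).ne)
  have hd : ∀ σ ∈ Icc (0 : ℝ) 1, HasDerivWithinAt (fun σ => c σ 0) (v σ 0) (Icc 0 1) σ :=
    fun σ hσ => (EuclideanSpace.proj (𝕜 := ℝ) (0 : Fin n)).hasFDerivAt.comp_hasDerivWithinAt σ
      (hsh.hasDerivWithinAt σ hσ)
  have hv0 : v τ 0 = 0 := by
    have hmin : IsLocalMin (fun σ => c σ 0) τ := by
      filter_upwards [Icc_mem_nhds hτ'.1 hτ'.2] with σ hσ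
      rw [← h0]
      exact hsh.nonneg σ hσ
    exact hmin.hasDerivAt_eq_zero ((hd τ hτ).hasDerivAt (Icc_mem_nhds hτ'.1 hτ'.2))
  set d := ‖c 1 - c 0‖ with hdd
  have hdpos : 0 < d := h.norm_chord_pos hG hp
  have hvle : ∀ σ ∈ Icc (0 : ℝ) 1, ‖v σ 0‖ ≤ η * d := by
    intro σ hσ
    have h1 := hsh.norm_velocity_sub_le σ hσ τ hτ
    have h2 : ‖(v σ - v τ) 0‖ ≤ ‖v σ - v τ‖ := PiLp.norm_apply_le _ _
    rw [PiLp.sub_apply, hv0, sub_zero] at h2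
    refine (h2.trans h1).trans (mul_le_of_le_one_right (by positivity) (abs_le.2 ⟨?_, ?_⟩))
    · linarith [hσ.1, hτ.2]
    · linarith [hσ.2, hτ.1]
  have hheight : ∀ σ ∈ Icc (0 : ℝ) 1, c σ 0 ≤ η * d := by
    intro σ hσ
    have h1 := (convex_Icc (0 : ℝ) 1).norm_image_sub_le_of_norm_hasDerivWithin_le hd hvle hτ hσ
    rw [← h0, sub_zero, Real.norm_eq_abs, Real.norm_eq_abs] at h1
    refine (le_abs_self _).trans (h1.trans (mul_le_of_le_one_right (by positivity)
      (abs_le.2 ⟨?_, ?_⟩)))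
    · linarith [hσ.1, hτ.2]
    · linarith [hσ.2, hτ.1]
  have hball : ∀ σ ∈ Icc (0 : ℝ) 1, ‖c σ - extChartAt (𝓡∂ n) x₀ x₀‖ ≤ 5 / 2 * ρ := by
    intro σ hσ
    have h1 := (hsh.mem_halfBall hη.le hp.η_le hσ).1
    rw [mem_closedBall_iff_norm] at h1
    linarith [hp.r_le]
  have hN : 0 ≤ N := (gradNorm_nonneg g u (x₀, t)).trans (hu.gradNorm_le x₀ t h.mem)
  have hηd : η * d ≤ d / 2 := by nlinarith [hp.η_le]
  have hdr : d ≤ r := hsh.norm_chord_le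
  have hρ := hG.pos
  have hr := hp.r_le
  have hb := hp.b_nonneg
  have key := sub_le_of_height_le hG hu h.mem (hball 1 m1) (hball 0 m0) (hsh.nonneg 1 m1)
    (hsh.nonneg 0 m0) (hheight 1 m1) (hheight 0 m0) (by linarith) hN hb
  refine h.false_of_sub_le hG hp (B := 2 * C ^ 2 * N * η + 2 * C ^ 2 * b) ?_ (key.trans ?_)
  · have h1 : 16 * C ^ 3 * η * N ≤ 16 * C ^ 3 * η * (2 * K) := by
      have := hp.N_le
      gcongr
    have h2 := mul_le_mul_of_nonneg_right hp.C_η_le hp.K_pos.le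
    have h3 := hp.b_le
    have e : 4 * C * (2 * C ^ 2 * N * η + 2 * C ^ 2 * b)
        = (16 * C ^ 3 * η * N) / 2 + 64 * C ^ 3 * b / 8 := by ring
    have h4 := hp.K_pos
    rw [e]
    linarith
  · have h1 : C ^ 2 * b * (d + 2 * (η * d)) ≤ C ^ 2 * b * (2 * d) := by
      gcongr; linarith
    linarith

end IsMaximizer

end BoundaryContact

/-! ### Maximizers are geodesics -/

section MaximizingGeodesics

open Topology Filter MeasureTheory

set_option maxSynthPendingDepth 3

variable {n : ℕ} [NeZero n] {M : Type*} [TopologicalSpace M]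
  [ChartedSpace (EuclideanHalfSpace n) M] [IsManifold (𝓡∂ n) ∞ M]

namespace IsMaximizer

variable {g : Metric n M} {x₀ : M} {u : M → ℝ → ℝ} {T C ρ η r α K N b lam C₀ t : ℝ}
  {c v : ℝ → Model n}

theorem mem_openHalfBall (h : IsMaximizer g u x₀ T ρ η r α K lam c v t)
    (hG : GoodChart g x₀ ρ C) (hp : SmallParameters C ρ η r α K N b lam C₀)
    (hu : IsBounded g T u N b C₀) {τ : ℝ} (hτ : τ ∈ Icc (0 : ℝ) 1) :
    c τ ∈ openHalfBall n x₀ ρ := by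
  refine ⟨?_, h.curve_pos hG hp hu hτ⟩
  have h1 := (h.isShortCurve.mem_halfBall hp.η_pos.le hp.η_le hτ).1
  refine Metric.closedBall_subset_ball ?_ h1
  linarith [hp.r_le, hG.pos]

/-- Short curves remain short under small perturbations with fixed end points. -/
theorem eventually_isShortCurve (h : IsMaximizer g u x₀ T ρ η r α K lam c v t)
    (hG : GoodChart g x₀ ρ C) (hp : SmallParameters C ρ η r α K N b lam C₀)
    (hu : IsBounded g T u N b C₀) {w w' : ℝ → Model n}
    (hw : ∀ τ, HasDerivAt w (w' τ) τ) (hw0 : w 0 = 0) (hw1 : w 1 = 0)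
    (hL : ∀ τ σ : ℝ, ‖(v τ + w' τ) - (v σ + w' σ)‖ ≤ η * ‖c 1 - c 0‖ * |τ - σ|) :
    ∀ᶠ ε in 𝓝[>] (0 : ℝ), IsShortCurve (extChartAt (𝓡∂ n) x₀ x₀) (2 * ρ) η r
      (fun τ => c τ + ε • w τ) (fun τ => v τ + ε • w' τ) := by
  have hsh := h.isShortCurve
  have hwc : Continuous w := continuous_iff_continuousAt.2 fun τ => (hw τ).continuousAt
  obtain ⟨τ₀, hτ₀, hmin⟩ := isCompact_Icc.exists_isMinOn (nonempty_Icc.2 zero_le_one)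
    ((EuclideanSpace.proj (𝕜 := ℝ) (0 : Fin n)).continuous.comp_continuousOn hsh.continuousOn)
  have hm : 0 < c τ₀ 0 := h.curve_pos hG hp hu hτ₀
  obtain ⟨B, hB⟩ := (isCompact_Icc (a := (0 : ℝ)) (b := 1)).exists_bound_of_continuousOn
    hwc.continuousOn
  have hB0 : 0 ≤ B := (norm_nonneg _).trans (hB 0 (by simp))
  filter_upwards [self_mem_nhdsWithin,
    nhdsWithin_le_nhds (Iio_mem_nhds (zero_lt_one : (0 : ℝ) < 1)),
    nhdsWithin_le_nhds (Iio_mem_nhds (by positivity : 0 < c τ₀ 0 / (B + 1)))] with ε hε0 hε1 hεB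
  have hε0 : 0 < ε := hε0
  have hε1 : ε < 1 := hε1
  have hεB : ε < c τ₀ 0 / (B + 1) := hεB
  refine ⟨fun τ hτ => (hsh.hasDerivWithinAt τ hτ).add ((hw τ).hasDerivWithinAt.const_smul ε),
    fun τ hτ σ hσ => ?_, fun τ hτ => ?_, ?_, ?_⟩
  · have e : v τ + ε • w' τ - (v σ + ε • w' σ)
        = (1 - ε) • (v τ - v σ) + ε • ((v τ + w' τ) - (v σ + w' σ)) := by module
    simp only [hw0, hw1, smul_zero, add_zero]
    rw [e]
    refine (norm_add_le _ _).trans ?_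
    rw [norm_smul, norm_smul, Real.norm_of_nonneg hε0.le, Real.norm_of_nonneg (by linarith)]
    have h1 := mul_le_mul_of_nonneg_left (hsh.norm_velocity_sub_le τ hτ σ hσ)
      (by linarith : 0 ≤ 1 - ε)
    have h2 := mul_le_mul_of_nonneg_left (hL τ σ) hε0.le
    linarith
  · have h1 : c τ₀ 0 ≤ c τ 0 := hmin hτ
    have h2 : |w τ 0| ≤ B := (PiLp.norm_apply_le (w τ) 0).trans (hB τ hτ)
    have h3 := (abs_le.1 h2).1
    rw [lt_div_iff₀ (by positivity)] at hεB
    have e : (c τ + ε • w τ) 0 = c τ 0 + ε * w τ 0 := by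
      simp [PiLp.add_apply, PiLp.smul_apply]
    rw [e]
    nlinarith
  · simpa [hw0] using hsh.norm_base_le
  · simpa [hw0, hw1] using hsh.norm_chord_le

/-- A maximizing curve is a geodesic. -/
theorem isGeodesic (h : IsMaximizer g u x₀ T ρ η r α K lam c v t)
    (hG : GoodChart g x₀ ρ C) (hp : SmallParameters C ρ η r α K N b lam C₀)
    (hu : IsBounded g T u N b C₀) (hv : Continuous v) (hc : ∀ τ, HasDerivAt c (v τ) τ) :
    IsGeodesic (chartMetric g x₀) c v := by
  have hsh := h.isShortCurve
  have hC := hG.one_le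
  have hd0 := h.norm_chord_pos hG hp
  have hdr := hsh.norm_chord_le
  have hη := hp.η_le
  have hCr := hp.C_r_le
  have hCd : 8 * C ^ 2 * ‖c 1 - c 0‖ ≤ η :=
    (mul_le_mul_of_nonneg_left hdr (by positivity)).trans hCr
  refine hG.metricBounds.isGeodesic_of_minimal (μ := 2 * ‖c 1 - c 0‖) (L := η * ‖c 1 - c 0‖) hv hc
    (fun τ hτ => h.mem_openHalfBall hG hp hu hτ)
    (fun τ hτ => hsh.norm_velocity_le hp.η_pos.le hp.η_le hτ) (by linarith) ?_ ?_
  · have := mul_le_mul_of_nonneg_right hCd hd0.le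
    linarith
  · intro w w' _ hw hw0 hw1 hL
    filter_upwards [h.eventually_isShortCurve hG hp hu hw hw0 hw1 hL] with ε hε
    by_contra! hlt
    have hE := hG.energy_nonneg (v := fun τ => v τ + ε • w' τ) fun τ hτ =>
      hε.mem_halfBall_chart hp.η_pos.le hp.η_le hp.r_le hτ
    have hs := Real.sqrt_lt_sqrt hE hlt
    have h1 := h.compare hG hp hε hs.le
    simp only [hw0, hw1, smul_zero, add_zero, sub_self, norm_zero, mul_zero] at h1
    have h2 := mul_pos hp.K_pos (sub_pos.2 hs)
    linarith

end IsMaximizer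

end MaximizingGeodesics

/-! ### Short geodesics in another chart -/

section ChangeOfChart

open Topology Filter MeasureTheory

set_option maxSynthPendingDepth 3

variable {n : ℕ} [NeZero n]

/-- Quadratic perturbations of an almost straight curve in the open half space are short curves. -/
theorem eventually_isShortCurve_perturb {z₀ : Model n} {ρ η r : ℝ} {c v : ℝ → Model n} (hη : 0 < η)
    (hd : ∀ τ ∈ Icc (0 : ℝ) 1, HasDerivWithinAt c (v τ) (Icc 0 1) τ)
    (hv : ∀ τ ∈ Icc (0 : ℝ) 1, ∀ σ ∈ Icc (0 : ℝ) 1,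
      ‖v τ - v σ‖ ≤ η / 2 * ‖c 1 - c 0‖ * |τ - σ|)
    (hpos : ∀ τ ∈ Icc (0 : ℝ) 1, 0 < c τ 0) (hbase : ‖c 0 - z₀‖ < ρ) (hχ : 0 < ‖c 1 - c 0‖)
    (hχr : ‖c 1 - c 0‖ < r) (a b w w' : Model n) :
    ∀ᶠ ε in 𝓝 (0 : ℝ), IsShortCurve z₀ ρ η r
      (fun τ => c τ + ε • (b + τ • (a - b)) + ε ^ 2 • (w + τ • w'))
      (fun τ => v τ + ε • (a - b) + ε ^ 2 • w') := by
  let pr : ℝ → ℝ := fun τ => (projIcc (0 : ℝ) 1 zero_le_one τ : ℝ)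
  have hpr : Continuous pr := continuous_subtype_val.comp continuous_projIcc
  have hcc : Continuous fun τ => c (pr τ) :=
    ContinuousOn.comp_continuous (fun τ hτ => (hd τ hτ).continuousWithinAt) hpr
      fun τ => (projIcc (0 : ℝ) 1 zero_le_one τ).2
  have hpre : ∀ τ ∈ Icc (0 : ℝ) 1, pr τ = τ := fun τ hτ => by
    simp only [pr, projIcc_of_mem zero_le_one hτ]
  -- the end points depend continuously on the perturbation
  have hend : ∀ τ : ℝ, Tendsto
      (fun ε : ℝ => c τ + ε • (b + τ • (a - b)) + ε ^ 2 • (w + τ • w')) (𝓝 0) (𝓝 (c τ)) := by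
    intro τ
    have h : Continuous fun ε : ℝ => c τ + ε • (b + τ • (a - b)) + ε ^ 2 • (w + τ • w') := by
      fun_prop
    simpa using h.tendsto 0
  have h1 := ((hend 0).sub_const z₀).norm.eventually_lt_const hbase
  have h2 := ((hend 1).sub (hend 0)).norm.eventually_lt_const hχr
  have h3 := ((hend 1).sub (hend 0)).norm.eventually_const_lt (by linarith : ‖c 1 - c 0‖ / 2 < _)
  have h4 : ∀ᶠ ε in 𝓝 (0 : ℝ), ∀ τ ∈ Icc (0 : ℝ) 1,
      0 < (c (pr τ) + ε • (b + τ • (a - b)) + ε ^ 2 • (w + τ • w')) 0 := by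
    refine isCompact_Icc.eventually_forall_of_forall_eventually fun τ hτ => ?_
    have h : Continuous fun p : ℝ × ℝ =>
        (c (pr p.2) + p.1 • (b + p.2 • (a - b)) + p.1 ^ 2 • (w + p.2 • w')) 0 := by
      refine (EuclideanSpace.proj (𝕜 := ℝ) (0 : Fin n)).continuous.comp
        (((hcc.comp continuous_snd).add ?_).add ?_)
      · fun_prop
      · fun_prop
    refine (h.tendsto (0, τ)).eventually_const_lt ?_
    simpa [hpre τ hτ] using hpos τ hτ
  filter_upwards [h1, h2, h3, h4] with ε e1 e2 e3 e4
  refine ⟨fun τ hτ => ?_, fun τ hτ σ hσ => ?_, fun τ hτ => ?_, e1.le, e2.le⟩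
  · have d1 := ((hasDerivAt_id τ).smul_const (a - b)).const_add b |>.const_smul ε
    have d2 := ((hasDerivAt_id τ).smul_const w').const_add w |>.const_smul (ε ^ 2)
    refine (((hd τ hτ).add d1.hasDerivWithinAt).add d2.hasDerivWithinAt).congr_deriv ?_
    simp
  · have e : v τ + ε • (a - b) + ε ^ 2 • w' - (v σ + ε • (a - b) + ε ^ 2 • w') = v τ - v σ := by
      abel
    rw [e]
    refine (hv τ hτ σ hσ).trans (mul_le_mul_of_nonneg_right ?_ (abs_nonneg _))
    have := mul_le_mul_of_nonneg_left e3.le hη.le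
    linarith
  · have := e4 τ hτ
    rw [hpre τ hτ] at this
    exact this.le

theorem IsShortCurve.mono {z₀ : Model n} {ρ ρ' η r : ℝ} {c v : ℝ → Model n}
    (h : IsShortCurve z₀ ρ η r c v) (hρ : ρ ≤ ρ') : IsShortCurve z₀ ρ' η r c v :=
  ⟨h.1, h.2, h.3, h.4.trans hρ, h.5⟩

variable {M : Type*} [TopologicalSpace M] [ChartedSpace (EuclideanHalfSpace n) M] {x₀ y₀ : M}
  {c v : ℝ → Model n}

theorem coordFn_transition {u : M → ℝ → ℝ} {t : ℝ} {z : Model n}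
    (hy : (extChartAt (𝓡∂ n) x₀).symm z ∈ (extChartAt (𝓡∂ n) y₀).source) :
    coordFn n u y₀ t (transition n x₀ y₀ z) = coordFn n u x₀ t z := by
  rw [coordFn, symm_transition hy, coordFn]

/-- Curves starting in a compact part of the chart at `y₀` stay in this chart for a uniform
distance, measured in the chart at `x₀`. -/
theorem exists_overlap [T2Space M] {S : Set (Model n)} (hS : IsCompact S)
    (hSt : S ⊆ (extChartAt (𝓡∂ n) x₀).target) {ρ : ℝ} (hρ : 0 < ρ)
    (hρt : halfBall n y₀ ρ ⊆ (extChartAt (𝓡∂ n) y₀).target) :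
    ∃ δ, 0 < δ ∧ ∀ z ∈ S, ∀ z' ∈ S,
      (extChartAt (𝓡∂ n) x₀).symm z ∈ (extChartAt (𝓡∂ n) y₀).source →
      transition n x₀ y₀ z ∈ Metric.ball (extChartAt (𝓡∂ n) y₀ y₀) ρ → ‖z' - z‖ < δ →
      (extChartAt (𝓡∂ n) x₀).symm z' ∈ (extChartAt (𝓡∂ n) y₀).source ∧
        transition n x₀ y₀ z' ∈ Metric.ball (extChartAt (𝓡∂ n) y₀ y₀) (2 * ρ) := by
  set B : Set (Model n) := Metric.closedBall (extChartAt (𝓡∂ n) y₀ y₀) ρ ∩ range (𝓡∂ n)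
  have hBt : B ⊆ (extChartAt (𝓡∂ n) y₀).target := fun z hz =>
    hρt ⟨Metric.closedBall_subset_closedBall (by linarith) hz.1, hz.2⟩
  have hK : IsCompact ((extChartAt (𝓡∂ n) y₀).symm '' B) :=
    ((isCompact_closedBall _ _).inter_right (𝓡∂ n).isClosed_range).image_of_continuousOn
      ((continuousOn_extChartAt_symm y₀).mono hBt)
  have hO : IsOpen ((extChartAt (𝓡∂ n) y₀).source ∩ extChartAt (𝓡∂ n) y₀ ⁻¹'
      Metric.ball (extChartAt (𝓡∂ n) y₀ y₀) (2 * ρ)) :=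
    (continuousOn_extChartAt y₀).isOpen_inter_preimage (isOpen_extChartAt_source y₀)
      Metric.isOpen_ball
  have hcont : ContinuousOn (extChartAt (𝓡∂ n) x₀).symm S :=
    (continuousOn_extChartAt_symm x₀).mono hSt
  have hA : IsCompact (S ∩ (extChartAt (𝓡∂ n) x₀).symm ⁻¹' ((extChartAt (𝓡∂ n) y₀).symm '' B)) :=
    hS.of_isClosed_subset (hcont.preimage_isClosed_of_isClosed hS.isClosed hK.isClosed)
      inter_subset_left
  obtain ⟨W, hW, hWS⟩ := continuousOn_iff'.1 hcont _ hO
  obtain ⟨δ, hδ, hδW⟩ := hA.exists_thickening_subset_open hW (by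
    rintro z ⟨hzS, x, hx, hxz⟩
    have hx' := hBt hx
    have : z ∈ (extChartAt (𝓡∂ n) x₀).symm ⁻¹' ((extChartAt (𝓡∂ n) y₀).source ∩
        extChartAt (𝓡∂ n) y₀ ⁻¹' Metric.ball (extChartAt (𝓡∂ n) y₀ y₀) (2 * ρ)) ∩ S := by
      refine ⟨?_, hzS⟩
      rw [mem_preimage, ← hxz]
      refine ⟨(extChartAt (𝓡∂ n) y₀).map_target hx', ?_⟩
      rw [mem_preimage, (extChartAt (𝓡∂ n) y₀).right_inv hx']
      exact Metric.closedBall_subset_ball (by linarith) hx.1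
    rw [hWS] at this
    exact this.1)
  refine ⟨δ, hδ, fun z hz z' hz' hy hzρ hzz => ?_⟩
  have h1 : z' ∈ W := by
    refine hδW (Metric.mem_thickening_iff.2 ⟨z, ⟨hz, transition n x₀ y₀ z, ⟨?_, ?_⟩, ?_⟩, ?_⟩)
    · exact Metric.ball_subset_closedBall hzρ
    · exact target_subset_range y₀ (transition_mem_target hy)
    · exact symm_transition hy
    · rwa [dist_eq_norm]
  have h2 : z' ∈ W ∩ S := ⟨h1, hz'⟩
  rw [← hWS] at h2
  exact ⟨h2.1.1, h2.1.2⟩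

variable [IsManifold (𝓡∂ n) ∞ M] {g : Metric n M}

theorem energy_transition
    (hz : ∀ τ ∈ Icc (0 : ℝ) 1, c τ ∈ (extChartAt (𝓡∂ n) x₀).target)
    (hz0 : ∀ τ ∈ Icc (0 : ℝ) 1, 0 < c τ 0)
    (hy : ∀ τ ∈ Icc (0 : ℝ) 1, (extChartAt (𝓡∂ n) x₀).symm (c τ) ∈ (extChartAt (𝓡∂ n) y₀).source) :
    energy (chartMetric g y₀) (fun τ => transition n x₀ y₀ (c τ))
      (fun τ => fderiv ℝ (transition n x₀ y₀) (c τ) (v τ)) = energy (chartMetric g x₀) c v := by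
  refine intervalIntegral.integral_congr fun τ hτ => ?_
  rw [uIcc_of_le zero_le_one] at hτ
  exact ((eventually_chartMetric g (hz τ hτ) (hz0 τ hτ) (hy τ hτ)).self_of_nhds _ _).symm

/-- Geodesics are geodesics in every chart. -/
theorem IsGeodesic.transition (h : IsGeodesic (chartMetric g x₀) c v)
    (hz : ∀ τ ∈ Icc (0 : ℝ) 1, c τ ∈ (extChartAt (𝓡∂ n) x₀).target)
    (hz0 : ∀ τ ∈ Icc (0 : ℝ) 1, 0 < c τ 0)
    (hy : ∀ τ ∈ Icc (0 : ℝ) 1, (extChartAt (𝓡∂ n) x₀).symm (c τ) ∈ (extChartAt (𝓡∂ n) y₀).source) :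
    IsGeodesic (chartMetric g y₀) (fun τ => transition n x₀ y₀ (c τ))
      (fun τ => fderiv ℝ (transition n x₀ y₀) (c τ) (v τ)) := by
  have hT := fun τ hτ => isTransition (hz τ hτ) (hz0 τ hτ) (hy τ hτ)
  refine ⟨fun τ hτ => (hT τ hτ).hasFDerivAt.comp_hasDerivWithinAt τ (h.hasDerivWithinAt τ hτ),
    fun τ hτ => ?_⟩
  have h1 := ((hT τ hτ).hasFDerivAt_fderiv.comp_hasDerivWithinAt τ
    (h.hasDerivWithinAt τ hτ)).clm_apply (h.hasDerivWithinAt_velocity τ hτ)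
  refine h1.congr_deriv ?_
  have hy' := transition_mem_target (hy τ hτ)
  have h2 := (hT τ hτ).fderiv_chris (differentiableAt_chartMetric g (hz τ hτ) (hz0 τ hτ))
    (differentiableAt_chartMetric g hy' (transition_pos (hz τ hτ) (hy τ hτ) (hz0 τ hτ)))
    (eventually_chartMetric g (hz τ hτ) (hz0 τ hτ) (hy τ hτ))
    (fun a b => chartMetric_symm g y₀ _ a b)
    (fun a ha => by
      by_contra hne
      exact (chartMetric_pos g hy' hne).ne' ha) (v τ) (v τ)
  simp only [Function.comp_apply]
  rw [map_neg, h2]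
  abel

/-- A sufficiently short geodesic is almost straight. -/
theorem GoodChart.straight_of_isGeodesic {ρ C η s : ℝ} (hG : GoodChart g x₀ ρ C)
    (h : IsGeodesic (chartMetric g x₀) c v) (hcO : ∀ τ ∈ Icc (0 : ℝ) 1, c τ ∈ openHalfBall n x₀ ρ)
    (hs0 : 0 < s) (hs : energy (chartMetric g x₀) c v = s ^ 2) (hη : η ≤ 1 / 2)
    (hsη : 8 * C ^ 5 * s ≤ η) :
    0 < ‖c 1 - c 0‖ ∧ ‖c 1 - c 0‖ ≤ C * s ∧ ∀ τ ∈ Icc (0 : ℝ) 1, ∀ σ ∈ Icc (0 : ℝ) 1,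
      ‖v τ - v σ‖ ≤ η / 2 * ‖c 1 - c 0‖ * |τ - σ| := by
  have m0 : (0 : ℝ) ∈ Icc (0 : ℝ) 1 := by simp
  have m1 : (1 : ℝ) ∈ Icc (0 : ℝ) 1 := by simp
  have hC := hG.one_le
  have hM := hG.metricBounds
  have hv : ∀ τ ∈ Icc (0 : ℝ) 1, ‖v τ - v 0‖ ≤ 2 * C ^ 4 * s ^ 2 := fun τ hτ => by
    refine (h.norm_velocity_sub_le hM hcO hs0.le hs hτ m0).trans ?_
    refine mul_le_of_le_one_right (by positivity) ?_
    rw [sub_zero, abs_of_nonneg hτ.1]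
    exact hτ.2
  have hv0 : s ≤ C * ‖v 0‖ := by
    refine abs_le_of_sq_le_sq' ?_ (by positivity) |>.2
    have h1 := hG.apply_le (openHalfBall_subset _ _ (hcO 0 m0)) (v 0)
    rw [← h.energy_eq hM hcO, hs] at h1
    have : 0 ≤ ‖v 0‖ ^ 2 := by positivity
    nlinarith
  have hχ : ‖c 1 - c 0 - v 0‖ ≤ 2 * C ^ 4 * s ^ 2 := by
    have h1 := (convex_Icc (0 : ℝ) 1).norm_image_sub_le_of_norm_hasDerivWithin_le
      (f := fun σ => c σ - σ • v 0) (f' := fun σ => v σ - v 0) (C := 2 * C ^ 4 * s ^ 2)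
      (fun σ hσ => ((h.hasDerivWithinAt σ hσ).sub
        ((hasDerivAt_id σ).smul_const (v 0)).hasDerivWithinAt).congr_deriv (by simp)) hv m0 m1
    have e : c 1 - (1 : ℝ) • v 0 - (c 0 - (0 : ℝ) • v 0) = c 1 - c 0 - v 0 := by
      rw [one_smul, zero_smul]; abel
    simpa only [e, sub_zero, norm_one, mul_one] using h1
  have hχs : s ≤ 2 * C * ‖c 1 - c 0‖ := by
    have h1 := _root_.norm_sub_le (c 1 - c 0) (c 1 - c 0 - v 0)
    rw [sub_sub_cancel] at h1
    have h2 : C * ‖v 0‖ ≤ C * (‖c 1 - c 0‖ + 2 * C ^ 4 * s ^ 2) := by gcongr; linarith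
    have h3 : 8 * C ^ 5 * s * s ≤ 1 / 2 * s := mul_le_mul_of_nonneg_right (hsη.trans hη) hs0.le
    have h4 : C * (2 * C ^ 4 * s ^ 2) = 8 * C ^ 5 * s * s / 4 := by ring
    rw [mul_add, h4] at h2
    linarith
  refine ⟨by_contra fun h0 => ?_, h.norm_sub_le hM hcO hs0.le hs m1 m0, fun τ hτ σ hσ => ?_⟩
  · have : 2 * C * ‖c 1 - c 0‖ ≤ 0 := mul_nonpos_of_nonneg_of_nonpos (by positivity) (not_lt.1 h0)
    linarith
  · refine (h.norm_velocity_sub_le hM hcO hs0.le hs hτ hσ).trans ?_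
    refine mul_le_mul_of_nonneg_right ?_ (abs_nonneg _)
    have h1 : 8 * C ^ 5 * s * s ≤ η * (2 * C * ‖c 1 - c 0‖) :=
      mul_le_mul hsη hχs hs0.le ((by positivity : 0 ≤ 8 * C ^ 5 * s).trans hsη)
    refine le_of_mul_le_mul_left (a := 4 * C) ?_ (by positivity)
    linarith

end ChangeOfChart

/-! ### The equation at the ends of a maximizer -/

section Equation

open Topology Filter MeasureTheory

set_option maxSynthPendingDepth 3

variable {n : ℕ} [NeZero n] {M : Type*} [TopologicalSpace M]
  [ChartedSpace (EuclideanHalfSpace n) M] [IsManifold (𝓡∂ n) ∞ M] {g : Metric n M} {x₀ : M}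
  {u : M → ℝ → ℝ} {T t : ℝ} {A : TensorCoeff n M} {z : Model n}

theorem IsCk.isAugDiag (hu : IsCk n 3 T u) (ht : t ∈ Icc 0 T)
    (hz : z ∈ (extChartAt (𝓡∂ n) x₀).target) (hz0 : 0 < z 0) {l : Fin n → ℝ}
    (h : IsEigenvalues g ((extChartAt (𝓡∂ n) x₀).symm z)
      (augHess g A u ((extChartAt (𝓡∂ n) x₀).symm z) t) l) :
    IsAugDiag (chartMetric g x₀) (coordTensor A x₀) (coordFn n u x₀ t) z t l :=
  isAugDiag_of_isEigenvalues g hz hz0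
    (((hu.contMDiff_slice ht).of_le (by norm_num)) _) h

/-- Admissibility in coordinates. -/
theorem IsAdmissible.exists_isAugDiag {Γ : Set (Fin (n + 1) → ℝ)} (h : IsAdmissible g T Γ A u)
    (hu : IsCk n 3 T u) (ht : t ∈ Icc 0 T) (hz : z ∈ (extChartAt (𝓡∂ n) x₀).target)
    (hz0 : 0 < z 0) :
    ∃ l, IsAugDiag (chartMetric g x₀) (coordTensor A x₀) (coordFn n u x₀ t) z t l ∧
      (Fin.snoc l (- timeDeriv T u ((extChartAt (𝓡∂ n) x₀).symm z) t) : Fin (n + 1) → ℝ) ∈ Γ := by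
  obtain ⟨m, ⟨l, hl, rfl⟩, hm⟩ := h _ ((interior_iff hz).2 hz0) t ht
  exact ⟨l, hu.isAugDiag ht hz hz0 hl, hm⟩

/-- The equation in coordinates. -/
theorem IsSolution.exists_isAugDiag {f : (Fin (n + 1) → ℝ) → ℝ} {ψ : ScalarCoeff n M}
    (h : IsSolution g T f A ψ u) (hu : IsCk n 3 T u) (ht : t ∈ Icc 0 T) (ht0 : 0 < t)
    (hz : z ∈ (extChartAt (𝓡∂ n) x₀).target) (hz0 : 0 < z 0) :
    ∃ l, IsAugDiag (chartMetric g x₀) (coordTensor A x₀) (coordFn n u x₀ t) z t l ∧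
      f (Fin.snoc l (- timeDeriv T u ((extChartAt (𝓡∂ n) x₀).symm z) t) : Fin (n + 1) → ℝ)
        = coordScalar ψ x₀ z t (fderiv ℝ (coordFn n u x₀ t) z) := by
  obtain ⟨m, ⟨l, hl, rfl⟩, hm⟩ := h _ ((interior_iff hz).2 hz0) t ⟨ht0, ht.2⟩
  refine ⟨l, hu.isAugDiag ht hz hz0 hl, hm.trans ?_⟩
  rw [grad_eq_covecFrom hz (hu.mdifferentiableAt ht _),
    fderivWithin_of_mem_nhds (range_model_mem_nhds hz0)]
  rfl

namespace IsMaximizer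

variable {y₀ : M} {C ρ ρ' η r α K N b lam C₀ : ℝ} {c v : ℝ → Model n}

/-- A maximizing geodesic in a chart that contains its starting point well inside. There the penalty
vanishes and all perturbations are competitors. -/
theorem exists_geodesic (h : IsMaximizer g u x₀ T ρ η r α K lam c v t)
    (hG : GoodChart g x₀ ρ C) (hp : SmallParameters C ρ η r α K N b lam C₀)
    (hu : IsBounded g T u N b C₀) (hc : IsGeodesic (chartMetric g x₀) c v)
    (hG' : GoodChart g y₀ ρ' C)
    (hmax : ∀ c' v', IsShortCurve (extChartAt (𝓡∂ n) y₀ y₀) (2 * ρ') η r c' v' →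
      twoPoint (chartMetric g y₀) (coordFn n u y₀ t) α K c' v'
        - penalty (extChartAt (𝓡∂ n) y₀ y₀) ρ' lam (c' 0)
      ≤ twoPoint (chartMetric g x₀) (coordFn n u x₀ t) α K c v
        - penalty (extChartAt (𝓡∂ n) x₀ x₀) ρ lam (c 0))
    (hy : ∀ τ ∈ Icc (0 : ℝ) 1,
      (extChartAt (𝓡∂ n) x₀).symm (c τ) ∈ (extChartAt (𝓡∂ n) y₀).source)
    (hyρ : ∀ τ ∈ Icc (0 : ℝ) 1,
      transition n x₀ y₀ (c τ) ∈ Metric.ball (extChartAt (𝓡∂ n) y₀ y₀) (2 * ρ'))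
    (hy0 : transition n x₀ y₀ (c 0) ∈ Metric.ball (extChartAt (𝓡∂ n) y₀ y₀) ρ')
    (hsη : 8 * C ^ 5 * √(energy (chartMetric g x₀) c v) ≤ η)
    (hsr : C * √(energy (chartMetric g x₀) c v) < r) :
    ∃ c' v', IsGeodesic (chartMetric g y₀) c' v' ∧
      (∀ τ ∈ Icc (0 : ℝ) 1, c' τ ∈ openHalfBall n y₀ ρ') ∧
      energy (chartMetric g y₀) c' v' = √(energy (chartMetric g x₀) c v) ^ 2 ∧
      (∀ τ ∈ Icc (0 : ℝ) 1,
        (extChartAt (𝓡∂ n) y₀).symm (c' τ) = (extChartAt (𝓡∂ n) x₀).symm (c τ)) ∧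
      ∀ a b w w' : Model n, ∀ᶠ ε in 𝓝 (0 : ℝ),
        coordFn n u y₀ t (c' 1 + ε • a + ε ^ 2 • (w + w'))
          - coordFn n u y₀ t (c' 0 + ε • b + ε ^ 2 • w)
          - K * lengthFn α (√(energy (chartMetric g y₀)
            (fun τ => c' τ + ε • (b + τ • (a - b)) + ε ^ 2 • (w + τ • w'))
            (fun τ => v' τ + ε • (a - b) + ε ^ 2 • w')))
          ≤ coordFn n u y₀ t (c' 1) - coordFn n u y₀ t (c' 0)
            - K * lengthFn α (√(energy (chartMetric g x₀) c v)) := by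
  have m0 : (0 : ℝ) ∈ Icc (0 : ℝ) 1 := by simp
  have m1 : (1 : ℝ) ∈ Icc (0 : ℝ) 1 := by simp
  have hz := fun τ hτ => hG.subset_target (h.mem_halfBall hp (τ := τ) hτ)
  have hz0 := fun τ hτ => h.curve_pos hG hp hu (τ := τ) hτ
  have hE := hG.energy_nonneg (v := v) fun τ hτ => h.mem_halfBall hp (τ := τ) hτ
  have hen : energy (chartMetric g y₀) (fun τ => transition n x₀ y₀ (c τ))
      (fun τ => fderiv ℝ (transition n x₀ y₀) (c τ) (v τ))
      = √(energy (chartMetric g x₀) c v) ^ 2 := by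
    rw [energy_transition hz hz0 hy, Real.sq_sqrt hE]
  have hgeo := hc.transition hz hz0 hy
  have hρ' := hG'.pos
  have hpos : ∀ τ ∈ Icc (0 : ℝ) 1, 0 < transition n x₀ y₀ (c τ) 0 := fun τ hτ =>
    transition_pos (hz τ hτ) (hy τ hτ) (hz0 τ hτ)
  have hO : ∀ τ ∈ Icc (0 : ℝ) 1, transition n x₀ y₀ (c τ) ∈ openHalfBall n y₀ ρ' := fun τ hτ =>
    ⟨Metric.ball_subset_ball (by linarith) (hyρ τ hτ), hpos τ hτ⟩
  obtain ⟨hχ, hχs, hlip⟩ := hG'.straight_of_isGeodesic hgeo hO (h.sqrt_energy_pos hG hp) hen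
    hp.η_le hsη
  refine ⟨fun τ => transition n x₀ y₀ (c τ), fun τ => fderiv ℝ (transition n x₀ y₀) (c τ) (v τ),
    hgeo, hO, hen, fun τ hτ => symm_transition (hy τ hτ), fun a b w w' => ?_⟩
  have hbase := hy0
  rw [mem_ball_iff_norm] at hbase
  filter_upwards [eventually_isShortCurve_perturb hp.η_pos hgeo.hasDerivWithinAt hlip hpos hbase hχ
    (hχs.trans_lt hsr) a b w w'] with ε hε
  have h1 := hmax _ _ (hε.mono (by linarith))
  rw [penalty_eq_zero hε.norm_base_le, sub_zero, twoPoint, twoPoint] at h1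
  have h2 := penalty_nonneg (z₀ := extChartAt (𝓡∂ n) x₀ x₀) (ρ := ρ) (y := c 0) hp.lam_nonneg
  have e1 : ∀ p : Model n, p + ε • (b + (1 : ℝ) • (a - b)) + ε ^ 2 • (w + (1 : ℝ) • w')
      = p + ε • a + ε ^ 2 • (w + w') := fun p => by module
  have e0 : ∀ p : Model n, p + ε • (b + (0 : ℝ) • (a - b)) + ε ^ 2 • (w + (0 : ℝ) • w')
      = p + ε • b + ε ^ 2 • w := fun p => by module
  simp only [e1, e0] at h1
  rw [coordFn_transition (hy 1 m1), coordFn_transition (hy 0 m0)]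
  linarith

/-- The time derivatives at the end points of a maximizing curve. -/
theorem timeDeriv_le (h : IsMaximizer g u x₀ T ρ η r α K lam c v t)
    (hG : GoodChart g x₀ ρ C) (hp : SmallParameters C ρ η r α K N b lam C₀)
    (hu : IsBounded g T u N b C₀) :
    timeDeriv T u ((extChartAt (𝓡∂ n) x₀).symm (c 0)) t
      ≤ timeDeriv T u ((extChartAt (𝓡∂ n) x₀).symm (c 1)) t := by
  refine hu.isCk.timeDeriv_le h.mem (h.time_pos hG hp hu) fun t' ht' => ?_
  have h1 := h.le c v t' h.isShortCurve ht'
  simp only [twoPoint, coordFn] at h1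
  linarith

end IsMaximizer

end Equation

/-! ### Positivity of the maximum -/

section Existence

open Topology Filter MeasureTheory

set_option maxSynthPendingDepth 3

variable {n : ℕ} [NeZero n] {M : Type*} [TopologicalSpace M]
  [ChartedSpace (EuclideanHalfSpace n) M] [IsManifold (𝓡∂ n) ∞ M] {g : Metric n M}
  {u : M → ℝ → ℝ} {T t : ℝ}

/-- Where the gradient exceeds the slope `K`, the two-point function of a small segment in the
direction of the gradient is positive. -/
theorem GoodChart.exists_twoPoint_pos {x₀ : M} {ρ C η r α K : ℝ} (hG : GoodChart g x₀ ρ C)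
    (hu : IsCk n 3 T u) (ht : t ∈ Icc 0 T) {z : Model n}
    (hz : z ∈ Metric.ball (extChartAt (𝓡∂ n) x₀ x₀) ρ) (hz0 : 0 < z 0) (hη : 0 ≤ η) (hr : 0 < r)
    (hK : 0 < K) (hKm : 3 / 2 * K ≤ gradNorm g u ((extChartAt (𝓡∂ n) x₀).symm z, t)) :
    ∃ c v, IsShortCurve (extChartAt (𝓡∂ n) x₀ x₀) ρ η r c v ∧
      0 < twoPoint (chartMetric g x₀) (coordFn n u x₀ t) α K c v := by
  have hC := hG.one_le
  have hρ := hG.pos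
  have hmem : ∀ y ∈ Metric.ball (extChartAt (𝓡∂ n) x₀ x₀) ρ, 0 < y 0 → y ∈ halfBall n x₀ ρ :=
    fun y hy hy0 => ⟨Metric.closedBall_subset_closedBall (by linarith)
      (Metric.ball_subset_closedBall hy), mem_range_model_iff.2 hy0.le⟩
  have hzt := hG.subset_target (hmem z hz hz0)
  obtain ⟨w, hw, hww⟩ := hu.exists_gradient (g := g) ht hzt
  set m := gradNorm g u ((extChartAt (𝓡∂ n) x₀).symm z, t)
  have hm : 0 < m := by linarith
  have hline : Continuous fun ε : ℝ => z + ε • w := by fun_prop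
  have hline0 : Tendsto (fun ε : ℝ => z + ε • w) (𝓝 0) (𝓝 z) := by simpa using hline.tendsto 0
  have hd : HasDerivAt (fun ε : ℝ => coordFn n u x₀ t (z + ε • w)) (m ^ 2) 0 := by
    have h1 := (hu.hasFDerivWithinAt_coordFn ht hzt).hasFDerivAt (range_model_mem_nhds hz0)
    have h2 : HasDerivAt (fun ε : ℝ => z + ε • w) w 0 := by
      simpa using ((hasDerivAt_id (0 : ℝ)).smul_const w).const_add z
    have h3 := h1.comp_hasDerivAt_of_eq (0 : ℝ) h2 (by simp)
    rw [hw, hww] at h3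
    exact h3
  have e1 : ∀ᶠ ε in 𝓝[>] (0 : ℝ),
      4 / 5 * m ^ 2 < slope (fun ε : ℝ => coordFn n u x₀ t (z + ε • w)) 0 ε :=
    ((hasDerivAt_iff_tendsto_slope.1 hd).mono_left
      (nhdsWithin_mono _ fun x hx => ne_of_gt hx)).eventually_const_lt
      (by have : 0 < m ^ 2 := by positivity
          linarith)
  have e2 : ∀ᶠ ε in 𝓝[>] (0 : ℝ),
      z + ε • w ∈ Metric.ball (extChartAt (𝓡∂ n) x₀ x₀) ρ ∩ {y | 0 < y 0} :=
    nhdsWithin_le_nhds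
      (hline0.eventually ((Metric.isOpen_ball.inter isOpen_pos).mem_nhds ⟨hz, hz0⟩))
  have e3 : ∀ᶠ ε in 𝓝[>] (0 : ℝ), ε * ‖w‖ < r := by
    have h : Continuous fun ε : ℝ => ε * ‖w‖ := by fun_prop
    exact nhdsWithin_le_nhds ((h.tendsto 0).eventually_lt_const (by simpa using hr))
  have e4 : ∀ᶠ ε in 𝓝[>] (0 : ℝ), C * (ε * ‖w‖) * ‖w‖ * ‖w‖ < m ^ 2 / 4 := by
    have h : Continuous fun ε : ℝ => C * (ε * ‖w‖) * ‖w‖ * ‖w‖ := by fun_prop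
    exact nhdsWithin_le_nhds ((h.tendsto 0).eventually_lt_const (by simp; positivity))
  -- the segment of parameter length `ε` in the direction of the gradient
  obtain ⟨ε, hε1, ⟨hε2, hε2'⟩, hε3, hε4, hε0⟩ :=
    (e1.and (e2.and (e3.and (e4.and self_mem_nhdsWithin)))).exists
  have hε0 : 0 < ε := hε0
  have hseg : ∀ τ ∈ Icc (0 : ℝ) 1, z + τ • (ε • w) ∈
      Metric.ball (extChartAt (𝓡∂ n) x₀ x₀) ρ ∩ {y | 0 < y 0} := by
    intro τ hτ
    have h := ((convex_ball (extChartAt (𝓡∂ n) x₀ x₀) ρ).inter (convex_halfSpace_gt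
      (EuclideanSpace.proj (𝕜 := ℝ) (0 : Fin n)).toLinearMap.isLinear 0)).add_smul_sub_mem
      (x := z) (y := z + ε • w) ⟨hz, hz0⟩ ⟨hε2, hε2'⟩ hτ
    rwa [add_sub_cancel_left] at h
  have hseg' : ∀ τ ∈ Icc (0 : ℝ) 1, z + τ • (ε • w) ∈ halfBall n x₀ ρ := fun τ hτ =>
    hmem _ (hseg τ hτ).1 (hseg τ hτ).2
  have hcont : ContinuousOn (fun τ : ℝ => z + τ • (ε • w)) (Icc 0 1) := by fun_prop
  refine ⟨fun τ => z + τ • (ε • w), fun _ => ε • w, ⟨fun τ _ => ?_, fun τ _ σ _ => ?_,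
    fun τ hτ => (hseg τ hτ).2.le, ?_, ?_⟩, ?_⟩
  · simpa using (((hasDerivAt_id τ).smul_const (ε • w)).const_add z).hasDerivWithinAt
  · rw [sub_self, norm_zero]; positivity
  · have := hseg 0 (by simp)
    rw [← dist_eq_norm]
    exact (Metric.mem_ball.1 this.1).le
  · rw [zero_smul, one_smul, add_zero, add_sub_cancel_left, norm_smul, Real.norm_of_nonneg hε0.le]
    exact hε3.le
  · have hE : energy (chartMetric g x₀) (fun τ => z + τ • (ε • w)) (fun _ => ε • w)
        ≤ ∫ _ in (0 : ℝ)..1, ε ^ 2 * (5 / 4 * m ^ 2) := by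
      refine intervalIntegral.integral_mono_on zero_le_one
        (intervalIntegrable_unit (hG.continuousOn_energy hcont continuousOn_const hseg'))
        intervalIntegrable_const fun τ hτ => ?_
      have h1 := hG.norm_sub_le _ (hseg' τ hτ) _ (hmem z hz hz0)
      rw [add_sub_cancel_left, norm_smul, norm_smul, Real.norm_of_nonneg hτ.1,
        Real.norm_of_nonneg hε0.le] at h1
      have h2 : C * (τ * (ε * ‖w‖)) ≤ C * (ε * ‖w‖) := by
        have := mul_le_of_le_one_left (by positivity : 0 ≤ ε * ‖w‖) hτ.2
        gcongr
      have h3 := abs_form_le (chartMetric g x₀ (z + τ • (ε • w)) - chartMetric g x₀ z)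
        (h1.trans h2) w w
      rw [sub_apply, sub_apply, hww] at h3
      have h4 := (le_abs_self _).trans h3
      simp only [map_smul, smul_apply, smul_eq_mul]
      rw [← mul_assoc, ← sq]
      refine mul_le_mul_of_nonneg_left ?_ (sq_nonneg ε)
      linarith
    rw [intervalIntegral.integral_const, sub_zero, one_smul] at hE
    have hs : √(energy (chartMetric g x₀) (fun τ => z + τ • (ε • w)) (fun _ => ε • w))
        ≤ 9 / 8 * m * ε := by
      rw [Real.sqrt_le_left (by positivity)]
      refine hE.trans ?_
      have : 0 ≤ ε ^ 2 * m ^ 2 := by positivity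
      nlinarith
    set s := √(energy (chartMetric g x₀) (fun τ => z + τ • (ε • w)) (fun _ => ε • w)) with hsd
    have hs0 : 0 ≤ s := Real.sqrt_nonneg _
    have hφ : lengthFn α s ≤ s := by
      have := Real.rpow_nonneg hs0 (1 + α)
      rw [lengthFn]; linarith
    rw [slope_def_field, zero_smul, add_zero, sub_zero, lt_div_iff₀ hε0] at hε1
    rw [twoPoint, one_smul, zero_smul, add_zero, ← hsd]
    have h1 : K * lengthFn α s ≤ 2 / 3 * m * (9 / 8 * m * ε) :=
      (mul_le_mul_of_nonneg_left (hφ.trans hs) hK.le).trans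
        (mul_le_mul_of_nonneg_right (by linarith) (by positivity))
    have h2 : 0 < m ^ 2 * ε := by positivity
    nlinarith

/-- The penalized two-point functions of finitely many charts have a common maximizer. -/
theorem exists_common_maximizer {F : Finset M} (hF : F.Nonempty) {ρ : M → ℝ} {C η r α K lam : ℝ}
    (hG : ∀ x ∈ F, GoodChart g x (ρ x) C) (hu : IsCk n 3 T u) (hT : 0 ≤ T) (hη : 0 ≤ η)
    (hη1 : η ≤ 1 / 2) (hr : 0 ≤ r) (hrρ : ∀ x ∈ F, 4 * r ≤ ρ x) (hα : 0 < α) :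
    ∃ x₀ ∈ F, ∃ c v t, IsShortCurve (extChartAt (𝓡∂ n) x₀ x₀) (2 * ρ x₀) η r c v ∧ t ∈ Icc 0 T ∧
      Continuous v ∧ (∀ τ, HasDerivAt c (v τ) τ) ∧
      ∀ y ∈ F, ∀ c' v' t', IsShortCurve (extChartAt (𝓡∂ n) y y) (2 * ρ y) η r c' v' →
        t' ∈ Icc 0 T →
        twoPoint (chartMetric g y) (coordFn n u y t') α K c' v'
            - penalty (extChartAt (𝓡∂ n) y y) (ρ y) lam (c' 0)
          ≤ twoPoint (chartMetric g x₀) (coordFn n u x₀ t) α K c v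
            - penalty (extChartAt (𝓡∂ n) x₀ x₀) (ρ x₀) lam (c 0) := by
  have key : ∀ x ∈ F, ∃ c v t, IsShortCurve (extChartAt (𝓡∂ n) x x) (2 * ρ x) η r c v ∧
      t ∈ Icc 0 T ∧ Continuous v ∧ (∀ τ, HasDerivAt c (v τ) τ) ∧
      ∀ c' v' t', IsShortCurve (extChartAt (𝓡∂ n) x x) (2 * ρ x) η r c' v' → t' ∈ Icc 0 T →
        twoPoint (chartMetric g x) (coordFn n u x t') α K c' v'
            - penalty (extChartAt (𝓡∂ n) x x) (ρ x) lam (c' 0)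
          ≤ twoPoint (chartMetric g x) (coordFn n u x t) α K c v
            - penalty (extChartAt (𝓡∂ n) x x) (ρ x) lam (c 0) := by
    intro x hx
    have hGx := hG x hx
    have hρ := hGx.pos
    refine exists_max_twoPoint (D := halfBall n x (ρ x)) (U := coordFn n u x) hη hη1 hr
      (by linarith) (target_subset_range x (mem_extChartAt_target x)) hT hα ?_
      hGx.continuousOn_chartMetric
      ((hu.continuousOn_coord x).mono (prod_mono hGx.subset_target Subset.rfl))
      (continuous_penalty _ _ _)
    refine inter_subset_inter_left _ (Metric.closedBall_subset_closedBall ?_)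
    linarith [hrρ x hx]
  choose! c v t h1 h2 h3 h4 h5 using key
  obtain ⟨x₀, hx₀, hmax⟩ := F.exists_max_image (fun x =>
    twoPoint (chartMetric g x) (coordFn n u x (t x)) α K (c x) (v x)
      - penalty (extChartAt (𝓡∂ n) x x) (ρ x) lam (c x 0)) hF
  exact ⟨x₀, hx₀, c x₀, v x₀, t x₀, h1 x₀ hx₀, h2 x₀ hx₀, h3 x₀ hx₀, h4 x₀ hx₀,
    fun y hy c' v' t' hc' ht' => (h5 y hy c' v' t' hc' ht').trans (hmax y hy)⟩

theorem exists_pos_forall_le {ι : Type*} (F : Finset ι) {δ : ι → ℝ}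
    (h : ∀ i ∈ F, 0 < δ i) : ∃ m, 0 < m ∧ ∀ i ∈ F, m ≤ δ i := by
  rcases F.eq_empty_or_nonempty with rfl | hF
  · exact ⟨1, one_pos, by simp⟩
  · obtain ⟨i, hi, hmin⟩ := F.exists_min_image δ hF
    exact ⟨δ i, h i hi, hmin⟩

end Existence

/-! ### The gradient bound -/

section GradientBound

open Topology Filter MeasureTheory

set_option maxSynthPendingDepth 3

variable {n : ℕ} [NeZero n] {M : Type*} [TopologicalSpace M] [T2Space M] [CompactSpace M]
  [ChartedSpace (EuclideanHalfSpace n) M] [IsManifold (𝓡∂ n) ∞ M]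

/-- The gradient bound, as a threshold `B`: a bound `N` that is almost attained by the gradient is
either less than `B` or less than `B * b`, where `b` bounds the gradient on the parabolic
boundary. -/
theorem exists_gradient_threshold (g : Metric n M) {T : ℝ} (hT : 0 < T)
    {Γ : Set (Fin (n + 1) → ℝ)} (hΓ : IsConeDomain Γ) {f : (Fin (n + 1) → ℝ) → ℝ}
    (hf : IsSymmSmooth Γ f) {A : TensorCoeff n M} {ψ : ScalarCoeff n M} (hA : SmoothTensor T A)
    (hψ : SmoothScalar T ψ) (hmono : ∀ l ∈ Γ, ∀ i, 0 < partialD f i l) (hconc : ConcaveOn ℝ Γ f)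
    {γ γ₁ : ℝ} (hγ : γ < 4) (hγ₁ : γ₁ < 2) {ψ₁ ψ₃ : M → ℝ → ℝ}
    (hψ₁ : IsGrowthBound T ψ₁) (hψ₃ : IsGrowthBound T ψ₃) (hG1 : GrowthDx g T A ψ ψ₁ γ)
    (hG3 : GrowthTensor g T A ψ₃ γ₁) {ν₀ : ℝ} (hν₀ : 0 < ν₀)
    (hneg : ∀ l ∈ Γ, ∀ j, l j < 0 → ν₀ * (1 + ∑ i, partialD f i l) ≤ partialD f j l) (C₀ : ℝ) :
    ∃ B : ℝ, 2 ≤ B ∧ ∀ (u : M → ℝ → ℝ) (N b : ℝ), IsAdmissible g T Γ A u → IsSolution g T f A ψ u →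
      IsBounded g T u N b C₀ → 0 ≤ b → B ≤ N → B * b ≤ N →
      (∃ x, ∃ t ∈ Icc 0 T, 3 / 4 * N < gradNorm g u (x, t)) → False := by
  -- the exponent of the length function is small enough for its concavity to absorb the growth of
  -- the coefficients, whose exponents may be taken to be at least `2` and `1`
  set α : ℝ := min (min ((4 - max γ 2) / 3) ((2 - max γ₁ 1) / 2)) (1 / 4) with hα
  have hα0 : 0 < α := by
    have h1 : max γ 2 < 4 := max_lt hγ (by norm_num)
    have h2 : max γ₁ 1 < 2 := max_lt hγ₁ (by norm_num)
    refine lt_min (lt_min ?_ ?_) (by norm_num) <;> linarith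
  have hα4 : α ≤ 1 / 4 := min_le_right _ _
  have hαγ : 3 * α ≤ 4 - max γ 2 := by
    have := (min_le_left _ _).trans (min_le_left _ _) |>.trans_eq' hα
    linarith
  have hαγ₁ : 2 * α ≤ 2 - max γ₁ 1 := by
    have := (min_le_left _ _).trans (min_le_right _ _) |>.trans_eq' hα
    linarith
  -- charts and bounds for the coefficients
  obtain ⟨F, ρ, C₁, hF₁, hcov⟩ := exists_goodCharts g
  obtain ⟨B₁, hB₁⟩ := exists_growth_bound hψ₁
  obtain ⟨B₃, hB₃⟩ := exists_growth_bound hψ₃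
  obtain ⟨R₁, hR₁⟩ := hG1
  obtain ⟨R₃, hR₃⟩ := hG3
  set B : ℝ := max 0 (max B₁ B₃)
  have hB0 : 0 ≤ B := le_max_left _ _
  have hBB₁ : B₁ ≤ B := (le_max_left _ _).trans (le_max_right _ _)
  have hBB₃ : B₃ ≤ B := (le_max_right _ _).trans (le_max_right _ _)
  set R : ℝ := max R₁ R₃
  set C : ℝ := max 1 (max C₁ (B * C₁))
  have hC : 1 ≤ C := le_max_left _ _
  have hC0 : 0 < C := by linarith
  have hF : ∀ x ∈ F, GoodChart g x (ρ x) C := fun x hx =>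
    (hF₁ x hx).mono ((le_max_left _ _).trans (le_max_right _ _))
  have hcoeff : ∀ x ∈ F, CoeffBounds (chartMetric g x) (openHalfBall n x (ρ x)) C T R γ γ₁
      (coordScalar ψ x) (coordTensor A x) := fun x hx =>
    (hF₁ x hx).coeffBounds hA hψ hB0 (fun x t ht => (hB₁ x t ht).trans hBB₁)
      (fun x t ht => (hB₃ x t ht).trans hBB₃)
      (fun x t ht p hp => hR₁ x t ht p ((le_max_left _ _).trans hp))
      (fun x t ht p hp => hR₃ x t ht p ((le_max_right _ _).trans hp))
      ((le_max_right _ _).trans (le_max_right _ _))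
  set D : ℝ := 4 * (|C₀| + 1)
  have hD : 0 < D := by positivity
  obtain ⟨K₀, hK₀⟩ := exists_interior_contradiction hΓ hf hconc hmono hν₀ hneg (T := T) (R := R) hC
    hD hα0 hα4 hαγ hαγ₁
  -- small parameters
  obtain ⟨ρm, hρm0, hρm⟩ := exists_pos_forall_le F fun x hx => (hF x hx).pos
  have hover : ∀ p ∈ F ×ˢ F, ∃ δ, 0 < δ ∧
      ∀ z ∈ halfBall n p.1 (ρ p.1), ∀ z' ∈ halfBall n p.1 (ρ p.1),
      (extChartAt (𝓡∂ n) p.1).symm z ∈ (extChartAt (𝓡∂ n) p.2).source →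
      transition n p.1 p.2 z ∈ Metric.ball (extChartAt (𝓡∂ n) p.2 p.2) (ρ p.2) → ‖z' - z‖ < δ →
      (extChartAt (𝓡∂ n) p.1).symm z' ∈ (extChartAt (𝓡∂ n) p.2).source ∧
        transition n p.1 p.2 z' ∈ Metric.ball (extChartAt (𝓡∂ n) p.2 p.2) (2 * ρ p.2) := by
    intro p hp
    obtain ⟨hp1, hp2⟩ := Finset.mem_product.1 hp
    exact exists_overlap (isCompact_halfBall _ _) (hF _ hp1).subset_target (hF _ hp2).pos
      (hF _ hp2).subset_target
  choose! δ hδ0 hδ using hover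
  obtain ⟨δm, hδm0, hδm⟩ := exists_pos_forall_le (F ×ˢ F) hδ0
  set η : ℝ := 1 / (64 * C ^ 3) with hη
  have hη0 : 0 < η := by positivity
  have hηC : 64 * C ^ 3 * η = 1 := by rw [hη]; field_simp
  have hη1 : η ≤ 1 / 2 := by
    have := one_le_pow₀ hC (n := 3)
    nlinarith
  set r : ℝ := min (ρm / 4) (min (η / (8 * C ^ 2)) ((2 / 5) ^ α⁻¹ / (2 * C))) with hr
  have hr0 : 0 < r := by positivity
  have hrρ : ∀ x ∈ F, 4 * r ≤ ρ x := fun x hx => by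
    have h1 : r ≤ ρm / 4 := min_le_left _ _
    linarith [hρm x hx]
  have hrη : 8 * C ^ 2 * r ≤ η := by
    have h1 : r ≤ η / (8 * C ^ 2) := (min_le_right _ _).trans (min_le_left _ _)
    rw [le_div_iff₀ (by positivity)] at h1
    linarith
  have hrα : (2 * C * r) ^ α ≤ 2 / 5 := by
    have h1 : r ≤ (2 / 5) ^ α⁻¹ / (2 * C) := (min_le_right _ _).trans (min_le_right _ _)
    rw [le_div_iff₀ (by positivity)] at h1
    have h2 := Real.rpow_le_rpow (by positivity) (by linarith : 2 * C * r ≤ (2 / 5) ^ α⁻¹) hα0.le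
    rwa [Real.rpow_inv_rpow (by norm_num) hα0.ne'] at h2
  set lam : ℝ := 2 * |C₀| / ρm with hlam
  have hlam0 : 0 ≤ lam := by positivity
  have hlamρ : ∀ x ∈ F, 2 * C₀ ≤ lam * ρ x := fun x hx => by
    have h1 : lam * ρm = 2 * |C₀| := by rw [hlam]; field_simp
    have h2 := mul_le_mul_of_nonneg_left (hρm x hx) hlam0
    linarith [le_abs_self C₀]
  -- the slope `K = N / 2` has to exceed this threshold; as `K s ≤ D` for the length `s` of a
  -- maximizing geodesic, this makes `s` small
  set K₁ : ℝ := |K₀| + 64 * C * lam + 8 * C ^ 5 * D / η + 2 * C * D / r + 8 * C * D / δm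
    + 64 * C ^ 3 with hK₁
  have hK₁a : 0 ≤ |K₀| := abs_nonneg _
  have hK₁b : 0 ≤ 64 * C * lam := by positivity
  have hK₁c : 0 ≤ 8 * C ^ 5 * D / η := by positivity
  have hK₁d : 0 ≤ 2 * C * D / r := by positivity
  have hK₁e : 0 ≤ 8 * C * D / δm := by positivity
  have hC3 : 1 ≤ C ^ 3 := one_le_pow₀ hC
  refine ⟨2 * K₁, by linarith, fun u N b hadm hsol hu hb hN hNb ⟨x₁, t₁, ht₁, hgrad⟩ => ?_⟩
  set K : ℝ := N / 2 with hK
  have hKK₁ : K₁ ≤ K := by linarith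
  have hK0 : 0 < K := by linarith
  have hbC : 64 * C ^ 3 * b ≤ K := by
    have : 64 * C ^ 3 * b ≤ K₁ * b := mul_le_mul_of_nonneg_right (by linarith) hb
    linarith
  have hp : ∀ x ∈ F, SmallParameters C (ρ x) η r α K N b lam C₀ := fun x hx =>
    { η_pos := hη0
      η_le := hη1
      C_η_le := hηC.le
      r_le := hrρ x hx
      C_r_le := hrη
      α_pos := hα0
      α_le := hα4
      rpow_le := hrα
      K_pos := hK0
      N_le := by linarith
      b_nonneg := hb
      b_le := hbC
      lam_nonneg := hlam0
      lam_le := by linarith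
      le_lam := hlamρ x hx }
  -- the point `x₁` of almost maximal gradient is interior and makes the maximum positive
  obtain ⟨y₁, hy₁, hxy₁, hxball⟩ := hcov x₁
  obtain ⟨x₀, hx₀, c, v, t, hsh, ht, hv, hc, hmax⟩ := exists_common_maximizer ⟨y₁, hy₁⟩ hF hu.isCk
    hT.le hη0.le hη1 hr0.le hrρ hα0 (K := K) (lam := lam)
  have hρ₁ := (hF y₁ hy₁).pos
  have hx₁ : x₁ ∈ (𝓡∂ n).interior M := by
    by_contra hx₁
    have h1 := hu.gradNorm_boundary_le (x₁, t₁)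
      (Or.inr ⟨by rwa [← ModelWithCorners.compl_interior], ht₁⟩)
    have h2 : 128 * b ≤ 2 * K₁ * b := mul_le_mul_of_nonneg_right (by linarith) hb
    linarith
  have hz₁ := (extChartAt (𝓡∂ n) y₁).left_inv hxy₁
  have hz₁0 : 0 < extChartAt (𝓡∂ n) y₁ x₁ 0 :=
    (interior_iff ((extChartAt (𝓡∂ n) y₁).map_source hxy₁)).1 (by rwa [hz₁])
  obtain ⟨c₁, v₁, hs₁, hpos₁⟩ := (hF y₁ hy₁).exists_twoPoint_pos (α := α) hu.isCk ht₁ hxball hz₁0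
    hη0.le hr0 hK0 (by rw [hz₁]; linarith)
  have hval := hmax y₁ hy₁ c₁ v₁ t₁ (hs₁.mono (by linarith)) ht₁
  rw [penalty_eq_zero hs₁.norm_base_le, sub_zero] at hval
  have h : IsMaximizer g u x₀ T (ρ x₀) η r α K lam c v t :=
    ⟨hsh, ht, hmax x₀ hx₀, hpos₁.trans_le hval⟩
  have hG := hF x₀ hx₀
  have hp₀ := hp x₀ hx₀
  have hgeo := h.isGeodesic hG hp₀ hu hv hc
  have hKs := h.mul_sqrt_energy_le hG hp₀ hu
  have hs0 := h.sqrt_energy_pos hG hp₀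
  have hχ := hG.norm_chord_le hsh hη0.le hη1 (hrρ x₀ hx₀)
  set s := √(energy (chartMetric g x₀) c v) with hs
  have hKsD : K * s ≤ D := by
    refine hKs.trans ?_
    have := le_abs_self C₀
    linarith
  have hsmall : ∀ {X Y : ℝ}, 0 ≤ X → 0 < Y → X * D / Y ≤ K → X * s ≤ Y := by
    intro X Y hX hY hXY
    rw [div_le_iff₀ hY] at hXY
    have h1 := mul_le_mul_of_nonneg_left hKsD hX
    exact le_of_mul_le_mul_left (by linarith) hK0
  have hs5 : 8 * C ^ 5 * s ≤ η := hsmall (by positivity) hη0 (by linarith)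
  have hs2 : 2 * C * s ≤ r := hsmall (by positivity) hr0 (by linarith)
  have hs8 : 8 * C * s ≤ δm := hsmall (by positivity) hδm0 (by linarith)
  have hCs : 0 < C * s := mul_pos hC0 hs0
  -- a chart in which the starting point lies well inside
  obtain ⟨y₀, hy₀, hy₀s, hy₀b⟩ := hcov ((extChartAt (𝓡∂ n) x₀).symm (c 0))
  have m0 : (0 : ℝ) ∈ Icc (0 : ℝ) 1 := by simp
  have m1 : (1 : ℝ) ∈ Icc (0 : ℝ) 1 := by simp
  have hmem : (x₀, y₀) ∈ F ×ˢ F := Finset.mem_product.2 ⟨hx₀, hy₀⟩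
  have hov := fun τ (hτ : τ ∈ Icc (0 : ℝ) 1) => hδ (x₀, y₀) hmem (c 0) (h.mem_halfBall hp₀ m0) (c τ)
    (h.mem_halfBall hp₀ hτ) hy₀s hy₀b (by
      have h1 := hsh.norm_sub_le hη0.le hη1 hτ m0
      have h2 := hδm (x₀, y₀) hmem
      linarith)
  have hG' := hF y₀ hy₀
  obtain ⟨c', v', hgeo', hO', hen', hsymm, hpert⟩ := h.exists_geodesic hG hp₀ hu hgeo hG'
    (fun c' v' hc' => hmax y₀ hy₀ c' v' t hc' ht) (fun τ hτ => (hov τ hτ).1)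
    (fun τ hτ => (hov τ hτ).2) hy₀b hs5 (by linarith)
  have hzt := fun τ hτ => hG'.subset_target (openHalfBall_subset _ _ (hO' τ hτ))
  have ht0 := h.time_pos hG hp₀ hu
  refine hK₀ (chartMetric g y₀) (openHalfBall n y₀ (ρ y₀)) (coordScalar ψ y₀) (coordTensor A y₀)
    c' v' (coordFn n u y₀ t) K s t (- timeDeriv T u ((extChartAt (𝓡∂ n) y₀).symm (c' 1)) t)
    (- timeDeriv T u ((extChartAt (𝓡∂ n) y₀).symm (c' 0)) t) hG'.metricBounds (hcoeff y₀ hy₀) hgeo'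
    hO' hs0 hen' ?_ ht ?_ hKsD hpert
    (hadm.exists_isAugDiag hu.isCk ht (hzt 1 m1) (hO' 1 m1).2)
    (hsol.exists_isAugDiag hu.isCk ht ht0 (hzt 1 m1) (hO' 1 m1).2)
    (hsol.exists_isAugDiag hu.isCk ht ht0 (hzt 0 m0) (hO' 0 m0).2) ?_
  · exact ((hu.isCk.contDiffOn_coordFn ht).mono
      ((openHalfBall_subset _ _).trans hG'.subset_target)).of_le (by norm_num)
  · linarith [le_abs_self K₀]
  · rw [hsymm 1 m1, hsymm 0 m0]
    exact neg_le_neg (h.timeDeriv_le hG hp₀ hu)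

end GradientBound

end ParabolicHessian

end

theorem theorem3p1
    {n : ℕ} [NeZero n] (hn : 2 ≤ n)
    {M : Type*} [TopologicalSpace M] [T2Space M] [CompactSpace M]
    [ChartedSpace (EuclideanHalfSpace n) M] [IsManifold (𝓡∂ n) ∞ M]
    (g : ParabolicHessian.Metric n M) (T : ℝ) (hT : 0 < T)
    (Γ : Set (Fin (n + 1) → ℝ)) (hΓ : ParabolicHessian.IsConeDomain Γ)
    (f : (Fin (n + 1) → ℝ) → ℝ) (hf : ParabolicHessian.IsSymmSmooth Γ f)
    (A : ParabolicHessian.TensorCoeff n M) (ψ : ParabolicHessian.ScalarCoeff n M)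
    (hA : ParabolicHessian.SmoothTensor T A) (hAsymm : ParabolicHessian.SymmTensor T A)
    (hψ : ParabolicHessian.SmoothScalar T ψ)
    (hmono : ∀ l ∈ Γ, ∀ i, 0 < ParabolicHessian.partialD f i l)
    (hconc : ConcaveOn ℝ Γ f)
    (γ γ₁ : ℝ) (hγ : γ ∈ Ioo (0 : ℝ) 4) (hγ₁ : γ₁ ∈ Ioo (0 : ℝ) 2)
    (ψ₁ ψ₂ ψ₃ : M → ℝ → ℝ)
    (hψ₁ : ParabolicHessian.IsGrowthBound T ψ₁) (hψ₂ : ParabolicHessian.IsGrowthBound T ψ₂)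
    (hψ₃ : ParabolicHessian.IsGrowthBound T ψ₃)
    (hG1 : ParabolicHessian.GrowthDx g T A ψ ψ₁ γ)
    (hG2 : ParabolicHessian.GrowthDp g T A ψ ψ₂ γ)
    (hG3 : ParabolicHessian.GrowthTensor g T A ψ₃ γ₁)
    (ν₀ : ℝ) (hν₀ : 0 < ν₀)
    (hneg : ∀ l ∈ Γ, ∀ j, l j < 0 →
      ν₀ * (1 + ∑ i, ParabolicHessian.partialD f i l) ≤ ParabolicHessian.partialD f j l)
    (C₀ : ℝ) :
    ∃ C₃ : ℝ, 0 < C₃ ∧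
      ∀ u : M → ℝ → ℝ,
        ParabolicHessian.IsCk n 3 T u →
        ParabolicHessian.IsAdmissible g T Γ A u →
        ParabolicHessian.IsSolution g T f A ψ u →
        (∀ x, ∀ t ∈ Icc 0 T, |u x t| ≤ C₀) →
        ∀ r ∈ (univ : Set M) ×ˢ Icc 0 T,
          ∃ r' ∈ ParabolicHessian.parabolicBoundary n M T,
            ParabolicHessian.gradNorm g u r ≤ C₃ * (1 + ParabolicHessian.gradNorm g u r') := by
  obtain ⟨B, hB2, hB⟩ := ParabolicHessian.exists_gradient_threshold g hT hΓ hf hA hψ hmono hconc hγ.2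
    hγ₁.2 hψ₁ hψ₃ hG1 hG3 hν₀ hneg C₀
  refine ⟨B, by linarith, fun u hu hadm hsol hC₀ r hr => ?_⟩
  by_contra! hlt
  have hbdd : BddAbove (ParabolicHessian.gradNorm g u '' (univ ×ˢ Icc 0 T)) := by
    obtain ⟨B', hB'⟩ := ParabolicHessian.exists_gradNorm_le (g := g) hT hu
    refine ⟨B', ?_⟩
    rintro _ ⟨q, hq, rfl⟩
    exact hB' q.1 q.2 hq.2
  set N : ℝ := sSup (ParabolicHessian.gradNorm g u '' (univ ×ˢ Icc 0 T)) with hN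
  have hle : ∀ q ∈ (univ : Set M) ×ˢ Icc 0 T, ParabolicHessian.gradNorm g u q ≤ N := fun q hq =>
    le_csSup hbdd (mem_image_of_mem _ hq)
  have hrN := hle r hr
  have hBN : B ≤ N := by
    have h1 := hlt (r.1, 0) (Or.inl ⟨mem_univ _, rfl⟩)
    have h2 := ParabolicHessian.gradNorm_nonneg g u (r.1, 0)
    nlinarith
  have hB0 : 0 < B := by linarith
  have hN0 : 0 < N := by linarith
  refine hB u N (N / B) hadm hsol ⟨hu, hC₀, fun x t ht => hle (x, t) ⟨mem_univ _, ht⟩, fun q hq => ?_⟩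
    (by positivity) hBN (by rw [mul_div_cancel₀ _ hB0.ne']) ?_
  · have h1 := hlt q hq
    rw [le_div_iff₀ hB0]
    linarith
  · obtain ⟨_, ⟨q, hq, rfl⟩, h1⟩ := exists_lt_of_lt_csSup ⟨_, mem_image_of_mem _ hr⟩
      (by linarith : 3 / 4 * N < N)
    exact ⟨q.1, q.2, hq.2, h1⟩
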